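/- Let $\mathbb F$ be a local field of characteristic $0$ with algebraic closure $\overline{\mathbb F}$, and let $\mathfrak g=\bigoplus_{i\in\mathbb Z}\mathfrak g_i$ be a finite-dimensional absolutely simple graded Lie algebra over $\mathbb F$, the grading being given by $H_0\in\mathfrak g_0$, $\mathfrak g_i=\{x:[H_0,x]=ix\}$, and $\mathfrak g$ being generated by $\mathfrak g_1$ and $\mathfrak g_{-1}$. For $h\in\mathfrak g$ and $i\in\mathbb Z$ put $E_i(h)=\{x\in\mathfrak g:[h,x]=ix\}$. An element $h$ is called *1-simple* if it is the neutral element of an $\mathfrak{sl}_2$-triple $(x,h,y)$ with $x\in\mathfrak g_1$, $y\in\mathfrak g_{-1}$; it is *1-simple special* if moreover $\bigoplus_{i>0}E_i(2H_0)\subset\bigoplus_{i\ge 0}E_i(h)$; and it is *very special* if $h$ and $2H_0-h$ are both 1-simple special. Assume that $(\mathfrak g_0,\mathfrak g_1)$ is absolutely irreducible (that is, $\overline{\mathbb F}\otimes\mathfrak g_1$ is an irreducible $\overline{\mathbb F}\otimes\mathfrak g_0$-module) and regular (that is, $2H_0$ is 1-simple). Let $H_1,\dots,H_p$ be pairwise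 commuting very special elements with $H_1+\dots+H_p=2H_0$, and put $h_k=H_1+\dots+H_k$ ($h_0=0$, $h_p=2H_0$). Let $G$ be the centralizer of $H_0$ in the group $\mathrm{Aut}_0(\mathfrak g)$ of the automorphisms of $\mathfrak g$ that become elementary over $\overline{\mathbb F}$ (products of automorphisms $\exp(\mathrm{ad}\,x)$ with $\mathrm{ad}\,x$ nilpotent), let $G_h$ be the centralizer of $h$ in $G$, and $G_{\mathfrak t}$ that of $\{H_1,\dots,H_p\}$. Let $\mathfrak n_{\mathfrak t}$ be the sum of the spaces $\{x\in\mathfrak g_0:[H_i,x]=m_ix \text{ for all } i\}$ over the $m\in\mathbb Z^p\setminus\{0\}$ whose last non-zero coordinate is positive, and let $P_{\mathfrak t}=P(H_1,\dots,H_p)=G_{\mathfrak t}\,N_{\mathfrak t}$ with $N_{\mathfrak t}=\exp(\mathrm{ad}\,\mathfrak n_{\mathfrak t})$ be the very special parabolic subgroup. Write $\overline P_{\mathfrak t}$ for the same group built from $\overline{\mathbb F}\otimes\mathfrak g$ and $1\otimes H_0,1\otimes H_1,\dots,1\otimes H_p$. A polynomial (or rational function) $f$ on a representation space of a group $\Gamma$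 is relatively invariant if $f(gx)=\chi(g)f(x)$ for a character $\chi$ of $\Gamma$. For $1\le k\le p$ let $F_k$ be a fundamental relative invariant (a non-constant relatively invariant polynomial of minimal degree) of $G_{h_k}$ acting on $E_2(h_k)\cap\mathfrak g_1$, extended to $\mathfrak g_1$ by means of the projection along $\bigoplus_{i\ne2}E_i(h_k)\cap\mathfrak g_1$; and for $0\le k\le p-1$ let $F^*_{p-k}$ be a fundamental relative invariant of $G_{h_k}$ acting on $E_0(h_k)\cap\mathfrak g_{-1}$, extended to $\mathfrak g_{-1}$ by means of the projection along $\bigoplus_{i\neq 0}E_i(h_k)\cap\mathfrak g_{-1}$. Then: 1. The action of $P_{\mathfrak t}$ on $\mathfrak g_1$ (resp. $\mathfrak g_{-1}$) is geometrically prehomogeneous: $\overline P_{\mathfrak t}$ has a Zariski-open orbit in $\overline{\mathbb F}\otimes\mathfrak g_1$ (resp. $\overline{\mathbb F}\otimes\mathfrak g_{-1}$). Its fundamental relative invariants are $F_1,\dots,F_p$ (resp. $F_1^*,\dots,F_p^*$): both for $P_{\mathfrak t}$ over $\mathbb F$ and for $\overline P_{\mathfrak t}$ over $\overline{\mathbb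 F}$, these polynomials are irreducible and relatively invariant, and every non-zero relatively invariant rational function on $\mathfrak g_1$ (resp. $\mathfrak g_{-1}$) can be written as $c\prod_kF_k^{m_k}$ (resp. $c\prod_k(F_k^*)^{m_k}$) with a non-zero constant $c$ and a unique $m\in\mathbb Z^p$. 2. Suppose that $\mathbb F=\mathbb C$, let $\chi_k$ be the character of $P_{\mathfrak t}$ with $F_k(gx)=\chi_k(g)F_k(x)$, and let $M=\bigcap_{1\le k\le p}\operatorname{Ker}\chi_k$. Then the ring $\mathbb C[\mathfrak g_1]^M$ of the $M$-invariant polynomials on $\mathfrak g_1$ is equal to $\mathbb C[F_1,\dots,F_p]$. -/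

import Mathlib

open scoped TensorProduct

noncomputable section

namespace ParabolicPV

/-! ### Polynomial functions on a vector space over an infinite field -/

section Polynomials

variable (K V : Type*) [Field K] [AddCommGroup V] [Module K V]

/-- The linear forms on `V`, as functions. -/
def linForms : Submodule K (V → K) :=
  LinearMap.range (LinearMap.ltoFun K V K K)

/-- The ring `K[V]` of polynomial functions on `V`: the algebra generated by the linear forms. -/
def polyFun : Subalgebra K (V → K) :=
  Algebra.adjoin K (linForms K V : Set (V → K))

/-- The polynomial functions of degree at most `d`: sums of products of at most `d` linear forms
(with scalar coefficients). -/
def polyLE (d : ℕ) : Submodule K (V → K) :=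
  (1 ⊔ linForms K V) ^ d

variable {K V}

/-- A set is Zariski open if it is the complement of the common zeros of a set of polynomials. -/
def IsZariskiOpen (S : Set V) : Prop :=
  ∃ I : Set (polyFun K V), S = {x | ∃ q ∈ I, (q : V → K) x ≠ 0}

/-- `q` is a non-constant polynomial function. -/
def IsNonconstant (q : polyFun K V) : Prop :=
  ∀ c : K, q ≠ algebraMap K (polyFun K V) c

end Polynomials

/-! ### Relative invariants of a linear representation -/

section RelativeInvariants

variable {K V Γ : Type*} [Field K] [AddCommGroup V] [Module K V] [Group Γ]

/-- `q` is relatively invariant with character `χ`. -/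
def IsRelInv (ρ : Representation K Γ V) (q : polyFun K V) (χ : Γ →* Kˣ) : Prop :=
  ∀ (g : Γ) (x : V), (q : V → K) (ρ g x) = (χ g : K) * (q : V → K) x

/-- The rational function `a / b` is relatively invariant with character `χ`
(written without denominators). -/
def IsRelInvFraction (ρ : Representation K Γ V) (a b : polyFun K V) (χ : Γ →* Kˣ) : Prop :=
  ∀ (g : Γ) (x : V), (a : V → K) (ρ g x) * (b : V → K) x =
    (χ g : K) * ((a : V → K) x * (b : V → K) (ρ g x))

/-- `q` is a fundamental relative invariant of an irreducible representation: a non-constant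
relatively invariant polynomial of minimal degree. -/
structure IsFundamental (ρ : Representation K Γ V) (q : polyFun K V) : Prop where
  relInv : ∃ χ : Γ →* Kˣ, IsRelInv ρ q χ
  nonconstant : IsNonconstant q
  minimal : ∀ (r : polyFun K V) (χ : Γ →* Kˣ), IsRelInv ρ r χ → IsNonconstant r →
    ∀ d : ℕ, (r : V → K) ∈ polyLE K V d → (q : V → K) ∈ polyLE K V d

/-- The family `q` is the family of the fundamental relative invariants of `(Γ, V)`: irreducible
relatively invariant polynomials such that every non-zero relatively invariant rational function
is, up to a non-zero constant, a product `∏ q_i ^ m_i` with `m_i ∈ ℤ`, in a unique way. -/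
structure IsFundamentalSystem {ι : Type*} [Fintype ι] (ρ : Representation K Γ V)
    (q : ι → polyFun K V) : Prop where
  relInv : ∀ i, ∃ χ : Γ →* Kˣ, IsRelInv ρ (q i) χ
  irreducible : ∀ i, Irreducible (q i)
  existsUnique : ∀ (a b : polyFun K V) (χ : Γ →* Kˣ), a ≠ 0 → b ≠ 0 →
    IsRelInvFraction ρ a b χ → ∃! m : ι → ℤ, ∃ c : Kˣ,
      a * ∏ i, q i ^ (-(m i)).toNat = (c : K) • (b * ∏ i, q i ^ (m i).toNat)

/-- `(Γ, V)` is prehomogeneous: there is a Zariski open orbit. -/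
def IsPrehomogeneous (ρ : Representation K Γ V) : Prop :=
  ∃ x : V, IsZariskiOpen (K := K) (Set.range fun g : Γ => ρ g x)

/-- The ring `K[V]^M` of the polynomials invariant under a subgroup `M`. -/
def invariantRing (ρ : Representation K Γ V) (M : Subgroup Γ) : Subalgebra K (polyFun K V) where
  carrier := {q | ∀ g ∈ M, ∀ x, (q : V → K) (ρ g x) = (q : V → K) x}
  mul_mem' ha hb g hg x := by simp [ha g hg x, hb g hg x]
  add_mem' ha hb g hg x := by simp [ha g hg x, hb g hg x]
  algebraMap_mem' c g _ x := by simp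

end RelativeInvariants

/-! ### Eigenspaces, 1-simple elements -/

section Elements

variable (K : Type*) {L : Type*} [Field K] [LieRing L] [LieAlgebra K L]

/-- `E_i(h) = {x | [h, x] = i x}`. In particular `𝔤_i = E_i(H₀)`. -/
def eig (h : L) (i : ℤ) : Submodule K L :=
  Module.End.eigenspace (LieAlgebra.ad K L h) (i : K)

variable {K} in
lemma mem_eig {h : L} {i : ℤ} {x : L} : x ∈ eig K h i ↔ ⁅h, x⁆ = (i : K) • x := by
  simp [eig]

/-- `𝔭(h) = ⨁_{i ≥ 0} E_i(h)`. -/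
def parab (h : L) : Submodule K L := ⨆ i : {i : ℤ // 0 ≤ i}, eig K h i

/-- `𝔫(h) = ⨁_{i > 0} E_i(h)`. -/
def nilrad (h : L) : Submodule K L := ⨆ i : {i : ℤ // 0 < i}, eig K h i

/-- `h` is 1-simple: it is the neutral element of an `sl₂`-triple `(x, h, y)` with
`x ∈ 𝔤_1` and `y ∈ 𝔤_{-1}`. -/
def IsOneSimple (H0 h : L) : Prop :=
  ∃ x ∈ eig K H0 1, ∃ y ∈ eig K H0 (-1), IsSl2Triple h x y

/-- `h` is 1-simple special: it is 1-simple and `𝔫(2H₀) ⊆ 𝔭(h)`. -/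
def IsSpecial (H0 h : L) : Prop :=
  IsOneSimple K H0 h ∧ nilrad K (2 • H0) ≤ parab K h

/-- `h` is (1-simple) very special: `h` and `2H₀ - h` are 1-simple special. -/
def IsVerySpecial (H0 h : L) : Prop :=
  IsSpecial K H0 h ∧ IsSpecial K H0 (2 • H0 - h)

/-- `𝔤_1` is an irreducible `𝔤_0`-module. -/
def IsIrreducibleDegreeOne (H0 : L) : Prop :=
  eig K H0 1 ≠ ⊥ ∧ ∀ W : Submodule K L, W ≤ eig K H0 1 →
    (∀ z ∈ eig K H0 0, ∀ w ∈ W, ⁅z, w⁆ ∈ W) → W = ⊥ ∨ W = eig K H0 1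

/-- The standing assumptions on the graded Lie algebra `𝔤 = ⨁ 𝔤_i`, `𝔤_i = E_i(H₀)`:
it is absolutely simple, generated by `𝔤_1` and `𝔤_{-1}`, and `(𝔤_0, 𝔤_1)` is absolutely
irreducible and regular (regularity being the condition that `2H₀` is 1-simple). -/
structure IsAbsIrredRegular (H0 : L) : Prop where
  simple : LieAlgebra.IsSimple (AlgebraicClosure K) (AlgebraicClosure K ⊗[K] L)
  graded : ⨆ i : ℤ, eig K H0 i = ⊤
  generated : LieSubalgebra.lieSpan K L ((eig K H0 1 : Set L) ∪ (eig K H0 (-1) : Set L)) = ⊤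
  irreducible : IsIrreducibleDegreeOne (AlgebraicClosure K)
    ((1 : AlgebraicClosure K) ⊗ₜ[K] H0)
  regular : IsOneSimple K H0 (2 • H0)

/-- `H_1, …, H_p` are commuting very special elements with sum `2H₀`. -/
structure IsVerySpecialSystem (H0 : L) {p : ℕ} (H : Fin p → L) : Prop where
  verySpecial : ∀ i, IsVerySpecial K H0 (H i)
  commute : ∀ i j, ⁅H i, H j⁆ = 0
  sum_eq : ∑ i, H i = 2 • H0

/-- `h_k = H_1 + ⋯ + H_k` (the index set `Fin p` starts at `0`, so this is the sum of the
first `k` members). -/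
def partialSum {p : ℕ} (H : Fin p → L) (k : ℕ) : L :=
  ∑ i ∈ Finset.univ.filter (fun i : Fin p => (i : ℕ) < k), H i

end Elements

/-! ### The groups -/

section Groups

variable (K L : Type*) [Field K] [LieRing L] [LieAlgebra K L]

/-- The group of automorphisms of the Lie algebra `L`. -/
def lieAut : Subgroup (L ≃ₗ[K] L) where
  carrier := {g | ∀ x y : L, g ⁅x, y⁆ = ⁅g x, g y⁆}
  mul_mem' ha hb x y := by simp only [LinearEquiv.mul_apply, hb x y, ha (_) (_)]
  one_mem' x y := rfl
  inv_mem' {a} ha x y := by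
    apply a.injective
    rw [ha]
    simp only [← LinearEquiv.mul_apply, mul_inv_cancel, LinearEquiv.coe_one, id_eq]

variable {L} in
/-- The set of the automorphisms `exp (ad x)` for the `x ∈ S` such that `ad x` is nilpotent
(`K` is of characteristic zero). -/
def expAd (S : Set L) : Set (L ≃ₗ[K] L) :=
  {g | ∃ x ∈ S, IsNilpotent (LieAlgebra.ad K L x) ∧
    (g : L →ₗ[K] L) = ∑ i ∈ Finset.range (nilpotencyClass (LieAlgebra.ad K L x)),
      ((i.factorial : K)⁻¹) • (LieAlgebra.ad K L x) ^ i}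

/-- The group of elementary automorphisms, generated by the `exp (ad x)`, `ad x` nilpotent. -/
def elemAut : Subgroup (L ≃ₗ[K] L) :=
  Subgroup.closure (expAd K (Set.univ : Set L))

/-- `Aut_0(L)`: the automorphisms of `L` that become elementary over an algebraic closure. -/
def aut0 : Subgroup (L ≃ₗ[K] L) where
  carrier := {g | g ∈ lieAut K L ∧
    LinearEquiv.baseChange K (AlgebraicClosure K) L L g ∈
      elemAut (AlgebraicClosure K) (AlgebraicClosure K ⊗[K] L)}
  mul_mem' ha hb := by
    refine ⟨mul_mem ha.1 hb.1, ?_⟩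
    rw [LinearEquiv.baseChange_mul]
    exact mul_mem ha.2 hb.2
  one_mem' := by
    refine ⟨one_mem _, ?_⟩
    rw [LinearEquiv.baseChange_one]
    exact one_mem _
  inv_mem' ha := by
    refine ⟨inv_mem ha.1, ?_⟩
    rw [LinearEquiv.baseChange_inv]
    exact inv_mem ha.2

variable {K L}

/-- The centralizer of `s` in a group `A` of automorphisms of `L`. For `A = aut0 K L` and
`s = {H₀}` this is the group `G`, for `s = {H₀, h}` it is `G_h`. -/
def centr (A : Subgroup (L ≃ₗ[K] L)) (s : Set L) : Subgroup (L ≃ₗ[K] L) :=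
  A ⊓ lieAut K L ⊓ fixingSubgroup (L ≃ₗ[K] L) s

/-- A weight `m` of `𝔱` (`m_i` is its value on `H_i`) is positive if its last non-zero value is
positive. -/
def IsPositiveWeight {p : ℕ} (m : Fin p → ℤ) : Prop :=
  ∃ k, 0 < m k ∧ ∀ j, k < j → m j = 0

variable (K) in
/-- `𝔫_𝔱`: the sum of the weight spaces of `𝔱` in `𝔤_0` for the positive weights. -/
def nilT (H0 : L) {p : ℕ} (H : Fin p → L) : Submodule K L :=
  ⨆ m : {m : Fin p → ℤ // IsPositiveWeight m}, eig K H0 0 ⊓ ⨅ i, eig K (H i) (m.1 i)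

/-- The parabolic subgroup `P(H_1, …, H_p) = G_𝔱 N_𝔱`, where `G_𝔱` is the centralizer
of `H_1, …, H_p` in `G` and `N_𝔱 = exp (ad 𝔫_𝔱)`. -/
def parabolic (A : Subgroup (L ≃ₗ[K] L)) (H0 : L) {p : ℕ} (H : Fin p → L) :
    Subgroup (L ≃ₗ[K] L) :=
  centr A (insert H0 (Set.range H)) ⊔ Subgroup.closure (expAd K (nilT K H0 H : Set L))

/-- The action of a group of linear automorphisms of `L` on a stable subspace. -/
def restrictRep (Γ : Subgroup (L ≃ₗ[K] L)) (V : Submodule K L)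
    (hV : ∀ g ∈ Γ, ∀ x ∈ V, g x ∈ V) : Representation K Γ V where
  toFun g := ((g : L ≃ₗ[K] L) : L →ₗ[K] L).restrict (hV g g.2)
  map_one' := by ext x; rfl
  map_mul' a b := by ext x; rfl

lemma centr_stable (A : Subgroup (L ≃ₗ[K] L)) {s : Set L} {h : L} (hs : h ∈ s) (i : ℤ) :
    ∀ g ∈ centr A s, ∀ x ∈ eig K h i, g x ∈ eig K h i := by
  rintro g ⟨⟨-, hg⟩, hfix⟩ x hx
  have hh : g h = h := (mem_fixingSubgroup_iff _).1 hfix h hs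
  rw [mem_eig] at hx ⊢
  have := hg h x
  rw [hh, hx] at this
  rw [← this, map_smul]

lemma expAd_stable {S : Set L} {h : L} (hS : ∀ x ∈ S, x ∈ eig K h 0) (i : ℤ) :
    ∀ g ∈ expAd K S, ∀ x ∈ eig K h i, g x ∈ eig K h i := by
  rintro g ⟨z, hz, -, hg⟩ x hx
  have hz0 := hS z hz
  have key : ∀ n : ℕ, ((LieAlgebra.ad K L z) ^ n) x ∈ eig K h i := by
    intro n
    induction n with
    | zero => simpa using hx
    | succ n ih =>
      rw [pow_succ', Module.End.mul_apply]
      rw [mem_eig] at ih hz0 ⊢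
      rw [LieAlgebra.ad_apply, leibniz_lie, hz0, ih]
      simp
  have : g x = (∑ i ∈ Finset.range (nilpotencyClass (LieAlgebra.ad K L z)),
      ((i.factorial : K)⁻¹) • (LieAlgebra.ad K L z) ^ i) x := by
    rw [← hg]; rfl
  rw [this, LinearMap.sum_apply]
  exact Submodule.sum_mem _ fun n _ => Submodule.smul_mem _ _ (key n)

/-- The action of `G_h` on `E_i(h) ∩ 𝔤_j`. -/
def subRep (A : Subgroup (L ≃ₗ[K] L)) (H0 h : L) (i j : ℤ) :
    Representation K (centr A {H0, h}) (eig K h i ⊓ eig K H0 j : Submodule K L) :=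
  restrictRep (centr A {H0, h}) (eig K h i ⊓ eig K H0 j) fun g hg x hx =>
    ⟨centr_stable A (by simp) i g hg x hx.1, centr_stable A (by simp) j g hg x hx.2⟩

lemma nilT_le (H0 : L) {p : ℕ} (H : Fin p → L) : nilT K H0 H ≤ eig K H0 0 :=
  iSup_le fun _ => inf_le_left

lemma parabolic_stable (A : Subgroup (L ≃ₗ[K] L)) [FiniteDimensional K L] (H0 : L) {p : ℕ}
    (H : Fin p → L) (j : ℤ) :
    ∀ g ∈ parabolic A H0 H, ∀ x ∈ eig K H0 j, g x ∈ eig K H0 j := by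
  let T : Subgroup (L ≃ₗ[K] L) :=
    { carrier := {g | ∀ x ∈ eig K H0 j, g x ∈ eig K H0 j}
      mul_mem' := fun ha hb x hx => ha _ (hb x hx)
      one_mem' := fun x hx => hx
      inv_mem' := fun {a} ha x hx => by
        have hle : (eig K H0 j).map (a : L →ₗ[K] L) ≤ eig K H0 j := by
          rintro _ ⟨y, hy, rfl⟩
          exact ha y hy
        have heq : (eig K H0 j).map (a : L →ₗ[K] L) = eig K H0 j :=
          Submodule.eq_of_le_of_finrank_eq hle (LinearEquiv.finrank_map_eq a _)
        rw [← heq] at hx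
        obtain ⟨y, hy, rfl⟩ := hx
        have : a⁻¹ (a y) = y := a.symm_apply_apply y
        simpa [this] using hy }
  have h1 : parabolic A H0 H ≤ T := by
    refine sup_le (fun g hg => centr_stable A (Set.mem_insert _ _) j g hg) ?_
    rw [Subgroup.closure_le]
    exact fun g hg => expAd_stable (fun x hx => nilT_le H0 H hx) j g hg
  exact fun g hg => h1 hg

/-- The action of `P(H_1, …, H_p)` on `𝔤_j`. -/
def parabolicRep (A : Subgroup (L ≃ₗ[K] L)) [FiniteDimensional K L] (H0 : L) {p : ℕ}
    (H : Fin p → L) (j : ℤ) : Representation K (parabolic A H0 H) (eig K H0 j) :=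
  restrictRep (parabolic A H0 H) (eig K H0 j) (parabolic_stable A H0 H j)

end Groups

/-! ### Extensions of polynomials -/

section Extensions

variable {K L : Type*} [Field K] [LieRing L] [LieAlgebra K L]

/-- `Q` is the extension to `𝔤_j` of the polynomial `q` on `E_i(h) ∩ 𝔤_j` along the complement
`⨁_{l ≠ i} E_l(h) ∩ 𝔤_j`. -/
def IsNaturalExtension {H0 h : L} {i j : ℤ}
    (q : polyFun K (eig K h i ⊓ eig K H0 j : Submodule K L)) (Q : polyFun K (eig K H0 j)) : Prop :=
  ∀ (z : eig K H0 j) (x : (eig K h i ⊓ eig K H0 j : Submodule K L)) (y : L),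
    y ∈ (⨆ l : {l : ℤ // l ≠ i}, eig K h l ⊓ eig K H0 j) → (z : L) = x + y →
      (Q : eig K H0 j → K) z = (q : (eig K h i ⊓ eig K H0 j : Submodule K L) → K) x

/-- `Qbar` is the polynomial on `𝔤_j ⊗ K̄` that extends the polynomial `Q` on `𝔤_j`. -/
def IsScalarExtension {H0 : L} {j : ℤ} (Q : polyFun K (eig K H0 j))
    (Qbar : polyFun (AlgebraicClosure K)
      (eig (AlgebraicClosure K) ((1 : AlgebraicClosure K) ⊗ₜ[K] H0) j)) : Prop :=
  ∀ (x : eig K H0 j) (y : eig (AlgebraicClosure K) ((1 : AlgebraicClosure K) ⊗ₜ[K] H0) j),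
    (y : AlgebraicClosure K ⊗[K] L) = 1 ⊗ₜ[K] (x : L) →
      (Qbar : eig (AlgebraicClosure K) ((1 : AlgebraicClosure K) ⊗ₜ[K] H0) j →
        AlgebraicClosure K) y = algebraMap K (AlgebraicClosure K) ((Q : eig K H0 j → K) x)

variable [FiniteDimensional K L]

/-- The action of the group `P(H_1, …, H_p)` of `L` over `K` on `𝔤_j`. -/
abbrev rationalRep (H0 : L) {p : ℕ} (H : Fin p → L) (j : ℤ) :
    Representation K (parabolic (aut0 K L) H0 H) (eig K H0 j) :=
  parabolicRep (aut0 K L) H0 H j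

/-- The action of the group `P(H_1, …, H_p)` of `K̄ ⊗ L` over `K̄` on `𝔤_j ⊗ K̄`. -/
abbrev geometricRep (H0 : L) {p : ℕ} (H : Fin p → L) (j : ℤ) :
    Representation (AlgebraicClosure K)
      (parabolic (elemAut (AlgebraicClosure K) (AlgebraicClosure K ⊗[K] L))
        ((1 : AlgebraicClosure K) ⊗ₜ[K] H0) fun i => (1 : AlgebraicClosure K) ⊗ₜ[K] H i)
      (eig (AlgebraicClosure K) ((1 : AlgebraicClosure K) ⊗ₜ[K] H0) j) :=
  parabolicRep (elemAut (AlgebraicClosure K) (AlgebraicClosure K ⊗[K] L))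
    ((1 : AlgebraicClosure K) ⊗ₜ[K] H0) (fun i => (1 : AlgebraicClosure K) ⊗ₜ[K] H i) j

/-- The action of `P(H_1, …, H_p)` on `𝔤_j` is geometrically prehomogeneous, and the polynomials
`Q_i` on `𝔤_j` are its fundamental relative invariants, over `K` as well as over `K̄`. -/
structure IsGeomPrehomogeneousWith (H0 : L) {p : ℕ} (H : Fin p → L) (j : ℤ)
    (Q : Fin p → polyFun K (eig K H0 j)) : Prop where
  prehomogeneous : IsPrehomogeneous (geometricRep (K := K) H0 H j)
  fundamental : IsFundamentalSystem (rationalRep (K := K) H0 H j) Q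
  geomFundamental : ∃ Qbar : Fin p → polyFun (AlgebraicClosure K)
      (eig (AlgebraicClosure K) ((1 : AlgebraicClosure K) ⊗ₜ[K] H0) j),
    (∀ i, IsScalarExtension (Q i) (Qbar i)) ∧
      IsFundamentalSystem (geometricRep (K := K) H0 H j) Qbar

end Extensions

end ParabolicPV

end

open ParabolicPV

open scoped TensorProduct

noncomputable section

set_option linter.unusedSectionVars false

namespace ParabolicPV

/-! ### The algebra of polynomial functions -/

section PolyFun

variable {K V : Type*} [Field K] [AddCommGroup V] [Module K V]

/-- A linear form as a polynomial function. -/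
def linElt (l : V →ₗ[K] K) : polyFun K V :=
  ⟨l, Algebra.subset_adjoin ⟨l, rfl⟩⟩

@[simp] lemma linElt_apply (l : V →ₗ[K] K) (x : V) : (linElt l : V → K) x = l x := rfl

lemma polyFun_ext {f g : polyFun K V} (h : ∀ x, (f : V → K) x = (g : V → K) x) : f = g :=
  Subtype.ext (funext h)

lemma polyFun_smul_apply (c : K) (f : polyFun K V) (x : V) :
    ((c • f : polyFun K V) : V → K) x = c * (f : V → K) x := rfl

lemma exists_apply_ne_zero {f : polyFun K V} (hf : f ≠ 0) : ∃ x, (f : V → K) x ≠ 0 := by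
  by_contra! h
  exact hf (polyFun_ext h)

lemma polyFun_induction {P : polyFun K V → Prop}
    (const : ∀ c, P (algebraMap K _ c)) (lin : ∀ l : V →ₗ[K] K, P (linElt l))
    (add : ∀ f g, P f → P g → P (f + g)) (mul : ∀ f g, P f → P g → P (f * g))
    (f : polyFun K V) : P f := by
  obtain ⟨f, hf⟩ := f
  induction hf using Algebra.adjoin_induction with
  | mem x hx => obtain ⟨l, rfl⟩ := hx; exact lin l
  | algebraMap r => exact const r
  | add x y hx hy h1 h2 => exact add _ _ h1 h2
  | mul x y hx hy h1 h2 => exact mul _ _ h1 h2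

/-- Composition of polynomial functions with a linear map. -/
def polyComp {W : Type*} [AddCommGroup W] [Module K W] (φ : V →ₗ[K] W) :
    polyFun K W →ₐ[K] polyFun K V where
  toFun f := ⟨fun x => (f : W → K) (φ x), by
    induction f using polyFun_induction with
    | const c => exact (algebraMap K (polyFun K V) c).2
    | lin l => exact (linElt (l ∘ₗ φ)).2
    | add f g hf hg => exact add_mem hf hg
    | mul f g hf hg => exact mul_mem hf hg⟩
  map_one' := rfl
  map_mul' _ _ := rfl
  map_zero' := rfl
  map_add' _ _ := rfl
  commutes' _ := rfl

@[simp] lemma polyComp_apply {W : Type*} [AddCommGroup W] [Module K W] (φ : V →ₗ[K] W)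
    (f : polyFun K W) (x : V) : (polyComp φ f : V → K) x = (f : W → K) (φ x) := rfl

section Basis

variable {ι : Type*}

/-- Evaluation of polynomials in the coordinates of a basis. -/
def polyAeval (b : Module.Basis ι K V) : MvPolynomial ι K →ₐ[K] polyFun K V :=
  MvPolynomial.aeval fun i => linElt (b.coord i)

lemma polyAeval_apply (b : Module.Basis ι K V) (p : MvPolynomial ι K) (x : V) :
    (polyAeval b p : V → K) x = MvPolynomial.eval (fun i => b.repr x i) p := by
  induction p using MvPolynomial.induction_on with
  | C a => simp [polyAeval]
  | add p q hp hq => simp [hp, hq]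
  | mul_X p i hp =>
    rw [map_mul, map_mul, ← hp]
    simp [polyAeval]

lemma polyAeval_X (b : Module.Basis ι K V) (i : ι) :
    polyAeval b (MvPolynomial.X i) = linElt (b.coord i) := by simp [polyAeval]

variable [Infinite K]

lemma polyAeval_bijective [Finite ι] (b : Module.Basis ι K V) :
    Function.Bijective (polyAeval b) := by
  have := Fintype.ofFinite ι
  constructor
  · intro p q h
    apply MvPolynomial.funext
    intro x
    have h1 := congrArg (fun f : polyFun K V => (f : V → K) (b.equivFun.symm x)) h
    simp only [polyAeval_apply] at h1
    have h2 : (fun i => b.repr (b.equivFun.symm x) i) = x := by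
      ext i
      have := congrFun (b.equivFun.apply_symm_apply x) i
      simpa only [Module.Basis.equivFun_apply] using this
    rwa [h2] at h1
  · intro f
    induction f using polyFun_induction with
    | const c => exact ⟨MvPolynomial.C c, by simp [polyAeval]⟩
    | lin l =>
      refine ⟨∑ i, MvPolynomial.C (l (b i)) * MvPolynomial.X i, polyFun_ext fun x => ?_⟩
      rw [polyAeval_apply]
      conv_rhs => rw [linElt_apply, ← b.sum_repr x, map_sum]
      simp [mul_comm]
    | add f g hf hg =>
      obtain ⟨p, rfl⟩ := hf; obtain ⟨q, rfl⟩ := hg; exact ⟨p + q, map_add _ _ _⟩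
    | mul f g hf hg =>
      obtain ⟨p, rfl⟩ := hf; obtain ⟨q, rfl⟩ := hg; exact ⟨p * q, map_mul _ _ _⟩

/-- The polynomial functions are the polynomials in the coordinates. -/
def polyEquiv [Finite ι] (b : Module.Basis ι K V) : MvPolynomial ι K ≃ₐ[K] polyFun K V :=
  AlgEquiv.ofBijective (polyAeval b) (polyAeval_bijective b)

lemma polyEquiv_apply [Finite ι] (b : Module.Basis ι K V) (p : MvPolynomial ι K) (x : V) :
    (polyEquiv b p : V → K) x = MvPolynomial.eval (fun i => b.repr x i) p :=
  polyAeval_apply b p x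

lemma polyEquiv_X [Finite ι] (b : Module.Basis ι K V) (i : ι) :
    polyEquiv b (MvPolynomial.X i) = linElt (b.coord i) := polyAeval_X b i

variable [FiniteDimensional K V]

instance polyFun_isDomain : IsDomain (polyFun K V) :=
  (polyEquiv (Module.finBasis K V)).symm.toMulEquiv.isDomain _

instance polyFun_ufm : UniqueFactorizationMonoid (polyFun K V) :=
  (polyEquiv (Module.finBasis K V)).toMulEquiv.uniqueFactorizationMonoid inferInstance

/-- The degree of a polynomial function. -/
def pdeg (f : polyFun K V) : ℕ := ((polyEquiv (Module.finBasis K V)).symm f).totalDegree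

lemma pdeg_mul {f g : polyFun K V} (hf : f ≠ 0) (hg : g ≠ 0) :
    pdeg (f * g) = pdeg f + pdeg g := by
  rw [pdeg, map_mul, MvPolynomial.totalDegree_mul_of_isDomain (by simpa) (by simpa)]
  rfl

lemma pdeg_mul_le (f g : polyFun K V) : pdeg (f * g) ≤ pdeg f + pdeg g := by
  rw [pdeg, map_mul]; exact MvPolynomial.totalDegree_mul _ _

lemma pdeg_add_le (f g : polyFun K V) : pdeg (f + g) ≤ max (pdeg f) (pdeg g) := by
  rw [pdeg, map_add]; exact MvPolynomial.totalDegree_add _ _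

lemma pdeg_algebraMap (c : K) : pdeg (algebraMap K (polyFun K V) c) = 0 := by
  rw [pdeg, AlgEquiv.commutes]; exact MvPolynomial.totalDegree_C c

lemma pdeg_one : pdeg (1 : polyFun K V) = 0 := by
  simpa using pdeg_algebraMap (V := V) (1 : K)

lemma pdeg_linElt_le (l : V →ₗ[K] K) : pdeg (linElt l) ≤ 1 := by
  set b := Module.finBasis K V
  have : (polyEquiv b).symm (linElt l) = ∑ i, MvPolynomial.C (l (b i)) * MvPolynomial.X i := by
    rw [AlgEquiv.symm_apply_eq]
    refine polyFun_ext fun x => ?_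
    rw [polyEquiv_apply]
    conv_lhs => rw [linElt_apply, ← b.sum_repr x, map_sum]
    simp [mul_comm]
  rw [pdeg, this]
  refine MvPolynomial.totalDegree_finsetSum_le fun i _ => ?_
  refine (MvPolynomial.totalDegree_mul _ _).trans ?_
  simp

lemma eq_algebraMap_of_pdeg_eq_zero {f : polyFun K V} (hf : pdeg f = 0) :
    ∃ c, f = algebraMap K _ c := by
  rw [pdeg, MvPolynomial.totalDegree_eq_zero_iff_eq_C] at hf
  rw [AlgEquiv.symm_apply_eq] at hf
  exact ⟨_, hf.trans ((polyEquiv (Module.finBasis K V)).commutes _)⟩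

lemma isUnit_polyFun_iff {f : polyFun K V} : IsUnit f ↔ ∃ c : K, c ≠ 0 ∧ f = algebraMap K _ c := by
  constructor
  · intro h
    obtain ⟨g, hg⟩ := h.exists_right_inv
    have hf0 : f ≠ 0 := h.ne_zero
    have hg0 : g ≠ 0 := by rintro rfl; simp at hg
    have := pdeg_mul hf0 hg0
    rw [hg, pdeg_one] at this
    obtain ⟨c, rfl⟩ := eq_algebraMap_of_pdeg_eq_zero (f := f) (by omega)
    exact ⟨c, by rintro rfl; simp at hf0, rfl⟩
  · rintro ⟨c, hc, rfl⟩
    exact (IsUnit.mk0 c hc).map _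

lemma isNonconstant_iff {f : polyFun K V} : IsNonconstant f ↔ pdeg f ≠ 0 := by
  constructor
  · intro h h0
    obtain ⟨c, hc⟩ := eq_algebraMap_of_pdeg_eq_zero h0
    exact h c hc
  · rintro h c rfl
    exact h (pdeg_algebraMap c)

lemma mem_polyLE_iff {f : polyFun K V} {d : ℕ} : (f : V → K) ∈ polyLE K V d ↔ pdeg f ≤ d := by
  constructor
  · have h1 : ∀ v ∈ (1 ⊔ linForms K V : Submodule K (V → K)),
        ∃ f : polyFun K V, (f : V → K) = v ∧ pdeg f ≤ 1 := by
      intro v hv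
      obtain ⟨a, ha, b, hb, rfl⟩ := Submodule.mem_sup.1 hv
      obtain ⟨c, rfl⟩ := Submodule.mem_one.1 ha
      obtain ⟨l, rfl⟩ := hb
      refine ⟨algebraMap K _ c + linElt l, rfl, (pdeg_add_le _ _).trans ?_⟩
      simp [pdeg_algebraMap, pdeg_linElt_le]
    have h2 : ∀ d, ∀ v ∈ polyLE K V d, ∃ f : polyFun K V, (f : V → K) = v ∧ pdeg f ≤ d := by
      intro d
      induction d with
      | zero =>
        intro v hv
        rw [polyLE, pow_zero] at hv
        obtain ⟨c, rfl⟩ := Submodule.mem_one.1 hv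
        exact ⟨algebraMap K _ c, rfl, (pdeg_algebraMap c).le⟩
      | succ d ih =>
        intro v hv
        rw [polyLE, pow_succ] at hv
        induction hv using Submodule.mul_induction_on' with
        | mem_mul_mem m hm n hn =>
          obtain ⟨f, rfl, hf⟩ := ih m hm
          obtain ⟨g, rfl, hg⟩ := h1 n hn
          exact ⟨f * g, rfl, (pdeg_mul_le _ _).trans (by omega)⟩
        | add x _ y _ hx hy =>
          obtain ⟨f, rfl, hf⟩ := hx
          obtain ⟨g, rfl, hg⟩ := hy
          exact ⟨f + g, rfl, (pdeg_add_le _ _).trans (by omega)⟩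
    intro h
    obtain ⟨g, hg, hd⟩ := h2 d _ h
    rwa [Subtype.ext hg] at hd
  · intro h
    set b := Module.finBasis K V
    have hmono : ∀ (s : Fin (Module.finrank K V) →₀ ℕ),
        ((polyEquiv b (MvPolynomial.monomial s 1) : polyFun K V) : V → K) ∈
          polyLE K V s.degree := by
      intro s
      induction s using Finsupp.induction_linear with
      | zero =>
        rw [map_zero, polyLE, pow_zero]
        exact Submodule.mem_one.2 ⟨1, by ext x; simp⟩
      | add s t hs ht =>
        have : (MvPolynomial.monomial (s + t) (1 : K)) =
          MvPolynomial.monomial s 1 * MvPolynomial.monomial t 1 := by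
          simp [MvPolynomial.monomial_mul]
        rw [this, map_add, polyLE, pow_add, map_mul]
        exact Submodule.mul_mem_mul hs ht
      | single i n =>
        rw [← MvPolynomial.X_pow_eq_monomial, map_pow, polyEquiv_X, Finsupp.degree_single]
        exact Submodule.pow_mem_pow _ (Submodule.mem_sup_right (LinearMap.mem_range_self
          (LinearMap.ltoFun K V K K) (b.coord i))) n
    have hle : ∀ {n}, n ≤ d → polyLE K V n ≤ polyLE K V d := fun hn =>
      pow_le_pow_right₀ (a := (1 ⊔ linForms K V : Submodule K (V → K))) le_sup_left hn
    have hf : f = polyEquiv b ((polyEquiv b).symm f) := by simp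
    rw [hf, MvPolynomial.as_sum ((polyEquiv b).symm f), map_sum]
    have : ((∑ x ∈ ((polyEquiv b).symm f).support, polyEquiv b (MvPolynomial.monomial x
        (MvPolynomial.coeff x ((polyEquiv b).symm f))) : polyFun K V) : V → K) =
      ∑ x ∈ ((polyEquiv b).symm f).support, MvPolynomial.coeff x ((polyEquiv b).symm f) •
        ((polyEquiv b (MvPolynomial.monomial x 1) : polyFun K V) : V → K) := by
      rw [AddSubmonoidClass.coe_finsetSum]
      refine Finset.sum_congr rfl fun s _ => ?_
      rw [← mul_one (MvPolynomial.coeff s _), ← smul_eq_mul, ← MvPolynomial.smul_monomial,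
        map_smul]
      simp
    rw [this]
    refine Submodule.sum_mem _ fun s hs => Submodule.smul_mem _ _ (hle ?_ (hmono s))
    exact (MvPolynomial.le_totalDegree hs).trans h

end Basis

section Derivations

lemma totalDegree_mkDerivation_le {σ : Type*} (g : σ → MvPolynomial σ K) {r : ℕ}
    (hg : ∀ i, (g i).totalDegree ≤ r) (p : MvPolynomial σ K) :
    (MvPolynomial.mkDerivation K g p).totalDegree ≤ p.totalDegree - 1 + r := by
  conv_lhs => rw [MvPolynomial.as_sum p, map_sum]
  refine MvPolynomial.totalDegree_finsetSum_le fun s hs => ?_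
  rw [MvPolynomial.mkDerivation_monomial]
  refine (MvPolynomial.totalDegree_smul_le _ _).trans ?_
  refine MvPolynomial.totalDegree_finsetSum_le fun i hi => ?_
  change (MvPolynomial.monomial (s - Finsupp.single i 1) (s i : K) * g i).totalDegree ≤ _
  refine (MvPolynomial.totalDegree_mul _ _).trans (add_le_add ?_ (hg i))
  refine (MvPolynomial.totalDegree_monomial_le _ _).trans ?_
  have h1 := MvPolynomial.le_totalDegree hs
  have h2 : (s - Finsupp.single i 1).degree + 1 = s.degree := by
    have h3 : s - Finsupp.single i 1 + Finsupp.single i 1 = s := by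
      apply tsub_add_cancel_of_le
      rw [Finsupp.single_le_iff]
      exact Nat.one_le_iff_ne_zero.2 (Finsupp.mem_support_iff.1 hi)
    conv_rhs => rw [← h3, map_add, Finsupp.degree_single]
  change (s - Finsupp.single i 1).degree ≤ _
  change s.degree ≤ _ at h1
  omega

variable [Infinite K] [FiniteDimensional K V]

/-- The derivation of the algebra of polynomial functions with prescribed values on the linear
forms. -/
def polyDer (φ : (V →ₗ[K] K) →ₗ[K] polyFun K V) : Derivation K (polyFun K V) (polyFun K V) :=
  let e := polyEquiv (Module.finBasis K V)
  let D := MvPolynomial.mkDerivation K fun i => e.symm (φ ((Module.finBasis K V).coord i))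
  Derivation.mk' (e.toLinearMap ∘ₗ D.toLinearMap ∘ₗ e.symm.toLinearMap) fun a b => by
    change e (D (e.symm (a * b))) = a * e (D (e.symm b)) + b * e (D (e.symm a))
    rw [map_mul, Derivation.leibniz]
    simp

lemma polyDer_apply (φ : (V →ₗ[K] K) →ₗ[K] polyFun K V) (f : polyFun K V) :
    polyDer φ f = polyEquiv (Module.finBasis K V) (MvPolynomial.mkDerivation K
      (fun i => (polyEquiv (Module.finBasis K V)).symm (φ ((Module.finBasis K V).coord i)))
        ((polyEquiv (Module.finBasis K V)).symm f)) := rfl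

lemma polyDer_linElt (φ : (V →ₗ[K] K) →ₗ[K] polyFun K V) (l : V →ₗ[K] K) :
    polyDer φ (linElt l) = φ l := by
  set b := Module.finBasis K V
  have hl : l = ∑ i, l (b i) • b.coord i := by
    apply b.ext
    intro j
    simp
  have h2 : linElt l = ∑ i, l (b i) • linElt (b.coord i) := by
    refine polyFun_ext fun x => ?_
    rw [AddSubmonoidClass.coe_finsetSum, Finset.sum_apply]
    exact (LinearMap.congr_fun hl x).trans (LinearMap.sum_apply _ _ _)
  rw [h2]
  conv_rhs => rw [hl]
  rw [map_sum, map_sum]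
  refine Finset.sum_congr rfl fun i _ => ?_
  rw [Derivation.map_smul, map_smul, polyDer_apply, ← polyEquiv_X, AlgEquiv.symm_apply_apply,
    MvPolynomial.mkDerivation_X, AlgEquiv.apply_symm_apply]

lemma pdeg_polyDer_le (φ : (V →ₗ[K] K) →ₗ[K] polyFun K V) {r : ℕ} (h : ∀ l, pdeg (φ l) ≤ r)
    (f : polyFun K V) : pdeg (polyDer φ f) ≤ pdeg f - 1 + r := by
  rw [polyDer_apply, pdeg, AlgEquiv.symm_apply_apply]
  exact totalDegree_mkDerivation_le _ (fun i => h _) _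

variable (K) in
/-- The derivative in a constant direction. -/
def pder (v : V) : Derivation K (polyFun K V) (polyFun K V) :=
  polyDer ((Algebra.linearMap K (polyFun K V)) ∘ₗ (Module.Dual.eval K V v))

lemma pder_linElt (v : V) (l : V →ₗ[K] K) : pder K v (linElt l) = algebraMap K _ (l v) :=
  polyDer_linElt _ _

/-- Linear forms as polynomial functions, as a linear map. -/
def linEltₗ : (V →ₗ[K] K) →ₗ[K] polyFun K V where
  toFun := linElt
  map_add' _ _ := rfl
  map_smul' _ _ := rfl

/-- The derivative along the linear vector field `T`. -/
def lder (T : V →ₗ[K] V) : Derivation K (polyFun K V) (polyFun K V) :=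
  polyDer (linEltₗ ∘ₗ LinearMap.lcomp K K T)

lemma lder_linElt (T : V →ₗ[K] V) (l : V →ₗ[K] K) : lder T (linElt l) = linElt (l ∘ₗ T) :=
  polyDer_linElt _ _

/-- The differential of a polynomial function at a point. -/
def dd (f : polyFun K V) (x : V) : V →ₗ[K] K where
  toFun v := (pder K v f : V → K) x
  map_add' v w := by
    induction f using polyFun_induction with
    | const c => simp
    | lin l => simp [pder_linElt]
    | add f g hf hg => simp only [map_add, AddMemClass.coe_add, Pi.add_apply] at *; rw [hf, hg]; ring
    | mul f g hf hg => simp at *; rw [hf, hg]; ring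
  map_smul' c v := by
    induction f using polyFun_induction with
    | const c => simp
    | lin l => simp [pder_linElt]
    | add f g hf hg => simp only [map_add, AddMemClass.coe_add, Pi.add_apply] at *; rw [hf, hg]; simp; ring
    | mul f g hf hg => simp at *; rw [hf, hg]; ring

lemma pder_apply (f : polyFun K V) (x v : V) : (pder K v f : V → K) x = dd f x v := rfl

@[simp] lemma dd_algebraMap (c : K) (x v : V) : dd (algebraMap K (polyFun K V) c) x v = 0 := by
  simp [← pder_apply]

@[simp] lemma dd_linElt (l : V →ₗ[K] K) (x v : V) : dd (linElt l) x v = l v := by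
  simp [← pder_apply, pder_linElt]

lemma dd_add (f g : polyFun K V) (x v : V) : dd (f + g) x v = dd f x v + dd g x v := by
  simp [← pder_apply]

lemma dd_mul (f g : polyFun K V) (x v : V) :
    dd (f * g) x v = (f : V → K) x * dd g x v + (g : V → K) x * dd f x v := by
  simp [← pder_apply]

lemma lder_apply (T : V →ₗ[K] V) (f : polyFun K V) (x : V) :
    (lder T f : V → K) x = dd f x (T x) := by
  induction f using polyFun_induction with
  | const c => simp
  | lin l => simp [lder_linElt]
  | add f g hf hg => simp [dd_add, hf, hg]
  | mul f g hf hg => simp [dd_mul, hf, hg]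

lemma dd_polyComp {W : Type*} [AddCommGroup W] [Module K W] [FiniteDimensional K W]
    (φ : V →ₗ[K] W) (f : polyFun K W) (x v : V) :
    dd (polyComp φ f) x v = dd f (φ x) (φ v) := by
  induction f using polyFun_induction with
  | const c => simp
  | lin l =>
    have : polyComp φ (linElt l) = linElt (l ∘ₗ φ) := rfl
    simp [this]
  | add f g hf hg => simp [dd_add, hf, hg]
  | mul f g hf hg => simp [dd_mul, hf, hg]

lemma pdeg_lder_le (T : V →ₗ[K] V) (f : polyFun K V) : pdeg (lder T f) ≤ pdeg f := by
  by_cases h : pdeg f = 0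
  · obtain ⟨c, rfl⟩ := eq_algebraMap_of_pdeg_eq_zero h
    simp [pdeg]
  · have := pdeg_polyDer_le (linEltₗ ∘ₗ LinearMap.lcomp K K T) (r := 1)
      (fun l => pdeg_linElt_le _) f
    exact this.trans (by omega)

lemma pdeg_pder_le (v : V) (f : polyFun K V) : pdeg (pder K v f) ≤ pdeg f - 1 := by
  rw [pder]
  refine pdeg_polyDer_le _ (r := 0) (fun l => ?_) f
  rw [LinearMap.comp_apply, Algebra.linearMap_apply]
  exact (pdeg_algebraMap _).le

lemma lder_eq_smul_of_dvd {T : V →ₗ[K] V} {f : polyFun K V} (h : f ∣ lder T f) :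
    ∃ c : K, lder T f = c • f := by
  obtain ⟨g, hg⟩ := h
  by_cases h0 : f = 0
  · exact ⟨0, by simp [h0]⟩
  by_cases hg0 : g = 0
  · exact ⟨0, by simp [hg, hg0]⟩
  have h1 := pdeg_lder_le T f
  rw [hg, pdeg_mul h0 hg0] at h1
  obtain ⟨c, rfl⟩ := eq_algebraMap_of_pdeg_eq_zero (f := g) (by omega)
  exact ⟨c, by rw [hg, mul_comm, Algebra.smul_def]⟩

/-- Chain rule along polynomial curves. -/
lemma exists_polynomial_comp {γ γ' : K → V}
    (h : ∀ l : V →ₗ[K] K, ∃ P : Polynomial K, ∀ s, l (γ s) = P.eval s ∧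
      l (γ' s) = P.derivative.eval s) (f : polyFun K V) :
    ∃ P : Polynomial K, ∀ s, (f : V → K) (γ s) = P.eval s ∧
      dd f (γ s) (γ' s) = P.derivative.eval s := by
  induction f using polyFun_induction with
  | const c => exact ⟨Polynomial.C c, by simp⟩
  | lin l => simpa using h l
  | add f g hf hg =>
    obtain ⟨P, hP⟩ := hf
    obtain ⟨Q, hQ⟩ := hg
    exact ⟨P + Q, fun s => by simp [dd_add, hP s, hQ s]⟩
  | mul f g hf hg =>
    obtain ⟨P, hP⟩ := hf
    obtain ⟨Q, hQ⟩ := hg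
    exact ⟨P * Q, fun s => by simp [dd_mul, hP s, hQ s]; ring⟩

lemma eq_of_dd_eq_zero_along [CharZero K] {γ γ' : K → V}
    (h : ∀ l : V →ₗ[K] K, ∃ P : Polynomial K, ∀ s, l (γ s) = P.eval s ∧
      l (γ' s) = P.derivative.eval s) {f : polyFun K V} (hf : ∀ s, dd f (γ s) (γ' s) = 0)
    (s t : K) : (f : V → K) (γ s) = (f : V → K) (γ t) := by
  obtain ⟨P, hP⟩ := exists_polynomial_comp h f
  have : P.derivative = 0 := Polynomial.funext fun s => by
    rw [← (hP s).2, hf, Polynomial.eval_zero]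
  rw [(hP s).1, (hP t).1, Polynomial.eq_C_of_derivative_eq_zero this, Polynomial.eval_C,
    Polynomial.eval_C]

lemma exists_line_polynomial (x v : V) (l : V →ₗ[K] K) :
    ∃ P : Polynomial K, ∀ s, l (x + s • v) = P.eval s ∧ l v = P.derivative.eval s :=
  ⟨Polynomial.C (l x) + Polynomial.C (l v) * Polynomial.X, fun s => by
    simp only [map_add, map_smul, smul_eq_mul, Polynomial.eval_add, Polynomial.eval_C,
      Polynomial.eval_mul, Polynomial.eval_X, Polynomial.derivative_C, zero_add,
      Polynomial.derivative_C_mul, Polynomial.derivative_X, mul_one, and_true]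
    rw [mul_comm]⟩

lemma eq_algebraMap_of_dd_eq_zero [CharZero K] {f : polyFun K V} (hf : ∀ x v, dd f x v = 0) :
    ∃ c, f = algebraMap K _ c := by
  refine ⟨(f : V → K) 0, polyFun_ext fun x => ?_⟩
  have := eq_of_dd_eq_zero_along (γ := fun s => 0 + s • x) (γ' := fun _ => x) (f := f)
    (exists_line_polynomial 0 x) (fun s => hf _ _) 1 0
  simpa using this

lemma eq_algebraMap_of_dvd_pder [CharZero K] {f : polyFun K V} (h : ∀ v, f ∣ pder K v f) :
    ∃ c, f = algebraMap K _ c := by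
  by_cases h0 : pdeg f = 0
  · exact eq_algebraMap_of_pdeg_eq_zero h0
  apply eq_algebraMap_of_dd_eq_zero
  intro x v
  suffices pder K v f = 0 by rw [← pder_apply, this]; rfl
  by_contra hne
  obtain ⟨g, hg⟩ := h v
  have h1 := pdeg_pder_le v f
  have hf0 : f ≠ 0 := by rintro rfl; simp at hne
  have hg0 : g ≠ 0 := by rintro rfl; simp [hg] at hne
  rw [hg, pdeg_mul hf0 hg0] at h1
  omega

lemma isRelPrime_dvd {f g h : polyFun K V} (hfg : IsRelPrime f g) (h1 : f ∣ h * g) : f ∣ h :=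
  hfg.dvd_of_dvd_mul_right h1

/-- Two polynomial functions are written as multiples of their greatest common divisor. -/
lemma exists_isRelPrime {f g : polyFun K V} (hf : f ≠ 0) :
    ∃ d a b : polyFun K V, d ≠ 0 ∧ f = d * a ∧ g = d * b ∧ IsRelPrime a b := by
  obtain ⟨a, b, d, hab, rfl, rfl⟩ := UniqueFactorizationMonoid.exists_reduced_factors f hf g
  exact ⟨d, a, b, left_ne_zero_of_mul hf, rfl, rfl, hab⟩

/-- Polynomial functions with the same logarithmic derivative are proportional. -/
lemma exists_eq_smul_of_dd_eq [CharZero K] {f g : polyFun K V} (hf : f ≠ 0) (hg : g ≠ 0)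
    (h : ∀ x v, dd f x v * (g : V → K) x = (f : V → K) x * dd g x v) :
    ∃ c : K, c ≠ 0 ∧ f = c • g := by
  obtain ⟨d, a, b, hd, rfl, rfl, hab⟩ := exists_isRelPrime (g := g) hf
  have h1 : ∀ v, pder K v a * b = a * pder K v b := by
    intro v
    have h2 : (d * d) * (pder K v a * b) = (d * d) * (a * pder K v b) := by
      refine polyFun_ext fun x => ?_
      have := h x v
      simp only [dd_mul, MulMemClass.coe_mul, Pi.mul_apply, pder_apply] at this ⊢
      linear_combination this
    exact mul_left_cancel₀ (mul_ne_zero hd hd) h2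
  obtain ⟨α, rfl⟩ := eq_algebraMap_of_dvd_pder (f := a) fun v =>
    isRelPrime_dvd hab ⟨_, h1 v⟩
  obtain ⟨β, rfl⟩ := eq_algebraMap_of_dvd_pder (f := b) fun v =>
    isRelPrime_dvd hab.symm ⟨pder K v (algebraMap K _ α), by rw [mul_comm _ (algebraMap K _ α), ← h1 v, mul_comm]⟩
  have hα : α ≠ 0 := by rintro rfl; simp at hf
  have hβ : β ≠ 0 := by rintro rfl; simp at hg
  refine ⟨α / β, div_ne_zero hα hβ, ?_⟩
  rw [← mul_smul_comm, Algebra.smul_def, ← map_mul, div_mul_cancel₀ _ hβ]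

/-- Irreducibility is preserved by composition with a linear surjection. -/
lemma irreducible_polyComp [CharZero K] {W : Type*} [AddCommGroup W] [Module K W] [FiniteDimensional K W]
    {φ : V →ₗ[K] W} {σ : W →ₗ[K] V} (hσ : ∀ w, φ (σ w) = w) {f : polyFun K W}
    (hf : Irreducible f) : Irreducible (polyComp φ f) := by
  have hinj : Function.Injective (polyComp φ) := fun a b hab => polyFun_ext fun w => by
    have := congrArg (fun q : polyFun K V => (q : V → K) (σ w)) hab
    simpa [hσ] using this
  have hf0 : polyComp φ f ≠ 0 := (map_ne_zero_iff _ hinj).2 hf.ne_zero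
  have key : ∀ a b : polyFun K V, polyComp φ f = a * b → a = polyComp φ (polyComp σ a) := by
    intro a b hab
    suffices h : ∀ x u : V, φ u = 0 → (a : V → K) (x + u) = (a : V → K) x by
      refine polyFun_ext fun x => ?_
      have := h (σ (φ x)) (x - σ (φ x)) (by simp [hσ])
      simpa using this
    intro x u hu
    have h1 : polyComp φ f * pder K u a = 0 := by
      refine polyFun_ext fun y => ?_
      by_cases hy : (polyComp φ f : V → K) y = 0
      · simp only [MulMemClass.coe_mul, Pi.mul_apply, hy, zero_mul]; rfl
      obtain ⟨P, hP⟩ := exists_polynomial_comp (exists_line_polynomial y u) a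
      obtain ⟨Q, hQ⟩ := exists_polynomial_comp (exists_line_polynomial y u) b
      have hPQ : P * Q = Polynomial.C ((polyComp φ f : V → K) y) := by
        refine Polynomial.funext fun s => ?_
        have h2 := congrArg (fun q : polyFun K V => (q : V → K) (y + s • u)) hab
        simp only [polyComp_apply, map_add, map_smul, hu, smul_zero, add_zero,
          MulMemClass.coe_mul, Pi.mul_apply] at h2
        rw [Polynomial.eval_mul, ← (hP s).1, ← (hQ s).1, ← h2]
        simp
      have hu2 : IsUnit P := isUnit_of_mul_isUnit_left (y := Q) (by
        rw [hPQ]; exact (IsUnit.mk0 _ hy).map Polynomial.C)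
      have h3 : P.derivative = 0 := by
        obtain ⟨r, -, rfl⟩ := Polynomial.isUnit_iff.1 hu2
        simp
      have h4 := (hP 0).2
      rw [h3] at h4
      simp only [zero_smul, add_zero, Polynomial.eval_zero] at h4
      simp only [MulMemClass.coe_mul, Pi.mul_apply, pder_apply, h4, mul_zero]; rfl
    have h2 : pder K u a = 0 := (mul_eq_zero.1 h1).resolve_left hf0
    have := eq_of_dd_eq_zero_along (γ := fun s => x + s • u) (γ' := fun _ => u) (f := a)
      (exists_line_polynomial x u) (fun s => by rw [← pder_apply, h2]; rfl) 1 0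
    simpa using this
  refine ⟨fun h => hf.not_isUnit ?_, fun a b hab => ?_⟩
  · obtain ⟨c, hc, h⟩ := isUnit_polyFun_iff.1 h
    refine isUnit_polyFun_iff.2 ⟨c, hc, hinj ?_⟩
    rw [h, AlgHom.commutes]
  · have ha := key a b hab
    have hb := key b a (by rw [hab, mul_comm])
    rw [ha, hb, ← map_mul] at hab
    rw [ha, hb]
    exact (hf.isUnit_or_isUnit (hinj hab)).imp (fun h => h.map _) (fun h => h.map _)

end Derivations

end PolyFun

/-! ### Eigenspaces of elements of a Lie algebra -/

section Eigen

variable {K L : Type*} [Field K] [LieRing L] [LieAlgebra K L]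

lemma lie_mem_eig {h x y : L} {i j : ℤ} (hx : x ∈ eig K h i) (hy : y ∈ eig K h j) :
    ⁅x, y⁆ ∈ eig K h (i + j) := by
  rw [mem_eig] at *
  rw [leibniz_lie, hx, hy, lie_smul, smul_lie, ← add_smul]
  push_cast
  rfl

lemma lie_mem_eig' {h x y : L} {i j l : ℤ} (hx : x ∈ eig K h i) (hy : y ∈ eig K h j)
    (hl : i + j = l) : ⁅x, y⁆ ∈ eig K h l := hl ▸ lie_mem_eig hx hy

lemma mem_eig_zero {h x : L} : x ∈ eig K h 0 ↔ ⁅h, x⁆ = 0 := by simp [mem_eig]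

lemma pow_ad_mem_eig {h x v : L} {i a : ℤ} (hx : x ∈ eig K h a) (hv : v ∈ eig K h i) (n : ℕ) :
    (LieAlgebra.ad K L x ^ n) v ∈ eig K h (i + n * a) := by
  induction n with
  | zero => simpa using hv
  | succ n ih =>
    rw [pow_succ', Module.End.mul_apply, LieAlgebra.ad_apply]
    exact lie_mem_eig' hx ih (by push_cast; ring)

variable (K) in
/-- `ad h` is diagonalizable with integral eigenvalues. -/
def IsDiag (h : L) : Prop := ⨆ i : ℤ, eig K h i = ⊤

variable [CharZero K]

lemma iSupIndep_eig (h : L) : iSupIndep fun i : ℤ => eig K h i :=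
  (Module.End.eigenspaces_iSupIndep (LieAlgebra.ad K L h)).comp (f := fun i : ℤ => (i : K))
    Int.cast_injective

/-- The projection to `E_i(h)` along the other eigenspaces. -/
def eproj (h : L) (hd : IsDiag K h) (i : ℤ) : L →ₗ[K] L :=
  have hi := DirectSum.isInternal_submodule_of_iSupIndep_of_iSup_eq_top (iSupIndep_eig (K := K) h) hd
  (eig K h i).subtype ∘ₗ DirectSum.component K ℤ (fun i => eig K h i) i ∘ₗ
    (LinearEquiv.ofBijective (DirectSum.coeLinearMap fun i : ℤ => eig K h i) hi).symm.toLinearMap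

lemma eproj_mem {h : L} (hd : IsDiag K h) (i : ℤ) (x : L) : eproj h hd i x ∈ eig K h i := by
  rw [eproj, LinearMap.comp_apply]
  exact Subtype.prop _

lemma eproj_eq_ite {h : L} (hd : IsDiag K h) {i j : ℤ} {x : L} (hx : x ∈ eig K h j) :
    eproj h hd i x = if i = j then x else 0 := by
  have hi := DirectSum.isInternal_submodule_of_iSupIndep_of_iSup_eq_top (iSupIndep_eig (K := K) h) hd
  have h1 : (LinearEquiv.ofBijective (DirectSum.coeLinearMap fun i : ℤ => eig K h i) hi).symm x =
      DirectSum.lof K ℤ (fun i => eig K h i) j ⟨x, hx⟩ := by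
    rw [LinearEquiv.symm_apply_eq]
    exact (DirectSum.coeLinearMap_lof (fun i => eig K h i) j ⟨x, hx⟩).symm
  change ((DirectSum.component K ℤ (fun i => eig K h i) i
    ((LinearEquiv.ofBijective (DirectSum.coeLinearMap fun i : ℤ => eig K h i) hi).symm x) : eig K h i) : L) = _
  rw [h1]
  split_ifs with hij
  · subst hij; rw [DirectSum.component.lof_self]
  · rw [DirectSum.component.of]
    rw [dif_neg (fun h => hij h.symm)]; rfl

lemma eproj_self {h : L} (hd : IsDiag K h) {i : ℤ} {x : L} (hx : x ∈ eig K h i) :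
    eproj h hd i x = x := by simp [eproj_eq_ite hd hx]

lemma eproj_of_ne {h : L} (hd : IsDiag K h) {i j : ℤ} (hij : i ≠ j) {x : L}
    (hx : x ∈ eig K h j) : eproj h hd i x = 0 := by simp [eproj_eq_ite hd hx, hij]

lemma diag_induction {h : L} (hd : IsDiag K h) {P : L → Prop} (x : L)
    (mem : ∀ i, ∀ x ∈ eig K h i, P x) (add : ∀ x y, P x → P y → P (x + y)) : P x := by
  have hx : x ∈ ⨆ i : ℤ, eig K h i := by rw [hd]; trivial
  induction hx using Submodule.iSup_induction' with
  | mem i x hx => exact mem i x hx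
  | zero => exact mem 0 0 (zero_mem _)
  | add x y _ _ h1 h2 => exact add x y h1 h2

lemma eproj_shift {h : L} (hd : IsDiag K h) {a : ℤ} {φ : L →ₗ[K] L}
    (hφ : ∀ j, ∀ x ∈ eig K h j, φ x ∈ eig K h (j + a)) (i : ℤ) (x : L) :
    eproj h hd (i + a) (φ x) = φ (eproj h hd i x) := by
  induction x using diag_induction hd with
  | mem j x hx =>
    rw [eproj_eq_ite hd hx, eproj_eq_ite hd (hφ j x hx)]
    simp only [add_left_inj]
    split_ifs <;> simp
  | add x y hx hy => simp [hx, hy]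

lemma eproj_lie {h u : L} (hd : IsDiag K h) {a : ℤ} (hu : u ∈ eig K h a) (i : ℤ) (x : L) :
    eproj h hd (i + a) ⁅u, x⁆ = ⁅u, eproj h hd i x⁆ :=
  eproj_shift hd (φ := LieAlgebra.ad K L u)
    (fun _ _ hx => lie_mem_eig' hu hx (add_comm _ _)) i x

lemma eproj_comm {h u : L} (hd : IsDiag K h) (hu : ⁅h, u⁆ = 0) (i : ℤ) (x : L) :
    eproj h hd i ⁅u, x⁆ = ⁅u, eproj h hd i x⁆ := by
  simpa using eproj_lie hd (a := 0) (mem_eig_zero.2 hu) i x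

lemma eproj_mem_eig {h h' : L} (hd : IsDiag K h) (hc : ⁅h, h'⁆ = 0) (i : ℤ) {j : ℤ} {x : L}
    (hx : x ∈ eig K h' j) : eproj h hd i x ∈ eig K h' j := by
  rw [mem_eig] at *
  rw [← eproj_comm hd hc, hx, map_smul]

lemma exists_eq_sum_eproj {h : L} (hd : IsDiag K h) (x : L) :
    ∃ s : Finset ℤ, x = ∑ i ∈ s, eproj h hd i x := by
  classical
  have hi := DirectSum.isInternal_submodule_of_iSupIndep_of_iSup_eq_top
    (iSupIndep_eig (K := K) h) hd
  refine ⟨DFinsupp.support ((LinearEquiv.ofBijective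
    (DirectSum.coeLinearMap fun i : ℤ => eig K h i) hi).symm x), ?_⟩
  conv_lhs => rw [← (LinearEquiv.ofBijective
    (DirectSum.coeLinearMap fun i : ℤ => eig K h i) hi).apply_symm_apply x]
  exact DirectSum.coeAddMonoidHom_eq_dfinsuppSum _ _

lemma eq_zero_of_eproj_eq_zero {h : L} (hd : IsDiag K h) {x : L}
    (hx : ∀ i, eproj h hd i x = 0) : x = 0 := by
  obtain ⟨s, hs⟩ := exists_eq_sum_eproj hd x
  rw [hs]
  exact Finset.sum_eq_zero fun i _ => hx i

variable [FiniteDimensional K L]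

variable (K) in
lemma exists_eig_eq_bot (h : L) : ∃ B : ℕ, ∀ i : ℤ, (B : ℤ) < |i| → eig K h i = ⊥ := by
  have hf := WellFoundedGT.finite_ne_bot_of_iSupIndep (iSupIndep_eig (K := K) h)
  obtain ⟨B, hB⟩ := (hf.image (fun i : ℤ => i.natAbs)).bddAbove
  refine ⟨B, fun i hi => ?_⟩
  by_contra hne
  have := hB ⟨i, hne, rfl⟩
  simp only at this
  rw [Int.abs_eq_natAbs] at hi
  omega

lemma isNilpotent_ad_of_mem_eig {h x : L} (hd : IsDiag K h) {a : ℤ} (ha : a ≠ 0)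
    (hx : x ∈ eig K h a) : IsNilpotent (LieAlgebra.ad K L x) := by
  obtain ⟨B, hB⟩ := exists_eig_eq_bot K h
  refine ⟨2 * B + 1, LinearMap.ext fun v => ?_⟩
  induction v using diag_induction hd with
  | mem i v hv =>
    by_cases hi : (B : ℤ) < |i|
    · rw [hB i hi, Submodule.mem_bot] at hv
      simp [hv]
    · have h1 := pow_ad_mem_eig hx hv (2 * B + 1)
      rw [hB] at h1
      · simpa using h1
      · have h2 : (2 * B + 1 : ℤ) ≤ |(2 * B + 1 : ℤ) * a| := by
          rw [abs_mul]
          have h3 : 1 ≤ |a| := Int.one_le_abs ha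
          have h4 : |(2 * B + 1 : ℤ)| = 2 * B + 1 := abs_of_nonneg (by positivity)
          rw [h4]; nlinarith
        have h5 := abs_sub_abs_le_abs_sub ((2 * B + 1 : ℤ) * a) (-i)
        rw [abs_neg, sub_neg_eq_add, add_comm _ i] at h5
        push_cast
        omega
  | add v w hv hw => simp only [map_add, hv, hw, LinearMap.zero_apply, add_zero]

/-! ### The Killing form -/

variable (K) in
/-- The Killing form. -/
abbrev kf (x y : L) : K := killingForm K L x y

lemma kf_comm (x y : L) : kf K x y = kf K y x := LieModule.traceForm_comm K L L x y

lemma kf_lie (x y z : L) : kf K ⁅x, y⁆ z = kf K x ⁅y, z⁆ :=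
  LieModule.traceForm_apply_lie_apply K L L x y z

lemma kf_eq_zero {h x y : L} {i j : ℤ} (hx : x ∈ eig K h i) (hy : y ∈ eig K h j)
    (hij : i + j ≠ 0) : kf K x y = 0 := by
  rw [mem_eig] at hx hy
  have h1 : kf K ⁅x, h⁆ y = kf K x ⁅h, y⁆ := kf_lie x h y
  rw [← lie_skew, hx, hy] at h1
  simp only [kf, map_neg, map_smul, LinearMap.neg_apply, LinearMap.smul_apply,
    smul_eq_mul] at h1 ⊢
  have h2 : ((i + j : ℤ) : K) * killingForm K L x y = 0 := by push_cast; linear_combination -h1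
  exact (mul_eq_zero.1 h2).resolve_left (Int.cast_ne_zero.2 hij)

lemma eq_zero_of_kf [LieAlgebra.IsKilling K L] {x : L} (hx : ∀ y, kf K x y = 0) : x = 0 := by
  have := LieAlgebra.IsKilling.killingForm_nondegenerate (R := K) (L := L)
  exact this.1 x hx

lemma kf_eproj {h : L} (hd : IsDiag K h) {i : ℤ} {x : L} (hx : x ∈ eig K h i) (y : L) :
    kf K x y = kf K x (eproj h hd (-i) y) := by
  induction y using diag_induction hd with
  | mem j y hy =>
    rw [eproj_eq_ite hd hy]
    split_ifs with hij
    · rfl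
    · rw [kf_eq_zero hx hy (by omega)]; simp [kf]
  | add y z hy hz => simp only [kf, map_add] at *; rw [hy, hz]

/-! ### Representations of `sl₂` -/

variable {h x y : L}

lemma lie_eq_zero_of_neg (t : IsSl2Triple h x y) {v : L} {i : ℤ} (hv : v ∈ eig K h i)
    (hi : i < 0) (h0 : ⁅x, v⁆ = 0) : v = 0 := by
  by_contra hne
  have P : t.HasPrimitiveVectorWith v (i : K) := ⟨hne, mem_eig.1 hv, h0⟩
  obtain ⟨n, hn⟩ := P.exists_nat
  have : i = n := by exact_mod_cast hn
  omega

lemma neg_mem_eig {i : ℤ} {v : L} (hv : v ∈ eig K h i) : v ∈ eig K (-h) (-i) := by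
  rw [mem_eig] at *
  simp [hv]

lemma IsSl2Triple.mem_e (t : IsSl2Triple h x y) : x ∈ eig K h 2 := by
  rw [mem_eig]; simpa using t.lie_h_e_smul K

lemma IsSl2Triple.mem_f (t : IsSl2Triple h x y) : y ∈ eig K h (-2) := by
  rw [mem_eig, t.lie_lie_smul_f K]; simp

/-- A vector of weight zero killed by `x` is killed by `y`. -/
lemma lie_f_eq_zero (t : IsSl2Triple h x y) {v : L} (hv : v ∈ eig K h 0) (h0 : ⁅x, v⁆ = 0) :
    ⁅y, v⁆ = 0 := by
  by_cases hne : v = 0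
  · simp [hne]
  have P : t.HasPrimitiveVectorWith v ((0 : ℕ) : K) := ⟨hne, by simpa using mem_eig.1 hv, h0⟩
  simpa using P.pow_toEnd_f_eq_zero_of_eq_nat rfl

lemma ad_e_pow_succ_ad_f (t : IsSl2Triple h x y) {w : L} {m : ℤ} (hw : w ∈ eig K h m)
    (h0 : ⁅x, w⁆ = 0) (n : ℕ) :
    ⁅x, (LieAlgebra.ad K L y ^ (n + 1)) w⁆ =
      (((n + 1) * (m - n) : ℤ) : K) • (LieAlgebra.ad K L y ^ n) w := by
  by_cases hne : w = 0
  · simp [hne]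
  have P : t.HasPrimitiveVectorWith w (m : K) := ⟨hne, mem_eig.1 hw, h0⟩
  have := P.lie_e_pow_succ_toEnd_f n
  push_cast
  exact this

/-- Vectors of non-negative weight are sums of the `y ^ j w_j` with primitive `w_j`. -/
lemma exists_primitive_decomp (hd : IsDiag K h) (t : IsSl2Triple h x y) {v : L} {i : ℤ}
    (hv : v ∈ eig K h i) (hi : 0 ≤ i) :
    ∃ (n : ℕ) (w : ℕ → L), (∀ j : ℕ, w j ∈ eig K h (i + 2 * j) ∧ ⁅x, w j⁆ = 0) ∧
      v = ∑ j ∈ Finset.range n, (LieAlgebra.ad K L y ^ j) (w j) := by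
  obtain ⟨N, hN⟩ := isNilpotent_ad_of_mem_eig hd two_ne_zero (IsSl2Triple.mem_e (K := K) t)
  have hNv : (LieAlgebra.ad K L x ^ N) v = 0 := by rw [hN]; rfl
  clear hN
  induction N generalizing v i with
  | zero =>
    refine ⟨0, fun _ => 0, by simp, ?_⟩
    simpa using hNv
  | succ N ih =>
    have h1 : ⁅x, v⁆ ∈ eig K h (i + 2) := lie_mem_eig' (IsSl2Triple.mem_e t) hv (by ring)
    obtain ⟨n, w, hw, hxv⟩ := ih h1 (by omega) (by simpa [pow_succ] using hNv)
    let c : ℕ → K := fun j => ((((j + 1) * (i + 2 + j) : ℤ) : K))⁻¹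
    have hc : ∀ j : ℕ, c j * (((j + 1) * (i + 2 + j) : ℤ) : K) = 1 := fun j =>
      inv_mul_cancel₀ (Int.cast_ne_zero.2 (by positivity))
    let u : L := v - ∑ j ∈ Finset.range n, c j • (LieAlgebra.ad K L y ^ (j + 1)) (w j)
    have hu : ⁅x, u⁆ = 0 := by
      simp only [u]
      rw [lie_sub, lie_sum, sub_eq_zero]
      conv_lhs => rw [hxv]
      refine Finset.sum_congr rfl fun j _ => ?_
      rw [lie_smul, ad_e_pow_succ_ad_f t (hw j).1 (hw j).2, smul_smul]
      have : ((j : ℤ) + 1) * (i + 2 + 2 * j - j) = (j + 1) * (i + 2 + j) := by ring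
      rw [this, hc, one_smul]
    have hu' : u ∈ eig K h i := by
      refine sub_mem hv (Submodule.sum_mem _ fun j _ => Submodule.smul_mem _ _ ?_)
      have := pow_ad_mem_eig (IsSl2Triple.mem_f (K := K) t) (hw j).1 (j + 1)
      convert this using 2
      push_cast; ring
    refine ⟨n + 1, fun j => Nat.casesOn j u fun j => c j • w j, ?_, ?_⟩
    · rintro (_ | j)
      · simpa using ⟨hu', hu⟩
      · refine ⟨Submodule.smul_mem _ _ ?_, by simp [(hw j).2]⟩
        convert (hw j).1 using 2
        push_cast; ring
    · rw [Finset.sum_range_succ']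
      simp [u]

/-- `ad x : E_{i-2}(h) → E_i(h)` is surjective for `i ≥ 1`. -/
lemma exists_lie_eq (hd : IsDiag K h) (t : IsSl2Triple h x y) {v : L} {i j : ℤ}
    (hv : v ∈ eig K h i) (hi : 1 ≤ i) (hj : j + 2 = i) : ∃ u ∈ eig K h j, ⁅x, u⁆ = v := by
  obtain ⟨n, w, hw, rfl⟩ := exists_primitive_decomp hd t hv (by omega)
  refine ⟨∑ l ∈ Finset.range n, ((((l + 1) * (i + l) : ℤ) : K))⁻¹ •
    (LieAlgebra.ad K L y ^ (l + 1)) (w l), Submodule.sum_mem _ fun l _ =>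
      Submodule.smul_mem _ _ ?_, ?_⟩
  · have := pow_ad_mem_eig (IsSl2Triple.mem_f (K := K) t) (hw l).1 (l + 1)
    convert this using 2
    push_cast; linarith
  · rw [lie_sum]
    refine Finset.sum_congr rfl fun l _ => ?_
    rw [lie_smul, ad_e_pow_succ_ad_f t (hw l).1 (hw l).2, smul_smul]
    have : ((l : ℤ) + 1) * (i + 2 * l - l) = (l + 1) * (i + l) := by ring
    rw [this, inv_mul_cancel₀ (Int.cast_ne_zero.2 (by positivity)), one_smul]

/-- `E_0(h)` is the sum of the image of `ad x` and of the invariants. -/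
lemma exists_lie_add_eq (hd : IsDiag K h) (t : IsSl2Triple h x y) {v : L}
    (hv : v ∈ eig K h 0) : ∃ u ∈ eig K h (-2), ∃ w ∈ eig K h 0, ⁅x, w⁆ = 0 ∧ v = ⁅x, u⁆ + w := by
  obtain ⟨n, w, hw, rfl⟩ := exists_primitive_decomp hd t hv le_rfl
  cases n with
  | zero => exact ⟨0, zero_mem _, 0, zero_mem _, by simp, by simp⟩
  | succ n =>
    refine ⟨∑ l ∈ Finset.range n, ((((l + 2) * (l + 1) : ℤ) : K))⁻¹ •
      (LieAlgebra.ad K L y ^ (l + 2)) (w (l + 1)), Submodule.sum_mem _ fun l _ =>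
        Submodule.smul_mem _ _ ?_, w 0, by simpa using (hw 0).1, (hw 0).2, ?_⟩
    · have := pow_ad_mem_eig (IsSl2Triple.mem_f (K := K) t) (hw (l + 1)).1 (l + 2)
      convert this using 2
      push_cast; ring
    · rw [Finset.sum_range_succ', lie_sum]
      congr 1
      refine Finset.sum_congr rfl fun l _ => ?_
      rw [lie_smul, ad_e_pow_succ_ad_f t (hw (l + 1)).1 (hw (l + 1)).2, smul_smul]
      have : (((l + 1 : ℕ) : ℤ) + 1) * (0 + 2 * ((l + 1 : ℕ) : ℤ) - ((l + 1 : ℕ) : ℤ)) =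
        (l + 2) * (l + 1) := by push_cast; ring
      rw [this, inv_mul_cancel₀ (Int.cast_ne_zero.2 (by positivity)), one_smul]

/-- `(ad x) ^ 2` is injective on `E_{-2}(h)`. -/
lemma eq_zero_of_lie_lie_eq_zero [LieAlgebra.IsKilling K L] (hd : IsDiag K h)
    (t : IsSl2Triple h x y) {v : L} (hv : v ∈ eig K h (-2)) (h0 : ⁅x, ⁅x, v⁆⁆ = 0) : v = 0 := by
  apply eq_zero_of_kf (K := K)
  intro z
  rw [kf_eproj hd hv]
  have hz := eproj_mem hd (- -2) z
  set z' := eproj h hd (- -2) z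
  obtain ⟨u, hu, hu'⟩ := exists_lie_eq hd t hz (by norm_num) (j := 0) (by norm_num)
  obtain ⟨u2, hu2, w, hw, hw0, rfl⟩ := exists_lie_add_eq hd t hu
  rw [lie_add, hw0, add_zero] at hu'
  rw [← hu', ← kf_lie, ← kf_lie, ← lie_skew, ← lie_skew v x, lie_neg, neg_neg, h0]
  simp [kf]

end Eigen

section Centre

variable {K L : Type*} [Field K] [LieRing L] [LieAlgebra K L] [CharZero K] [FiniteDimensional K L]

/-- A linear form on a subspace on which the Killing form is non-degenerate is represented by an
element of this subspace. -/
lemma exists_kf_eq {m : Submodule K L} (nd : ∀ x ∈ m, (∀ y ∈ m, kf K x y = 0) → x = 0)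
    (l : m →ₗ[K] K) : ∃ z ∈ m, ∀ x : m, kf K z x = l x := by
  let B : m →ₗ[K] Module.Dual K m := (killingForm K L).domRestrict₁₂ m m
  have hinj : Function.Injective B := by
    rw [injective_iff_map_eq_zero]
    intro x hx
    refine Subtype.ext (nd x x.2 fun y hy => ?_)
    exact LinearMap.congr_fun hx ⟨y, hy⟩
  have hsurj : Function.Surjective B :=
    (LinearMap.injective_iff_surjective_of_finrank_eq_finrank
      (Subspace.dual_finrank_eq (K := K) (V := m)).symm).1 hinj
  obtain ⟨z, hz⟩ := hsurj l
  exact ⟨z, z.2, fun x => LinearMap.congr_fun hz x⟩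

/-- An invariant linear form on a subalgebra is represented by a central element. -/
lemma lie_eq_zero_of_kf {m : Submodule K L} (hm : ∀ x ∈ m, ∀ y ∈ m, ⁅x, y⁆ ∈ m)
    (nd : ∀ x ∈ m, (∀ y ∈ m, kf K x y = 0) → x = 0) {z : L} (hz : z ∈ m)
    (h : ∀ x ∈ m, ∀ y ∈ m, kf K z ⁅x, y⁆ = 0) {x : L} (hx : x ∈ m) : ⁅z, x⁆ = 0 :=
  nd _ (hm z hz x hx) fun y hy => by rw [kf_lie, h x hx y hy]

lemma eq_zero_of_central [IsAlgClosed K] {m : Submodule K L}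
    (hm : ∀ x ∈ m, ∀ y ∈ m, ⁅x, y⁆ ∈ m)
    (nd : ∀ x ∈ m, (∀ y ∈ m, kf K x y = 0) → x = 0) {z : L} (hz : z ∈ m)
    (hzc : ∀ x ∈ m, ⁅z, x⁆ = 0)
    (hperp : ∀ z' ∈ m, (∀ x ∈ m, ⁅z', x⁆ = 0) → kf K z z' = 0) : z = 0 := by
  have hcomm : ∀ x ∈ m, Commute (LieAlgebra.ad K L z) (LieAlgebra.ad K L x) := by
    intro x hx
    refine LinearMap.ext fun v => ?_
    simp only [Module.End.mul_apply, LieAlgebra.ad_apply]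
    rw [leibniz_lie, hzc x hx, zero_lie, zero_add]
  have hnil : IsNilpotent (LieAlgebra.ad K L z) := by
    have key : ∀ μ : K, μ ≠ 0 → (LieAlgebra.ad K L z).maxGenEigenspace μ = ⊥ := by
      intro μ hμ
      set M := (LieAlgebra.ad K L z).maxGenEigenspace μ with hM
      have hst : ∀ x : m, ∀ v ∈ M, LieAlgebra.ad K L (x : L) v ∈ M := fun x =>
        Module.End.mapsTo_maxGenEigenspace_of_comm (hcomm x x.2) μ
      let l : m →ₗ[K] K :=
        { toFun := fun x => LinearMap.trace K M ((LieAlgebra.ad K L (x : L)).restrict (hst x))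
          map_add' := fun x y => by
            rw [← map_add]; congr 1; ext v; simp
          map_smul' := fun c x => by
            rw [RingHom.id_apply, ← map_smul]; congr 1; ext v; simp }
      obtain ⟨z', hz', hl⟩ := exists_kf_eq nd l
      have hc' : ∀ x ∈ m, ⁅z', x⁆ = 0 := fun x hx => lie_eq_zero_of_kf hm nd hz' (fun x hx y hy => by
        rw [hl ⟨⁅x, y⁆, hm x hx y hy⟩]
        change LinearMap.trace K M _ = 0
        have : (LieAlgebra.ad K L ⁅x, y⁆).restrict (hst ⟨⁅x, y⁆, hm x hx y hy⟩) =
          (LieAlgebra.ad K L x).restrict (hst ⟨x, hx⟩) *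
            (LieAlgebra.ad K L y).restrict (hst ⟨y, hy⟩) -
          (LieAlgebra.ad K L y).restrict (hst ⟨y, hy⟩) *
            (LieAlgebra.ad K L x).restrict (hst ⟨x, hx⟩) := by
          ext v; simp
        rw [this, map_sub, LinearMap.trace_mul_comm, sub_self]) hx
      have h1 : l ⟨z, hz⟩ = 0 := by rw [← hl, kf_comm]; exact hperp z' hz' hc'
      have h2 : l ⟨z, hz⟩ = μ * Module.finrank K M := by
        change LinearMap.trace K M _ = _
        have hn : IsNilpotent ((LieAlgebra.ad K L z).restrict (hst ⟨z, hz⟩) -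
            algebraMap K (Module.End K M) μ) := by
          have := Module.End.isNilpotent_restrict_maxGenEigenspace_sub_algebraMap
            (LieAlgebra.ad K L z) μ
          convert this using 1
          ext v
          simp
          rfl
        have h3 := LinearMap.isNilpotent_trace_of_isNilpotent hn
        rw [map_sub, isNilpotent_iff_eq_zero, sub_eq_zero] at h3
        rw [h3, Algebra.algebraMap_eq_smul_one, map_smul, LinearMap.trace_one, smul_eq_mul]
      rw [h1, eq_comm, mul_eq_zero] at h2
      have h4 := h2.resolve_left hμ
      rw [Nat.cast_eq_zero] at h4
      exact Submodule.finrank_eq_zero.1 h4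
    have h5 : (LieAlgebra.ad K L z).maxGenEigenspace 0 = ⊤ := by
      rw [eq_top_iff, ← Module.End.iSup_maxGenEigenspace_eq_top (LieAlgebra.ad K L z)]
      refine iSup_le fun μ => ?_
      by_cases hμ : μ = 0
      · rw [hμ]
      · rw [key μ hμ]; exact bot_le
    rw [Module.End.maxGenEigenspace_eq_genEigenspace_finrank, Module.End.genEigenspace_nat,
      zero_smul, sub_zero, LinearMap.ker_eq_top] at h5
    exact ⟨_, h5⟩
  refine nd z hz fun y hy => ?_
  have h6 : IsNilpotent (LieAlgebra.ad K L z ∘ₗ LieAlgebra.ad K L y) :=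
    (hcomm y hy).isNilpotent_mul_right hnil
  have := LinearMap.isNilpotent_trace_of_isNilpotent h6
  rw [isNilpotent_iff_eq_zero] at this
  exact this

end Centre

section Curves

variable {K V : Type*} [Field K] [CharZero K] [AddCommGroup V] [Module K V] [FiniteDimensional K V]

lemma lder_comm (S T : V →ₗ[K] V) (f : polyFun K V) :
    lder S (lder T f) - lder T (lder S f) = lder (T ∘ₗ S - S ∘ₗ T) f := by
  induction f using polyFun_induction with
  | const c => simp
  | lin l =>
    simp only [lder_linElt]
    refine polyFun_ext fun x => ?_
    simp
  | add f g hf hg => simp only [map_add] at *; rw [← hf, ← hg]; ring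
  | mul f g hf hg =>
    simp only [Derivation.leibniz, map_add, smul_eq_mul] at *
    linear_combination f * hg + g * hf

/-- An eigenvector of the derivative along a diagonalizable linear vector field with eigenvalues in
`ℕ` has its eigenvalue in `ℕ`, and is homogeneous. -/
lemma exists_nat_of_lder {T : V →ₗ[K] V} {f : polyFun K V} {c : K}
    (hf : ∀ y, dd f y (T y) = c * (f : V → K) y) (s : Finset ℕ) (x : ℕ → V)
    (hx : ∀ i, T (x i) = (i : K) • x i) (h0 : (f : V → K) (∑ i ∈ s, x i) ≠ 0) :
    ∃ n : ℕ, c = n ∧ ∀ t : K, (f : V → K) (∑ i ∈ s, t ^ i • x i) =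
      t ^ n * (f : V → K) (∑ i ∈ s, x i) := by
  obtain ⟨P, hP⟩ := exists_polynomial_comp (γ := fun t => ∑ i ∈ s, t ^ i • x i)
    (γ' := fun t => ∑ i ∈ s, (i * t ^ (i - 1) : K) • x i) (fun l =>
      ⟨∑ i ∈ s, Polynomial.C (l (x i)) * Polynomial.X ^ i, fun t => by
        simp only [map_sum, map_smul, smul_eq_mul, Polynomial.eval_finsetSum, Polynomial.eval_mul,
          Polynomial.eval_C, Polynomial.eval_pow, Polynomial.eval_X, Polynomial.derivative_C_mul,
          Polynomial.derivative_X_pow]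
        constructor <;> refine Finset.sum_congr rfl fun i _ => ?_ <;> ring⟩) f
  have hP1 : P.eval 1 = (f : V → K) (∑ i ∈ s, x i) := by rw [← (hP 1).1]; simp
  have hP0 : P ≠ 0 := by rintro rfl; simp at hP1; exact h0 hP1.symm
  have hode : Polynomial.X * P.derivative = Polynomial.C c * P := by
    refine Polynomial.funext fun t => ?_
    simp only [Polynomial.eval_mul, Polynomial.eval_X, Polynomial.eval_C, ← (hP t).1, ← (hP t).2]
    rw [← hf, ← smul_eq_mul, ← map_smul]
    congr 1
    simp only [map_sum, map_smul, hx, Finset.smul_sum, smul_smul]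
    refine Finset.sum_congr rfl fun i _ => ?_
    rcases i with _ | i
    · simp
    · congr 1; simp; ring
  have hcoef : ∀ n : ℕ, P.coeff n ≠ 0 → c = n := by
    intro n hn
    have h1 := congrArg (fun q => Polynomial.coeff q n) hode
    simp only [Polynomial.coeff_C_mul] at h1
    rcases n with _ | n
    · simp only [Polynomial.coeff_X_mul_zero] at h1
      simpa [hn] using h1.symm
    · rw [Polynomial.coeff_X_mul, Polynomial.coeff_derivative] at h1
      refine mul_right_cancel₀ hn ?_
      rw [← h1]; push_cast; ring
  have hc := hcoef P.natDegree (by simpa using hP0)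
  refine ⟨P.natDegree, hc, fun t => ?_⟩
  have hmon : P = Polynomial.monomial P.natDegree P.leadingCoeff := by
    ext n
    rw [Polynomial.coeff_monomial]
    split_ifs with h
    · rw [← h]; rfl
    · by_contra hn
      have := (hcoef n hn).symm.trans hc
      exact h (by exact_mod_cast this.symm)
  have he : ∀ t, P.eval t = P.leadingCoeff * t ^ P.natDegree := fun t => by
    conv_lhs => rw [hmon]
    rw [Polynomial.eval_monomial]
  rw [(hP t).1, ← hP1, he t, he 1]
  ring

/-- A polynomial function killed by the Euler vector field is constant. -/
lemma exists_nat_euler {f : polyFun K V} {c : K} (hf : ∀ y, dd f y y = c * (f : V → K) y)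
    (hne : IsNonconstant f) : ∃ n : ℕ, 0 < n ∧ c = n ∧
      ∀ (t : K) (x : V), (f : V → K) (t • x) = t ^ n * (f : V → K) x := by
  have hf0 : f ≠ 0 := by
    have := hne 0
    simpa using this
  obtain ⟨x₀, hx₀⟩ := exists_apply_ne_zero hf0
  have key : ∀ x, (f : V → K) x ≠ 0 → ∃ n : ℕ, c = n ∧ ∀ t : K, (f : V → K) (t • x) =
      t ^ n * (f : V → K) x := by
    intro x hx
    simpa using exists_nat_of_lder (T := LinearMap.id) (c := c) (f := f) (by simpa using hf) {1}
      (fun i => if i = 1 then x else 0) (by intro i; by_cases h : i = 1 <;> simp [h]) (by simpa using hx)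
  obtain ⟨n, hc, hn⟩ := key x₀ hx₀
  have hall : ∀ (t : K) (x : V), (f : V → K) (t • x) = t ^ n * (f : V → K) x := by
    intro t x
    by_cases hx : (f : V → K) x = 0
    · rw [hx, mul_zero]
      by_contra h1
      have ht : t ≠ 0 := by
        rintro rfl
        obtain ⟨m, hm, h2⟩ := key _ h1
        have h3 := hn 0
        simp only [zero_smul] at h3 h1 h2
        have : n = 0 := by
          by_contra hn0
          rw [zero_pow hn0, zero_mul] at h3
          exact h1 h3
        subst this
        have : ∀ y, dd f y y = 0 := by intro y; rw [hf, hc]; simp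
        obtain ⟨P, hP⟩ := exists_polynomial_comp (exists_line_polynomial 0 x) f
        have h6 : Polynomial.X * P.derivative = 0 := Polynomial.funext fun s => by
          rw [Polynomial.eval_mul, ← (hP s).2, Polynomial.eval_X, ← smul_eq_mul, ← map_smul]
          simpa using this (s • x)
        have h7 : P.derivative = 0 := (mul_eq_zero.1 h6).resolve_left Polynomial.X_ne_zero
        have h8 := Polynomial.eq_C_of_derivative_eq_zero h7
        have h9 := (hP 1).1
        have h10 := (hP 0).1
        rw [h8] at h9 h10
        simp only [zero_smul, add_zero, one_smul, zero_add, Polynomial.eval_C] at h9 h10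
        rw [← h10, hx] at h9
        exact h1 h9.symm
      obtain ⟨m, -, hm⟩ := key _ h1
      have := hm t⁻¹
      rw [smul_smul, inv_mul_cancel₀ ht, one_smul, hx] at this
      exact (mul_ne_zero (pow_ne_zero _ (inv_ne_zero ht)) h1) this.symm
    · obtain ⟨m, hm, h2⟩ := key x hx
      have : n = m := by exact_mod_cast hc.symm.trans hm
      rw [this, h2]
  refine ⟨n, Nat.pos_of_ne_zero ?_, hc, hall⟩
  rintro rfl
  refine hne ((f : V → K) 0) (polyFun_ext fun x => ?_)
  have := hall 0 x
  simp only [zero_smul, pow_zero, one_mul] at this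
  rw [← this]; simp

end Curves

section InfinitesimalInvariants

variable {K L : Type*} [Field K] [LieRing L] [LieAlgebra K L] [CharZero K] [FiniteDimensional K L]

/-- `f` is an infinitesimal relative invariant on `W` for the element `X` of the Lie algebra, with
value `c` of the infinitesimal character. -/
def InfRel {W : Submodule K L} (f : polyFun K W) (X : L) (c : K) : Prop :=
  ∀ x w : W, (w : L) = ⁅X, (x : L)⁆ → dd f x w = c * (f : W → K) x

variable {W : Submodule K L} {f g : polyFun K W} {X Y : L} {c d : K}

lemma InfRel.mul (hf : InfRel f X c) (hg : InfRel g X d) : InfRel (f * g) X (c + d) := by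
  intro x w hw
  rw [dd_mul, hf x w hw, hg x w hw]
  simp only [MulMemClass.coe_mul, Pi.mul_apply]
  ring

lemma infRel_algebraMap (a : K) : InfRel (algebraMap K (polyFun K W) a) X 0 := fun x w _ => by
  simp

lemma InfRel.pow (hf : InfRel f X c) (n : ℕ) : InfRel (f ^ n) X (n * c) := by
  induction n with
  | zero => simpa using infRel_algebraMap (W := W) (X := X) (1 : K)
  | succ n ih =>
    rw [pow_succ]
    convert ih.mul hf using 1
    push_cast; ring

lemma InfRel.smul (hf : InfRel f X c) (a : K) : InfRel (a • f) X c := by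
  rw [Algebra.smul_def]
  simpa using (infRel_algebraMap (W := W) (X := X) a).mul hf

lemma infRel_iff (hX : ∀ x ∈ W, ⁅X, x⁆ ∈ W) :
    InfRel f X c ↔ lder ((LieAlgebra.ad K L X).restrict hX) f = c • f := by
  constructor
  · intro h
    refine polyFun_ext fun x => ?_
    rw [lder_apply]
    exact h x _ rfl
  · intro h x w hw
    have := congrArg (fun q : polyFun K W => (q : W → K) x) h
    simp only [lder_apply] at this
    have h2 : w = (LieAlgebra.ad K L X).restrict hX x := Subtype.ext hw
    rw [h2, this]
    rfl

lemma InfRel.add (hX : ∀ x ∈ W, ⁅X, x⁆ ∈ W) (hf : InfRel f X c) (hg : InfRel f Y d) :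
    InfRel f (X + Y) (c + d) := by
  intro x w hw
  have h1 := hf x ⟨_, hX x x.2⟩ rfl
  have h2 := hg x (w - ⟨_, hX x x.2⟩) (by simp [hw])
  rw [map_sub, h1] at h2
  linear_combination h2

lemma InfRel.smul_left (hX : ∀ x ∈ W, ⁅X, x⁆ ∈ W) (hf : InfRel f X c) (a : K) :
    InfRel f (a • X) (a * c) := by
  intro x w hw
  have h1 := hf x ⟨_, hX x x.2⟩ rfl
  have : w = a • ⟨_, hX x x.2⟩ := Subtype.ext (by simpa using hw)
  rw [this, map_smul, h1, smul_eq_mul, mul_assoc]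

lemma InfRel.lie (hX : ∀ x ∈ W, ⁅X, x⁆ ∈ W) (hY : ∀ x ∈ W, ⁅Y, x⁆ ∈ W) (hf : InfRel f X c)
    (hg : InfRel f Y d) : InfRel f ⁅X, Y⁆ 0 := by
  intro x w hw
  rw [infRel_iff hX] at hf
  rw [infRel_iff hY] at hg
  have h := lder_comm ((LieAlgebra.ad K L Y).restrict hY) ((LieAlgebra.ad K L X).restrict hX) f
  rw [hf, hg, Derivation.map_smul, Derivation.map_smul, hf, hg, smul_comm, sub_self] at h
  have h2 := congrArg (fun q : polyFun K W => (q : W → K) x) h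
  simp only [lder_apply] at h2
  have : w = ((LieAlgebra.ad K L X).restrict hX ∘ₗ (LieAlgebra.ad K L Y).restrict hY -
      (LieAlgebra.ad K L Y).restrict hY ∘ₗ (LieAlgebra.ad K L X).restrict hX) x := by
    refine Subtype.ext ?_
    rw [hw, lie_lie]
    rfl
  rw [this, ← h2, zero_mul]
  rfl

lemma InfRel.unique (hX : ∀ x ∈ W, ⁅X, x⁆ ∈ W) (hf : InfRel f X c) (hf0 : f ≠ 0)
    (hf' : InfRel f X d) : c = d := by
  obtain ⟨x, hx⟩ := exists_apply_ne_zero hf0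
  exact mul_right_cancel₀ hx ((hf x ⟨_, hX x x.2⟩ rfl).symm.trans (hf' x ⟨_, hX x x.2⟩ rfl))

/-- The factors of an infinitesimal relative invariant are infinitesimal relative invariants. -/
lemma InfRel.of_isRelPrime (hX : ∀ x ∈ W, ⁅X, x⁆ ∈ W) (h : InfRel (f * g) X c)
    (hfg : IsRelPrime f g) : ∃ d, InfRel f X d := by
  simp only [infRel_iff hX] at *
  rw [Derivation.leibniz, smul_eq_mul, smul_eq_mul] at h
  refine lder_eq_smul_of_dvd (isRelPrime_dvd hfg ⟨c • g - lder ((LieAlgebra.ad K L X).restrict hX) g, ?_⟩)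
  rw [mul_sub, mul_smul_comm, ← h]
  ring

lemma InfRel.of_pow (hX : ∀ x ∈ W, ⁅X, x⁆ ∈ W) {n : ℕ} (hn : n ≠ 0) (h : InfRel (f ^ n) X c) :
    InfRel f X (c / n) := by
  by_cases hf : f = 0
  · subst hf
    intro x w _
    have : (0 : polyFun K W) = algebraMap K _ 0 := by simp
    rw [this, dd_algebraMap]; simp
  simp only [infRel_iff hX] at *
  obtain ⟨m, rfl⟩ := Nat.exists_eq_succ_of_ne_zero hn
  rw [Derivation.leibniz_pow] at h
  have hn' : ((m.succ : ℕ) : K) ≠ 0 := Nat.cast_ne_zero.2 hn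
  have h2 : f ^ m * ((m.succ : K) • lder ((LieAlgebra.ad K L X).restrict hX) f) = f ^ m * (c • f) := by
    rw [mul_smul_comm, mul_smul_comm, ← pow_succ, ← h, Nat.cast_smul_eq_nsmul]
    simp
  have h3 := mul_left_cancel₀ (pow_ne_zero m hf) h2
  rw [div_eq_inv_mul, mul_smul, ← h3, smul_smul, inv_mul_cancel₀ hn', one_smul]

lemma InfRel.of_dvd (hX : ∀ x ∈ W, ⁅X, x⁆ ∈ W) (h : InfRel f X c) (hf : f ≠ 0)
    (hg : Irreducible g) (hgf : g ∣ f) : ∃ d, InfRel g X d := by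
  obtain ⟨q, hfq, hq⟩ := (FiniteMultiplicity.of_prime_left
    (UniqueFactorizationMonoid.irreducible_iff_prime.1 hg) hf).exists_eq_pow_mul_and_not_dvd
  generalize multiplicity g f = n at hfq
  subst hfq
  have hn : n ≠ 0 := by rintro rfl; simp at hgf; exact hq hgf
  have hrp : IsRelPrime (g ^ n) q := IsRelPrime.pow_left ((hg.isRelPrime_iff_not_dvd).2 hq)
  obtain ⟨d, hd⟩ := h.of_isRelPrime hX hrp
  exact ⟨_, hd.of_pow hX hn⟩

end InfinitesimalInvariants

section Irreducible

variable {K L : Type*} [Field K] [LieRing L] [LieAlgebra K L] [CharZero K] [FiniteDimensional K L]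

/-- A regular irreducible prehomogeneous space of parabolic type: a subalgebra `m` with an
irreducible module `W` in duality with `W'`, and an element `h` of the centre of `m`. -/
structure IsRegularPair (m W W' : Submodule K L) (h : L) : Prop where
  lie_mem : ∀ x ∈ m, ∀ y ∈ m, ⁅x, y⁆ ∈ m
  nondeg : ∀ x ∈ m, (∀ y ∈ m, kf K x y = 0) → x = 0
  stable : ∀ x ∈ m, ∀ y ∈ W, ⁅x, y⁆ ∈ W
  ne_bot : W ≠ ⊥
  irred : ∀ U : Submodule K L, U ≤ W → (∀ z ∈ m, ∀ w ∈ U, ⁅z, w⁆ ∈ U) → U = ⊥ ∨ U = W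
  dual : ∀ l : W →ₗ[K] K, ∃ y ∈ W', ∀ x : W, kf K y x = l x
  lie_mem' : ∀ x ∈ W, ∀ y ∈ W', ⁅x, y⁆ ∈ m
  mem : h ∈ m
  central : ∀ x ∈ m, ⁅h, x⁆ = 0
  le : W ≤ eig K h 2
  le' : W' ≤ eig K h (-2)
  mem_span : h ∈ Submodule.span K {z | ∃ x ∈ W, ∃ y ∈ W', z = ⁅x, y⁆}
  kf_ne : kf K h h ≠ 0

variable {m W W' : Submodule K L} {h : L}

lemma IsRegularPair.exists_scalar [IsAlgClosed K] (D : IsRegularPair m W W' h) {z : L} (hz : z ∈ m)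
    (hc : ∀ x ∈ m, ⁅z, x⁆ = 0) : ∃ a : K, ∀ x ∈ W, ⁅z, x⁆ = a • x := by
  have : Nontrivial W := Submodule.nontrivial_iff_ne_bot.2 D.ne_bot
  obtain ⟨a, ha⟩ := Module.End.exists_eigenvalue ((LieAlgebra.ad K L z).restrict (D.stable z hz))
  obtain ⟨v, hv, hv0⟩ := ha.exists_hasEigenvector
  refine ⟨a, ?_⟩
  have := D.irred (W ⊓ Module.End.eigenspace (LieAlgebra.ad K L z) a) inf_le_left
    (fun y hy w hw => ⟨D.stable y hy w hw.1, by
      have h1 := hw.2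
      simp only [SetLike.mem_coe, Module.End.mem_eigenspace_iff, LieAlgebra.ad_apply] at h1 ⊢
      rw [leibniz_lie, hc y hy, zero_lie, zero_add, h1, lie_smul]⟩)
  rcases this with h0 | h0
  · exfalso
    have hmem : (v : L) ∈ W ⊓ Module.End.eigenspace (LieAlgebra.ad K L z) a := by
      refine ⟨v.2, ?_⟩
      rw [Module.End.mem_eigenspace_iff] at hv
      exact Module.End.mem_eigenspace_iff.2 (congrArg Subtype.val hv)
    rw [h0, Submodule.mem_bot] at hmem
    exact hv0 (Subtype.ext hmem)
  · intro x hx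
    rw [← h0] at hx
    simpa using hx.2

/-- The structure of an infinitesimal relative invariant of a regular pair. -/
theorem IsRegularPair.exists_triple [IsAlgClosed K] (D : IsRegularPair m W W' h) {f : polyFun K W}
    (hf : ∀ X ∈ m, ∃ c, InfRel f X c) (hne : IsNonconstant f) :
    (∃ n : ℕ, 0 < n ∧ (∀ X ∈ m, ∀ c, InfRel f X c → c * kf K h h = 2 * n * kf K h X) ∧
      ∀ (t : K) (x : W), (f : W → K) (t • x) = t ^ n * (f : W → K) x) ∧
    ∀ x : W, (f : W → K) x ≠ 0 → ∃ t ∈ W', IsSl2Triple h (x : L) t := by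
  have hf0 : f ≠ 0 := by
    have := hne 0
    simpa using this
  obtain ⟨c, hc⟩ := hf h D.mem
  have heuler : ∀ y, dd f y y = c / 2 * (f : W → K) y := by
    intro y
    have h1 := hc y ((2 : K) • y) (by
      have := mem_eig.1 (D.le y.2)
      rw [this]; simp)
    rw [map_smul, smul_eq_mul] at h1
    linear_combination h1 / 2
  obtain ⟨n, hn, hcn, hhom⟩ := exists_nat_euler heuler hne
  rw [hcn] at heuler
  obtain ⟨S, hS⟩ : ∃ S : K, ∀ z' a, (∀ x ∈ W, ⁅z', x⁆ = a • x) → kf K h z' = a * S := by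
    have hspan := D.mem_span
    clear heuler hc D
    induction hspan using Submodule.span_induction with
    | mem u hu =>
      obtain ⟨x, hx, y, hy, rfl⟩ := hu
      refine ⟨kf K x y, fun z' a ha => ?_⟩
      rw [kf_comm, ← kf_lie, ha x hx]
      simp [kf]
    | zero => exact ⟨0, by simp [kf]⟩
    | add u v _ _ h1 h2 =>
      obtain ⟨S, hS⟩ := h1
      obtain ⟨T, hT⟩ := h2
      refine ⟨S + T, fun z' a ha => ?_⟩
      have e1 := hS z' a ha
      have e2 := hT z' a ha
      simp only [kf, map_add, LinearMap.add_apply] at *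
      rw [e1, e2]; ring
    | smul r u _ h1 =>
      obtain ⟨S, hS⟩ := h1
      refine ⟨r * S, fun z' a ha => ?_⟩
      have e1 := hS z' a ha
      simp only [kf, map_smul, LinearMap.smul_apply, smul_eq_mul] at *
      rw [e1]; ring
  have hS2 : kf K h h = 2 * S := hS h 2 fun x hx => by
    have := mem_eig.1 (D.le hx)
    simpa using this
  have hS0 : S ≠ 0 := by
    rintro rfl
    exact D.kf_ne (by simpa using hS2)
  have key : ∀ x : W, (f : W → K) x ≠ 0 → ∃ φ ∈ W', ⁅(x : L), φ⁆ = ((n : K) / S) • h ∧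
      ∀ X ∈ m, ∀ c, InfRel f X c → c = kf K ⁅(x : L), φ⁆ X := by
    intro x hx
    obtain ⟨φ, hφ, hφx⟩ := D.dual (((f : W → K) x)⁻¹ • dd f x)
    have hz := D.lie_mem' x x.2 φ hφ
    have hzX : ∀ X ∈ m, ∀ c, InfRel f X c → c = kf K ⁅(x : L), φ⁆ X := by
      intro X hX c hc
      rw [kf_lie, kf_comm, kf_lie, hφx ⟨_, D.stable X hX x x.2⟩, LinearMap.smul_apply,
        hc x ⟨_, D.stable X hX x x.2⟩ rfl, smul_eq_mul]
      field_simp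
    refine ⟨φ, hφ, ?_, hzX⟩
    set z := ⁅(x : L), φ⁆
    have hcz : ∀ X ∈ m, ⁅z, X⁆ = 0 := fun X hX =>
      lie_eq_zero_of_kf D.lie_mem D.nondeg hz (fun X hX Y hY => by
        obtain ⟨c, hc⟩ := hf X hX
        obtain ⟨d, hd⟩ := hf Y hY
        exact (hzX _ (D.lie_mem X hX Y hY) 0
          (hc.lie (D.stable X hX) (D.stable Y hY) hd)).symm) hX
    rw [← sub_eq_zero]
    refine eq_zero_of_central D.lie_mem D.nondeg (sub_mem hz (m.smul_mem _ D.mem))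
      (fun X hX => by rw [sub_lie, smul_lie, hcz X hX, D.central X hX, smul_zero, sub_zero]) ?_
    intro z' hz' hc'
    obtain ⟨a, ha⟩ := D.exists_scalar hz' hc'
    obtain ⟨c, hc⟩ := hf z' hz'
    have h1 := hzX z' hz' c hc
    have h2 := hc x (a • x) (by rw [ha x x.2]; rfl)
    rw [map_smul, heuler, smul_eq_mul] at h2
    have h3 : c = a * n := mul_right_cancel₀ hx (by rw [← h2]; ring)
    have h4 := hS z' a ha
    simp only [kf, map_sub, map_smul, LinearMap.sub_apply, LinearMap.smul_apply,
      smul_eq_mul] at h1 h4 ⊢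
    rw [← h1, h4, h3]
    field_simp
    ring
  refine ⟨⟨n, hn, fun X hX c hc => ?_, hhom⟩, fun x hx => ?_⟩
  · obtain ⟨x, hx⟩ := exists_apply_ne_zero hf0
    obtain ⟨φ, hφ, e1, e2⟩ := key x hx
    rw [e2 X hX c hc, e1, hS2]
    simp only [kf, map_smul, LinearMap.smul_apply, smul_eq_mul]
    field_simp
  · obtain ⟨φ, hφ, e1, -⟩ := key x hx
    have hn0 : (n : K) ≠ 0 := Nat.cast_ne_zero.2 hn.ne'
    refine ⟨(S / n) • φ, W'.smul_mem _ hφ, ?_, ?_, ?_, ?_⟩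
    · rintro rfl
      exact D.kf_ne (by simp [kf])
    · rw [lie_smul, e1, smul_smul]
      field_simp
      simp
    · have := mem_eig.1 (D.le x.2)
      rw [this, ofNat_smul_eq_nsmul]; simp [two_smul]
    · have := mem_eig.1 (D.le' (W'.smul_mem (S / n) hφ))
      rw [this]; simp [two_smul]

/-- Outside the zeros of an infinitesimal relative invariant of a regular pair the tangent map of
the orbits is onto. -/
lemma IsRegularPair.exists_lie_eq [IsAlgClosed K] (D : IsRegularPair m W W' h) {x t : L}
    (hx : x ∈ W) (ht : IsSl2Triple h x t) {w : L} (hw : w ∈ W) : ∃ X ∈ m, ⁅X, x⁆ = w := by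
  let T : m →ₗ[K] W := LinearMap.codRestrict W ((-LieAlgebra.ad K L x) ∘ₗ m.subtype) (fun X => by
    have := D.stable X X.2 x hx
    simpa using this)
  have hT : ∀ X : m, (T X : L) = ⁅(X : L), x⁆ := fun X => by simp [T]
  suffices hsurj : LinearMap.range T = ⊤ by
    obtain ⟨X, hX⟩ := LinearMap.range_eq_top.1 hsurj ⟨w, hw⟩
    exact ⟨X, X.2, by rw [← hT, hX]⟩
  by_contra hne
  obtain ⟨l, hl, hl0⟩ := Submodule.exists_le_ker_of_lt_top _ (lt_top_iff_ne_top.2 hne)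
  obtain ⟨y, hy, hyl⟩ := D.dual l
  have h1 : ⁅x, y⁆ = 0 := D.nondeg _ (D.lie_mem' x hx y hy) fun X hX => by
    rw [kf_lie, kf_comm, kf_lie]
    have : l (T ⟨X, hX⟩) = 0 := hl0 ⟨_, rfl⟩
    rw [← hyl, hT] at this
    exact this
  have h2 := lie_eq_zero_of_neg (K := K) ht (D.le' hy) (by norm_num) h1
  apply hl
  ext x
  rw [← hyl, h2]
  simp [kf]

/-- Two infinitesimal relative invariants of a regular pair are, up to constants, powers of the
same polynomial. -/
theorem IsRegularPair.exists_pow_eq [IsAlgClosed K] (D : IsRegularPair m W W' h) {f g : polyFun K W}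
    (hf : ∀ X ∈ m, ∃ c, InfRel f X c) (hfne : IsNonconstant f)
    (hg : ∀ X ∈ m, ∃ c, InfRel g X c) (hgne : IsNonconstant g) :
    ∃ a b : ℕ, 0 < a ∧ 0 < b ∧ (∀ (t : K) (x : W), (f : W → K) (t • x) = t ^ a * (f : W → K) x) ∧
      (∀ (t : K) (x : W), (g : W → K) (t • x) = t ^ b * (g : W → K) x) ∧
      ∃ c : K, c ≠ 0 ∧ f ^ b = c • g ^ a := by
  have hf0 : f ≠ 0 := by simpa using hfne 0
  have hg0 : g ≠ 0 := by simpa using hgne 0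
  obtain ⟨⟨a, ha, ha1, hah⟩, ha2⟩ := D.exists_triple hf hfne
  obtain ⟨⟨b, hb, hb1, hbh⟩, -⟩ := D.exists_triple hg hgne
  refine ⟨a, b, ha, hb, hah, hbh, exists_eq_smul_of_dd_eq (pow_ne_zero _ hf0) (pow_ne_zero _ hg0) ?_⟩
  have key : ∀ x v, (f : W → K) x ≠ 0 → dd (f ^ b) x v * ((g ^ a : polyFun K W) : W → K) x =
      ((f ^ b : polyFun K W) : W → K) x * dd (g ^ a) x v := by
    intro x v hx
    obtain ⟨t, ht, htr⟩ := ha2 x hx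
    obtain ⟨X, hX, hXx⟩ := D.exists_lie_eq x.2 htr v.2
    obtain ⟨c, hc⟩ := hf X hX
    obtain ⟨d, hd⟩ := hg X hX
    rw [hc.pow b x v hXx.symm, hd.pow a x v hXx.symm]
    have e1 := ha1 X hX c hc
    have e2 := hb1 X hX d hd
    have e3 : (b : K) * c = a * d := mul_right_cancel₀ D.kf_ne (by linear_combination b * e1 - a * e2)
    rw [e3]; ring
  intro x v
  have h1 : f * (pder K v (f ^ b) * g ^ a) = f * (f ^ b * pder K v (g ^ a)) := by
    refine polyFun_ext fun y => ?_
    by_cases hy : (f : W → K) y = 0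
    · simp [hy]
    · simp only [MulMemClass.coe_mul, Pi.mul_apply, pder_apply]
      rw [key y v hy]
  have h2 := congrArg (fun q : polyFun K W => (q : W → K) x) (mul_left_cancel₀ hf0 h1)
  exact h2

end Irreducible

section Exponential

variable {K L : Type*} [Field K] [LieRing L] [LieAlgebra K L] [CharZero K]

lemma exists_expAd {X : L} (hX : IsNilpotent (LieAlgebra.ad K L X)) :
    ∃ g : L ≃ₗ[K] L, (∀ x y : L, g ⁅x, y⁆ = ⁅g x, g y⁆) ∧
      (g : L →ₗ[K] L) = ∑ i ∈ Finset.range (nilpotencyClass (LieAlgebra.ad K L X)),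
      ((i.factorial : K)⁻¹) • (LieAlgebra.ad K L X) ^ i := by
  let _ : Module ℚ L := Module.compHom L (algebraMap ℚ K)
  have : IsScalarTower ℚ K L := ⟨fun a b x => by
    rw [Algebra.smul_def, mul_smul]
    rfl⟩
  let _ : LieAlgebra ℚ L := { lie_smul := fun t x m => lie_smul (algebraMap ℚ K t) x m }
  let D : LieDerivation K L L := LieDerivation.ad K L X
  have hDX : D.toLinearMap = LieAlgebra.ad K L X := by ext v; simp [D]
  have hD : IsNilpotent D.toLinearMap := by rw [hDX]; exact hX
  refine ⟨(LieDerivation.exp D hD).toLinearEquiv, fun x y => (LieDerivation.exp D hD).map_lie x y, ?_⟩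
  have h1 : ((LieDerivation.exp D hD).toLinearEquiv : L →ₗ[K] L) = IsNilpotent.exp D.toLinearMap := rfl
  rw [h1, IsNilpotent.exp, hDX]
  refine Finset.sum_congr rfl fun i _ => ?_
  ext v
  simp only [LinearMap.smul_apply]
  change (algebraMap ℚ K ((i.factorial : ℚ)⁻¹)) • ((LieAlgebra.ad K L X ^ i) v) = _
  simp

/-- The automorphism `exp (ad X)`. -/
def expE (X : L) (hX : IsNilpotent (LieAlgebra.ad K L X)) : L ≃ₗ[K] L :=
  (exists_expAd hX).choose

variable {X : L} (hX : IsNilpotent (LieAlgebra.ad K L X))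

lemma expE_lie (x y : L) : expE X hX ⁅x, y⁆ = ⁅expE X hX x, expE X hX y⁆ :=
  (exists_expAd hX).choose_spec.1 x y

lemma expE_mem_lieAut : expE X hX ∈ lieAut K L := expE_lie hX

lemma expE_eq : (expE X hX : L →ₗ[K] L) =
    ∑ i ∈ Finset.range (nilpotencyClass (LieAlgebra.ad K L X)),
      ((i.factorial : K)⁻¹) • (LieAlgebra.ad K L X) ^ i := (exists_expAd hX).choose_spec.2

lemma expE_mem {S : Set L} (hS : X ∈ S) : expE X hX ∈ expAd K S := ⟨X, hS, hX, expE_eq hX⟩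

lemma eq_expE {g : L ≃ₗ[K] L} (h : (g : L →ₗ[K] L) =
    ∑ i ∈ Finset.range (nilpotencyClass (LieAlgebra.ad K L X)),
      ((i.factorial : K)⁻¹) • (LieAlgebra.ad K L X) ^ i) : g = expE X hX :=
  LinearEquiv.toLinearMap_injective (h.trans (expE_eq hX).symm)

lemma expE_apply {v : L} {N : ℕ} (hN : (LieAlgebra.ad K L X ^ N) v = 0) :
    expE X hX v = ∑ i ∈ Finset.range N, ((i.factorial : K)⁻¹) • (LieAlgebra.ad K L X ^ i) v := by
  have h1 : expE X hX v = (expE X hX : L →ₗ[K] L) v := rfl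
  have key : ∀ (M : ℕ), (LieAlgebra.ad K L X ^ M) v = 0 → ∀ i, M ≤ i →
      (LieAlgebra.ad K L X ^ i) v = 0 := by
    intro M hM i hi
    obtain ⟨j, rfl⟩ := Nat.exists_eq_add_of_le hi
    rw [add_comm, pow_add, Module.End.mul_apply, hM, map_zero]
  have hn : (LieAlgebra.ad K L X ^ nilpotencyClass (LieAlgebra.ad K L X)) v = 0 := by
    rw [pow_nilpotencyClass hX]; rfl
  rw [h1, expE_eq, LinearMap.sum_apply]
  simp only [LinearMap.smul_apply]
  set M := nilpotencyClass (LieAlgebra.ad K L X)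
  rw [← Finset.sum_subset (Finset.range_mono (min_le_left M N)),
    ← Finset.sum_subset (Finset.range_mono (min_le_right M N))]
  · intro i _ hi
    rw [Finset.mem_range, not_lt, min_le_iff] at hi
    rcases hi with hi | hi
    · rw [key M hn i hi, smul_zero]
    · rw [key N hN i hi, smul_zero]
  · intro i _ hi
    rw [Finset.mem_range, not_lt, min_le_iff] at hi
    rcases hi with hi | hi
    · rw [key M hn i hi, smul_zero]
    · rw [key N hN i hi, smul_zero]

lemma expE_mem_submodule {S : Submodule K L} (hS : ∀ v ∈ S, ⁅X, v⁆ ∈ S) {v : L} (hv : v ∈ S) :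
    expE X hX v ∈ S := by
  have h1 : expE X hX v = (expE X hX : L →ₗ[K] L) v := rfl
  rw [h1, expE_eq, LinearMap.sum_apply]
  refine Submodule.sum_mem _ fun i hi => Submodule.smul_mem _ _ ?_
  clear hi
  induction i with
  | zero => simpa using hv
  | succ i ih => rw [pow_succ', Module.End.mul_apply]; exact hS _ ih

end Exponential

section Weights

variable {K L : Type*} [Field K] [LieRing L] [LieAlgebra K L] [CharZero K] [FiniteDimensional K L]

lemma eq_of_mem_eig {h x : L} {i j : ℤ} (hx : x ∈ eig K h i) (hx' : x ∈ eig K h j) (h0 : x ≠ 0) :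
    i = j := by
  rw [mem_eig] at *
  have := sub_eq_zero.2 (hx.symm.trans hx')
  rw [← sub_smul, smul_eq_zero] at this
  have := this.resolve_right h0
  rw [sub_eq_zero] at this
  exact_mod_cast this

lemma mem_eig_sum {ι : Type*} (s : Finset ι) {H : ι → L} {m : ι → ℤ} {x : L}
    (h : ∀ i ∈ s, x ∈ eig K (H i) (m i)) : x ∈ eig K (∑ i ∈ s, H i) (∑ i ∈ s, m i) := by
  rw [mem_eig, sum_lie, Int.cast_sum, Finset.sum_smul]
  exact Finset.sum_congr rfl fun i hi => mem_eig.1 (h i hi)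

/-- A sum decomposition into eigenvectors. -/
lemma eproj_induction {h : L} (hd : IsDiag K h) {P : L → Prop} (x : L)
    (mem : ∀ i, P (eproj h hd i x)) (zero : P 0) (add : ∀ x y, P x → P y → P (x + y)) : P x := by
  obtain ⟨s, hs⟩ := exists_eq_sum_eproj hd x
  rw [hs]
  exact Finset.sum_induction _ P add zero fun i _ => mem i

lemma joint_induction {ι : Type*} [Finite ι] {H : ι → L} (hd : ∀ i, IsDiag K (H i))
    (hc : ∀ i j, ⁅H i, H j⁆ = 0) (S : Submodule K L)
    (hS : ∀ i j, ∀ x ∈ S, eproj (H i) (hd i) j x ∈ S) {P : L → Prop}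
    (mem : ∀ (m : ι → ℤ), ∀ x ∈ S, (∀ i, x ∈ eig K (H i) (m i)) → P x)
    (add : ∀ x y, P x → P y → P (x + y)) {x : L} (hx : x ∈ S) : P x := by
  classical
  have := Fintype.ofFinite ι
  have zero : P 0 := mem 0 0 (zero_mem _) fun i => zero_mem _
  suffices h : ∀ s : Finset ι, (∀ (m : ι → ℤ), ∀ x ∈ S, (∀ i ∈ s, x ∈ eig K (H i) (m i)) → P x) →
      ∀ x ∈ S, P x from h Finset.univ (fun m x hx h => mem m x hx fun i => h i (Finset.mem_univ i)) x hx
  intro s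
  induction s using Finset.induction_on with
  | empty => exact fun h x hx => h 0 x hx (by simp)
  | insert j s hj ih =>
    intro h
    refine ih fun m x hx hm => ?_
    refine eproj_induction (hd j) x (fun a => ?_) zero add
    refine h (Function.update m j a) _ (hS j a x hx) fun i hi => ?_
    rcases Finset.mem_insert.1 hi with rfl | hi
    · simpa using eproj_mem (hd i) a x
    · have hij : i ≠ j := fun h => hj (h ▸ hi)
      rw [Function.update_of_ne hij]
      exact eproj_mem_eig (hd j) (hc j i) a (hm i hi)

end Weights

section System

variable {K L : Type*} [Field K] [LieRing L] [LieAlgebra K L] [CharZero K] [FiniteDimensional K L]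
  {p : ℕ}

variable (K) in
/-- The properties of a very special system `H_1, …, H_p` that are used below; they are symmetric
with respect to the change of signs of all elements. -/
structure Sys (H0 : L) (H : Fin p → L) : Prop where
  diag₀ : IsDiag K H0
  diag : ∀ i, IsDiag K (H i)
  comm : ∀ i j, ⁅H i, H j⁆ = 0
  sum_eq : ∑ i, H i = 2 • H0
  triple : ∀ i, ∃ x ∈ eig K H0 1, ∃ y ∈ eig K H0 (-1), IsSl2Triple (H i) x y
  pos : ∀ i j, ∀ x ∈ eig K H0 1, x ∈ eig K (H i) j → j < 0 → x = 0
  neg : ∀ i j, ∀ x ∈ eig K H0 (-1), x ∈ eig K (H i) j → 0 < j → x = 0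

lemma mem_eig_neg {h x : L} {i : ℤ} : x ∈ eig K (-h) i ↔ x ∈ eig K h (-i) := by
  rw [mem_eig, mem_eig, neg_lie, neg_eq_iff_eq_neg]
  simp

lemma IsDiag.neg {h : L} (hd : IsDiag K h) : IsDiag K (-h) := by
  rw [IsDiag, eq_top_iff, ← (show _ = _ from hd)]
  refine iSup_le fun i => ?_
  exact (show eig K h i ≤ eig K (-h) (-i) from fun x hx => neg_mem_eig hx).trans
    (le_iSup (fun i => eig K (-h) i) (-i))

variable {H0 : L} {H : Fin p → L}

lemma Sys.symm (S : Sys K H0 H) : Sys K (-H0) (fun i => -H i) where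
  diag₀ := S.diag₀.neg
  diag i := (S.diag i).neg
  comm i j := by simp [S.comm i j]
  sum_eq := by simp [S.sum_eq]
  triple i := by
    obtain ⟨x, hx, y, hy, t⟩ := S.triple i
    exact ⟨y, mem_eig_neg.2 hy, x, mem_eig_neg.2 (by simpa using hx), t.symm⟩
  pos i j x hx hx' hj := S.neg i (-j) x (mem_eig_neg.1 hx) (mem_eig_neg.1 hx') (by omega)
  neg i j x hx hx' hj := S.pos i (-j) x (by simpa using mem_eig_neg.1 hx) (mem_eig_neg.1 hx')
    (by omega)

lemma Sys.reindex (S : Sys K H0 H) (e : Fin p ≃ Fin p) : Sys K H0 (fun i => H (e i)) where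
  diag₀ := S.diag₀
  diag i := S.diag (e i)
  comm i j := S.comm _ _
  sum_eq := by rw [← S.sum_eq]; exact Equiv.sum_comp e H
  triple i := S.triple _
  pos i := S.pos _
  neg i := S.neg _

lemma Sys.mem_zero (S : Sys K H0 H) (i : Fin p) : H i ∈ eig K H0 0 := by
  obtain ⟨x, hx, y, hy, t⟩ := S.triple i
  rw [← t.lie_e_f]
  exact lie_mem_eig' hx hy (by norm_num)

lemma Sys.comm₀ (S : Sys K H0 H) (i : Fin p) : ⁅H i, H0⁆ = 0 := by
  rw [← lie_skew, mem_eig_zero.1 (S.mem_zero i), neg_zero]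

lemma partialSum_zero (H : Fin p → L) : partialSum H 0 = 0 := by simp [partialSum]

lemma partialSum_succ (H : Fin p → L) {k : ℕ} (hk : k < p) :
    partialSum H (k + 1) = partialSum H k + H ⟨k, hk⟩ := by
  have : Finset.univ.filter (fun i : Fin p => (i : ℕ) < k + 1) =
      insert ⟨k, hk⟩ (Finset.univ.filter (fun i : Fin p => (i : ℕ) < k)) := by
    ext i
    simp only [Finset.mem_filter, Finset.mem_univ, true_and, Finset.mem_insert, Fin.ext_iff]
    omega
  rw [partialSum, this, Finset.sum_insert (by simp), add_comm]
  rfl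

lemma partialSum_self (H : Fin p → L) : partialSum H p = ∑ i, H i := by
  rw [partialSum, Finset.filter_true_of_mem fun i _ => i.2]

lemma partialSum_neg (H : Fin p → L) (k : ℕ) : partialSum (fun i => -H i) k = -partialSum H k := by
  simp [partialSum]

lemma Sys.lie_partialSum (S : Sys K H0 H) (i : Fin p) (k : ℕ) : ⁅H i, partialSum H k⁆ = 0 := by
  rw [partialSum, lie_sum]
  exact Finset.sum_eq_zero fun j _ => S.comm i j

lemma Sys.partialSum_mem (S : Sys K H0 H) (k : ℕ) : partialSum H k ∈ eig K H0 0 :=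
  Submodule.sum_mem _ fun i _ => S.mem_zero i

lemma Sys.induction (S : Sys K H0 H) {P : L → Prop} (T : Set (L × ℤ))
    (hT : ∀ q ∈ T, ∀ i, ⁅H i, q.1⁆ = 0)
    (mem : ∀ (m : Fin p → ℤ) x, (∀ q ∈ T, x ∈ eig K q.1 q.2) →
      (∀ i, x ∈ eig K (H i) (m i)) → P x)
    (add : ∀ x y, P x → P y → P (x + y)) {x : L} (hx : ∀ q ∈ T, x ∈ eig K q.1 q.2) : P x := by
  refine joint_induction S.diag S.comm (⨅ q ∈ T, eig K q.1 q.2) (fun i j x hx => ?_)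
    (fun m x hx hm => mem m x (by simpa only [Submodule.mem_iInf] using hx) hm) add
    (by simpa only [Submodule.mem_iInf] using hx)
  simp only [Submodule.mem_iInf] at hx ⊢
  exact fun q hq => eproj_mem_eig _ (hT q hq i) j (hx q hq)

lemma Sys.diag_of_comm (S : Sys K H0 H) {h : L} (c : (Fin p → ℤ) → ℤ)
    (hh : ∀ (m : Fin p → ℤ) x, (∀ i, x ∈ eig K (H i) (m i)) → x ∈ eig K h (c m)) : IsDiag K h := by
  rw [IsDiag, eq_top_iff]
  intro x _
  refine S.induction (P := fun x => x ∈ ⨆ i, eig K h i) ∅ (by simp) (fun m x _ hm => ?_)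
    (fun x y => add_mem) (by simp)
  exact Submodule.mem_iSup_of_mem (c m) (hh m x hm)

lemma mem_eig_partialSum {m : Fin p → ℤ} {x : L} (hm : ∀ i, x ∈ eig K (H i) (m i)) (k : ℕ) :
    x ∈ eig K (partialSum H k) (∑ i ∈ Finset.univ.filter (fun i : Fin p => (i : ℕ) < k), m i) :=
  mem_eig_sum _ fun i _ => hm i

lemma Sys.diag_partialSum (S : Sys K H0 H) (k : ℕ) : IsDiag K (partialSum H k) :=
  S.diag_of_comm _ fun _ _ hm => mem_eig_partialSum hm k

lemma mem_eig_two_smul {x : L} {i : ℤ} : x ∈ eig K (2 • H0) (2 * i) ↔ x ∈ eig K H0 i := by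
  rw [mem_eig, mem_eig, ← Nat.cast_smul_eq_nsmul K, smul_lie]
  push_cast
  rw [mul_smul]
  exact (smul_right_injective L (two_ne_zero (α := K))).eq_iff

lemma Sys.sum_weight (S : Sys K H0 H) {m : Fin p → ℤ} {x : L} {a : ℤ} (hx : x ∈ eig K H0 a)
    (hm : ∀ i, x ∈ eig K (H i) (m i)) (h0 : x ≠ 0) : ∑ i, m i = 2 * a := by
  have h1 := mem_eig_sum Finset.univ fun i _ => hm i
  rw [S.sum_eq] at h1
  exact eq_of_mem_eig h1 (mem_eig_two_smul.2 hx) h0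

lemma Sys.weight_one (S : Sys K H0 H) {m : Fin p → ℤ} {x : L} (hx : x ∈ eig K H0 1)
    (hm : ∀ i, x ∈ eig K (H i) (m i)) (h0 : x ≠ 0) : ∀ i, 0 ≤ m i := by
  intro i
  by_contra h
  exact h0 (S.pos i (m i) x hx (hm i) (by omega))

/-- Induction over the weight vectors of a given degree and a given weight with respect to `h`. -/
lemma Sys.induction₂ (S : Sys K H0 H) {P : L → Prop} {a c : ℤ} {h : L} (hh : ∀ i, ⁅H i, h⁆ = 0)
    (mem : ∀ (m : Fin p → ℤ) x, x ∈ eig K H0 a → x ∈ eig K h c →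
      (∀ i, x ∈ eig K (H i) (m i)) → x ≠ 0 → P x) (zero : P 0)
    (add : ∀ x y, P x → P y → P (x + y)) {x : L} (hx : x ∈ eig K H0 a) (hx' : x ∈ eig K h c) :
    P x := by
  refine S.induction {(H0, a), (h, c)} (by simp [S.comm₀, hh]) (fun m x hx hm => ?_) add
    (by simp [hx, hx'])
  by_cases h0 : x = 0
  · rwa [h0]
  · exact mem m x (hx (H0, a) (by simp)) (hx (h, c) (by simp)) hm h0

/-- In degree one, the partial sums have the weights `0, 1, 2`. -/
lemma Sys.eq_zero_of_one (S : Sys K H0 H) {k : ℕ} {c : ℤ} {x : L} (hx : x ∈ eig K H0 1)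
    (hc : x ∈ eig K (partialSum H k) c) (h : c < 0 ∨ 2 < c) : x = 0 := by
  refine S.induction₂ (P := fun x => x = 0) (S.lie_partialSum · k) (fun m x hx hc hm h0 => ?_) rfl
    (fun x y hx hy => by rw [hx, hy, add_zero]) hx hc
  have h1 := S.weight_one hx hm h0
  have h2 := S.sum_weight hx hm h0
  have h3 := eq_of_mem_eig hc (mem_eig_partialSum hm k) h0
  have h4 := Finset.sum_nonneg (s := Finset.univ.filter (fun i : Fin p => (i : ℕ) < k))
    fun i _ => h1 i
  have h5 := Finset.sum_le_sum_of_subset_of_nonneg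
    (Finset.filter_subset (fun i : Fin p => (i : ℕ) < k) Finset.univ) fun i _ _ => h1 i
  omega

lemma Sys.mem_eig_zero_of_lt (S : Sys K H0 H) {k : ℕ} {x : L} (hx : x ∈ eig K H0 1)
    (hc : x ∈ eig K (partialSum H k) 0) {i : Fin p} (hi : (i : ℕ) < k) : x ∈ eig K (H i) 0 := by
  refine S.induction₂ (P := fun x => x ∈ eig K (H i) 0) (S.lie_partialSum · k)
    (fun m x hx hc hm h0 => ?_) (zero_mem _) (fun x y => add_mem) hx hc
  have h1 := S.weight_one hx hm h0
  have h3 := eq_of_mem_eig hc (mem_eig_partialSum hm k) h0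
  have h4 := (Finset.sum_eq_zero_iff_of_nonneg fun i _ => h1 i).1 h3.symm i (by simpa using hi)
  rw [← h4]
  exact hm i

lemma Sys.mem_eig_zero_of_two (S : Sys K H0 H) {j : Fin p} {x : L} (hx : x ∈ eig K H0 1)
    (hc : x ∈ eig K (H j) 2) {i : Fin p} (hi : i ≠ j) : x ∈ eig K (H i) 0 := by
  refine S.induction₂ (P := fun x => x ∈ eig K (H i) 0) (S.comm · j)
    (fun m x hx hc hm h0 => ?_) (zero_mem _) (fun x y => add_mem) hx hc
  have h1 := S.weight_one hx hm h0
  have h2 := S.sum_weight hx hm h0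
  have h3 := eq_of_mem_eig hc (hm j) h0
  have h5 := Finset.sum_le_sum_of_subset_of_nonneg (f := m)
    (show {i, j} ⊆ Finset.univ from Finset.subset_univ _) fun i _ _ => h1 i
  rw [Finset.sum_pair hi] at h5
  have := h1 i
  have h6 : m i = 0 := by omega
  rw [← h6]
  exact hm i

lemma Sys.eq_zero_of_one' (S : Sys K H0 H) {i : Fin p} {c : ℤ} {x : L} (hx : x ∈ eig K H0 1)
    (hc : x ∈ eig K (H i) c) (h : c < 0 ∨ 2 < c) : x = 0 := by
  refine S.induction₂ (P := fun x => x = 0) (S.comm · i) (fun m x hx hc hm h0 => ?_) rfl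
    (fun x y hx hy => by rw [hx, hy, add_zero]) hx hc
  have h1 := S.weight_one hx hm h0
  have h2 := S.sum_weight hx hm h0
  have h3 := eq_of_mem_eig hc (hm i) h0
  have h4 := Finset.single_le_sum (fun i _ => h1 i) (Finset.mem_univ i)
  have := h1 i
  omega

lemma Sys.eq_zero_of_neg_one' (S : Sys K H0 H) {i : Fin p} {c : ℤ} {x : L}
    (hx : x ∈ eig K H0 (-1)) (hc : x ∈ eig K (H i) c) (h : 0 < c ∨ c < -2) : x = 0 :=
  S.symm.eq_zero_of_one' (i := i) (c := -c) (mem_eig_neg.2 hx)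
    (by rw [mem_eig_neg]; simpa using hc) (by omega)

/-- The weights in degree zero: if `m i` is negative, the other weights are non-negative. -/
lemma Sys.weight_zero (S : Sys K H0 H) {m : Fin p → ℤ} {X : L} (hX : X ∈ eig K H0 0)
    (hm : ∀ i, X ∈ eig K (H i) (m i)) (h0 : X ≠ 0) {i : Fin p} (hi : m i < 0) {j : Fin p}
    (hj : j ≠ i) : 0 ≤ m j := by
  obtain ⟨x, hx, y, hy, t⟩ := S.triple i
  have h1 : ⁅x, X⁆ ≠ 0 := fun h => h0 (lie_eq_zero_of_neg t (hm i) hi h)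
  have hxj := S.mem_eig_zero_of_two hx (IsSl2Triple.mem_e (K := K) t) hj
  by_contra hlt
  exact h1 (S.pos j (m j) _ (lie_mem_eig' hx hX (by norm_num)) (lie_mem_eig' hxj (hm j) (by simp))
    (by omega))

lemma Sys.weight_zero' (S : Sys K H0 H) {m : Fin p → ℤ} {X : L} (hX : X ∈ eig K H0 0)
    (hm : ∀ i, X ∈ eig K (H i) (m i)) (h0 : X ≠ 0) {i : Fin p} (hi : 0 < m i) {j : Fin p}
    (hj : j ≠ i) : m j ≤ 0 := by
  have := S.symm.weight_zero (m := fun i => -m i) (mem_eig_neg.2 (by simpa using hX))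
    (fun i => mem_eig_neg.2 (by simpa using hm i)) h0 (i := i) (by simpa using hi) hj
  simpa using this

/-- The non-zero weights in degree zero have one positive and one negative coordinate, with
sum zero. -/
lemma Sys.exists_weight_zero (S : Sys K H0 H) {m : Fin p → ℤ} {X : L} (hX : X ∈ eig K H0 0)
    (hm : ∀ i, X ∈ eig K (H i) (m i)) (h0 : X ≠ 0) (hm0 : m ≠ 0) :
    ∃ a b, 0 < m a ∧ m b = - m a ∧ ∀ i, i ≠ a → i ≠ b → m i = 0 := by
  have hsum := S.sum_weight hX hm h0
  rw [mul_zero] at hsum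
  obtain ⟨a, ha⟩ : ∃ a, 0 < m a := by
    by_contra! h
    exact hm0 (funext fun i => (Finset.sum_eq_zero_iff_of_nonpos fun i _ => h i).1 hsum i
      (Finset.mem_univ i))
  obtain ⟨b, hb⟩ : ∃ b, m b < 0 := by
    by_contra! h
    exact hm0 (funext fun i => (Finset.sum_eq_zero_iff_of_nonneg fun i _ => h i).1 hsum i
      (Finset.mem_univ i))
  have hab : a ≠ b := by rintro rfl; omega
  have hz : ∀ i, i ≠ a → i ≠ b → m i = 0 := fun i hia hib =>
    le_antisymm (S.weight_zero' hX hm h0 ha hia) (S.weight_zero hX hm h0 hb hib)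
  refine ⟨a, b, ha, ?_, hz⟩
  rw [← Finset.sum_subset (Finset.subset_univ {a, b})
    (fun i _ hi => by simp at hi; exact hz i hi.1 hi.2), Finset.sum_pair hab] at hsum
  omega

lemma isPositiveWeight_iff {m : Fin p → ℤ} {a b : Fin p} (ha : 0 < m a) (hb : m b = -m a)
    (hz : ∀ i, i ≠ a → i ≠ b → m i = 0) : IsPositiveWeight m ↔ b < a := by
  have hab : a ≠ b := by rintro rfl; omega
  constructor
  · rintro ⟨k, hk, hk'⟩
    have hka : k = a := by
      by_contra h
      have hkb : k ≠ b := by rintro rfl; omega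
      have := hz k h hkb
      omega
    subst hka
    by_contra hlt
    have := hk' b (lt_of_le_of_ne (not_lt.1 hlt) hab)
    omega
  · intro h
    refine ⟨a, ha, fun j hj => hz j hj.ne' (h.trans hj).ne'⟩

lemma sum_filter_eq {m : Fin p → ℤ} {a b : Fin p} (hab : a ≠ b)
    (hz : ∀ i, i ≠ a → i ≠ b → m i = 0) (k : ℕ) :
    ∑ i ∈ Finset.univ.filter (fun i : Fin p => (i : ℕ) < k), m i =
      (if (a : ℕ) < k then m a else 0) + if (b : ℕ) < k then m b else 0 := by
  rw [Finset.sum_filter, ← Finset.sum_subset (Finset.subset_univ {a, b})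
    (fun i _ hi => by simp at hi; simp [hz i hi.1 hi.2]), Finset.sum_pair hab]

lemma Sys.nilT_induction (S : Sys K H0 H) {P : L → Prop}
    (mem : ∀ (m : Fin p → ℤ) (a b : Fin p) (X : L), X ∈ nilT K H0 H → X ∈ eig K H0 0 →
      (∀ i, X ∈ eig K (H i) (m i)) → X ≠ 0 → 0 < m a → m b = -m a → b < a →
      (∀ i, i ≠ a → i ≠ b → m i = 0) → P X) (zero : P 0)
    (add : ∀ x y, P x → P y → P (x + y)) {X : L} (hX : X ∈ nilT K H0 H) : P X := by
  have hX' := hX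
  rw [nilT] at hX'
  induction hX' using Submodule.iSup_induction' with
  | mem m X hXm =>
    by_cases h0 : X = 0
    · rwa [h0]
    have hm : ∀ i, X ∈ eig K (H i) (m.1 i) := by simpa using hXm.2
    have hm0 : m.1 ≠ 0 := by
      obtain ⟨k, hk, -⟩ := m.2
      intro h
      rw [h] at hk
      simp at hk
    obtain ⟨a, b, ha, hb, hz⟩ := S.exists_weight_zero hXm.1 hm h0 hm0
    exact mem m.1 a b X (Submodule.mem_iSup_of_mem m hXm) hXm.1 hm h0 ha hb
      ((isPositiveWeight_iff ha hb hz).1 m.2) hz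
  | zero => exact zero
  | add x y hx hy h1 h2 => exact add x y (h1 hx) (h2 hy)

lemma mem_nilT {m : Fin p → ℤ} (hm : IsPositiveWeight m) {X : L} (hX : X ∈ eig K H0 0)
    (h : ∀ i, X ∈ eig K (H i) (m i)) : X ∈ nilT K H0 H :=
  Submodule.mem_iSup_of_mem ⟨m, hm⟩ ⟨hX, by simpa using h⟩

/-- The weights of the partial sums on `𝔫_𝔱` are non-positive. -/
lemma Sys.eproj_nilT (S : Sys K H0 H) {X : L} (hX : X ∈ nilT K H0 H) (k : ℕ) {c : ℤ} (hc : 0 < c) :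
    eproj (partialSum H k) (S.diag_partialSum k) c X = 0 := by
  refine S.nilT_induction
    (P := fun X => eproj (partialSum H k) (S.diag_partialSum k) c X = 0)
    (fun m a b X _ hX hm h0 ha hb hab hz => ?_) (map_zero _)
    (fun x y hx hy => by rw [map_add, hx, hy, add_zero]) hX
  refine eproj_of_ne _ ?_ (mem_eig_partialSum hm k)
  rw [sum_filter_eq hab.ne' hz, hb]
  have : (b : ℕ) < a := hab
  split_ifs <;> omega

lemma Sys.eproj_mem_nilT (S : Sys K H0 H) {X : L} (hX : X ∈ nilT K H0 H) {h : L} (hd : IsDiag K h)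
    (c : (Fin p → ℤ) → ℤ)
    (hh : ∀ (m : Fin p → ℤ) x, (∀ i, x ∈ eig K (H i) (m i)) → x ∈ eig K h (c m)) (j : ℤ) :
    eproj h hd j X ∈ nilT K H0 H := by
  refine S.nilT_induction (P := fun X => eproj h hd j X ∈ nilT K H0 H)
    (fun m a b X hX' hX hm h0 ha hb hab hz => ?_) (by simp)
    (fun x y hx hy => by rw [map_add]; exact add_mem hx hy) hX
  rw [eproj_eq_ite hd (hh m X hm)]
  split_ifs
  exacts [hX', zero_mem _]

lemma Sys.mem_nilT_of_neg (S : Sys K H0 H) {X : L} (hX : X ∈ eig K H0 0) {k : ℕ} {c : ℤ}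
    (hc : c < 0) (hXc : X ∈ eig K (partialSum H k) c) : X ∈ nilT K H0 H := by
  refine S.induction₂ (P := fun x => x ∈ nilT K H0 H) (S.lie_partialSum · k)
    (fun m x hx hc' hm h0 => ?_) (zero_mem _) (fun x y => add_mem) hX hXc
  have h1 := eq_of_mem_eig hc' (mem_eig_partialSum hm k) h0
  have hm0 : m ≠ 0 := by
    rintro rfl
    simp at h1
    omega
  obtain ⟨a, b, ha, hb, hz⟩ := S.exists_weight_zero hx hm h0 hm0
  refine mem_nilT ((isPositiveWeight_iff ha hb hz).2 ?_) hx hm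
  have hab : a ≠ b := by rintro rfl; omega
  rw [sum_filter_eq hab hz, hb] at h1
  rw [Fin.lt_def]
  split_ifs at h1 <;> omega

lemma Sys.lie_nilT_eq_zero (S : Sys K H0 H) {X u : L} (hX : X ∈ nilT K H0 H) {j : Fin p}
    (hXj : X ∈ eig K (H j) 0) (hu : u ∈ eig K H0 1) (huj : u ∈ eig K (H j) 2) : ⁅X, u⁆ = 0 := by
  rw [← eproj_self (S.diag j) hXj]
  clear hXj
  refine S.nilT_induction (P := fun X => ⁅eproj (H j) (S.diag j) 0 X, u⁆ = 0)
    (fun m a b X _ hX hm h0 ha hb hab hz => ?_) (by simp)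
    (fun x y hx hy => by rw [map_add, add_lie, hx, hy, add_zero]) hX
  rw [eproj_eq_ite _ (hm j)]
  split_ifs with hj
  · have hbj : b ≠ j := by rintro rfl; omega
    exact S.pos b (m b) _ (lie_mem_eig' hX hu (by norm_num))
      (lie_mem_eig' (hm b) (S.mem_eig_zero_of_two hu huj hbj) (by simp)) (by omega)
  · simp

end System

section Nilpotent

variable {K L : Type*} [Field K] [LieRing L] [LieAlgebra K L] [CharZero K] [FiniteDimensional K L]

/-- A sum of eigenvectors with negative eigenvalues is ad-nilpotent. -/
lemma isNilpotent_ad_of_mem_iSup {h X : L} (hd : IsDiag K h)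
    (hX : X ∈ ⨆ i : {i : ℤ // i < 0}, eig K h i) : IsNilpotent (LieAlgebra.ad K L X) := by
  obtain ⟨B, hB⟩ := exists_eig_eq_bot K h
  let Fl : ℤ → Submodule K L := fun r => ⨆ i : {i : ℤ // i ≤ r}, eig K h i
  have hstep : ∀ r, ∀ v ∈ Fl r, ⁅X, v⁆ ∈ Fl (r - 1) := by
    intro r v hv
    induction hv using Submodule.iSup_induction' with
    | mem i v hv =>
      induction hX using Submodule.iSup_induction' with
      | mem j X hX =>
        exact Submodule.mem_iSup_of_mem (⟨j + i, by have := i.2; have := j.2; omega⟩ :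
          {i : ℤ // i ≤ r - 1}) (lie_mem_eig hX hv)
      | zero => simp
      | add X Y _ _ h1 h2 => rw [add_lie]; exact add_mem h1 h2
    | zero => simp
    | add v w _ _ h1 h2 => rw [lie_add]; exact add_mem h1 h2
  have hpow : ∀ (n : ℕ) v, v ∈ Fl B → (LieAlgebra.ad K L X ^ n) v ∈ Fl (B - n) := by
    intro n v hv
    induction n with
    | zero => simpa using hv
    | succ n ih =>
      rw [pow_succ', Module.End.mul_apply]
      have := hstep _ _ ih
      push_cast
      rwa [← sub_sub]
  have hbot : Fl (B - (2 * B + 1 : ℕ)) = ⊥ := by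
    rw [eq_bot_iff]
    refine iSup_le fun i => ?_
    have hi := i.2
    rw [hB i]
    rw [abs_of_nonpos] <;> push_cast at hi <;> omega
  have htop : ∀ v, v ∈ Fl B := by
    intro v
    induction v using diag_induction hd with
    | mem i v hv =>
      by_cases hi : i ≤ B
      · exact Submodule.mem_iSup_of_mem (⟨i, hi⟩ : {i : ℤ // i ≤ B}) hv
      · rw [hB i (by rw [abs_of_nonneg] <;> omega)] at hv
        rw [(Submodule.mem_bot K).1 hv]
        exact zero_mem _
    | add v w h1 h2 => exact add_mem h1 h2
  refine ⟨2 * B + 1, LinearMap.ext fun v => ?_⟩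
  have := hpow (2 * B + 1) v (htop v)
  rwa [hbot] at this

end Nilpotent

section NilT

variable {K L : Type*} [Field K] [LieRing L] [LieAlgebra K L] [CharZero K] [FiniteDimensional K L]
  {p : ℕ} {H0 : L} {H : Fin p → L}

lemma Sys.isNilpotent_nilT (S : Sys K H0 H) {X : L} (hX : X ∈ nilT K H0 H) :
    IsNilpotent (LieAlgebra.ad K L X) := by
  let h : L := ∑ i : Fin p, (-(i : ℕ) : ℤ) • H i
  have hh : ∀ (m : Fin p → ℤ) x, (∀ i, x ∈ eig K (H i) (m i)) →
      x ∈ eig K h (∑ i : Fin p, (-(i : ℕ) : ℤ) * m i) := fun m x hm =>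
    mem_eig_sum _ fun i _ => by
      have := mem_eig.1 (hm i)
      rw [mem_eig, smul_lie, this, ← Int.cast_smul_eq_zsmul K, smul_smul, ← Int.cast_mul]
  refine isNilpotent_ad_of_mem_iSup (S.diag_of_comm _ hh) ?_
  refine S.nilT_induction (P := fun X => X ∈ ⨆ i : {i : ℤ // i < 0}, eig K h i)
    (fun m a b X _ hX hm h0 ha hb hab hz => ?_) (zero_mem _) (fun x y => add_mem) hX
  suffices hneg : ∑ i : Fin p, (-(i : ℕ) : ℤ) * m i < 0 from
    Submodule.mem_iSup_of_mem (⟨_, hneg⟩ : {i : ℤ // i < 0}) (hh m X hm)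
  rw [← Finset.sum_subset (Finset.subset_univ {a, b})
    (fun i _ hi => by simp at hi; simp [hz i hi.1 hi.2]), Finset.sum_pair hab.ne', hb]
  have h1 : (b : ℕ) < a := hab
  have h2 : ((b : ℕ) : ℤ) < (a : ℕ) := by exact_mod_cast h1
  nlinarith

lemma isPositiveWeight_add {m m' : Fin p → ℤ} (hm : IsPositiveWeight m) (hm' : IsPositiveWeight m') :
    IsPositiveWeight (m + m') := by
  obtain ⟨a, ha, ha'⟩ := hm
  obtain ⟨b, hb, hb'⟩ := hm'
  rcases lt_trichotomy a b with hab | rfl | hab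
  · exact ⟨b, by simp [ha' b hab, hb], fun j hj => by simp [ha' j (hab.trans hj), hb' j hj]⟩
  · exact ⟨a, by simp; omega, fun j hj => by simp [ha' j hj, hb' j hj]⟩
  · exact ⟨a, by simp [hb' a hab, ha], fun j hj => by simp [ha' j hj, hb' j (hab.trans hj)]⟩

lemma lie_mem_nilT {X Y : L} (hX : X ∈ nilT K H0 H) (hY : Y ∈ nilT K H0 H) :
    ⁅X, Y⁆ ∈ nilT K H0 H := by
  rw [nilT] at hX
  induction hX using Submodule.iSup_induction' with
  | mem m X hX =>
    rw [nilT] at hY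
    induction hY using Submodule.iSup_induction' with
    | mem n Y hY =>
      have h1 : ∀ i, X ∈ eig K (H i) (m.1 i) := by simpa using hX.2
      have h2 : ∀ i, Y ∈ eig K (H i) (n.1 i) := by simpa using hY.2
      exact mem_nilT (isPositiveWeight_add m.2 n.2) (lie_mem_eig' hX.1 hY.1 (by norm_num))
        fun i => lie_mem_eig (h1 i) (h2 i)
    | zero => simp
    | add v w _ _ h1 h2 => rw [lie_add]; exact add_mem h1 h2
  | zero => simp
  | add v w _ _ h1 h2 => rw [add_lie]; exact add_mem h1 h2

/-- The component of degree zero of an element of `𝔫_𝔱` with respect to a partial sum. -/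
def Sys.levi (S : Sys K H0 H) (k : ℕ) (X : L) : L :=
  eproj (partialSum H k) (S.diag_partialSum k) 0 X

lemma Sys.levi_mem (S : Sys K H0 H) {X : L} (hX : X ∈ nilT K H0 H) (k : ℕ) :
    S.levi k X ∈ nilT K H0 H :=
  S.eproj_mem_nilT hX _ _ (fun _ _ hm => mem_eig_partialSum hm k) 0

lemma Sys.lie_levi (S : Sys K H0 H) (X : L) (k : ℕ) : ⁅S.levi k X, partialSum H k⁆ = 0 := by
  rw [← lie_skew, Sys.levi, mem_eig_zero.1 (eproj_mem (S.diag_partialSum k) 0 X), neg_zero]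

/-- The projection of degree one to the top eigenspace of a partial sum. -/
abbrev Sys.top (S : Sys K H0 H) (k : ℕ) : L →ₗ[K] L :=
  eproj (partialSum H k) (S.diag_partialSum k) 2

lemma Sys.comm_partialSum (S : Sys K H0 H) (k : ℕ) : ⁅partialSum H k, H0⁆ = 0 := by
  rw [← lie_skew, mem_eig_zero.1 (S.partialSum_mem k), neg_zero]

lemma Sys.top_mem (S : Sys K H0 H) (k : ℕ) {x : L} (hx : x ∈ eig K H0 1) :
    S.top k x ∈ eig K H0 1 := eproj_mem_eig _ (S.comm_partialSum k) _ hx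

lemma Sys.top_lie (S : Sys K H0 H) {X : L} (hX : X ∈ nilT K H0 H) (k : ℕ) {v : L}
    (hv : v ∈ eig K H0 1) : S.top k ⁅X, v⁆ = ⁅S.levi k X, S.top k v⁆ := by
  obtain ⟨s, hs⟩ := exists_eq_sum_eproj (S.diag_partialSum k) X
  classical
  have key : ∀ c, S.top k ⁅eproj (partialSum H k) (S.diag_partialSum k) c X, v⁆ =
      if c = 0 then ⁅S.levi k X, S.top k v⁆ else 0 := by
    intro c
    have h1 := eproj_lie (S.diag_partialSum k) (eproj_mem (S.diag_partialSum k) c X) (2 - c) v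
    rw [sub_add_cancel] at h1
    rw [Sys.top, h1]
    split_ifs with hc
    · subst hc; rfl
    · rcases lt_or_gt_of_ne hc with hc | hc
      · rw [S.eq_zero_of_one (eproj_mem_eig _ (S.comm_partialSum k) _ hv) (eproj_mem _ _ _)
          (Or.inr (by omega)), lie_zero]
      · rw [S.eproj_nilT hX k hc, zero_lie]
  conv_lhs => rw [hs, sum_lie, map_sum]
  rw [Finset.sum_congr rfl fun c _ => key c, Finset.sum_ite_eq']
  split_ifs with h0
  · rfl
  · have : S.levi k X = 0 := by
      rw [Sys.levi, hs, map_sum]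
      refine Finset.sum_eq_zero fun c hc => eproj_of_ne _ ?_ (eproj_mem _ c X)
      rintro rfl
      exact h0 hc
    rw [this, zero_lie]

lemma Sys.top_expE (S : Sys K H0 H) {X : L} (hX : X ∈ nilT K H0 H) (k : ℕ) {v : L}
    (hv : v ∈ eig K H0 1) : S.top k (expE X (S.isNilpotent_nilT hX) v) =
      expE (S.levi k X) (S.isNilpotent_nilT (S.levi_mem hX k)) (S.top k v) := by
  have hmem : ∀ n, (LieAlgebra.ad K L X ^ n) v ∈ eig K H0 1 := by
    intro n
    have := pow_ad_mem_eig (nilT_le _ _ hX) hv n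
    simpa using this
  have hpow : ∀ n, S.top k ((LieAlgebra.ad K L X ^ n) v) =
      (LieAlgebra.ad K L (S.levi k X) ^ n) (S.top k v) := by
    intro n
    induction n with
    | zero => simp
    | succ n ih =>
      rw [pow_succ', Module.End.mul_apply, pow_succ', Module.End.mul_apply, ← ih,
        LieAlgebra.ad_apply, LieAlgebra.ad_apply, S.top_lie hX k (hmem n)]
  have hnil := S.isNilpotent_nilT hX
  obtain ⟨N, hN⟩ := hnil
  have hN1 : (LieAlgebra.ad K L X ^ N) v = 0 := by rw [hN]; rfl
  rw [expE_apply _ hN1, expE_apply (N := N) _ (by rw [← hpow, hN1, map_zero]), map_sum]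
  refine Finset.sum_congr rfl fun i _ => ?_
  rw [map_smul, hpow]

lemma expE_of_lie_eq_zero {X : L} (hX : IsNilpotent (LieAlgebra.ad K L X)) {v : L}
    (h : ⁅X, v⁆ = 0) : expE X hX v = v := by
  rw [expE_apply (N := 1) hX (by simpa using h)]
  simp

lemma expE_mem_eig {X : L} (hX : IsNilpotent (LieAlgebra.ad K L X)) {h : L} (hXh : X ∈ eig K h 0)
    {v : L} {i : ℤ} (hv : v ∈ eig K h i) : expE X hX v ∈ eig K h i :=
  expE_mem_submodule hX (fun v hv => lie_mem_eig' hXh hv (by simp)) hv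

/-- The points of degree one all of whose projections `S.top k` are parts of `sl₂`-triples with
neutral element `h_k`. -/
def Sys.Good (S : Sys K H0 H) (x : L) : Prop :=
  x ∈ eig K H0 1 ∧ ∀ k, k ≤ p → ∃ t ∈ eig K H0 (-1), t ∈ eig K (partialSum H k) (-2) ∧
    ⁅S.top k x, t⁆ = partialSum H k

/-- The points of degree one where the orbits of `𝔱`-parabolic subalgebra are open, in dual form. -/
def Transversal (K : Type*) [Field K] [LieAlgebra K L] (H0 : L) (H : Fin p → L) (x : L) : Prop :=
  ∀ y ∈ eig K H0 (-1), ⁅x, y⁆ ∈ nilT K H0 H → y = 0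

lemma Sys.good_expE (S : Sys K H0 H) {X x : L} (hX : X ∈ nilT K H0 H) (hx : S.Good x) :
    S.Good (expE X (S.isNilpotent_nilT hX) x) := by
  refine ⟨expE_mem_eig _ (nilT_le _ _ hX) hx.1, fun k hk => ?_⟩
  obtain ⟨t, ht0, ht, h⟩ := hx.2 k hk
  have hl := S.levi_mem hX k
  have h0 : S.levi k X ∈ eig K (partialSum H k) 0 := eproj_mem _ _ _
  refine ⟨expE _ (S.isNilpotent_nilT hl) t, expE_mem_eig _ (nilT_le _ _ hl) ht0,
    expE_mem_eig _ h0 ht, ?_⟩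
  rw [S.top_expE hX k hx.1, ← expE_lie, h, expE_of_lie_eq_zero _ (S.lie_levi X k)]

lemma Sys.transversal_of_expE (S : Sys K H0 H) {X x : L} (hX : X ∈ nilT K H0 H)
    (h : Transversal K H0 H (expE X (S.isNilpotent_nilT hX) x)) : Transversal K H0 H x := by
  intro y hy hxy
  have h1 := h (expE X (S.isNilpotent_nilT hX) y) (expE_mem_eig _ (nilT_le _ _ hX) hy) (by
    rw [← expE_lie]
    exact expE_mem_submodule _ (fun v hv => lie_mem_nilT hX hv) hxy)
  exact (LinearEquiv.map_eq_zero_iff _).1 h1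

end NilT

section NormalForm

variable {K L : Type*} [Field K] [LieRing L] [LieAlgebra K L] [CharZero K] [FiniteDimensional K L]
  {p : ℕ} {H0 : L} {H : Fin p → L}

lemma partialSum_congr {u v : Fin p → L} {k : ℕ} (h : ∀ i : Fin p, (i : ℕ) < k → u i = v i) :
    partialSum u k = partialSum v k :=
  Finset.sum_congr rfl fun i hi => h i (by simpa using hi)

lemma partialSum_mem_of {u : Fin p → L} {k : ℕ} {S : Submodule K L}
    (h : ∀ i : Fin p, (i : ℕ) < k → u i ∈ S) : partialSum u k ∈ S :=
  Submodule.sum_mem _ fun i hi => h i (by simpa using hi)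

lemma lie_partialSum_eq_zero {u : Fin p → L} {k : ℕ} {y : L}
    (h : ∀ i : Fin p, (i : ℕ) < k → ⁅y, u i⁆ = 0) : ⁅y, partialSum u k⁆ = 0 := by
  rw [partialSum, lie_sum]
  exact Finset.sum_eq_zero fun i hi => h i (by simpa using hi)

lemma partialSum_lie_eq_zero {u : Fin p → L} {k : ℕ} {y : L}
    (h : ∀ i : Fin p, (i : ℕ) < k → ⁅u i, y⁆ = 0) : ⁅partialSum u k, y⁆ = 0 := by
  rw [partialSum, sum_lie]
  exact Finset.sum_eq_zero fun i hi => h i (by simpa using hi)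

lemma Sys.mem_eig_partialSum_two (S : Sys K H0 H) {i : Fin p} {k : ℕ} (hi : (i : ℕ) < k) {u : L}
    (hu : u ∈ eig K H0 1) (hui : u ∈ eig K (H i) 2) : u ∈ eig K (partialSum H k) 2 := by
  have := mem_eig_partialSum (H := H) (m := fun j => if j = i then 2 else 0) (x := u) (fun j => by
    split_ifs with hj
    · rwa [hj]
    · exact S.mem_eig_zero_of_two hu hui hj) k
  rwa [Finset.sum_ite_eq', if_pos (by simpa using hi)] at this

lemma Sys.mem_eig_partialSum_neg_two (S : Sys K H0 H) {i : Fin p} {k : ℕ} (hi : (i : ℕ) < k) {u : L}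
    (hu : u ∈ eig K H0 (-1)) (hui : u ∈ eig K (H i) (-2)) : u ∈ eig K (partialSum H k) (-2) := by
  have := S.symm.mem_eig_partialSum_two hi (mem_eig_neg.2 hu) (mem_eig_neg.2 hui)
  rwa [partialSum_neg, mem_eig_neg] at this

lemma Sys.partialSum_ne_zero (S : Sys K H0 H) {k : ℕ} (h0 : 0 < k) (hk : k ≤ p) :
    partialSum H k ≠ 0 := by
  intro h
  obtain ⟨x, hx, y, hy, t⟩ := S.triple ⟨0, by omega⟩
  have h1 := S.mem_eig_partialSum_two h0 hx (IsSl2Triple.mem_e (K := K) t)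
  rw [h, mem_eig, zero_lie] at h1
  simp only [Int.cast_ofNat, eq_comm (a := (0 : L)), smul_eq_zero, OfNat.ofNat_ne_zero, false_or] at h1
  exact t.e_ne_zero h1

lemma isSl2Triple_of_mem {h x y : L} (h0 : h ≠ 0) (hx : x ∈ eig K h 2) (hy : y ∈ eig K h (-2))
    (hxy : ⁅x, y⁆ = h) : IsSl2Triple h x y := by
  refine ⟨h0, hxy, ?_, ?_⟩
  · rw [mem_eig.1 hx, ofNat_smul_eq_nsmul]; simp [two_smul]
  · rw [mem_eig.1 hy]; simp [two_smul]

/-- Sums of vectors in distinct weight spaces vanish only if all the vectors do. -/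
lemma Sys.eq_zero_of_partialSum (S : Sys K H0 H) {k : ℕ} {z : Fin p → L}
    (hz : ∀ i : Fin p, (i : ℕ) < k → z i ∈ eig K (H i) 2)
    (hz' : ∀ i j : Fin p, (i : ℕ) < k → (j : ℕ) < k → j ≠ i → z i ∈ eig K (H j) 0)
    (h : partialSum z k = 0) {i : Fin p} (hi : (i : ℕ) < k) : z i = 0 := by
  have h1 := congrArg (eproj (H i) (S.diag i) 2) h
  rw [partialSum, map_sum, map_zero, Finset.sum_eq_single i, eproj_self _ (hz i hi)] at h1
  · exact h1
  · intro j hj hji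
    exact eproj_of_ne _ (by norm_num) (hz' j i (by simpa using hj) hi hji.symm)
  · intro h
    simp [hi] at h

lemma Sys.eproj_sum_three (S : Sys K H0 H) {x : L} (hx : x ∈ eig K H0 1) (i : Fin p) :
    x = eproj (H i) (S.diag i) 2 x + eproj (H i) (S.diag i) 1 x + eproj (H i) (S.diag i) 0 x := by
  rw [← sub_eq_zero]
  refine eq_zero_of_eproj_eq_zero (S.diag i) fun c => ?_
  have h1 : ∀ c, eproj (H i) (S.diag i) c x ∈ eig K H0 1 := fun c =>
    eproj_mem_eig _ (S.comm₀ i) c hx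
  simp only [map_sub, map_add, eproj_eq_ite _ (eproj_mem (S.diag i) _ x)]
  by_cases h2 : c = 2
  · subst h2; simp
  by_cases h3 : c = 1
  · subst h3; simp
  by_cases h4 : c = 0
  · subst h4; simp
  rw [if_neg h2, if_neg h3, if_neg h4, S.eq_zero_of_one' (h1 c) (eproj_mem _ c x) (by omega)]
  simp

lemma Sys.eproj_sum_three' (S : Sys K H0 H) {x : L} (hx : x ∈ eig K H0 (-1)) (i : Fin p) :
    x = eproj (H i) (S.diag i) 0 x + eproj (H i) (S.diag i) (-1) x +
      eproj (H i) (S.diag i) (-2) x := by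
  rw [← sub_eq_zero]
  refine eq_zero_of_eproj_eq_zero (S.diag i) fun c => ?_
  have h1 : ∀ c, eproj (H i) (S.diag i) c x ∈ eig K H0 (-1) := fun c =>
    eproj_mem_eig _ (S.comm₀ i) c hx
  simp only [map_sub, map_add, eproj_eq_ite _ (eproj_mem (S.diag i) _ x)]
  by_cases h2 : c = 0
  · subst h2; simp
  by_cases h3 : c = -1
  · subst h3; simp
  by_cases h4 : c = -2
  · subst h4; simp
  rw [if_neg h2, if_neg h3, if_neg h4, S.eq_zero_of_neg_one' (h1 c) (eproj_mem _ c x) (by omega)]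
  simp

/-- A system of `sl₂`-triples with neutral elements `H_i`, `i < k`, whose nilpositive elements
commute, and a remainder that commutes with them. -/
structure Sys.State (S : Sys K H0 H) (k : ℕ) (u v : Fin p → L) (x' : L) : Prop where
  u_mem : ∀ i : Fin p, (i : ℕ) < k → u i ∈ eig K H0 1
  u_mem' : ∀ i : Fin p, (i : ℕ) < k → u i ∈ eig K (H i) 2
  v_mem : ∀ i : Fin p, (i : ℕ) < k → v i ∈ eig K H0 (-1)
  v_mem' : ∀ i : Fin p, (i : ℕ) < k → v i ∈ eig K (H i) (-2)
  lie_eq : ∀ i : Fin p, (i : ℕ) < k → ⁅u i, v i⁆ = H i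
  comm : ∀ i j : Fin p, (i : ℕ) < k → (j : ℕ) < k → i ≠ j → ⁅u i, u j⁆ = 0
  rem_mem : x' ∈ eig K H0 1
  rem_mem' : x' ∈ eig K (partialSum H k) 0
  comm' : ∀ i : Fin p, (i : ℕ) < k → ⁅u i, x'⁆ = 0

variable {S : Sys K H0 H} {k : ℕ} {u v : Fin p → L} {x' : L}

lemma Sys.State.triple (st : S.State k u v x') {i : Fin p} (hi : (i : ℕ) < k) :
    IsSl2Triple (H i) (u i) (v i) := by
  obtain ⟨_, _, _, _, t⟩ := S.triple i
  exact isSl2Triple_of_mem t.h_ne_zero (st.u_mem' i hi) (st.v_mem' i hi) (st.lie_eq i hi)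

/-- An element of weight zero commuting with `u i` commutes with `v i`. -/
lemma Sys.State.lie_v (st : S.State k u v x') {i : Fin p} (hi : (i : ℕ) < k) {z : L}
    (hz : z ∈ eig K (H i) 0) (h : ⁅u i, z⁆ = 0) : ⁅z, v i⁆ = 0 := by
  have := lie_f_eq_zero (K := K) (st.triple hi) hz h
  rw [← lie_skew, this, neg_zero]

lemma Sys.State.lie_sum (st : S.State k u v x') : ⁅partialSum u k, partialSum v k⁆ = partialSum H k := by
  have h1 : ∀ i j : Fin p, (i : ℕ) < k → (j : ℕ) < k → i ≠ j → ⁅u i, v j⁆ = 0 := fun i j hi hj hij =>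
    st.lie_v hj (S.mem_eig_zero_of_two (st.u_mem i hi) (st.u_mem' i hi) hij.symm)
      (st.comm j i hj hi hij.symm)
  rw [partialSum, partialSum, sum_lie_sum]
  refine Finset.sum_congr rfl fun i hi => ?_
  have hi' : (i : ℕ) < k := by simpa using hi
  rw [Finset.sum_eq_single i, st.lie_eq i hi']
  · exact fun j hj hji => h1 i j hi' (by simpa using hj) hji.symm
  · exact fun h => absurd hi h

lemma Sys.State.u_sum_mem (st : S.State k u v x') : partialSum u k ∈ eig K (partialSum H k) 2 :=
  partialSum_mem_of fun i hi => S.mem_eig_partialSum_two hi (st.u_mem i hi) (st.u_mem' i hi)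

lemma Sys.State.v_sum_mem (st : S.State k u v x') : partialSum v k ∈ eig K (partialSum H k) (-2) :=
  partialSum_mem_of fun i hi => S.mem_eig_partialSum_neg_two hi (st.v_mem i hi) (st.v_mem' i hi)

lemma mem_eig_add {h h' x : L} {i j l : ℤ} (hx : x ∈ eig K h i) (hx' : x ∈ eig K h' j)
    (hl : i + j = l) : x ∈ eig K (h + h') l := by
  rw [mem_eig] at *
  rw [add_lie, hx, hx', ← add_smul, ← hl]
  push_cast
  rfl

lemma mem_eig_of_add {h h' x : L} {i j l : ℤ} (hx : x ∈ eig K (h + h') l) (hx' : x ∈ eig K h' j)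
    (hl : i + j = l) : x ∈ eig K h i := by
  rw [mem_eig] at *
  rw [add_lie, hx', ← hl] at hx
  push_cast at hx
  rw [add_smul] at hx
  exact add_right_cancel hx

/-- The nilnegative element for the top component of the remainder. -/
lemma Sys.State.exists_v [LieAlgebra.IsKilling K L] (st : S.State k u v x') (hk : k < p) {a t : L}
    (ha0 : ∀ i : Fin p, (i : ℕ) < k → a ∈ eig K (H i) 0)
    (hak : a ∈ eig K (H ⟨k, hk⟩) 2) (hua : ∀ i : Fin p, (i : ℕ) < k → ⁅u i, a⁆ = 0)
    (ht : t ∈ eig K H0 (-1)) (ht2 : t ∈ eig K (partialSum H (k + 1)) (-2))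
    (hat : ⁅partialSum u k + a, t⁆ = partialSum H (k + 1)) :
    ∃ w ∈ eig K H0 (-1), w ∈ eig K (H ⟨k, hk⟩) (-2) ∧ ⁅a, w⁆ = H ⟨k, hk⟩ := by
  set Hk := H ⟨k, hk⟩ with hHk
  have hd := S.diag ⟨k, hk⟩
  rw [← hHk] at hd
  set w := t - partialSum v k with hw
  have hwmem : w ∈ eig K H0 (-1) := sub_mem ht (partialSum_mem_of st.v_mem)
  have hw2 : w ∈ eig K (partialSum H (k + 1)) (-2) := sub_mem ht2 (partialSum_mem_of fun i hi =>
    S.mem_eig_partialSum_neg_two (by omega) (st.v_mem i hi) (st.v_mem' i hi))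
  have hs0 : partialSum u k ∈ eig K Hk 0 := partialSum_mem_of fun i hi =>
    S.mem_eig_zero_of_two (st.u_mem i hi) (st.u_mem' i hi) (by rintro rfl; simp at hi)
  have hsw : ⁅partialSum u k, w⁆ + ⁅a, w⁆ = Hk := by
    have h1 : ⁅a, partialSum v k⁆ = 0 :=
      lie_partialSum_eq_zero fun i hi => st.lie_v hi (ha0 i hi) (hua i hi)
    rw [← add_lie, hw, lie_sub, hat, add_lie, st.lie_sum, h1, add_zero, partialSum_succ H hk]
    abel
  have hc : ∀ c, ⁅partialSum u k, eproj Hk hd c w⁆ + ⁅a, eproj Hk hd (c - 2) w⁆ =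
      eproj Hk hd c Hk := by
    intro c
    have h1 := eproj_lie hd hs0 c w
    have h2 := eproj_lie hd hak (c - 2) w
    rw [add_zero] at h1
    rw [sub_add_cancel] at h2
    rw [← h1, ← h2, ← map_add, hsw]
  have hHk0 : Hk ∈ eig K Hk 0 := mem_eig_zero.2 (lie_self _)
  have hwc : ∀ c, eproj Hk hd c w ∈ eig K H0 (-1) := fun c => eproj_mem_eig hd (S.comm₀ _) c hwmem
  have e0 := hc 0
  have e2 := hc (-2)
  rw [eproj_self hd hHk0] at e0
  rw [eproj_of_ne hd (by norm_num) hHk0,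
    S.eq_zero_of_neg_one' (hwc (-2 - 2)) (eproj_mem hd _ w) (by norm_num), lie_zero, add_zero] at e2
  have hw0 : eproj Hk hd 0 w = 0 := by
    have h1 : ⁅partialSum u k, ⁅partialSum u k, eproj Hk hd 0 w⁆⁆ = 0 := by
      have h2 := congrArg (fun z => ⁅partialSum u k, z⁆) e0
      simp only [lie_add] at h2
      have h3 : ⁅partialSum u k, a⁆ = 0 := partialSum_lie_eq_zero hua
      have h4 : ⁅partialSum u k, Hk⁆ = 0 := by
        rw [← lie_skew, mem_eig_zero.1 hs0, neg_zero]
      rw [zero_sub, leibniz_lie _ a, h3, zero_lie, zero_add, e2, lie_zero, add_zero, h4] at h2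
      exact h2
    have h2 : eproj Hk hd 0 w ∈ eig K (partialSum H k) (-2) := by
      have h3 : eproj Hk hd 0 w ∈ eig K (partialSum H (k + 1)) (-2) :=
        eproj_mem_eig hd (S.lie_partialSum _ _) 0 hw2
      rw [partialSum_succ H hk] at h3
      exact mem_eig_of_add h3 (eproj_mem hd 0 w) (by norm_num)
    rcases Nat.eq_zero_or_pos k with rfl | hk0
    · rw [partialSum_zero, mem_eig, zero_lie, eq_comm, smul_eq_zero] at h2
      exact h2.resolve_left (by norm_num)
    · exact eq_zero_of_lie_lie_eq_zero (S.diag_partialSum k) (isSl2Triple_of_mem (K := K)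
        (S.partialSum_ne_zero hk0 hk.le) st.u_sum_mem st.v_sum_mem st.lie_sum) h2 h1
  rw [hw0, lie_zero, zero_add] at e0
  exact ⟨_, hwc _, eproj_mem hd (-2) w, e0⟩

lemma expE_apply_two {X : L} (hX : IsNilpotent (LieAlgebra.ad K L X)) {v : L} (h : ⁅X, ⁅X, v⁆⁆ = 0) :
    expE X hX v = v + ⁅X, v⁆ := by
  rw [expE_apply (N := 2) hX (by simpa [pow_two] using h)]
  simp [Finset.sum_range_succ]

lemma expE_apply_three {X : L} (hX : IsNilpotent (LieAlgebra.ad K L X)) {v : L}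
    (h : ⁅X, ⁅X, ⁅X, v⁆⁆⁆ = 0) : expE X hX v = v + ⁅X, v⁆ + (2 : K)⁻¹ • ⁅X, ⁅X, v⁆⁆ := by
  rw [expE_apply (N := 3) hX (by simpa [pow_succ] using h)]
  simp [Finset.sum_range_succ, pow_two]

/-- One step of the reduction to the normal form. -/
lemma Sys.State.step [LieAlgebra.IsKilling K L] (st : S.State k u v x') (hk : k < p)
    (hg : S.Good (partialSum u k + x')) :
    ∃ (X Y : L) (hX : X ∈ nilT K H0 H) (hY : Y ∈ nilT K H0 H) (u' v' : Fin p → L) (x'' : L),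
      S.State (k + 1) u' v' x'' ∧ expE Y (S.isNilpotent_nilT hY) (expE X (S.isNilpotent_nilT hX)
        (partialSum u k + x')) = partialSum u' (k + 1) + x'' := by
  set kk : Fin p := ⟨k, hk⟩ with hkk
  set h := partialSum H (k + 1) with hh
  have hsucc : h = partialSum H k + H kk := partialSum_succ H hk
  have hd : IsDiag K h := S.diag_partialSum (k + 1)
  have hch : ⁅h, H0⁆ = 0 := S.comm_partialSum (k + 1)
  have hx'c : ∀ c, eproj (H kk) (S.diag kk) c x' ∈ eig K H0 1 := fun c =>
    eproj_mem_eig _ (S.comm₀ _) c st.rem_mem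
  have hx'k : ∀ c, eproj (H kk) (S.diag kk) c x' ∈ eig K (partialSum H k) 0 := fun c =>
    eproj_mem_eig _ (S.lie_partialSum _ _) c st.rem_mem'
  have hx'h : ∀ c, eproj (H kk) (S.diag kk) c x' ∈ eig K h c := fun c => by
    rw [hsucc]; exact mem_eig_add (hx'k c) (eproj_mem _ c x') (by simp)
  have hdec := S.eproj_sum_three st.rem_mem kk
  set a := eproj (H kk) (S.diag kk) 2 x' with ha
  set b := eproj (H kk) (S.diag kk) 1 x' with hb
  set c := eproj (H kk) (S.diag kk) 0 x' with hc
  have hu0 : ∀ i : Fin p, (i : ℕ) < k → u i ∈ eig K (H kk) 0 := fun i hi =>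
    S.mem_eig_zero_of_two (st.u_mem i hi) (st.u_mem' i hi) (fun h => by simp [← h, hkk] at hi)
  have hua : ∀ i : Fin p, (i : ℕ) < k → ⁅u i, a⁆ = 0 := fun i hi => by
    have := eproj_lie (S.diag kk) (hu0 i hi) 2 x'
    rw [st.comm' i hi, map_zero] at this
    exact this.symm
  have ha0 : ∀ i : Fin p, (i : ℕ) < k → a ∈ eig K (H i) 0 := fun i hi =>
    S.mem_eig_zero_of_lt (hx'c 2) (hx'k 2) hi
  set s := partialSum u k + a with hs
  have hs1 : s ∈ eig K H0 1 := add_mem (partialSum_mem_of st.u_mem) (hx'c 2)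
  have hs2 : s ∈ eig K h 2 := add_mem (partialSum_mem_of fun i hi =>
    S.mem_eig_partialSum_two (by omega) (st.u_mem i hi) (st.u_mem' i hi)) (hx'h 2)
  have hxs : partialSum u k + x' = s + b + c := by rw [hs]; nth_rewrite 1 [hdec]; abel
  obtain ⟨t, ht, ht2, hst⟩ := hg.2 (k + 1) (by omega)
  have htop : S.top (k + 1) (partialSum u k + x') = s := by
    rw [hxs, map_add, map_add, Sys.top, eproj_self _ hs2, eproj_of_ne _ (by norm_num) (hx'h 1),
      eproj_of_ne _ (by norm_num) (hx'h 0), add_zero, add_zero]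
  rw [htop] at hst
  have tr : IsSl2Triple h s t :=
    isSl2Triple_of_mem (K := K) (S.partialSum_ne_zero (by omega) (by omega)) hs2 ht2 hst
  obtain ⟨X', hX', hsX'⟩ := exists_lie_eq hd tr (hx'h 1) le_rfl (show (-1 : ℤ) + 2 = 1 by norm_num)
  have hc0 : ⁅H0, h⁆ = 0 := by rw [← lie_skew, hch, neg_zero]
  set X := eproj H0 S.diag₀ 0 X' with hX
  have hX0 : X ∈ eig K H0 0 := eproj_mem _ _ _
  have hXh : X ∈ eig K h (-1) := eproj_mem_eig _ hc0 0 hX'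
  have hXs : ⁅X, s⁆ = -b := by
    have h1 := eproj_lie S.diag₀ hs1 0 X'
    rw [hsX', zero_add, eproj_self _ (hx'c 1)] at h1
    rw [← lie_skew, ← h1]
  have hXn := S.mem_nilT_of_neg hX0 (by norm_num) hXh
  have hXc : ⁅X, c⁆ = 0 := S.eq_zero_of_one (lie_mem_eig' hX0 (hx'c 0) (by norm_num))
    (lie_mem_eig' hXh (hx'h 0) rfl) (by norm_num)
  have hXb0 : ⁅X, b⁆ ∈ eig K h 0 := lie_mem_eig' hXh (hx'h 1) (by norm_num)
  have hXb1 : ⁅X, b⁆ ∈ eig K H0 1 := lie_mem_eig' hX0 (hx'c 1) (by norm_num)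
  have hXXb : ⁅X, ⁅X, b⁆⁆ = 0 := S.eq_zero_of_one (lie_mem_eig' hX0 hXb1 (by norm_num))
    (lie_mem_eig' hXh hXb0 rfl) (by norm_num)
  set w := c + (2 : K)⁻¹ • ⁅X, b⁆ with hw
  have hw0 : w ∈ eig K h 0 := add_mem (hx'h 0) (Submodule.smul_mem _ _ hXb0)
  have hw1 : w ∈ eig K H0 1 := add_mem (hx'c 0) (Submodule.smul_mem _ _ hXb1)
  have e1 : expE X (S.isNilpotent_nilT hXn) (partialSum u k + x') = s + w := by
    rw [hxs, map_add, map_add, expE_apply_three _ (by rw [hXs, lie_neg, lie_neg, hXXb, neg_zero]), expE_apply_two _ hXXb,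
      expE_of_lie_eq_zero _ hXc, hXs, lie_neg, hw]
    have : ⁅X, b⁆ = (2 : K)⁻¹ • ⁅X, b⁆ + (2 : K)⁻¹ • ⁅X, b⁆ := by
      rw [← add_smul, ← two_mul, mul_inv_cancel₀ two_ne_zero, one_smul]
    nth_rewrite 2 [this]
    rw [smul_neg]
    abel
  obtain ⟨Y', hY', w', hw', hsw', hwe⟩ := exists_lie_add_eq hd tr hw0
  set Y := eproj H0 S.diag₀ 0 Y' with hY
  set z := eproj H0 S.diag₀ 1 w' with hz
  have hY0 : Y ∈ eig K H0 0 := eproj_mem _ _ _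
  have hYh : Y ∈ eig K h (-2) := eproj_mem_eig _ hc0 0 hY'
  have hYn := S.mem_nilT_of_neg hY0 (by norm_num) hYh
  have hz1 : z ∈ eig K H0 1 := eproj_mem _ _ _
  have hz0 : z ∈ eig K h 0 := eproj_mem_eig _ hc0 1 hw'
  have hsz : ⁅s, z⁆ = 0 := by
    have := eproj_lie S.diag₀ hs1 1 w'
    rw [hsw', map_zero] at this
    exact this.symm
  have hwz : w = ⁅s, Y⁆ + z := by
    have h1 := eproj_lie S.diag₀ hs1 0 Y'
    rw [zero_add] at h1
    rw [← h1, hz, ← map_add, ← hwe, eproj_self _ hw1]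
  have hYw : ⁅Y, w⁆ = 0 := S.eq_zero_of_one (lie_mem_eig' hY0 hw1 (by norm_num))
    (lie_mem_eig' hYh hw0 rfl) (by norm_num)
  have hYYs : ⁅Y, ⁅Y, s⁆⁆ = 0 := S.eq_zero_of_one
    (lie_mem_eig' hY0 (lie_mem_eig' hY0 hs1 rfl) (by norm_num))
    (lie_mem_eig' hYh (lie_mem_eig' hYh hs2 rfl) rfl) (by norm_num)
  have e2 : expE Y (S.isNilpotent_nilT hYn) (s + w) = s + z := by
    rw [map_add, expE_of_lie_eq_zero _ hYw, expE_apply_two _ hYYs, hwz, ← lie_skew s Y]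
    abel
  obtain ⟨v₁, hv1, hv2, hv3⟩ := st.exists_v hk ha0 (eproj_mem _ 2 x') hua ht ht2 hst
  classical
  have hne : ∀ i : Fin p, (i : ℕ) < k → i ≠ kk := fun i hi h => by simp [h, hkk] at hi
  have hsum : s = partialSum (fun i => if i = kk then a else u i) (k + 1) := by
    rw [partialSum_succ _ hk, if_pos rfl, hs, partialSum_congr fun i hi => (if_neg (hne i hi)).symm]
  have hcases : ∀ i : Fin p, (i : ℕ) < k + 1 → i = kk ∨ ((i : ℕ) < k ∧ i ≠ kk) := fun i hi => by
    by_cases h : i = kk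
    · exact Or.inl h
    · refine Or.inr ⟨?_, h⟩
      rw [hkk, Fin.ext_iff] at h
      simp only at h
      omega
  have hzi : ∀ i : Fin p, (i : ℕ) < k + 1 → z ∈ eig K (H i) 0 := fun i hi =>
    S.mem_eig_zero_of_lt hz1 hz0 hi
  have hu1' : ∀ i : Fin p, (i : ℕ) < k + 1 → (if i = kk then a else u i) ∈ eig K H0 1 := by
    intro i hi
    rcases hcases i hi with rfl | ⟨h1, h2⟩
    · rw [if_pos rfl]; exact hx'c 2
    · rw [if_neg h2]; exact st.u_mem i h1
  have hu2' : ∀ i : Fin p, (i : ℕ) < k + 1 → (if i = kk then a else u i) ∈ eig K (H i) 2 := by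
    intro i hi
    rcases hcases i hi with rfl | ⟨h1, h2⟩
    · rw [if_pos rfl]; exact eproj_mem _ 2 x'
    · rw [if_neg h2]; exact st.u_mem' i h1
  refine ⟨X, Y, hXn, hYn, fun i => if i = kk then a else u i, fun i => if i = kk then v₁ else v i, z,
    ⟨hu1', hu2', ?_, ?_, ?_, ?_, hz1, hz0, ?_⟩, ?_⟩
  · intro i hi
    rcases hcases i hi with rfl | ⟨h1, h2⟩
    · rw [if_pos rfl]; exact hv1
    · rw [if_neg h2]; exact st.v_mem i h1
  · intro i hi
    rcases hcases i hi with rfl | ⟨h1, h2⟩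
    · rw [if_pos rfl]; exact hv2
    · rw [if_neg h2]; exact st.v_mem' i h1
  · intro i hi
    rcases hcases i hi with rfl | ⟨h1, h2⟩
    · rw [if_pos rfl, if_pos rfl]; exact hv3
    · rw [if_neg h2, if_neg h2]; exact st.lie_eq i h1
  · intro i j hi hj hij
    rcases hcases i hi with rfl | ⟨h1, h2⟩
    · rcases hcases j hj with rfl | ⟨h3, h4⟩
      · exact absurd rfl hij
      · rw [if_pos rfl, if_neg h4, ← lie_skew, hua j h3, neg_zero]
    · rcases hcases j hj with rfl | ⟨h3, h4⟩
      · rw [if_pos rfl, if_neg h2, hua i h1]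
      · rw [if_neg h2, if_neg h4, st.comm i j h1 h3 hij]
  · intro i hi
    refine S.eq_zero_of_partialSum (k := k + 1)
      (z := fun i => ⁅(if i = kk then a else u i), z⁆) (fun i hi => ?_)
      (fun i j hi hj hij => ?_) ?_ hi
    · exact lie_mem_eig' (hu2' i hi) (hzi i hi) (by norm_num)
    · exact lie_mem_eig' (S.mem_eig_zero_of_two (hu1' i hi) (hu2' i hi) hij) (hzi j hj) (by norm_num)
    · rw [hsum, partialSum, sum_lie] at hsz
      exact hsz
  · rw [e1, e2, hsum]

lemma partialSum_sub (u : Fin p → L) (k : ℕ) : partialSum u p - partialSum u k =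
    ∑ i ∈ Finset.univ.filter (fun i : Fin p => k ≤ i), u i := by
  rw [partialSum_self, partialSum, sub_eq_iff_eq_add, add_comm]
  simp_rw [← not_lt]
  exact (Finset.sum_filter_add_sum_filter_not _ _ _).symm

/-- The points in normal form are transversal. -/
lemma Sys.State.transversal_aux [LieAlgebra.IsKilling K L] (st : S.State p u v x') (n : ℕ) :
    ∀ k, k + n = p → ∀ y ∈ eig K H0 (-1), y ∈ eig K (partialSum H k) 0 →
      ⁅partialSum u p - partialSum u k, y⁆ ∈ nilT K H0 H → y = 0 := by
  induction n with
  | zero =>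
    rintro k hk y hy hyk -
    rw [add_zero] at hk
    subst hk
    rw [partialSum_self, S.sum_eq] at hyk
    by_contra h0
    have := eq_of_mem_eig hy ((mem_eig_two_smul (i := 0)).1 (by simpa using hyk)) h0
    omega
  | succ n ih =>
    intro k hk y hy hyk hn
    have hkp : k < p := by omega
    set kk : Fin p := ⟨k, hkp⟩ with hkk
    have hd := S.diag kk
    set σ := partialSum u p - partialSum u (k + 1) with hσ
    have hsplit : partialSum u p - partialSum u k = u kk + σ := by
      rw [hσ, partialSum_succ u hkp]; abel
    have hσ0 : σ ∈ eig K (H kk) 0 := by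
      rw [hσ, partialSum_sub]
      refine Submodule.sum_mem _ fun i hi => S.mem_eig_zero_of_two (st.u_mem i i.2) (st.u_mem' i i.2) ?_
      rintro rfl
      simp [hkk] at hi
    have huσ : ⁅u kk, σ⁆ = 0 := by
      rw [hσ, partialSum_sub, _root_.lie_sum]
      refine Finset.sum_eq_zero fun i hi => st.comm _ _ kk.2 i.2 ?_
      rintro rfl
      simp [hkk] at hi
    have hu2 := st.u_mem' kk kk.2
    rw [hsplit, add_lie] at hn
    have hy_mem : ∀ c, eproj (H kk) hd c y ∈ eig K H0 (-1) := fun c =>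
      eproj_mem_eig hd (S.comm₀ _) c hy
    have hcomp : ∀ c, eproj (H kk) hd c (⁅u kk, y⁆ + ⁅σ, y⁆) =
        ⁅u kk, eproj (H kk) hd (c - 2) y⁆ + ⁅σ, eproj (H kk) hd c y⁆ := by
      intro c
      have h1 := eproj_lie hd hu2 (c - 2) y
      have h2 := eproj_lie hd hσ0 c y
      rw [add_zero] at h2
      rw [sub_add_cancel] at h1
      rw [map_add, h1, h2]
    have hz : ∀ c, 0 < c → eproj (H kk) hd c y = 0 := fun c hc =>
      S.eq_zero_of_neg_one' (hy_mem c) (eproj_mem hd c y) (Or.inl hc)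
    have hpos : ∀ c, 0 < c → eproj (H kk) hd c (⁅u kk, y⁆ + ⁅σ, y⁆) = 0 := by
      intro c hc
      have hmem : ⁅u kk, y⁆ + ⁅σ, y⁆ ∈ eig K (partialSum H k) 0 := by
        rw [← add_lie]
        refine lie_mem_eig' (add_mem ?_ ?_) hyk (add_zero 0)
        · rw [partialSum]
          have := mem_eig_sum (K := K) (x := u kk) (H := H) (m := fun _ => 0)
            (Finset.univ.filter (fun i : Fin p => (i : ℕ) < k)) fun i hi =>
            S.mem_eig_zero_of_two (st.u_mem kk kk.2) hu2 (fun h => by simp [h, hkk] at hi)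
          simpa using this
        · rw [hσ, partialSum_sub]
          refine Submodule.sum_mem _ fun j hj => ?_
          have := mem_eig_sum (K := K) (x := u j) (H := H) (m := fun _ => 0)
            (Finset.univ.filter (fun i : Fin p => (i : ℕ) < k)) fun i hi =>
            S.mem_eig_zero_of_two (st.u_mem j j.2) (st.u_mem' j j.2) (fun h => by
              simp [h] at hi hj; omega)
          simpa [partialSum] using this
      have h1 := S.eproj_nilT hn (k + 1) hc
      have h2 : eproj (H kk) hd c (⁅u kk, y⁆ + ⁅σ, y⁆) ∈ eig K (partialSum H (k + 1)) c := by
        rw [partialSum_succ H hkp]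
        exact mem_eig_add (eproj_mem_eig hd (S.lie_partialSum _ _) c hmem) (eproj_mem hd c _) (by simp)
      rw [← eproj_self (S.diag_partialSum (k + 1)) h2]
      have h3 : ∀ z, eproj (partialSum H (k + 1)) (S.diag_partialSum (k + 1)) c
          (eproj (H kk) hd c z) = eproj (H kk) hd c
            (eproj (partialSum H (k + 1)) (S.diag_partialSum (k + 1)) c z) := fun z =>
        (eproj_shift (S.diag_partialSum (k + 1)) (a := 0) (φ := eproj (H kk) hd c)
          (fun j x hx => by
            rw [add_zero]
            exact eproj_mem_eig hd (S.lie_partialSum _ _) c hx) c z) ▸ by rw [add_zero]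
      rw [h3, h1, map_zero]
    have e2 := hpos 2 (by norm_num)
    rw [hcomp, hz 2 (by norm_num), lie_zero, add_zero, sub_self] at e2
    have e1 := hpos 1 (by norm_num)
    rw [hcomp, hz 1 (by norm_num), lie_zero, add_zero] at e1
    have y1 : eproj (H kk) hd (-1) y = 0 :=
      lie_eq_zero_of_neg (K := K) (st.triple kk.2) (eproj_mem hd (-1) y) (by norm_num) e1
    have e0 : eproj (H kk) hd 0 (⁅u kk, y⁆ + ⁅σ, y⁆) ∈ nilT K H0 H :=
      S.eproj_mem_nilT hn hd (fun m => m kk) (fun m x hm => hm kk) 0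
    have e0' := S.lie_nilT_eq_zero e0 (eproj_mem hd 0 _) (st.u_mem kk kk.2) hu2
    rw [hcomp, ← lie_skew, neg_eq_zero, lie_add, leibniz_lie (u kk) σ, huσ, zero_lie, e2, lie_zero,
      add_zero, add_zero] at e0'
    have y2 : eproj (H kk) hd (0 - 2) y = 0 :=
      eq_zero_of_lie_lie_eq_zero hd (st.triple kk.2) (eproj_mem hd (-2) y) e0'
    have hy0 : y = eproj (H kk) hd 0 y := by
      have := S.eproj_sum_three' hy kk
      rw [y1, show (-2 : ℤ) = 0 - 2 by norm_num, y2, add_zero, add_zero] at this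
      exact this
    refine ih (k + 1) (by omega) y hy ?_ ?_
    · rw [partialSum_succ H hkp]
      exact mem_eig_add hyk (by rw [hy0]; exact eproj_mem hd 0 y) (add_zero 0)
    · rw [hcomp, y2, lie_zero, zero_add, ← hy0] at e0
      exact e0

lemma Sys.transversal [LieAlgebra.IsKilling K L] (S : Sys K H0 H) {x : L} (hx : S.Good x) :
    Transversal K H0 H x := by
  suffices h : ∀ (n k : ℕ), k + n = p → ∀ (u v : Fin p → L) (x' : L), S.State k u v x' →
      S.Good (partialSum u k + x') → Transversal K H0 H (partialSum u k + x') by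
    have := h p 0 (by omega) 0 0 x ⟨by simp, by simp, by simp, by simp, by simp, by simp, hx.1,
      by rw [partialSum_zero, mem_eig]; simp, by simp⟩
    simp only [partialSum_zero, zero_add] at this
    exact this hx
  intro n
  induction n with
  | zero =>
    intro k hk u v x' st _
    rw [add_zero] at hk
    subst hk
    have hx0 : x' = 0 := by
      have := st.rem_mem'
      rw [partialSum_self, S.sum_eq] at this
      by_contra h0
      have := eq_of_mem_eig st.rem_mem ((mem_eig_two_smul (i := 0)).1 (by simpa using this)) h0
      omega
    rw [hx0, add_zero]
    intro y hy hyn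
    exact st.transversal_aux k 0 (by omega) y hy (by rw [partialSum_zero, mem_eig]; simp)
      (by rwa [partialSum_zero, sub_zero])
  | succ n ih =>
    intro k hk u v x' st hg
    obtain ⟨X, Y, hX, hY, u', v', x'', st', he⟩ := st.step (by omega) hg
    refine S.transversal_of_expE hX (S.transversal_of_expE hY ?_)
    rw [he]
    refine ih (k + 1) (by omega) u' v' x'' st' ?_
    rw [← he]
    exact S.good_expE hY (S.good_expE hX hg)

end NormalForm

section Regular

variable {K L : Type*} [Field K] [LieRing L] [LieAlgebra K L] [CharZero K] [FiniteDimensional K L]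
  {p : ℕ} {H0 : L} {H : Fin p → L}

lemma exists_kf_self {h : L} (hd : IsDiag K h) :
    ∃ n : ℕ, kf K h h = n ∧ (n = 0 → ∀ i : ℤ, i ≠ 0 → eig K h i = ⊥) := by
  classical
  have hi := DirectSum.isInternal_submodule_of_iSupIndep_of_iSup_eq_top
    (iSupIndep_eig (K := K) h) hd
  have hf : {i : ℤ | eig K h i ≠ ⊥}.Finite :=
    WellFoundedGT.finite_ne_bot_of_iSupIndep (iSupIndep_eig (K := K) h)
  have hmaps : ∀ i : ℤ, Set.MapsTo (LieAlgebra.ad K L h ∘ₗ LieAlgebra.ad K L h) (eig K h i) (eig K h i) := by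
    intro i x hx
    have hx' := mem_eig.1 hx
    simp only [LinearMap.comp_apply, LieAlgebra.ad_apply, hx', lie_smul]
    exact Submodule.smul_mem _ _ (Submodule.smul_mem _ _ hx)
  have htr : kf K h h = ∑ i ∈ hf.toFinset, ((i.natAbs ^ 2 * Module.finrank K (eig K h i) : ℕ) : K) := by
    change LinearMap.trace K L (LieAlgebra.ad K L h ∘ₗ LieAlgebra.ad K L h) = _
    rw [LinearMap.trace_eq_sum_trace_restrict' hi hf hmaps]
    refine Finset.sum_congr rfl fun i _ => ?_
    have : (LieAlgebra.ad K L h ∘ₗ LieAlgebra.ad K L h).restrict (hmaps i) =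
        ((i : K) ^ 2) • (1 : Module.End K (eig K h i)) := by
      ext x
      have hx' := mem_eig.1 x.2
      change ⁅h, ⁅h, (x : L)⁆⁆ = ((i : K) ^ 2) • (x : L)
      rw [hx', lie_smul, hx', smul_smul, sq]
    rw [this, map_smul, LinearMap.trace_one, smul_eq_mul]
    push_cast
    congr 1
    have h5 : (((i.natAbs : ℤ) ^ 2 : ℤ) : K) = ((i ^ 2 : ℤ) : K) := by rw [Int.natAbs_sq]
    rw [Int.cast_pow, Int.cast_pow, Int.cast_natCast] at h5
    exact h5.symm
  refine ⟨∑ i ∈ hf.toFinset, i.natAbs ^ 2 * Module.finrank K (eig K h i), by rw [htr]; push_cast; rfl,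
    fun h0 i hi0 => ?_⟩
  by_contra hne
  have h1 := (Finset.sum_eq_zero_iff.1 h0) i (by simpa using hne)
  rcases Nat.mul_eq_zero.1 h1 with h2 | h2
  · exact hi0 (by simpa using h2)
  · exact hne (Submodule.finrank_eq_zero.1 h2)

lemma exists_mem_kf_eq [LieAlgebra.IsKilling K L] {W : Submodule K L} (l : W →ₗ[K] K) :
    ∃ z : L, ∀ x : W, kf K z x = l x := by
  obtain ⟨l', hl'⟩ := LinearMap.exists_extend l
  obtain ⟨z, -, hz⟩ := exists_kf_eq (m := (⊤ : Submodule K L))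
    (fun x _ h => eq_zero_of_kf fun y => h y trivial) (l' ∘ₗ (⊤ : Submodule K L).subtype)
  exact ⟨z, fun x => by rw [hz ⟨x, trivial⟩, ← hl']; rfl⟩

lemma Sys.kf_eq_zero (S : Sys K H0 H) {i j : Fin p} (hij : i ≠ j) : kf K (H i) (H j) = 0 := by
  obtain ⟨x, hx, y, hy, t⟩ := S.triple j
  have h1 := mem_eig_zero.1 (S.mem_eig_zero_of_two hx (IsSl2Triple.mem_e (K := K) t) hij)
  rw [← t.lie_e_f, ← kf_lie, h1]
  simp [kf]

lemma Sys.kf_partialSum (S : Sys K H0 H) (k : ℕ) (j : Fin p) :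
    kf K (partialSum H k) (H j) = if (j : ℕ) < k then kf K (H j) (H j) else 0 := by
  simp only [kf, partialSum, map_sum, LinearMap.sum_apply]
  rw [Finset.sum_filter, Finset.sum_eq_single j]
  · intro i _ hij
    have := S.kf_eq_zero hij
    simp only [kf] at this
    simp [this]
  · simp

lemma Sys.exists_kf_nat (S : Sys K H0 H) (j : Fin p) : ∃ n : ℕ, 0 < n ∧ kf K (H j) (H j) = n := by
  obtain ⟨n, hn, h0⟩ := exists_kf_self (S.diag j)
  refine ⟨n, Nat.pos_of_ne_zero fun h => ?_, hn⟩
  obtain ⟨x, hx, y, hy, t⟩ := S.triple j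
  have := IsSl2Triple.mem_e (K := K) t
  rw [h0 h 2 two_ne_zero] at this
  exact t.e_ne_zero ((Submodule.mem_bot K).1 this)

/-- The top eigenspace of an irreducible graded module is irreducible. -/
lemma irreducible_top {h : L} (hd : IsDiag K h) (hc : ⁅h, H0⁆ = 0)
    (hirr : IsIrreducibleDegreeOne K H0) {r : ℤ}
    (hr : ∀ i, r < i → ∀ x ∈ eig K H0 1, x ∈ eig K h i → x = 0) (U : Submodule K L)
    (hU : U ≤ eig K h r ⊓ eig K H0 1)
    (hst : ∀ z ∈ eig K h 0 ⊓ eig K H0 0, ∀ w ∈ U, ⁅z, w⁆ ∈ U) :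
    U = ⊥ ∨ U = eig K h r ⊓ eig K H0 1 := by
  by_cases hbot : U = ⊥
  · exact Or.inl hbot
  right
  let 𝒮 : Set (Submodule K L) := {M | U ≤ M ∧ ∀ n ∈ eig K H0 0, ∀ i < 0, n ∈ eig K h i →
    ∀ v ∈ M, ⁅n, v⁆ ∈ M}
  let N : Submodule K L := sInf 𝒮
  have hUN : U ≤ N := le_sInf fun M hM => hM.1
  have hNn : ∀ n ∈ eig K H0 0, ∀ i < 0, n ∈ eig K h i → ∀ v ∈ N, ⁅n, v⁆ ∈ N := by
    intro n hn i hi hni v hv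
    rw [Submodule.mem_sInf] at hv ⊢
    exact fun M hM => hM.2 n hn i hi hni v (hv M hM)
  have hN1 : N ≤ eig K H0 1 := sInf_le ⟨hU.trans inf_le_right, fun n hn i _ _ v hv =>
    lie_mem_eig' hn hv (by norm_num)⟩
  have hNg : ∀ X ∈ eig K H0 0, ∀ v ∈ N, ⁅X, v⁆ ∈ N := by
    let M : Submodule K L :=
      { carrier := {v | v ∈ N ∧ ∀ X ∈ eig K H0 0, ⁅X, v⁆ ∈ N}
        add_mem' := fun ha hb => ⟨add_mem ha.1 hb.1, fun X hX => by
          rw [lie_add]; exact add_mem (ha.2 X hX) (hb.2 X hX)⟩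
        zero_mem' := ⟨zero_mem _, fun X _ => by simp⟩
        smul_mem' := fun c v hv => ⟨N.smul_mem c hv.1, fun X hX => by
          rw [lie_smul]; exact N.smul_mem c (hv.2 X hX)⟩ }
    have hM : N ≤ M := by
      refine sInf_le ⟨fun u hu => ⟨hUN hu, fun X hX => ?_⟩, fun n hn i hi hni v hv =>
        ⟨hNn n hn i hi hni v hv.1, fun X hX => ?_⟩⟩
      · refine eproj_induction (P := fun X => ⁅X, u⁆ ∈ N) hd X (fun i => ?_) (by simp)
          fun x y hx hy => by rw [add_lie]; exact add_mem hx hy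
        have h1 : eproj h hd i X ∈ eig K H0 0 := eproj_mem_eig hd hc i hX
        have h2 := eproj_mem hd i X
        rcases lt_trichotomy i 0 with hi | rfl | hi
        · exact hNn _ h1 i hi h2 u (hUN hu)
        · exact hUN (hst _ ⟨h2, h1⟩ u hu)
        · rw [hr (i + r) (by omega) _ (lie_mem_eig' h1 (hU hu).2 (by norm_num))
            (lie_mem_eig h2 (hU hu).1)]
          exact zero_mem _
      · rw [leibniz_lie]
        exact add_mem (hv.2 _ (lie_mem_eig' hX hn (by norm_num)))
          (hNn n hn i hi hni _ (hv.2 X hX))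
    exact fun X hX v hv => (hM hv).2 X hX
  have hNe : N = eig K H0 1 := (hirr.2 N hN1 hNg).resolve_left fun h0 =>
    hbot (eq_bot_iff.2 (h0 ▸ hUN))
  have hN0 : N ≤ U ⊔ ⨆ i : {i : ℤ // i < r}, eig K h i := by
    refine sInf_le ⟨le_sup_left, fun n hn i hi hni v hv => ?_⟩
    obtain ⟨u, hu, w, hw, rfl⟩ := Submodule.mem_sup.1 hv
    rw [lie_add]
    refine Submodule.mem_sup_right (add_mem ?_ ?_)
    · exact Submodule.mem_iSup_of_mem (⟨i + r, by omega⟩ : {i : ℤ // i < r})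
        (lie_mem_eig hni (hU hu).1)
    · induction hw using Submodule.iSup_induction' with
      | mem j w hw =>
        exact Submodule.mem_iSup_of_mem (⟨i + j, by have := j.2; omega⟩ : {i : ℤ // i < r})
          (lie_mem_eig hni hw)
      | zero => simp
      | add a b _ _ h1 h2 =>
        rw [lie_add]
        exact add_mem (h1 (Submodule.mem_sup.2 ⟨u, hu, a, ‹_›, rfl⟩))
          (h2 (Submodule.mem_sup.2 ⟨u, hu, b, ‹_›, rfl⟩))
  refine le_antisymm hU fun x hx => ?_
  have hxN : x ∈ U ⊔ ⨆ i : {i : ℤ // i < r}, eig K h i := hN0 (hNe ▸ hx.2)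
  obtain ⟨u, hu, w, hw, rfl⟩ := Submodule.mem_sup.1 hxN
  have h1 := eproj_self hd hx.1
  rw [map_add, eproj_self hd (hU hu).1] at h1
  have h2 : eproj h hd r w = 0 := by
    clear h1 hx hxN
    induction hw using Submodule.iSup_induction' with
    | mem j w hw => exact eproj_of_ne hd (by have := j.2; omega) hw
    | zero => simp
    | add a b _ _ h1 h2 => rw [map_add, h1, h2, add_zero]
  rw [h2, add_zero] at h1
  rw [← h1]
  exact hu

lemma nondeg_inf [LieAlgebra.IsKilling K L] {h : L} (hd0 : IsDiag K H0) (hd : IsDiag K h)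
    (hc : ⁅h, H0⁆ = 0) {x : L} (hx : x ∈ eig K h 0 ⊓ eig K H0 0)
    (hxy : ∀ y ∈ eig K h 0 ⊓ eig K H0 0, kf K x y = 0) : x = 0 := by
  refine eq_zero_of_kf (K := K) fun y => ?_
  rw [kf_eproj hd0 hx.2, kf_eproj hd hx.1]
  refine hxy _ ⟨by simpa using eproj_mem hd (-0) _, ?_⟩
  exact eproj_mem_eig hd hc _ (by simpa using eproj_mem hd0 (-0) y)

theorem Sys.isRegularPair [LieAlgebra.IsKilling K L] (S : Sys K H0 H)
    (hirr : IsIrreducibleDegreeOne K H0) {k : ℕ} (h0 : 0 < k) (hk : k ≤ p) :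
    IsRegularPair (eig K (partialSum H k) 0 ⊓ eig K H0 0) (eig K (partialSum H k) 2 ⊓ eig K H0 1)
      (eig K (partialSum H k) (-2) ⊓ eig K H0 (-1)) (partialSum H k) where
  lie_mem x hx y hy := ⟨lie_mem_eig' hx.1 hy.1 rfl, lie_mem_eig' hx.2 hy.2 rfl⟩
  nondeg x hx h := nondeg_inf S.diag₀ (S.diag_partialSum k) (S.comm_partialSum k) hx h
  stable x hx y hy := ⟨lie_mem_eig' hx.1 hy.1 (by norm_num), lie_mem_eig' hx.2 hy.2 (by norm_num)⟩
  ne_bot := by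
    obtain ⟨x, hx, y, hy, t⟩ := S.triple ⟨0, by omega⟩
    exact Submodule.ne_bot_iff _ |>.2 ⟨x, ⟨S.mem_eig_partialSum_two h0 hx
      (IsSl2Triple.mem_e (K := K) t), hx⟩, t.e_ne_zero⟩
  irred U hU hst := irreducible_top (S.diag_partialSum k) (S.comm_partialSum k) hirr
    (fun i hi x hx hx' => S.eq_zero_of_one hx hx' (Or.inr hi)) U hU hst
  dual l := by
    obtain ⟨z, hz⟩ := exists_mem_kf_eq l
    refine ⟨eproj H0 S.diag₀ (-1) (eproj _ (S.diag_partialSum k) (-2) z),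
      ⟨eproj_mem_eig _ ?_ _ (eproj_mem _ _ _), eproj_mem _ _ _⟩, fun x => ?_⟩
    · rw [← lie_skew, S.comm_partialSum, neg_zero]
    · rw [← hz, kf_comm, kf_comm z, kf_eproj (S.diag_partialSum k) x.2.1 z, kf_eproj S.diag₀ x.2.2 (eproj _ _ _ z)]
  lie_mem' x hx y hy := ⟨lie_mem_eig' hx.1 hy.1 (by norm_num), lie_mem_eig' hx.2 hy.2 (by norm_num)⟩
  mem := ⟨mem_eig_zero.2 (lie_self _), S.partialSum_mem k⟩
  central x hx := mem_eig_zero.1 hx.1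
  le := inf_le_left
  le' := inf_le_left
  mem_span := by
    refine partialSum_mem_of fun i hi => ?_
    obtain ⟨x, hx, y, hy, t⟩ := S.triple i
    exact Submodule.subset_span ⟨x, ⟨S.mem_eig_partialSum_two hi hx (IsSl2Triple.mem_e (K := K) t), hx⟩,
      y, ⟨S.mem_eig_partialSum_neg_two hi hy (IsSl2Triple.mem_f (K := K) t), hy⟩, t.lie_e_f.symm⟩
  kf_ne := by
    obtain ⟨n, hn, hn0⟩ := exists_kf_self (S.diag_partialSum k)
    rw [hn, Nat.cast_ne_zero]
    intro h
    obtain ⟨x, hx, y, hy, t⟩ := S.triple ⟨0, by omega⟩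
    have := S.mem_eig_partialSum_two h0 hx (IsSl2Triple.mem_e (K := K) t)
    rw [hn0 h 2 two_ne_zero] at this
    exact t.e_ne_zero ((Submodule.mem_bot K).1 this)

/-- The subalgebra `𝔭_𝔱 = 𝔤_𝔱 + 𝔫_𝔱`. -/
def parT (K : Type*) [Field K] [LieAlgebra K L] (H0 : L) (H : Fin p → L) : Submodule K L :=
  (eig K H0 0 ⊓ ⨅ i, eig K (H i) 0) ⊔ nilT K H0 H

lemma parT_le : parT K H0 H ≤ eig K H0 0 := sup_le inf_le_left (nilT_le _ _)

lemma Sys.mem_nilT_of_kf [LieAlgebra.IsKilling K L] (S : Sys K H0 H) {Z : L} (hZ : Z ∈ eig K H0 0)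
    (h : ∀ X ∈ parT K H0 H, kf K Z X = 0) : Z ∈ nilT K H0 H := by
  classical
  have hdec : ∃ Y ∈ nilT K H0 H, Z - Y ∈ eig K H0 0 ∧ ∀ X ∈ eig K H0 0, ∀ n : Fin p → ℤ, n ≠ 0 →
      ¬ IsPositiveWeight n → (∀ i, X ∈ eig K (H i) (n i)) → X ≠ 0 → kf K (Z - Y) X = 0 := by
    refine S.induction₂ (a := 0) (c := 0) (h := 0) (P := fun Z => ∃ Y ∈ nilT K H0 H, Z - Y ∈ eig K H0 0 ∧
      ∀ X ∈ eig K H0 0, ∀ n : Fin p → ℤ, n ≠ 0 →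
      ¬ IsPositiveWeight n → (∀ i, X ∈ eig K (H i) (n i)) → X ≠ 0 → kf K (Z - Y) X = 0) (by simp)
      (fun m Z hZ _ hm h0 => ?_) ⟨0, zero_mem _, by simp, by simp [kf]⟩ ?_ hZ
      (by rw [mem_eig]; simp)
    · by_cases hpos : IsPositiveWeight m
      · exact ⟨Z, mem_nilT hpos hZ hm, by simp, by simp [kf]⟩
      · refine ⟨0, zero_mem _, by simpa using hZ, fun X hX n hn0 hn hXn hX0 => ?_⟩
        rw [sub_zero]
        by_contra hne
        have hmn : ∀ i, m i + n i = 0 := fun i => by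
          by_contra h1
          exact hne (ParabolicPV.kf_eq_zero (hm i) (hXn i) h1)
        have hm0 : m ≠ 0 := fun h => hn0 (funext fun i => by
          have := hmn i; rw [h] at this; simpa using this)
        obtain ⟨a, b, ha, hb, hz⟩ := S.exists_weight_zero hZ hm h0 hm0
        have hab : a ≠ b := by rintro rfl; omega
        have h1 : ¬ b < a := fun hlt => hpos ((isPositiveWeight_iff ha hb hz).2 hlt)
        have h2 : a < b := lt_of_le_of_ne (not_lt.1 h1) hab
        refine hn ((isPositiveWeight_iff (a := b) (b := a) ?_ ?_ ?_).2 h2)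
        · have := hmn b; omega
        · have := hmn b; have := hmn a; omega
        · intro i hi1 hi2
          have := hmn i
          have := hz i hi2 hi1
          omega
    · rintro Z Z' ⟨Y, hY, h1, h2⟩ ⟨Y', hY', h1', h2'⟩
      refine ⟨Y + Y', add_mem hY hY', by rw [add_sub_add_comm]; exact add_mem h1 h1',
        fun X hX n hn0 hn hXn hX0 => ?_⟩
      have e1 := h2 X hX n hn0 hn hXn hX0
      have e2 := h2' X hX n hn0 hn hXn hX0
      rw [add_sub_add_comm]
      simp only [kf, map_add, LinearMap.add_apply] at *
      rw [e1, e2, add_zero]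
  obtain ⟨Y, hY, h1, h2⟩ := hdec
  have hYp : ∀ X ∈ parT K H0 H, kf K Y X = 0 := by
    intro X hX
    refine S.nilT_induction (P := fun Y => kf K Y X = 0) (fun m a b Y _ hY hm h0 ha hb hab hz => ?_)
      (by simp [kf]) (fun x y hx hy => by simp only [kf, map_add, LinearMap.add_apply] at *; rw [hx, hy, add_zero]) hY
    obtain ⟨X1, hX1, X2, hX2, rfl⟩ := Submodule.mem_sup.1 hX
    have e1 : kf K Y X1 = 0 := ParabolicPV.kf_eq_zero (hm a) (by
      have := hX1.2; simp only [SetLike.mem_coe, Submodule.mem_iInf] at this; exact this a) (by omega)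
    have e2 : kf K Y X2 = 0 := by
      refine S.nilT_induction (P := fun X => kf K Y X = 0)
        (fun m' a' b' X _ hX hm' h0' ha' hb' hab' hz' => ?_)
        (by simp [kf]) (fun x y hx hy => by simp only [kf, map_add] at *; rw [hx, hy, add_zero]) hX2
      by_contra hne
      have hmn : ∀ i, m i + m' i = 0 := fun i => by
        by_contra h1
        exact hne (ParabolicPV.kf_eq_zero (hm i) (hm' i) h1)
      have e3 : b' = a := by
        by_contra h
        have h3 := hmn a
        by_cases h4 : a = a'
        · subst h4; omega
        · have := hz' a h4 (Ne.symm h); omega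
      have e4 : a' = b := by
        by_contra h
        have h3 := hmn b
        by_cases h4 : b = b'
        · subst h4; subst e3; omega
        · have := hz' b (Ne.symm h) h4; omega
      subst e3 e4
      exact absurd (hab.trans hab') (lt_irrefl _)
    simp only [kf, map_add] at *
    rw [e1, e2, add_zero]
  suffices h0 : Z - Y = 0 by rw [sub_eq_zero] at h0; rwa [h0]
  refine eq_zero_of_kf (K := K) fun X => ?_
  rw [kf_eproj S.diag₀ h1]
  have hX : eproj H0 S.diag₀ (-0) X ∈ eig K H0 0 := by simpa using eproj_mem S.diag₀ (-0) X
  refine S.induction₂ (a := 0) (c := 0) (h := 0) (P := fun X => kf K (Z - Y) X = 0) (by simp)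
    (fun m X hX _ hm h0 => ?_) (by simp [kf]) ?_ hX (by rw [mem_eig]; simp)
  · by_cases hp : X ∈ parT K H0 H
    · have e1 := h X hp
      have e2 := hYp X hp
      simp only [kf, map_sub, LinearMap.sub_apply] at *
      rw [e1, e2, sub_zero]
    · refine h2 X hX m (fun hm0 => hp (Submodule.mem_sup_left ⟨hX, ?_⟩))
        (fun hpos => hp (Submodule.mem_sup_right (mem_nilT hpos hX hm))) hm h0
      simp only [SetLike.mem_coe, Submodule.mem_iInf]
      intro i
      have := hm i
      rwa [hm0] at this
  · intro x y hx hy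
    simp only [kf, map_add] at *
    rw [hx, hy, add_zero]

/-- At transversal points the tangent map of the orbits of the parabolic subgroup is onto. -/
lemma Sys.exists_lie_eq [LieAlgebra.IsKilling K L] (S : Sys K H0 H) {x : L} (hx : x ∈ eig K H0 1)
    (ht : Transversal K H0 H x) {w : L} (hw : w ∈ eig K H0 1) : ∃ X ∈ parT K H0 H, ⁅X, x⁆ = w := by
  let T : parT K H0 H →ₗ[K] eig K H0 1 := LinearMap.codRestrict _
    ((-LieAlgebra.ad K L x) ∘ₗ (parT K H0 H).subtype) (fun X => by
      have := lie_mem_eig' (l := 1) (parT_le X.2) hx (by norm_num)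
      simpa using this)
  have hT : ∀ X : parT K H0 H, (T X : L) = ⁅(X : L), x⁆ := fun X => by simp [T]
  suffices hsurj : LinearMap.range T = ⊤ by
    obtain ⟨X, hX⟩ := LinearMap.range_eq_top.1 hsurj ⟨w, hw⟩
    exact ⟨X, X.2, by rw [← hT, hX]⟩
  by_contra hne
  obtain ⟨l, hl, hl0⟩ := Submodule.exists_le_ker_of_lt_top _ (lt_top_iff_ne_top.2 hne)
  obtain ⟨z, hz⟩ := exists_mem_kf_eq l
  set y := eproj H0 S.diag₀ (-1) z with hy
  have hy1 : y ∈ eig K H0 (-1) := eproj_mem _ _ _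
  have hyl : ∀ x : eig K H0 1, kf K y x = l x := fun x => by
    rw [← hz, kf_comm, kf_comm z, kf_eproj S.diag₀ x.2 z]
  have h1 := S.mem_nilT_of_kf (lie_mem_eig' (l := 0) hx hy1 (by norm_num)) fun X hX => by
    rw [kf_lie, kf_comm, kf_lie]
    have : l (T ⟨X, hX⟩) = 0 := hl0 ⟨_, rfl⟩
    rw [← hyl, hT] at this
    exact this
  have h2 := ht y hy1 h1
  apply hl
  ext x
  rw [← hyl, h2]
  simp [kf]

end Regular

section Nullstellensatz

variable {K V : Type*} [Field K] [IsAlgClosed K] [AddCommGroup V] [Module K V]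
  [FiniteDimensional K V]

/-- A polynomial function vanishing at the zeros of an irreducible one is a multiple of it. -/
lemma dvd_of_zeros [Infinite K] {q f : polyFun K V} (hq : Irreducible q)
    (h : ∀ x, (q : V → K) x = 0 → (f : V → K) x = 0) : q ∣ f := by
  let b := Module.finBasis K V
  let e := polyEquiv b
  have hev : ∀ (g : polyFun K V) (c : Fin (Module.finrank K V) → K),
      MvPolynomial.aeval c (e.symm g) = (g : V → K) (∑ i, c i • b i) := by
    intro g c
    conv_rhs => rw [← e.apply_symm_apply g]
    rw [polyEquiv_apply]
    simp only [b.repr_sum_self] at *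
    rfl
  have hmem : e.symm f ∈ (Ideal.span {e.symm q}).radical := by
    rw [← MvPolynomial.vanishingIdeal_zeroLocus_eq_radical (K := K)]
    rw [MvPolynomial.mem_vanishingIdeal_iff]
    intro c hc
    rw [MvPolynomial.mem_zeroLocus_iff] at hc
    rw [hev]
    exact h _ (by rw [← hev]; exact hc _ (Ideal.subset_span rfl))
  obtain ⟨n, hn⟩ := hmem
  rw [Ideal.mem_span_singleton, ← map_pow] at hn
  have := map_dvd e hn
  simp only [AlgEquiv.apply_symm_apply] at this
  exact (UniqueFactorizationMonoid.irreducible_iff_prime.1 hq).dvd_of_dvd_pow this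

end Nullstellensatz

section Classification

variable {K L : Type*} [Field K] [LieRing L] [LieAlgebra K L] [CharZero K] [FiniteDimensional K L]
  {p : ℕ} {H0 : L} {H : Fin p → L}

lemma parT_lie_mem {X : L} (hX : X ∈ parT K H0 H) : ∀ x ∈ eig K H0 1, ⁅X, x⁆ ∈ eig K H0 1 :=
  fun _ hx => lie_mem_eig' (parT_le hX) hx (by norm_num)

/-- An irreducible infinitesimal relative invariant of the parabolic subalgebra divides one of the
polynomials whose common non-zeros are good. -/
theorem Sys.exists_dvd [IsAlgClosed K] [LieAlgebra.IsKilling K L] (S : Sys K H0 H)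
    {F : Fin p → polyFun K (eig K H0 1)}
    (hF : ∀ x : eig K H0 1, (∀ k, (F k : eig K H0 1 → K) x ≠ 0) → S.Good (x : L))
    {q : polyFun K (eig K H0 1)} (hq : Irreducible q)
    (hinf : ∀ X ∈ parT K H0 H, ∃ c, InfRel q X c) : ∃ k, q ∣ F k := by
  have hprime := UniqueFactorizationMonoid.irreducible_iff_prime.1 hq
  by_contra! hno
  have hdvd : ∀ v, q ∣ pder K v q := by
    intro v
    have h1 : q ∣ pder K v q * ∏ k, F k := by
      refine dvd_of_zeros hq fun x hx => ?_
      by_cases hgood : ∀ k, (F k : eig K H0 1 → K) x ≠ 0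
      · have hg := hF x hgood
        obtain ⟨X, hX, hXx⟩ := S.exists_lie_eq hg.1 (S.transversal hg) v.2
        obtain ⟨c, hc⟩ := hinf X hX
        have := hc x v hXx.symm
        rw [hx, mul_zero] at this
        simp [pder_apply, this]
      · push Not at hgood
        obtain ⟨k, hk⟩ := hgood
        have h2 : ((∏ k, F k : polyFun K (eig K H0 1)) : eig K H0 1 → K) x = 0 := by
          rw [SubmonoidClass.coe_finsetProd, Finset.prod_apply]
          exact Finset.prod_eq_zero (Finset.mem_univ k) hk
        rw [MulMemClass.coe_mul, Pi.mul_apply, h2, mul_zero]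
    rcases hprime.dvd_or_dvd h1 with h | h
    · exact h
    · obtain ⟨k, -, hk⟩ := (hprime.dvd_finsetProd_iff _).1 h
      exact absurd hk (hno k)
  obtain ⟨c, rfl⟩ := eq_algebraMap_of_dvd_pder hdvd
  refine hq.not_isUnit (isUnit_polyFun_iff.2 ⟨c, ?_, rfl⟩)
  rintro rfl
  simp at hprime

/-- Every infinitesimal relative invariant is a product of powers of the basic ones. -/
theorem Sys.exists_eq_prod [IsAlgClosed K] [LieAlgebra.IsKilling K L] (S : Sys K H0 H)
    {F : Fin p → polyFun K (eig K H0 1)} (hirr : ∀ k, Irreducible (F k))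
    (hF : ∀ x : eig K H0 1, (∀ k, (F k : eig K H0 1 → K) x ≠ 0) → S.Good (x : L))
    {a : polyFun K (eig K H0 1)} (ha : a ≠ 0)
    (hinf : ∀ X ∈ parT K H0 H, ∃ c, InfRel a X c) :
    ∃ (n : Fin p → ℕ) (c : K), c ≠ 0 ∧ a = c • ∏ k, F k ^ n k := by
  classical
  have key : ∀ s : Multiset (polyFun K (eig K H0 1)), (∀ q ∈ s, ∃ k, Associated q (F k)) →
      ∃ n : Fin p → ℕ, Associated s.prod (∏ k, F k ^ n k) := by
    intro s
    induction s using Multiset.induction_on with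
    | empty => exact fun _ => ⟨0, by simp⟩
    | cons q s ih =>
      intro h
      obtain ⟨n, hn⟩ := ih fun q hq => h q (Multiset.mem_cons_of_mem hq)
      obtain ⟨k, hk⟩ := h q (Multiset.mem_cons_self q s)
      refine ⟨n + Pi.single k 1, ?_⟩
      rw [Multiset.prod_cons]
      have : ∏ j, F j ^ (n + Pi.single k 1 : Fin p → ℕ) j = F k * ∏ j, F j ^ n j := by
        simp only [Pi.add_apply, pow_add, Finset.prod_mul_distrib]
        rw [mul_comm, Finset.prod_eq_single k]
        · simp
        · intro j _ hj
          simp [hj]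
        · simp
      rw [this]
      exact hk.mul_mul hn
  obtain ⟨s, hs, hsa⟩ := UniqueFactorizationMonoid.exists_prime_factors a ha
  obtain ⟨n, hn⟩ := key s fun q hq => by
    have hq' := (hs q hq).irreducible
    obtain ⟨k, hk⟩ := S.exists_dvd hF hq' fun X hX => by
      obtain ⟨c, hc⟩ := hinf X hX
      exact hc.of_dvd (parT_lie_mem hX) ha hq' ((Multiset.dvd_prod hq).trans hsa.dvd)
    exact ⟨k, hq'.associated_of_dvd (hirr k) hk⟩
  obtain ⟨u, hu⟩ := (hn.symm.trans hsa)
  obtain ⟨c, hc, huc⟩ := isUnit_polyFun_iff.1 u.isUnit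
  refine ⟨n, c, hc, ?_⟩
  rw [← hu, huc, Algebra.smul_def, mul_comm]

end Classification

section Torus

variable {K L : Type*} [Field K] [LieRing L] [LieAlgebra K L] [CharZero K] [FiniteDimensional K L]
  {h e f : L}

lemma isNilpotent_ad_smul {X : L} (hX : IsNilpotent (LieAlgebra.ad K L X)) (c : K) :
    IsNilpotent (LieAlgebra.ad K L (c • X)) := by
  rw [map_smul]; exact hX.smul c

lemma expE_mem_elemAut {X : L} (hX : IsNilpotent (LieAlgebra.ad K L X)) :
    expE X hX ∈ elemAut K L := Subgroup.subset_closure (expE_mem hX trivial)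

lemma elemAut_le_lieAut : elemAut K L ≤ lieAut K L := by
  rw [elemAut, Subgroup.closure_le]
  rintro g ⟨X, -, hX, hg⟩
  rw [eq_expE hX hg]
  exact expE_mem_lieAut hX

lemma eproj_expE {X : L} (hd : IsDiag K h) (hX : IsNilpotent (LieAlgebra.ad K L X))
    (hXh : X ∈ eig K h (-2)) {u : L} {a b : ℤ} (hu : u ∈ eig K h a) (hab : a ≤ b) :
    eproj h hd b (expE X hX u) = if a = b then u else 0 := by
  have hn := hX
  obtain ⟨N, hN⟩ := hn
  have h1 : (LieAlgebra.ad K L X ^ (N + 1)) u = 0 := by rw [pow_succ, hN, zero_mul]; rfl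
  have hz : ∀ i : ℕ, i ≠ 0 → eproj h hd b ((LieAlgebra.ad K L X ^ i) u) = 0 := fun i hi =>
    eproj_of_ne hd (by omega) (pow_ad_mem_eig hXh hu i)
  rw [expE_apply hX h1, map_sum, Finset.sum_eq_single 0]
  · simp only [Nat.factorial_zero, Nat.cast_one, inv_one, pow_zero, Module.End.one_apply, one_smul]
    rw [eproj_eq_ite hd hu]
    simp only [eq_comm]
  · intro i _ hi
    rw [map_smul, hz i hi, smul_zero]
  · simp

/-- The elements of the normalizer of the torus attached to an `sl₂`-triple. -/
lemma exists_reflection (hd : IsDiag K h) (tr : IsSl2Triple h e f) {t : K} (ht : t ≠ 0) :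
    ∃ g ∈ elemAut K L, g h = -h ∧ g e = -((t⁻¹ * t⁻¹) • f) ∧
      ∀ (m : ℕ) (v : L), v ∈ eig K h (-m) → ⁅f, v⁆ = 0 →
        g v = ((m.factorial : K)⁻¹ * t ^ m) • (LieAlgebra.ad K L e ^ m) v := by
  have hE := isNilpotent_ad_smul (isNilpotent_ad_of_mem_eig hd two_ne_zero (IsSl2Triple.mem_e (K := K) tr)) t
  have hF := isNilpotent_ad_smul (isNilpotent_ad_of_mem_eig hd (by norm_num) (IsSl2Triple.mem_f (K := K) tr)) (-t⁻¹)
  have heh : ⁅e, h⁆ = -((2 : K) • e) := by rw [← lie_skew, tr.lie_h_e_smul K]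
  have hfh : ⁅f, h⁆ = (2 : K) • f := by rw [← lie_skew, tr.lie_lie_smul_f K, neg_neg]
  have hef : ⁅e, f⁆ = h := tr.lie_e_f
  have hfe : ⁅f, e⁆ = -h := by rw [← lie_skew, hef]
  have Eh : expE (t • e) hE h = h - (2 * t) • e := by
    rw [expE_apply_two hE (by simp [heh])]
    simp only [smul_lie, heh, smul_neg, smul_smul]
    rw [mul_comm, sub_eq_add_neg]
  have Ee : expE (t • e) hE e = e := expE_of_lie_eq_zero hE (by simp)
  have Ef : expE (t • e) hE f = f + t • h - (t * t) • e := by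
    rw [expE_apply_three hE (by simp [hef, heh])]
    simp only [smul_lie, hef, lie_smul, heh, smul_neg, smul_smul, sub_eq_add_neg]
    congr 3
    field_simp
  have Fh : expE ((-t⁻¹) • f) hF h = h - (2 * t⁻¹) • f := by
    rw [expE_apply_two hF (by simp [hfh])]
    simp only [smul_lie, hfh, smul_smul, sub_eq_add_neg, ← neg_smul]
    congr 2
    ring
  have Ff : expE ((-t⁻¹) • f) hF f = f := expE_of_lie_eq_zero hF (by simp)
  have Fe : expE ((-t⁻¹) • f) hF e = e + t⁻¹ • h - (t⁻¹ * t⁻¹) • f := by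
    rw [expE_apply_three hF (by simp [hfe, hfh])]
    simp only [smul_lie, hfe, lie_smul, lie_neg, hfh]
    match_scalars <;> field_simp
  set E := expE (t • e) hE with hEdef
  set F := expE ((-t⁻¹) • f) hF with hFdef
  have hg : F * E * F ∈ elemAut K L :=
    mul_mem (mul_mem (expE_mem_elemAut hF) (expE_mem_elemAut hE)) (expE_mem_elemAut hF)
  have hgh : (F * E * F) h = -h := by
    simp only [LinearEquiv.mul_apply, Fh, Eh, Ef, map_sub, map_add, map_smul, Fe, Ff]
    match_scalars <;> field_simp <;> ring
  have hge : (F * E * F) e = -((t⁻¹ * t⁻¹) • f) := by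
    simp only [LinearEquiv.mul_apply, Fh, Eh, Ef, map_sub, map_add, map_smul, Ee, Fe, Ff]
    match_scalars <;> field_simp <;> ring
  refine ⟨F * E * F, hg, hgh, hge, fun m v hv hfv => ?_⟩
  have hw : (F * E * F) v ∈ eig K h m := by
    rw [mem_eig]
    have h1 := elemAut_le_lieAut hg h v
    rw [mem_eig.1 hv, hgh, map_smul, neg_lie] at h1
    have h2 : ⁅h, (F * E * F) v⁆ = -((-(m : ℤ) : ℤ) : K) • (F * E * F) v := by
      rw [neg_smul, h1, neg_neg]
    rw [h2]; simp
  have hFv : F v = v := expE_of_lie_eq_zero hF (by simp [hfv])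
  have hpow : (LieAlgebra.ad K L e ^ (m + 1)) v = 0 := by
    by_cases hv0 : v = 0
    · simp [hv0]
    have P : tr.symm.HasPrimitiveVectorWith v ((m : ℕ) : K) :=
      ⟨hv0, by rw [neg_lie, mem_eig.1 hv]; simp, hfv⟩
    exact P.pow_toEnd_f_eq_zero_of_eq_nat rfl
  have hpow' : (LieAlgebra.ad K L (t • e) ^ (m + 1)) v = 0 := by
    rw [map_smul, smul_pow, LinearMap.smul_apply, hpow, smul_zero]
  have hmem : ∀ i : ℕ, (LieAlgebra.ad K L e ^ i) v ∈ eig K h (-m + i * 2) := fun i =>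
    pow_ad_mem_eig (IsSl2Triple.mem_e (K := K) tr) hv i
  have hproj : ∀ i : ℕ, i ≤ m → eproj h hd m (F ((LieAlgebra.ad K L e ^ i) v)) =
      if i = m then (LieAlgebra.ad K L e ^ i) v else 0 := by
    intro i hi
    have hF2 : (-t⁻¹) • f ∈ eig K h (-2) := Submodule.smul_mem _ _ (IsSl2Triple.mem_f (K := K) tr)
    rw [eproj_expE hd hF hF2 (hmem i) (by omega)]
    congr 1
    rw [eq_iff_iff]
    omega
  rw [← eproj_self hd hw, LinearEquiv.mul_apply, LinearEquiv.mul_apply, hFv, hEdef,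
    expE_apply hE hpow', map_sum, map_sum, Finset.sum_eq_single m]
  · rw [map_smul, map_smul, map_smul, smul_pow, LinearMap.smul_apply, map_smul, map_smul,
      hproj m le_rfl, if_pos rfl, smul_smul]
  · intro i hi him
    rw [map_smul, map_smul, map_smul, smul_pow, LinearMap.smul_apply, map_smul, map_smul,
      hproj i (by have := Finset.mem_range.1 hi; omega), if_neg him, smul_zero, smul_zero]
  · simp

/-- The one-parameter torus attached to an `sl₂`-triple. -/
theorem exists_torus (hd : IsDiag K h) (tr : IsSl2Triple h e f) {t : K} (ht : t ≠ 0) :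
    ∃ g ∈ elemAut K L, ∀ i : ℤ, ∀ x ∈ eig K h i, g x = t ^ i • x := by
  obtain ⟨g, hg, hgh, hge, hgv⟩ := exists_reflection hd tr ht
  obtain ⟨g₁, hg₁, hgh₁, hge₁, hgv₁⟩ := exists_reflection hd tr (one_ne_zero (α := K))
  have hle := fun x y => elemAut_le_lieAut hg x y
  have hle₁ := fun x y => elemAut_le_lieAut hg₁ x y
  have hstep : ∀ (l : ℤ) (u : L), g u = t ^ (-l) • g₁ u → g ⁅e, u⁆ = t ^ (-(l + 2)) • g₁ ⁅e, u⁆ := by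
    intro l u hu
    rw [hle, hle₁, hu, hge, hge₁]
    simp only [neg_lie, smul_lie, lie_smul, smul_neg, smul_smul, inv_one, mul_one]
    congr 2
    rw [neg_add, zpow_add₀ ht]
    have : t ^ (-2 : ℤ) = t⁻¹ * t⁻¹ := by rw [zpow_neg, ← mul_inv, ← sq]; norm_cast
    rw [this]
  have hneg : ∀ l : ℤ, l ≤ 0 → ∀ u ∈ eig K h l, g u = t ^ (-l) • g₁ u := by
    intro l hl u hu
    obtain ⟨n, w, hw, rfl⟩ := exists_primitive_decomp (K := K) hd.neg tr.symm
      (neg_mem_eig hu) (by omega)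
    rw [map_sum, map_sum, Finset.smul_sum]
    refine Finset.sum_congr rfl fun j _ => ?_
    have hpow : ∀ i : ℕ, g ((LieAlgebra.ad K L e ^ i) (w j)) =
        t ^ (-(l - 2 * j + 2 * i)) • g₁ ((LieAlgebra.ad K L e ^ i) (w j)) := by
      intro i
      induction i with
      | zero =>
        have h1 := mem_eig_neg.1 (hw j).1
        obtain ⟨m, hm⟩ := Int.eq_ofNat_of_zero_le (show 0 ≤ -l + 2 * (j : ℤ) by omega)
        rw [hm] at h1
        have e1 := hgv m (w j) h1 (hw j).2
        have e2 := hgv₁ m (w j) h1 (hw j).2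
        simp only [pow_zero, Module.End.one_apply, e1, e2, smul_smul, one_pow, mul_one]
        congr 1
        rw [mul_comm]
        congr 1
        rw [← zpow_natCast]
        congr 1
        push_cast
        omega
      | succ i ih =>
        rw [pow_succ', Module.End.mul_apply, LieAlgebra.ad_apply, hstep _ _ ih]
        congr 2
        push_cast
        ring
    rw [hpow j]
    congr 2
    ring
  have hall : ∀ (n : ℕ) (l : ℤ), l ≤ n → ∀ u ∈ eig K h l, g u = t ^ (-l) • g₁ u := by
    intro n
    induction n with
    | zero => exact fun l hl => hneg l (by simpa using hl)
    | succ n ih =>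
      intro l hl u hu
      by_cases hl1 : l ≤ n
      · exact ih l hl1 u hu
      obtain ⟨u', hu', rfl⟩ := exists_lie_eq hd tr hu (by omega) (show l - 2 + 2 = l by ring)
      rw [hstep _ _ (ih (l - 2) (by push_cast at hl; omega) u' hu')]
      congr 2
      ring
  refine ⟨g * g₁⁻¹, mul_mem hg (inv_mem hg₁), fun i x hx => ?_⟩
  obtain ⟨u, rfl⟩ := g₁.surjective x
  have hu : u ∈ eig K h (-i) := by
    rw [mem_eig] at hx ⊢
    apply g₁.injective
    rw [hle₁, hgh₁, neg_lie, hx, map_smul]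
    simp
  have h1 : g₁⁻¹ (g₁ u) = u := g₁.symm_apply_apply u
  rw [LinearEquiv.mul_apply, h1, hall (-i).toNat (-i) (Int.self_le_toNat _) u hu, neg_neg]

end Torus

section Cartan

variable {K L : Type*} [Field K] [LieRing L] [LieAlgebra K L]

variable (K) in
/-- `ad c` is diagonalizable over `K`. -/
def IsAdDiag (c : L) : Prop := ⨆ a : K, Module.End.eigenspace (LieAlgebra.ad K L c) a = ⊤

lemma IsDiag.isAdDiag {c : L} (hc : IsDiag K c) : IsAdDiag K c :=
  eq_top_iff.2 (hc ▸ iSup_le fun i => le_iSup (fun a : K =>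
    Module.End.eigenspace (LieAlgebra.ad K L c) a) (i : K))

lemma IsAdDiag.lie_eq_zero {c : L} (hc : IsAdDiag K c) {x : L} (hx : ⁅c, ⁅c, x⁆⁆ = 0) :
    ⁅c, x⁆ = 0 := by
  classical
  have hind := Module.End.eigenspaces_iSupIndep (LieAlgebra.ad K L c)
  obtain ⟨v, hv, rfl⟩ := (Submodule.mem_iSup_iff_exists_finsupp _ x).1
    (hc ▸ Submodule.mem_top : x ∈ ⨆ a : K, Module.End.eigenspace (LieAlgebra.ad K L c) a)
  have hl : ∀ a, ⁅c, v a⁆ = a • v a := fun a => by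
    simpa using Module.End.mem_eigenspace_iff.1 (hv a)
  simp only [Finsupp.sum, lie_sum, hl, lie_smul] at hx ⊢
  have h0 := (iSupIndep_iff_finsetSum_eq_zero_imp_eq_zero _).1 hind v.support
    (fun a => a • a • v a) (fun a _ => Submodule.smul_mem _ _ (Submodule.smul_mem _ _ (hv a))) hx
  refine Finset.sum_eq_zero fun a ha => ?_
  have := h0 a ha
  rw [smul_eq_zero] at this
  rcases this with h | h
  · rw [h, zero_smul]
  · exact h

/-- A Cartan subalgebra of the centralizer of a set of diagonalizable commuting elements is a Cartan
subalgebra. -/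
lemma isCartanSubalgebra_map {C : LieSubalgebra K L} {s : Set L} (hs : ∀ z ∈ s, IsAdDiag K z)
    (hC : ∀ x, x ∈ C ↔ ∀ z ∈ s, ⁅z, x⁆ = 0) (hsC : s ⊆ C) (E : LieSubalgebra K C)
    [hE : E.IsCartanSubalgebra] :
    (E.map C.incl).IsCartanSubalgebra ∧ s ⊆ E.map C.incl := by
  have hmem : ∀ x : L, x ∈ E.map C.incl ↔ ∃ hx : x ∈ C, (⟨x, hx⟩ : C) ∈ E := by
    intro x
    rw [LieSubalgebra.mem_map]
    constructor
    · rintro ⟨y, hy, rfl⟩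
      exact ⟨y.2, hy⟩
    · rintro ⟨hx, h⟩
      exact ⟨_, h, rfl⟩
  have hsE : s ⊆ E.map C.incl := by
    intro z hz
    refine (hmem z).2 ⟨hsC hz, ?_⟩
    rw [← hE.self_normalizing, LieSubalgebra.mem_normalizer_iff]
    intro y _
    have : ⁅(⟨z, hsC hz⟩ : C), y⁆ = 0 := Subtype.ext ((hC y).1 y.2 z hz)
    rw [this]
    exact zero_mem _
  refine ⟨⟨?_, ?_⟩, hsE⟩
  · have e := E.equivMapOfInjective C.incl Subtype.val_injective
    have := hE.nilpotent
    exact (LieEquiv.nilpotent_iff_equiv_nilpotent e).1 this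
  · refine le_antisymm (fun x hx => ?_) (LieSubalgebra.le_normalizer _)
    rw [LieSubalgebra.mem_normalizer_iff] at hx
    have hxC : x ∈ C := by
      refine (hC x).2 fun z hz => (hs z hz).lie_eq_zero ?_
      have h1 := ((hmem _).1 (hx z (hsE hz))).1
      have h2 := (hC _).1 h1 z hz
      rw [← lie_skew z x, lie_neg, h2, neg_zero]
    refine (hmem x).2 ⟨hxC, ?_⟩
    rw [← hE.self_normalizing, LieSubalgebra.mem_normalizer_iff]
    intro y hy
    exact ((hmem _).1 (hx y ((hmem _).2 ⟨y.2, hy⟩))).2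

/-- The centralizer of a set, as a subalgebra. -/
def centralizerSubalgebra (s : Set L) : LieSubalgebra K L where
  carrier := {x | ∀ z ∈ s, ⁅z, x⁆ = 0}
  add_mem' ha hb z hz := by rw [lie_add, ha z hz, hb z hz, add_zero]
  zero_mem' z _ := lie_zero z
  smul_mem' c x hx z hz := by rw [lie_smul, hx z hz, smul_zero]
  lie_mem' ha hb z hz := by rw [leibniz_lie, ha z hz, hb z hz, zero_lie, lie_zero, add_zero]

variable [FiniteDimensional K L]

lemma exists_isCartanSubalgebra_mem [Infinite K] {c : L} (hc : IsAdDiag K c) :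
    ∃ H : LieSubalgebra K L, H.IsCartanSubalgebra ∧ c ∈ H := by
  obtain ⟨x, hx⟩ := LieAlgebra.exists_isCartanSubalgebra_engel K
    (centralizerSubalgebra (K := K) {c})
  obtain ⟨h1, h2⟩ := isCartanSubalgebra_map (s := {c}) (by simpa using hc) (fun _ => Iff.rfl)
    (by rintro _ rfl z rfl; exact lie_self _) (LieSubalgebra.engel K x)
  exact ⟨_, h1, h2 rfl⟩

lemma isCartanSubalgebra_engel_of_isRegular [Infinite K] {x : L} (hx : LieAlgebra.IsRegular K x) :
    (LieSubalgebra.engel K x).IsCartanSubalgebra := by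
  refine ⟨?_, LieSubalgebra.normalizer_engel _ _⟩
  apply LieSubalgebra.isNilpotent_of_forall_le_engel
  intro y hy
  set Ex : {LieSubalgebra.engel K z | z ∈ LieSubalgebra.engel K x} :=
    ⟨LieSubalgebra.engel K x, x, LieSubalgebra.self_mem_engel _ _, rfl⟩
  suffices IsBot Ex from @this ⟨LieSubalgebra.engel K y, y, hy, rfl⟩
  apply LieAlgebra.engel_isBot_of_isMin (Cardinal.natCast_le_aleph0.trans
    (Cardinal.infinite_iff.mp ‹Infinite K›)) (LieSubalgebra.engel K x) Ex le_rfl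
  rintro ⟨_, y, hy, rfl⟩ hyx
  suffices Module.finrank K (LieSubalgebra.engel K x) ≤
      Module.finrank K (LieSubalgebra.engel K y) by
    suffices LieSubalgebra.engel K y = LieSubalgebra.engel K x from this.ge
    apply LieSubalgebra.toSubmodule_injective
    exact Submodule.eq_of_le_of_finrank_le hyx this
  rw [(LieAlgebra.isRegular_iff_finrank_engel_eq_rank K x).mp hx]
  apply LieAlgebra.rank_le_finrank_engel

lemma exists_generic_isRegular [Infinite K] :
    ∃ P : polyFun K L, P ≠ 0 ∧ ∀ c : L, (P : L → K) c ≠ 0 → LieAlgebra.IsRegular K c := by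
  let b := Module.finBasis K L
  let P := polyEquiv b ((LinearMap.polyCharpoly (LieAlgebra.ad K L : L →ₗ[K] Module.End K L) b).coeff
    (LieAlgebra.rank K L))
  have hP : ∀ c : L, (P : L → K) c = MvPolynomial.eval (b.repr c)
      ((LinearMap.polyCharpoly (LieAlgebra.ad K L : L →ₗ[K] Module.End K L) b).coeff (LieAlgebra.rank K L)) :=
    fun c => polyEquiv_apply _ _ _
  refine ⟨P, ?_, fun c hc => ?_⟩
  · rintro h0
    obtain ⟨x, hx⟩ := LieAlgebra.exists_isRegular K L
    rw [LieAlgebra.isRegular_iff_coeff_polyCharpoly_rank_ne_zero K b, ← hP, h0] at hx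
    exact hx rfl
  · rw [LieAlgebra.isRegular_iff_coeff_polyCharpoly_rank_ne_zero K b, ← hP]
    exact hc

/-- Generic elements of the centralizer of a set of commuting diagonalizable elements are
diagonalizable. -/
lemma exists_generic_isAdDiag [CharZero K] [IsAlgClosed K] [LieAlgebra.IsKilling K L]
    {C : LieSubalgebra K L} {s : Set L}
    (hs : ∀ z ∈ s, IsAdDiag K z) (hC : ∀ x, x ∈ C ↔ ∀ z ∈ s, ⁅z, x⁆ = 0) (hsC : s ⊆ C) :
    ∃ P : polyFun K C, P ≠ 0 ∧ ∀ c : C, (P : C → K) c ≠ 0 → IsAdDiag K (c : L) := by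
  obtain ⟨P, hP0, hP⟩ := exists_generic_isRegular (K := K) (L := C)
  refine ⟨P, hP0, fun c hc => ?_⟩
  have h1 := isCartanSubalgebra_engel_of_isRegular (hP c hc)
  have h2 := (isCartanSubalgebra_map hs hC hsC (LieSubalgebra.engel K c)).1
  have h3 : (c : L) ∈ (LieSubalgebra.engel K c).map C.incl :=
    (LieSubalgebra.mem_map ..).2 ⟨c, LieSubalgebra.self_mem_engel _ _, rfl⟩
  exact (LieAlgebra.IsKilling.isSemisimple_ad_of_mem_isCartanSubalgebra h3).iSup_eigenspace_eq_top

end Cartan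

section PowerTraces

variable {K L : Type*} [Field K] [LieRing L] [LieAlgebra K L]

/-- The elements `z_j` represent the linear forms `y ↦ tr (ad y (ad c) ^ j)`. -/
def IsPowerTrace (c : L) (z : ℕ → L) : Prop :=
  ∀ j y, killingForm K L (z j) y =
    LinearMap.trace K L (LieAlgebra.ad K L y * LieAlgebra.ad K L c ^ j)

/-- The common eigenspace of the `ad (z_j)` for the eigenvalues `D⁻¹ ∑ a^j m_a`. -/
def powerEig (z : ℕ → L) (D : ℕ) (A : Finset K) (m : K → ℤ) : Submodule K L :=
  ⨅ j : ℕ, Module.End.eigenspace (LieAlgebra.ad K L (z j)) ((D : K)⁻¹ * ∑ a ∈ A, a ^ j * m a)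

lemma mem_powerEig {z : ℕ → L} {D : ℕ} {A : Finset K} {m : K → ℤ} {x : L} :
    x ∈ powerEig z D A m ↔ ∀ j, ⁅z j, x⁆ = ((D : K)⁻¹ * ∑ a ∈ A, a ^ j * m a) • x := by
  simp [powerEig, Submodule.mem_iInf]

variable [FiniteDimensional K L]

lemma IsPowerTrace.exists [LieAlgebra.IsKilling K L] (c : L) :
    ∃ z : ℕ → L, IsPowerTrace (K := K) c z := by
  have hnd := LieAlgebra.IsKilling.killingForm_nondegenerate K L
  refine ⟨fun j => ((killingForm K L).toDual hnd).symm (LinearMap.trace K L ∘ₗ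
    LinearMap.mulRight K (LieAlgebra.ad K L c ^ j) ∘ₗ (LieAlgebra.ad K L : L →ₗ[K] Module.End K L)),
    fun j y => ?_⟩
  rw [← LinearMap.BilinForm.toDual_def hnd, LinearEquiv.apply_symm_apply]
  rfl

variable [CharZero K] [LieAlgebra.IsKilling K L] {c : L} {z : ℕ → L}

lemma IsPowerTrace.lie_eq_zero (hz : IsPowerTrace (K := K) c z) {u : L} (hu : ⁅u, c⁆ = 0) (j : ℕ) :
    ⁅u, z j⁆ = 0 := by
  have hcomm : Commute (LieAlgebra.ad K L u) (LieAlgebra.ad K L c) := by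
    ext x
    have := leibniz_lie u c x
    rw [hu, zero_lie, zero_add] at this
    simpa using this
  refine eq_zero_of_kf (K := K) fun y => ?_
  have had : LieAlgebra.ad K L ⁅u, y⁆ = LieAlgebra.ad K L u * LieAlgebra.ad K L y -
      LieAlgebra.ad K L y * LieAlgebra.ad K L u := by
    ext x
    simp
  rw [← lie_skew, kf, map_neg, LinearMap.neg_apply, neg_eq_zero]
  change kf K ⁅z j, u⁆ y = 0
  rw [kf_lie, kf, hz, had, sub_mul, map_sub, mul_assoc, LinearMap.trace_mul_comm, mul_assoc,
    mul_assoc, (hcomm.pow_right j).eq, sub_self]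

lemma IsPowerTrace.eq_one (hz : IsPowerTrace (K := K) c z) : z 1 = c := by
  rw [← sub_eq_zero]
  refine eq_zero_of_kf (K := K) fun y => ?_
  rw [kf, map_sub, LinearMap.sub_apply, hz, pow_one, sub_eq_zero, LieModule.traceForm_comm]
  rfl

lemma IsPowerTrace.mem_powerEig_zero (hz : IsPowerTrace (K := K) c z) {u : L} (hu : ⁅u, c⁆ = 0)
    (D : ℕ) (A : Finset K) : u ∈ powerEig z D A 0 := by
  rw [mem_powerEig]
  intro j
  rw [← lie_skew, hz.lie_eq_zero hu]
  simp

end PowerTraces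

section Roots

open LieAlgebra LieAlgebra.IsKilling LieModule

variable {K L : Type*} [Field K] [LieRing L] [LieAlgebra K L] [CharZero K] [FiniteDimensional K L]
  [IsAlgClosed K] [IsKilling K L] {H : LieSubalgebra K L} [H.IsCartanSubalgebra]

lemma trace_ad_mul_pow (y c : H) (j : ℕ) :
    LinearMap.trace K L (ad K L y * ad K L c ^ j) =
      ∑ χ : Weight K H L, Module.finrank K (rootSpace H χ) • (χ y * χ c ^ j) := by
  classical
  have hpow : ∀ (χ : Weight K H L) (n : ℕ), ∀ m ∈ rootSpace H χ,
      (ad K L c ^ n) m = χ c ^ n • m := by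
    intro χ n m hm
    induction n with
    | zero => simp
    | succ n ih =>
      have h1 : ⁅(c : L), m⁆ = χ c • m := lie_eq_smul_of_mem_rootSpace hm c
      rw [pow_succ', Module.End.mul_apply, ih, map_smul, ad_apply, h1, smul_smul, pow_succ]
  have hact : ∀ (χ : Weight K H L), ∀ m ∈ rootSpace H χ,
      (ad K L y * ad K L c ^ j) m = (χ y * χ c ^ j) • m := by
    intro χ m hm
    have h1 : ⁅(y : L), m⁆ = χ y • m := lie_eq_smul_of_mem_rootSpace hm y
    rw [Module.End.mul_apply, hpow χ j m hm, map_smul, ad_apply, h1, smul_smul, mul_comm]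
  have hmaps : ∀ χ : Weight K H L, Set.MapsTo (ad K L y * ad K L c ^ j)
      (rootSpace H χ).toSubmodule (rootSpace H χ).toSubmodule := fun χ m hm => by
    rw [SetLike.mem_coe, hact χ m hm]
    exact Submodule.smul_mem _ _ hm
  have hds := DirectSum.isInternal_submodule_of_iSupIndep_of_iSup_eq_top
    (LieSubmodule.iSupIndep_toSubmodule.mpr <| iSupIndep_genWeightSpace' K H L)
    (LieSubmodule.iSup_toSubmodule_eq_top.mpr <| iSup_genWeightSpace_eq_top' K H L)
  rw [LinearMap.trace_eq_sum_trace_restrict hds hmaps]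
  refine Finset.sum_congr rfl fun χ _ => ?_
  have : (ad K L y * ad K L c ^ j).restrict (hmaps χ) =
      (χ y * χ c ^ j) • (LinearMap.id : (rootSpace H χ).toSubmodule →ₗ[K] _) := by
    ext m
    exact hact χ m m.2
  rw [this, map_smul, LinearMap.trace_id, smul_eq_mul, nsmul_eq_mul, mul_comm]
  rfl

/-- The integer `β(α^∨)`. -/
def rootInt (α β : Weight K H L) : ℤ := chainBotCoeff α β - chainTopCoeff α β

lemma apply_coroot (α β : Weight K H L) : β (coroot α) = (rootInt α β : K) :=
  apply_coroot_eq_cast α β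

/-- The integer `κ(α^∨, α^∨)`. -/
def corootNorm (α : Weight K H L) : ℕ :=
  ∑ χ : Weight K H L, Module.finrank K (rootSpace H χ) * (rootInt α χ).natAbs ^ 2

lemma corootNorm_eq (α : Weight K H L) :
    (corootNorm α : K) = traceForm K H L (coroot α) (coroot α) := by
  rw [traceForm_eq_sum_finrank_nsmul_mul, corootNorm]
  push_cast
  refine Finset.sum_congr rfl fun χ _ => ?_
  rw [apply_coroot, nsmul_eq_mul, ← sq]
  congr 1
  have := congrArg (Int.cast : ℤ → K) (Int.natAbs_sq (rootInt α χ))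
  push_cast at this
  simpa using this

lemma corootNorm_mul {α : Weight K H L} (hα : α.IsNonZero) (y : H) :
    (corootNorm α : K) * α y = 2 * traceForm K H L (coroot α) y := by
  have h0 := root_apply_cartanEquivDual_symm_ne_zero hα
  rw [corootNorm_eq, traceForm_coroot, traceForm_coroot, root_apply_coroot hα]
  simp only [smul_eq_mul, nsmul_eq_mul]
  push_cast
  ring

lemma corootNorm_ne_zero {α : Weight K H L} (hα : α.IsNonZero) : corootNorm α ≠ 0 := by
  intro h
  have := corootNorm_eq α
  rw [h, traceForm_coroot, root_apply_coroot hα] at this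
  have h0 := root_apply_cartanEquivDual_symm_ne_zero hα
  simp at this
  exact h0 (by simpa using this)

lemma isDiag_coroot (α : Weight K H L) : IsDiag K (coroot α : L) := by
  refine eq_top_iff.2 ?_
  rw [← LieSubmodule.iSup_toSubmodule_eq_top.mpr (iSup_genWeightSpace_eq_top' K H L)]
  refine iSup_le fun β x hx => ?_
  refine Submodule.mem_iSup_of_mem (rootInt α β) ?_
  rw [mem_eig, ← apply_coroot]
  exact lie_eq_smul_of_mem_rootSpace hx (coroot α)

lemma mem_eig_coroot (α β : Weight K H L) {x : L} (hx : x ∈ rootSpace H β) :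
    x ∈ eig K (coroot α : L) (rootInt α β) := by
  rw [mem_eig, ← apply_coroot]
  exact lie_eq_smul_of_mem_rootSpace hx (coroot α)

lemma exists_root_torus {α : Weight K H L} (hα : α.IsNonZero) {t : K} (ht : t ≠ 0) :
    ∃ g ∈ elemAut K L, ∀ β : Weight K H L, ∀ x ∈ rootSpace H β, g x = t ^ rootInt α β • x := by
  obtain ⟨h, e, f, ht', he, hf⟩ := exists_isSl2Triple_of_weight_isNonZero hα
  obtain rfl := ht'.h_eq_coroot hα he hf
  obtain ⟨g, hg, hgx⟩ := exists_torus (isDiag_coroot α) ht' ht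
  exact ⟨g, hg, fun β x hx => hgx _ x (mem_eig_coroot α β hx)⟩

lemma exists_root_torus_prod (s : Finset (Weight K H L)) (hs : ∀ α ∈ s, α.IsNonZero)
    (t : Weight K H L → K) (ht : ∀ α ∈ s, t α ≠ 0) :
    ∃ g ∈ elemAut K L, ∀ β : Weight K H L, ∀ x ∈ rootSpace H β,
      g x = (∏ α ∈ s, t α ^ rootInt α β) • x := by
  classical
  induction s using Finset.induction_on with
  | empty => exact ⟨1, one_mem _, fun β x _ => by simp⟩
  | insert α s hα ih =>
    obtain ⟨g, hg, hgx⟩ := ih (fun β hβ => hs β (Finset.mem_insert_of_mem hβ))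
      (fun β hβ => ht β (Finset.mem_insert_of_mem hβ))
    obtain ⟨g', hg', hgx'⟩ := exists_root_torus (hs α (Finset.mem_insert_self _ _))
      (ht α (Finset.mem_insert_self _ _))
    refine ⟨g' * g, mul_mem hg' hg, fun β x hx => ?_⟩
    rw [LinearEquiv.mul_apply, hgx β x hx, map_smul, hgx' β x hx, smul_smul,
      Finset.prod_insert hα, mul_comm]

lemma exists_sum_root (x : L) : ∃ v : Weight K H L → L, (∀ β : Weight K H L, v β ∈ rootSpace H β) ∧
    x = ∑ β, v β := by
  have hx : x ∈ ⨆ β : Weight K H L, (rootSpace H β).toSubmodule := by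
    rw [LieSubmodule.iSup_toSubmodule_eq_top.mpr (iSup_genWeightSpace_eq_top' K H L)]
    trivial
  obtain ⟨v, hv, hsum⟩ := (Submodule.mem_iSup_iff_exists_finsupp _ x).1 hx
  refine ⟨v, hv, ?_⟩
  rw [← hsum, Finsupp.sum_fintype _ _ fun _ => rfl]

lemma eq_zero_of_sum_root {v : Weight K H L → L} (hv : ∀ β : Weight K H L, v β ∈ rootSpace H β)
    (h : ∑ β, v β = 0) (β : Weight K H L) : v β = 0 :=
  (iSupIndep_iff_finsetSum_eq_zero_imp_eq_zero _).1
    (LieSubmodule.iSupIndep_toSubmodule.mpr <| iSupIndep_genWeightSpace' K H L) Finset.univ v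
    (fun β _ => hv β) h β (Finset.mem_univ β)

/-- `D = ∏ κ(α^∨, α^∨)`. -/
def rootDen (H : LieSubalgebra K L) [H.IsCartanSubalgebra] : ℕ := ∏ α ∈ H.root, corootNorm α

open Classical in
/-- `w_α = 2D / κ(α^∨, α^∨)`. -/
def rootWt (α : Weight K H L) : ℕ := 2 * ∏ β ∈ H.root.erase α, corootNorm β

lemma rootWt_mul {α : Weight K H L} (hα : α ∈ H.root) :
    rootWt α * corootNorm α = 2 * rootDen H := by
  classical
  rw [rootWt, rootDen, mul_assoc, Finset.prod_erase_mul _ _ hα]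

lemma isNonZero_of_mem_root {α : Weight K H L} (hα : α ∈ H.root) : α.IsNonZero :=
  LieSubalgebra.isNonZero_coe_root ⟨α, hα⟩

lemma rootDen_ne_zero : rootDen H ≠ 0 :=
  Finset.prod_ne_zero_iff.2 fun _ hα => corootNorm_ne_zero (isNonZero_of_mem_root hα)

variable {c : L} {z : ℕ → L}

lemma IsPowerTrace.mem (hz : IsPowerTrace (K := K) c z) (hc : c ∈ H) (j : ℕ) : z j ∈ H := by
  rw [← LieSubalgebra.IsCartanSubalgebra.self_normalizing (H := H), LieSubalgebra.mem_normalizer_iff']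
  intro y hy
  rw [hz.lie_eq_zero]
  · exact zero_mem _
  · have : ⁅(⟨y, hy⟩ : H), (⟨c, hc⟩ : H)⁆ = 0 := trivial_lie_zero _ _ _ _
    exact congrArg Subtype.val this

lemma IsPowerTrace.eq_sum (hz : IsPowerTrace (K := K) c z) (hc : c ∈ H) (j : ℕ) :
    (rootDen H : K) • (⟨z j, hz.mem hc j⟩ : H) =
      ∑ α ∈ H.root, ((rootWt α : K) * α ⟨c, hc⟩ ^ j) • coroot α := by
  apply (cartanEquivDual H).injective
  ext y
  have h0 : ∀ u : H, cartanEquivDual H u y = traceForm K H L u y := fun _ => rfl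
  rw [h0, h0, map_smul, map_sum, LinearMap.smul_apply, LinearMap.sum_apply]
  have h1 : traceForm K H L (⟨z j, hz.mem hc j⟩ : H) y =
      ∑ χ : Weight K H L, Module.finrank K (rootSpace H χ) • (χ y * χ ⟨c, hc⟩ ^ j) := by
    rw [← trace_ad_mul_pow, ← hz j y]
    rfl
  have h2 : ∑ χ : Weight K H L, Module.finrank K (rootSpace H χ) • (χ y * χ ⟨c, hc⟩ ^ j) =
      ∑ χ ∈ H.root, χ y * χ ⟨c, hc⟩ ^ j := by
    symm
    rw [← Finset.sum_subset (Finset.subset_univ H.root)]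
    · refine Finset.sum_congr rfl fun χ hχ => ?_
      rw [finrank_rootSpace_eq_one χ (isNonZero_of_mem_root hχ), one_smul]
    · intro χ _ hχ
      have : χ.IsZero := by simpa [LieSubalgebra.root] using hχ
      have h0 : χ y = 0 := congrFun this y
      rw [h0, zero_mul, smul_zero]
  rw [h1, h2, Finset.smul_sum]
  refine Finset.sum_congr rfl fun α hα => ?_
  have e1 := corootNorm_mul (isNonZero_of_mem_root hα) y
  have e2 : (rootWt α : K) * corootNorm α = 2 * rootDen H := by
    exact_mod_cast congrArg (Nat.cast : ℕ → K) (rootWt_mul hα)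
  rw [map_smul, LinearMap.smul_apply, smul_eq_mul, smul_eq_mul]
  have h3 : (2 : K) * ((rootDen H : K) * (α y * α ⟨c, hc⟩ ^ j)) =
      2 * ((rootWt α : K) * α ⟨c, hc⟩ ^ j * traceForm K H L (coroot α) y) := by
    linear_combination (-(α y * α ⟨c, hc⟩ ^ j)) * e2 + (rootWt α : K) * α ⟨c, hc⟩ ^ j * e1
  exact mul_left_cancel₀ two_ne_zero h3

open Classical in
/-- `m_a(β) = ∑_{α(c) = a} w_α β(α^∨)`. -/
def rootExp (c : H) (β : Weight K H L) (a : K) : ℤ :=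
  ∑ α ∈ H.root with α c = a, (rootWt α : ℤ) * rootInt α β

lemma sum_rootExp (c : H) (β : Weight K H L) (A : Finset K) (hA : ∀ α : Weight K H L, α c ∈ A)
    (φ : K → K) : ∑ a ∈ A, φ a * rootExp c β a = ∑ α ∈ H.root, (rootWt α : K) * φ (α c) * rootInt α β := by
  classical
  rw [← Finset.sum_fiberwise_of_maps_to (s := H.root) (t := A) (g := fun α => α c) fun α _ => hA α]
  refine Finset.sum_congr rfl fun a _ => ?_
  rw [rootExp, Int.cast_sum, Finset.mul_sum]
  refine Finset.sum_congr rfl fun α hα => ?_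
  rw [← (Finset.mem_filter.1 hα).2]
  push_cast
  ring

lemma prod_rootExp (c : H) (β : Weight K H L) (A : Finset K) (hA : ∀ α : Weight K H L, α c ∈ A)
    (φ : K → K) (hφ : ∀ a ∈ A, φ a ≠ 0) :
    ∏ a ∈ A, φ a ^ rootExp c β a = ∏ α ∈ H.root, (φ (α c) ^ rootWt α) ^ rootInt α β := by
  classical
  rw [← Finset.prod_fiberwise_of_maps_to (s := H.root) (t := A) (g := fun α => α c) fun α _ => hA α]
  refine Finset.prod_congr rfl fun a ha => ?_
  have key : ∀ s : Finset (Weight K H L), φ a ^ (∑ α ∈ s, (rootWt α : ℤ) * rootInt α β) =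
      ∏ α ∈ s, (φ a ^ rootWt α) ^ rootInt α β := by
    intro s
    induction s using Finset.induction_on with
    | empty => simp
    | insert α s hα ih =>
      rw [Finset.sum_insert hα, Finset.prod_insert hα, zpow_add₀ (hφ a ha), ih, zpow_mul, zpow_natCast]
  rw [rootExp, key]
  refine Finset.prod_congr rfl fun α hα => ?_
  rw [(Finset.mem_filter.1 hα).2]

lemma IsPowerTrace.mem_powerEig (hz : IsPowerTrace (K := K) c z) (hc : c ∈ H) (A : Finset K)
    (hA : ∀ α : Weight K H L, α ⟨c, hc⟩ ∈ A) (β : Weight K H L) (j : ℕ) :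
    β ⟨z j, hz.mem hc j⟩ = (rootDen H : K)⁻¹ * ∑ a ∈ A, a ^ j * rootExp ⟨c, hc⟩ β a := by
  have h0 : (rootDen H : K) ≠ 0 := Nat.cast_ne_zero.2 rootDen_ne_zero
  rw [eq_inv_mul_iff_mul_eq₀ h0, sum_rootExp _ _ _ hA, ← smul_eq_mul, ← Weight.toLinear_apply,
    ← map_smul, hz.eq_sum hc, map_sum]
  refine Finset.sum_congr rfl fun α _ => ?_
  rw [map_smul, Weight.toLinear_apply, apply_coroot, smul_eq_mul]

end Roots

lemma eq_of_forall_sum_pow {K : Type*} [Field K] [CharZero K] {A : Finset K} {m m' : K → ℤ}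
    (h : ∀ j : ℕ, ∑ a ∈ A, a ^ j * (m a : K) = ∑ a ∈ A, a ^ j * (m' a : K)) :
    ∀ a ∈ A, m a = m' a := by
  classical
  have key : ∀ p : Polynomial K, ∑ a ∈ A, p.eval a * ((m a : K) - m' a) = 0 := by
    intro p
    induction p using Polynomial.induction_on' with
    | add p q hp hq => simp [add_mul, Finset.sum_add_distrib, hp, hq]
    | monomial n c =>
      have := h n
      rw [← sub_eq_zero, ← Finset.sum_sub_distrib] at this
      simp only [Polynomial.eval_monomial, mul_assoc, ← Finset.mul_sum]
      rw [show ∑ a ∈ A, a ^ n * ((m a : K) - m' a) = 0 by simpa [mul_sub] using this, mul_zero]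
  intro a ha
  have := key (Lagrange.basis A id a)
  rw [Finset.sum_eq_single a] at this
  · have h1 := Lagrange.eval_basis_self (Function.injective_id.injOn (s := (A : Set K))) ha
    rw [id] at h1
    rw [h1, one_mul, sub_eq_zero] at this
    exact_mod_cast this
  · intro b hb hba
    have := Lagrange.eval_basis_of_ne (v := id) (Ne.symm hba) hb
    rw [id] at this
    rw [this, zero_mul]
  · exact fun h => absurd ha h

section Main

open LieAlgebra LieAlgebra.IsKilling LieModule

variable {K L : Type*} [Field K] [LieRing L] [LieAlgebra K L] [CharZero K] [FiniteDimensional K L]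
  [IsAlgClosed K] [IsKilling K L]

/-- The elements `∏ (1 + t a) ^ (D ad τ_a)` of the torus attached to a diagonalizable `ad c`. -/
theorem exists_elemAut_of_isAdDiag {c : L} (hc : IsAdDiag K c) {z : ℕ → L}
    (hz : IsPowerTrace (K := K) c z) {A : Finset K}
    (hA : ∀ a, Module.End.HasEigenvalue (ad K L c) a → a ∈ A) :
    ∃ D : ℕ, D ≠ 0 ∧ ⨆ m : K → ℤ, powerEig z D A m = ⊤ ∧
      ∀ φ : K → K, (∀ a ∈ A, φ a ≠ 0) → ∃ g ∈ elemAut K L, ∀ m : K → ℤ,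
        ∀ x ∈ powerEig z D A m, g x = (∏ a ∈ A, φ a ^ m a) • x := by
  obtain ⟨H, hH, hcH⟩ := exists_isCartanSubalgebra_mem hc
  have hA' : ∀ α : Weight K H L, α ⟨c, hcH⟩ ∈ A := by
    intro α
    obtain ⟨e, he, he0⟩ := α.exists_ne_zero
    refine hA _ (Module.End.hasEigenvalue_of_hasEigenvector (x := e) ⟨?_, he0⟩)
    rw [Module.End.mem_eigenspace_iff]
    exact lie_eq_smul_of_mem_rootSpace he ⟨c, hcH⟩
  refine ⟨rootDen H, rootDen_ne_zero, ?_, fun φ hφ => ?_⟩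
  · refine eq_top_iff.2 ?_
    rw [← LieSubmodule.iSup_toSubmodule_eq_top.mpr (iSup_genWeightSpace_eq_top' K H L)]
    refine iSup_le fun β x hx => ?_
    refine Submodule.mem_iSup_of_mem (rootExp ⟨c, hcH⟩ β) ?_
    rw [mem_powerEig]
    intro j
    rw [← hz.mem_powerEig hcH A hA' β j]
    exact lie_eq_smul_of_mem_rootSpace hx ⟨z j, _⟩
  · obtain ⟨g, hg, hgx⟩ := exists_root_torus_prod H.root (fun α hα => isNonZero_of_mem_root hα)
      (fun α => φ (α ⟨c, hcH⟩) ^ rootWt α) (fun α _ => pow_ne_zero _ (hφ _ (hA' α)))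
    refine ⟨g, hg, fun m x hx => ?_⟩
    obtain ⟨v, hv, rfl⟩ := exists_sum_root (H := H) x
    rw [map_sum, Finset.smul_sum]
    refine Finset.sum_congr rfl fun β _ => ?_
    by_cases h0 : v β = 0
    · rw [h0, map_zero, smul_zero]
    rw [hgx β _ (hv β), ← prod_rootExp ⟨c, hcH⟩ β A hA' φ hφ]
    congr 1
    refine Finset.prod_congr rfl fun a ha => ?_
    congr 1
    refine eq_of_forall_sum_pow (fun j => ?_) a ha
    have hj := mem_powerEig.1 hx j
    have h0' : (rootDen H : K) ≠ 0 := Nat.cast_ne_zero.2 rootDen_ne_zero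
    have : ∑ β, (β ⟨z j, hz.mem hcH j⟩ - (rootDen H : K)⁻¹ * ∑ a ∈ A, a ^ j * m a) • v β = 0 := by
      simp only [sub_smul, Finset.sum_sub_distrib]
      rw [← Finset.smul_sum, ← hj, sub_eq_zero, lie_sum]
      refine Finset.sum_congr rfl fun β _ => ?_
      exact (lie_eq_smul_of_mem_rootSpace (hv β) ⟨z j, _⟩).symm
    have h1 := eq_zero_of_sum_root (fun β => Submodule.smul_mem _ _ (hv β)) this β
    rw [smul_eq_zero, or_iff_left h0, hz.mem_powerEig hcH A hA' β j, ← mul_sub, mul_eq_zero,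
      or_iff_right (inv_ne_zero h0'), sub_eq_zero] at h1
    exact h1

end Main

/-! ### Polynomial functions and extension of scalars -/

section PolyBaseChange

variable {F k V W : Type*} [Field F] [Field k] [Algebra F k] [CharZero F]
  [AddCommGroup V] [Module F V] [FiniteDimensional F V]
  [AddCommGroup W] [Module F W] [Module k W] [IsScalarTower F k W]
  {ε : V →ₗ[F] W}

lemma charZero_of_algebra (F k : Type*) [Field F] [Field k] [Algebra F k] [CharZero F] : CharZero k :=
  charZero_of_injective_algebraMap (algebraMap F k).injective

/-- `g` is the polynomial over `k` that extends the polynomial `f` over `F`. -/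
def IsPolyExt (ε : V →ₗ[F] W) (f : polyFun F V) (g : polyFun k W) : Prop :=
  ∀ x, (g : W → k) (ε x) = algebraMap F k ((f : V → F) x)

lemma finiteDimensional_of_isBaseChange (hε : IsBaseChange k ε) : FiniteDimensional k W :=
  Module.Finite.of_basis (hε.basis (Module.finBasis F V))

lemma IsPolyExt.mul {f f' : polyFun F V} {g g' : polyFun k W} (h : IsPolyExt ε f g)
    (h' : IsPolyExt ε f' g') : IsPolyExt ε (f * f') (g * g') := fun x => by
  have e1 := h x
  have e2 := h' x
  simp [e1, e2]

lemma isPolyExt_algebraMap (c : F) : IsPolyExt ε (algebraMap F (polyFun F V) c)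
    (algebraMap k (polyFun k W) (algebraMap F k c)) := fun _ => rfl

lemma IsPolyExt.pow {f : polyFun F V} {g : polyFun k W} (h : IsPolyExt ε f g) (n : ℕ) :
    IsPolyExt ε (f ^ n) (g ^ n) := fun x => by
  have e1 := h x
  simp [e1]

lemma IsPolyExt.prod {ι : Type*} (s : Finset ι) {f : ι → polyFun F V} {g : ι → polyFun k W}
    (h : ∀ i ∈ s, IsPolyExt ε (f i) (g i)) : IsPolyExt ε (∏ i ∈ s, f i) (∏ i ∈ s, g i) := by
  classical
  induction s using Finset.induction_on with
  | empty =>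
    rw [Finset.prod_empty, Finset.prod_empty]
    intro x
    simp
  | insert i s hi ih =>
    rw [Finset.prod_insert hi, Finset.prod_insert hi]
    exact (h i (Finset.mem_insert_self _ _)).mul
      (ih fun j hj => h j (Finset.mem_insert_of_mem hj))

lemma eval_repr_isBaseChange (hε : IsBaseChange k ε) {ι : Type*} (b : Module.Basis ι F V)
    (p : MvPolynomial ι k) (x : V) : MvPolynomial.eval ((hε.basis b).repr (ε x)) p =
      MvPolynomial.eval (fun i => algebraMap F k (b.repr x i)) p := by
  congr 2
  funext i
  rw [hε.basis_repr_comp_apply]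

lemma exists_isPolyExt (hε : IsBaseChange k ε) (f : polyFun F V) :
    ∃ g : polyFun k W, IsPolyExt ε f g := by
  have := charZero_of_algebra F k
  let b := Module.finBasis F V
  refine ⟨polyEquiv (hε.basis b) (MvPolynomial.map (algebraMap F k) ((polyEquiv b).symm f)),
    fun x => ?_⟩
  rw [polyEquiv_apply, eval_repr_isBaseChange]
  have h1 : (f : V → F) x = MvPolynomial.eval (b.repr x) ((polyEquiv b).symm f) := by
    rw [← polyEquiv_apply, AlgEquiv.apply_symm_apply]
  rw [h1, MvPolynomial.eval_map]
  generalize (polyEquiv b).symm f = q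
  induction q using MvPolynomial.induction_on with
  | C a => simp
  | add p q hp hq => simp [hp, hq]
  | mul_X p i hp => simp [hp]

/-- A polynomial over `k` is determined by its values at the points defined over `F`. -/
lemma eq_of_forall_base (hε : IsBaseChange k ε) {g g' : polyFun k W}
    (h : ∀ x, (g : W → k) (ε x) = (g' : W → k) (ε x)) : g = g' := by
  have := charZero_of_algebra F k
  let b := Module.finBasis F V
  apply (polyEquiv (hε.basis b)).symm.injective
  apply MvPolynomial.funext_set (fun _ => Set.range (algebraMap F k))
    (fun _ => Set.infinite_range_of_injective (algebraMap F k).injective)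
  intro y hy
  choose u hu using fun i => hy i (Set.mem_univ i)
  have h1 := h (∑ i, u i • b i)
  have h2 : ∀ g : polyFun k W, (g : W → k) (ε (∑ i, u i • b i)) =
      MvPolynomial.eval y ((polyEquiv (hε.basis b)).symm g) := by
    intro g
    conv_lhs => rw [← (polyEquiv (hε.basis b)).apply_symm_apply g]
    rw [polyEquiv_apply, eval_repr_isBaseChange]
    congr 2
    funext i
    rw [← hu]
    congr 1
    simp [Finsupp.single_apply]
  rwa [h2, h2] at h1

lemma exists_base_ne_zero (hε : IsBaseChange k ε) {g : polyFun k W} (hg : g ≠ 0) :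
    ∃ x, (g : W → k) (ε x) ≠ 0 := by
  by_contra h
  push Not at h
  exact hg (eq_of_forall_base hε fun x => by rw [h x]; rfl)

lemma IsPolyExt.unique (hε : IsBaseChange k ε) {f : polyFun F V} {g g' : polyFun k W}
    (h : IsPolyExt ε f g) (h' : IsPolyExt ε f g') : g = g' :=
  eq_of_forall_base hε fun x => by rw [h x, h' x]

lemma IsPolyExt.inj {f f' : polyFun F V} {g : polyFun k W}
    (h : IsPolyExt ε f g) (h' : IsPolyExt ε f' g) : f = f' :=
  polyFun_ext fun x => (algebraMap F k).injective (by rw [← h x, ← h' x])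

lemma IsPolyExt.ne_zero {f : polyFun F V} {g : polyFun k W} (h : IsPolyExt ε f g) (hf : f ≠ 0) :
    g ≠ 0 := by
  rintro rfl
  exact hf (h.inj fun x => by simp)

/-- The conjugate of a polynomial by an automorphism of `k` over `F`. -/
lemma exists_conj (hε : IsBaseChange k ε) (γ : k ≃ₐ[F] k) :
    ∃ φ : polyFun k W ≃+* polyFun k W, ∀ g x, (φ g : W → k) (ε x) = γ ((g : W → k) (ε x)) := by
  have := charZero_of_algebra F k
  let b := Module.finBasis F V
  let e := (polyEquiv (hε.basis b)).toRingEquiv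
  refine ⟨(e.symm.trans (MvPolynomial.mapEquiv _ γ.toRingEquiv)).trans e, fun g x => ?_⟩
  have h1 : ∀ g, (e g : W → k) (ε x) = MvPolynomial.eval (fun i => algebraMap F k (b.repr x i)) g :=
    fun g => by rw [← eval_repr_isBaseChange hε]; exact polyEquiv_apply _ _ _
  conv_rhs => rw [← e.apply_symm_apply g, h1]
  simp only [RingEquiv.trans_apply]
  rw [h1, MvPolynomial.mapEquiv_apply, MvPolynomial.eval_map]
  generalize e.symm g = q
  change MvPolynomial.eval₂ (γ : k →+* k) _ _ = _
  induction q using MvPolynomial.induction_on with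
  | C a => simp
  | add p q hp hq => simp [hp, hq]
  | mul_X p i hp => simp [hp]

variable [Algebra.IsAlgebraic F k] [IsAlgClosed k]

lemma mem_range_of_fixed {a : k} (h : ∀ γ : k ≃ₐ[F] k, γ a = a) : a ∈ Set.range (algebraMap F k) := by
  have : IsAlgClosure F k := ⟨inferInstance, inferInstance⟩
  have : IsGalois F k := IsAlgClosure.isGalois F k
  exact (InfiniteGalois.mem_range_algebraMap_iff_fixed a).2 h

lemma exists_isPolyExt_of_fixed (hε : IsBaseChange k ε) {g : polyFun k W}
    (h : ∀ (γ : k ≃ₐ[F] k) x, γ ((g : W → k) (ε x)) = (g : W → k) (ε x)) :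
    ∃ f : polyFun F V, IsPolyExt ε f g := by
  have := charZero_of_algebra F k
  let b := Module.finBasis F V
  let q := (polyEquiv (hε.basis b)).symm g
  have hq : ∀ γ : k ≃ₐ[F] k, MvPolynomial.map (γ : k →+* k) q = q := by
    intro γ
    apply (polyEquiv (hε.basis b)).injective
    refine eq_of_forall_base hε fun x => ?_
    have h1 : (g : W → k) (ε x) = MvPolynomial.eval (fun i => algebraMap F k (b.repr x i)) q := by
      rw [← eval_repr_isBaseChange hε, ← polyEquiv_apply, AlgEquiv.apply_symm_apply]
    have h2 := h γ x
    rw [polyEquiv_apply, polyEquiv_apply, eval_repr_isBaseChange, eval_repr_isBaseChange, ← h1,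
      ← h2, h1]
    generalize q = q
    induction q using MvPolynomial.induction_on with
    | C a => simp
    | add p q hp hq => simp [hp, hq]
    | mul_X p i hp => simp [hp]
  have hmem : q ∈ Set.range (MvPolynomial.map (σ := Fin (Module.finrank F V)) (algebraMap F k)) := by
    rw [MvPolynomial.mem_range_map_iff_coeffs_subset]
    rintro a ha
    obtain ⟨m, hm, rfl⟩ := MvPolynomial.mem_coeffs_iff.1 ha
    refine mem_range_of_fixed fun γ => ?_
    have := congrArg (MvPolynomial.coeff m) (hq γ)
    rwa [MvPolynomial.coeff_map] at this
  obtain ⟨q₀, hq₀⟩ := hmem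
  refine ⟨polyEquiv b q₀, fun x => ?_⟩
  have h1 : (g : W → k) (ε x) = MvPolynomial.eval (fun i => algebraMap F k (b.repr x i)) q := by
    rw [← eval_repr_isBaseChange hε, ← polyEquiv_apply, AlgEquiv.apply_symm_apply]
  rw [h1, ← hq₀, polyEquiv_apply, MvPolynomial.eval_map]
  generalize q₀ = q₀
  induction q₀ using MvPolynomial.induction_on with
  | C a => simp
  | add p q hp hq => simp [hp, hq]
  | mul_X p i hp => simp [hp]

end PolyBaseChange

/-! ### Lie algebras and extension of scalars -/

section LieBaseChange

variable {F k L : Type*} [Field F] [Field k] [Algebra F k] [LieRing L] [LieAlgebra F L]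

lemma mem_baseChange_of_forall {ι : Type*} {T : ι → L →ₗ[F] L} {x : k ⊗[F] L}
    (hx : ∀ i, (T i).baseChange k x = 0) : x ∈ (⨅ i, LinearMap.ker (T i)).baseChange k := by
  let b := Module.Basis.ofVectorSpace F k
  obtain ⟨c, rfl⟩ := TensorProduct.eq_repr_basis_left b x
  refine Submodule.sum_mem _ fun j _ => Submodule.tmul_mem_baseChange_of_mem _ ?_
  rw [Submodule.mem_iInf]
  intro i
  have h1 : ((c.mapRange (T i) (map_zero _)).sum fun i n => b i ⊗ₜ[F] n) = 0 := by
    rw [Finsupp.sum_mapRange_index (by simp), ← hx i, Finsupp.sum, Finsupp.sum, map_sum]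
    simp
  have h2 := TensorProduct.sum_tmul_basis_left_eq_zero b _ h1
  simpa using DFunLike.congr_fun h2 j

variable (k) in
lemma one_tmul_mem_eig {h x : L} {i : ℤ} (hx : x ∈ eig F h i) :
    (1 : k) ⊗ₜ[F] x ∈ eig k ((1 : k) ⊗ₜ[F] h) i := by
  rw [mem_eig] at hx ⊢
  rw [LieAlgebra.ExtendScalars.bracket_tmul, hx, mul_one, ← TensorProduct.smul_tmul,
    TensorProduct.smul_tmul']
  congr 1
  simp [Algebra.smul_def]

lemma mem_baseChange_eig {ι : Type*} {h : ι → L} {n : ι → ℤ} {x : k ⊗[F] L}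
    (hx : ∀ i, x ∈ eig k ((1 : k) ⊗ₜ[F] h i) (n i)) :
    x ∈ (⨅ i, eig F (h i) (n i)).baseChange k := by
  have : ∀ i, eig F (h i) (n i) = LinearMap.ker (LieAlgebra.ad F L (h i) - (n i : F) • LinearMap.id) :=
    fun i => by
      ext y
      rw [mem_eig, LinearMap.mem_ker, LinearMap.sub_apply, sub_eq_zero]
      rfl
  simp only [this]
  refine mem_baseChange_of_forall fun i => ?_
  have h1 := mem_eig.1 (hx i)
  have h2 : (LieAlgebra.ad F L (h i)).baseChange k x = ⁅(1 : k) ⊗ₜ[F] h i, x⁆ := by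
    have := LieModule.toEnd_baseChange (R := F) k L L (h i)
    exact (LinearMap.congr_fun this x).symm
  rw [LinearMap.baseChange_sub, LinearMap.sub_apply, h2, h1, LinearMap.baseChange_smul,
    LinearMap.baseChange_id, sub_eq_zero]
  change _ = (n i : F) • x
  rw [← algebraMap_smul k (n i : F) x]
  simp

lemma mem_baseChange_eig_inf {h h' : L} {n n' : ℤ} {x : k ⊗[F] L}
    (hx : x ∈ eig k ((1 : k) ⊗ₜ[F] h) n ⊓ eig k ((1 : k) ⊗ₜ[F] h') n') :
    x ∈ (eig F h n ⊓ eig F h' n').baseChange k := by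
  have := mem_baseChange_eig (F := F) (h := fun b : Bool => cond b h h') (n := fun b => cond b n n')
    (x := x) (by rintro (_ | _); exacts [hx.2, hx.1])
  refine Submodule.baseChange_mono (A := k) ?_ this
  exact le_inf (iInf_le_of_le true le_rfl) (iInf_le_of_le false le_rfl)

/-- The map `x ↦ 1 ⊗ x` between subspaces. -/
def tmulMap {V : Submodule F L} {W : Submodule k (k ⊗[F] L)}
    (h : ∀ x ∈ V, (1 : k) ⊗ₜ[F] x ∈ W) : V →ₗ[F] W where
  toFun x := ⟨(1 : k) ⊗ₜ[F] (x : L), h x x.2⟩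
  map_add' x y := Subtype.ext (TensorProduct.tmul_add _ _ _)
  map_smul' c x := Subtype.ext (by
    change (1 : k) ⊗ₜ[F] (c • (x : L)) = c • ((1 : k) ⊗ₜ[F] (x : L))
    rw [TensorProduct.tmul_smul])

lemma isBaseChange_tmulMap {V : Submodule F L} {W : Submodule k (k ⊗[F] L)}
    (h : ∀ x ∈ V, (1 : k) ⊗ₜ[F] x ∈ W) (h' : W ≤ V.baseChange k) :
    IsBaseChange k (tmulMap h) := by
  have hW : V.baseChange k = W := le_antisymm (by
    rw [Submodule.baseChange_eq_span, Submodule.span_le]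
    rintro _ ⟨x, hx, rfl⟩
    exact h x hx) h'
  subst hW
  exact IsBaseChange.of_equiv (Submodule.toBaseChange.toLinearEquiv k V) fun x => rfl

lemma isSl2Triple_tmul {h e f : L} (t : IsSl2Triple h e f) :
    IsSl2Triple ((1 : k) ⊗ₜ[F] h) ((1 : k) ⊗ₜ[F] e) ((1 : k) ⊗ₜ[F] f) where
  h_ne_zero := by
    intro h0
    apply t.h_ne_zero
    refine Module.FaithfullyFlat.tensorProduct_mk_injective (A := F) (B := k) L (by simpa using h0)
  lie_e_f := by rw [LieAlgebra.ExtendScalars.bracket_tmul, t.lie_e_f, mul_one]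
  lie_h_e_nsmul := by
    rw [LieAlgebra.ExtendScalars.bracket_tmul, t.lie_h_e_nsmul, mul_one, TensorProduct.tmul_smul]
  lie_h_f_nsmul := by
    rw [LieAlgebra.ExtendScalars.bracket_tmul, t.lie_h_f_nsmul, mul_one, TensorProduct.tmul_neg,
      TensorProduct.tmul_smul]

variable (k) in
lemma isDiag_tmul {h : L} (hd : IsDiag F h) : IsDiag k ((1 : k) ⊗ₜ[F] h) := by
  refine eq_top_iff.2 ?_
  rw [← Submodule.baseChange_top, ← (show _ = _ from hd), Submodule.baseChange_eq_span,
    Submodule.span_le]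
  rintro _ ⟨x, hx, rfl⟩
  refine Submodule.iSup_induction _ (motive := fun x : L => (1 : k) ⊗ₜ[F] x ∈
    ⨆ i : ℤ, eig k ((1 : k) ⊗ₜ[F] h) i) hx (fun i x hx => ?_) (by simp) fun x y hx hy => ?_
  · exact Submodule.mem_iSup_of_mem i (one_tmul_mem_eig k hx)
  · rw [TensorProduct.tmul_add]
    exact add_mem hx hy

lemma eq_zero_of_mem_baseChange {V : Submodule F L} {x : k ⊗[F] L} (hx : x ∈ V.baseChange k)
    (hV : V = ⊥) : x = 0 := by
  rw [hV, Submodule.baseChange_bot] at hx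
  exact (Submodule.mem_bot k).1 hx

variable (k) in
lemma sys_tmul {p : ℕ} {H0 : L} {H : Fin p → L} (S : Sys F H0 H) :
    Sys k ((1 : k) ⊗ₜ[F] H0) (fun i => (1 : k) ⊗ₜ[F] H i) where
  diag₀ := isDiag_tmul k S.diag₀
  diag i := isDiag_tmul k (S.diag i)
  comm i j := by rw [LieAlgebra.ExtendScalars.bracket_tmul, S.comm, TensorProduct.tmul_zero]
  sum_eq := by rw [← TensorProduct.tmul_sum, S.sum_eq, TensorProduct.tmul_smul]
  triple i := by
    obtain ⟨x, hx, y, hy, t⟩ := S.triple i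
    exact ⟨_, one_tmul_mem_eig k hx, _, one_tmul_mem_eig k hy, isSl2Triple_tmul t⟩
  pos i j x hx hx' hj := eq_zero_of_mem_baseChange (mem_baseChange_eig_inf ⟨hx', hx⟩)
    ((Submodule.eq_bot_iff _).2 fun y hy => S.pos i j y hy.2 hy.1 hj)
  neg i j x hx hx' hj := eq_zero_of_mem_baseChange (mem_baseChange_eig_inf ⟨hx', hx⟩)
    ((Submodule.eq_bot_iff _).2 fun y hy => S.neg i j y hy.2 hy.1 hj)

lemma partialSum_tmul {p : ℕ} (H : Fin p → L) (j : ℕ) :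
    partialSum (fun i => (1 : k) ⊗ₜ[F] H i) j = (1 : k) ⊗ₜ[F] partialSum H j :=
  (TensorProduct.tmul_sum _ _ _).symm

lemma nilT_baseChange_le {p : ℕ} {H0 : L} {H : Fin p → L} :
    nilT k ((1 : k) ⊗ₜ[F] H0) (fun i => (1 : k) ⊗ₜ[F] H i) ≤ (nilT F H0 H).baseChange k := by
  refine iSup_le fun m x hx => ?_
  have := mem_baseChange_eig (F := F) (h := fun o : Option (Fin p) => o.elim H0 H)
    (n := fun o => o.elim 0 m.1) (x := x) (by
      rintro (_ | i)
      · exact hx.1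
      · exact (Submodule.mem_iInf _).1 hx.2 i)
  refine Submodule.baseChange_mono (A := k) ?_ this
  refine le_trans ?_ (le_iSup (fun m : {m : Fin p → ℤ // IsPositiveWeight m} =>
    eig F H0 0 ⊓ ⨅ i, eig F (H i) (m.1 i)) m)
  exact le_inf (iInf_le_of_le none le_rfl) (le_iInf fun i => iInf_le_of_le (some i) le_rfl)

lemma one_tmul_mem_nilT {p : ℕ} {H0 : L} {H : Fin p → L} {x : L} (hx : x ∈ nilT F H0 H) :
    (1 : k) ⊗ₜ[F] x ∈ nilT k ((1 : k) ⊗ₜ[F] H0) (fun i => (1 : k) ⊗ₜ[F] H i) := by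
  refine Submodule.iSup_induction _ (motive := fun x : L => (1 : k) ⊗ₜ[F] x ∈
    nilT k ((1 : k) ⊗ₜ[F] H0) (fun i => (1 : k) ⊗ₜ[F] H i)) hx (fun m x hx => ?_) (by simp)
    fun x y hx hy => ?_
  · refine Submodule.mem_iSup_of_mem m ⟨one_tmul_mem_eig k hx.1, ?_⟩
    rw [SetLike.mem_coe, Submodule.mem_iInf]
    exact fun i => one_tmul_mem_eig k ((Submodule.mem_iInf _).1 hx.2 i)
  · rw [TensorProduct.tmul_add]
    exact add_mem hx hy

lemma baseChange_mem_lieAut {g : L ≃ₗ[F] L} (hg : g ∈ lieAut F L) :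
    LinearEquiv.baseChange F k L L g ∈ lieAut k (k ⊗[F] L) := by
  intro x y
  induction x using TensorProduct.induction_on with
  | zero => simp
  | add x x' hx hx' => rw [add_lie, map_add, hx, hx', map_add, add_lie]
  | tmul a x =>
    induction y using TensorProduct.induction_on with
    | zero => simp
    | add y y' hy hy' => rw [lie_add, map_add, hy, hy', map_add, lie_add]
    | tmul b y =>
      simp only [LieAlgebra.ExtendScalars.bracket_tmul, LinearEquiv.baseChange_tmul]
      rw [hg]

lemma ad_tmul (X : L) : LieAlgebra.ad k (k ⊗[F] L) ((1 : k) ⊗ₜ[F] X) =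
    (LieAlgebra.ad F L X).baseChange k :=
  LieModule.toEnd_baseChange (R := F) k L L X

lemma isNilpotent_ad_tmul {X : L} (hX : IsNilpotent (LieAlgebra.ad F L X)) :
    IsNilpotent (LieAlgebra.ad k (k ⊗[F] L) ((1 : k) ⊗ₜ[F] X)) := by
  obtain ⟨n, hn⟩ := hX
  exact ⟨n, by rw [ad_tmul, ← LinearMap.baseChange_pow, hn, LinearMap.baseChange_zero]⟩

variable [CharZero F] [CharZero k] [FiniteDimensional F L]

lemma baseChange_expE {X : L} (hX : IsNilpotent (LieAlgebra.ad F L X)) :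
    LinearEquiv.baseChange F k L L (expE X hX) =
      expE ((1 : k) ⊗ₜ[F] X) (isNilpotent_ad_tmul hX) := by
  have hn := hX
  obtain ⟨n, hn⟩ := hn
  apply LinearEquiv.toLinearMap_injective
  refine TensorProduct.AlgebraTensorModule.curry_injective ?_
  ext v
  change (LinearEquiv.baseChange F k L L (expE X hX)) ((1 : k) ⊗ₜ[F] v) =
    expE ((1 : k) ⊗ₜ[F] X) (isNilpotent_ad_tmul hX) ((1 : k) ⊗ₜ[F] v)
  rw [LinearEquiv.baseChange_tmul, expE_apply (N := n) hX (by rw [hn]; rfl), expE_apply (N := n) _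
    (by rw [ad_tmul, ← LinearMap.baseChange_pow, hn, LinearMap.baseChange_zero]; rfl),
    TensorProduct.tmul_sum]
  refine Finset.sum_congr rfl fun i _ => ?_
  rw [ad_tmul, ← LinearMap.baseChange_pow, LinearMap.baseChange_tmul, TensorProduct.tmul_smul,
    ← algebraMap_smul k ((i.factorial : F)⁻¹)]
  simp

lemma baseChange_mem_elemAut {g : L ≃ₗ[F] L} (hg : g ∈ elemAut F L) :
    LinearEquiv.baseChange F k L L g ∈ elemAut k (k ⊗[F] L) := by
  induction hg using Subgroup.closure_induction with
  | mem g hg =>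
    obtain ⟨X, -, hX, h⟩ := hg
    rw [eq_expE hX h, baseChange_expE]
    exact expE_mem_elemAut _
  | one => rw [LinearEquiv.baseChange_one]; exact one_mem _
  | mul a b _ _ ha hb => rw [LinearEquiv.baseChange_mul]; exact mul_mem ha hb
  | inv a _ ha => rw [LinearEquiv.baseChange_inv]; exact inv_mem ha

lemma elemAut_le_aut0 : elemAut F L ≤ aut0 F L :=
  fun _ hg => ⟨elemAut_le_lieAut hg, haveI := charZero_of_algebra F (AlgebraicClosure F)
    baseChange_mem_elemAut hg⟩

end LieBaseChange

/-! ### Galois descent -/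

section Galois

variable {F k L : Type*} [Field F] [Field k] [Algebra F k] [LieRing L] [LieAlgebra F L]

/-- The semilinear action of the Galois group on `k ⊗ L`. -/
def galAct (γ : k ≃ₐ[F] k) : k ⊗[F] L →ₗ[F] k ⊗[F] L :=
  (γ.toLinearMap).rTensor L

@[simp] lemma galAct_tmul (γ : k ≃ₐ[F] k) (a : k) (x : L) :
    galAct γ (a ⊗ₜ[F] x) = γ a ⊗ₜ[F] x := rfl

lemma galAct_smul (γ : k ≃ₐ[F] k) (a : k) (x : k ⊗[F] L) : galAct γ (a • x) = γ a • galAct γ x := by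
  induction x using TensorProduct.induction_on with
  | zero => simp
  | add x y hx hy => simp [hx, hy]
  | tmul b x => simp [TensorProduct.smul_tmul']

lemma galAct_lie (γ : k ≃ₐ[F] k) (z : L) (x : k ⊗[F] L) :
    galAct γ ⁅(1 : k) ⊗ₜ[F] z, x⁆ = ⁅(1 : k) ⊗ₜ[F] z, galAct γ x⁆ := by
  induction x using TensorProduct.induction_on with
  | zero => simp
  | add x y hx hy => simp [hx, hy]
  | tmul b x => simp [LieAlgebra.ExtendScalars.bracket_tmul]

lemma galAct_symm (γ : k ≃ₐ[F] k) (x : k ⊗[F] L) : galAct γ.symm (galAct γ x) = x := by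
  induction x using TensorProduct.induction_on with
  | zero => simp
  | add x y hx hy => simp [hx, hy]
  | tmul b x => simp

lemma one_tmul_injective : Function.Injective fun x : L => (1 : k) ⊗ₜ[F] x :=
  Module.FaithfullyFlat.tensorProduct_mk_injective (A := F) (B := k) L

variable [FiniteDimensional F L] [CharZero F] [Algebra.IsAlgebraic F k] [IsAlgClosed k]

lemma exists_eq_one_tmul {x : k ⊗[F] L} (hx : ∀ γ : k ≃ₐ[F] k, galAct γ x = x) :
    ∃ y : L, x = (1 : k) ⊗ₜ[F] y := by
  let b := Module.finBasis F L
  let b' := b.baseChange k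
  have hrepr : ∀ (γ : k ≃ₐ[F] k) (x : k ⊗[F] L) i, b'.repr (galAct γ x) i = γ (b'.repr x i) := by
    intro γ x i
    induction x using TensorProduct.induction_on with
    | zero => simp
    | add x y hx hy => simp [hx, hy]
    | tmul a x => simp [b', Module.Basis.baseChange_repr_tmul]
  have : ∀ i, b'.repr x i ∈ Set.range (algebraMap F k) := fun i =>
    mem_range_of_fixed fun γ => by rw [← hrepr, hx]
  choose c hc using this
  refine ⟨∑ i, c i • b i, ?_⟩
  rw [← b'.sum_repr x, TensorProduct.tmul_sum]
  refine Finset.sum_congr rfl fun i _ => ?_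
  rw [← hc, TensorProduct.tmul_smul, algebraMap_smul]
  simp [b']

lemma exists_baseChange_eq {T : k ⊗[F] L →ₗ[k] k ⊗[F] L}
    (hT : ∀ (γ : k ≃ₐ[F] k) x, T (galAct γ x) = galAct γ (T x)) :
    ∃ T₀ : L →ₗ[F] L, ∀ x : L, T ((1 : k) ⊗ₜ[F] x) = (1 : k) ⊗ₜ[F] T₀ x := by
  have : ∀ x : L, ∃ y : L, T ((1 : k) ⊗ₜ[F] x) = (1 : k) ⊗ₜ[F] y := fun x =>
    exists_eq_one_tmul fun γ => by rw [← hT, galAct_tmul, map_one]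
  choose T₀ h using this
  refine ⟨{ toFun := T₀, map_add' := fun x y => ?_, map_smul' := fun c x => ?_ }, h⟩
  · apply one_tmul_injective (F := F) (k := k)
    simp only [TensorProduct.tmul_add, ← h, map_add]
  · apply one_tmul_injective (F := F) (k := k)
    simp only [RingHom.id_apply, TensorProduct.tmul_smul, ← h]
    rw [← algebraMap_smul k c, map_smul, algebraMap_smul]

lemma exists_linearEquiv_baseChange_eq {g : k ⊗[F] L ≃ₗ[k] k ⊗[F] L}
    (hg : ∀ (γ : k ≃ₐ[F] k) x, g (galAct γ x) = galAct γ (g x)) :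
    ∃ g₀ : L ≃ₗ[F] L, LinearEquiv.baseChange F k L L g₀ = g := by
  obtain ⟨T, hT⟩ := exists_baseChange_eq (T := g.toLinearMap) hg
  obtain ⟨T', hT'⟩ := exists_baseChange_eq (T := g.symm.toLinearMap) (fun γ x => by
    apply g.injective
    change g (g.symm _) = g (galAct γ (g.symm x))
    rw [hg, g.apply_symm_apply, g.apply_symm_apply])
  refine ⟨LinearEquiv.ofLinearMap T T' (LinearMap.ext fun x => ?_) (LinearMap.ext fun x => ?_), ?_⟩
  · apply one_tmul_injective (F := F) (k := k)
    change (1 : k) ⊗ₜ[F] T (T' x) = (1 : k) ⊗ₜ[F] x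
    rw [← hT, ← hT']
    exact g.apply_symm_apply _
  · apply one_tmul_injective (F := F) (k := k)
    change (1 : k) ⊗ₜ[F] T' (T x) = (1 : k) ⊗ₜ[F] x
    rw [← hT', ← hT]
    exact g.symm_apply_apply _
  · apply LinearEquiv.toLinearMap_injective
    refine TensorProduct.AlgebraTensorModule.curry_injective ?_
    ext x
    exact (hT x).symm

lemma mem_lieAut_of_baseChange {g : L ≃ₗ[F] L}
    (hg : LinearEquiv.baseChange F k L L g ∈ lieAut k (k ⊗[F] L)) : g ∈ lieAut F L := by
  intro x y
  apply one_tmul_injective (F := F) (k := k)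
  have := hg ((1 : k) ⊗ₜ[F] x) ((1 : k) ⊗ₜ[F] y)
  simpa [LieAlgebra.ExtendScalars.bracket_tmul] using this

end Galois

section Torus

variable {F k L : Type*} [Field F] [Field k] [Algebra F k] [LieRing L] [LieAlgebra F L]
  [FiniteDimensional F L] [CharZero F]

lemma killingForm_tmul (x y : L) : killingForm k (k ⊗[F] L) ((1 : k) ⊗ₜ[F] x) ((1 : k) ⊗ₜ[F] y) =
    algebraMap F k (killingForm F L x y) := by
  have := LieModule.traceForm_baseChange (R := F) (L := L) (M := L) k
  change LieModule.traceForm k (k ⊗[F] L) (k ⊗[F] L) _ _ = _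
  rw [this]
  simp [Algebra.algebraMap_eq_smul_one]

lemma IsPowerTrace.baseChange {c : L} {z : ℕ → L} (hz : IsPowerTrace (K := F) c z) :
    IsPowerTrace (K := k) ((1 : k) ⊗ₜ[F] c) (fun j => (1 : k) ⊗ₜ[F] z j) := by
  intro j y
  induction y using TensorProduct.induction_on with
  | zero => simp
  | add x y hx hy => rw [map_add, hx, hy, map_add, add_mul, map_add]
  | tmul a y =>
    have h1 : a ⊗ₜ[F] y = a • ((1 : k) ⊗ₜ[F] y) := by simp [TensorProduct.smul_tmul']
    rw [h1, map_smul, map_smul, smul_mul_assoc, map_smul, killingForm_tmul, hz, ad_tmul, ad_tmul,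
      ← LinearMap.baseChange_pow, ← LinearMap.baseChange_mul, LinearMap.trace_baseChange]

variable [Algebra.IsAlgebraic F k] [IsAlgClosed k] [LieAlgebra.IsKilling F L]
  [LieAlgebra.IsKilling k (k ⊗[F] L)]

lemma exists_rational_of_isAdDiag {c : L} (hc : IsAdDiag k ((1 : k) ⊗ₜ[F] c)) :
    ∃ (z : ℕ → k ⊗[F] L) (A : Finset k) (D : ℕ), IsPowerTrace (K := k) ((1 : k) ⊗ₜ[F] c) z ∧
      D ≠ 0 ∧ ⨆ m : k → ℤ, powerEig z D A m = ⊤ ∧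
      ∀ t : F, (∀ a ∈ A, 1 + algebraMap F k t * a ≠ 0) → ∃ g : L ≃ₗ[F] L,
        LinearEquiv.baseChange F k L L g ∈ elemAut k (k ⊗[F] L) ∧ g ∈ lieAut F L ∧
        ∀ m : k → ℤ, ∀ x ∈ powerEig z D A m, LinearEquiv.baseChange F k L L g x =
          (∏ a ∈ A, (1 + algebraMap F k t * a) ^ m a) • x := by
  classical
  have := charZero_of_algebra F k
  obtain ⟨z, hz⟩ := IsPowerTrace.exists (K := F) c
  have hz' := hz.baseChange (k := k)
  let A : Finset k := (LieAlgebra.ad k (k ⊗[F] L) ((1 : k) ⊗ₜ[F] c)).charpoly.roots.toFinset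
  have hA : ∀ a, a ∈ A ↔
      Module.End.HasEigenvalue (LieAlgebra.ad k (k ⊗[F] L) ((1 : k) ⊗ₜ[F] c)) a := by
    intro a
    rw [Module.End.hasEigenvalue_iff_isRoot_charpoly, Multiset.mem_toFinset, Polynomial.mem_roots
      (LinearMap.charpoly_monic _).ne_zero]
  obtain ⟨D, hD, htop, hex⟩ := exists_elemAut_of_isAdDiag hc hz' fun a => (hA a).2
  refine ⟨_, A, D, hz', hD, htop, fun t ht => ?_⟩
  obtain ⟨g, hg, hgx⟩ := hex (fun a => 1 + algebraMap F k t * a) ht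
  have hAγ : ∀ (γ : k ≃ₐ[F] k) a, a ∈ A → γ a ∈ A := by
    intro γ a ha
    obtain ⟨v, hv, hv0⟩ := ((hA a).1 ha).exists_hasEigenvector
    refine (hA _).2 (Module.End.hasEigenvalue_of_hasEigenvector (x := galAct γ v) ⟨?_, fun h0 => hv0 ?_⟩)
    · rw [Module.End.mem_eigenspace_iff] at hv ⊢
      rw [LieAlgebra.ad_apply] at hv ⊢
      rw [← galAct_lie, hv, galAct_smul]
    · rw [← galAct_symm γ v, h0, map_zero]
  have hcomm : ∀ (γ : k ≃ₐ[F] k) x, g (galAct γ x) = galAct γ (g x) := by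
    intro γ x
    have hx : x ∈ ⨆ m : k → ℤ, powerEig (fun j => (1 : k) ⊗ₜ[F] z j) D A m := htop ▸ Submodule.mem_top
    refine Submodule.iSup_induction _ (motive := fun x => g (galAct γ x) = galAct γ (g x)) hx
      (fun m x hx => ?_) (by simp) fun x y hx hy => by simp [hx, hy]
    have hbij : ∀ φ : k → k, ∑ b ∈ A, φ b * (m (γ.symm b) : k) = ∑ a ∈ A, φ (γ a) * (m a : k) := by
      intro φ
      symm
      refine Finset.sum_bij (fun a _ => γ a) (fun a ha => hAγ γ a ha)
        (fun a _ b _ h => γ.injective h) (fun b hb => ⟨γ.symm b, hAγ γ.symm b hb, by simp⟩) ?_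
      intro a _
      simp
    have hmem : galAct γ x ∈ powerEig (fun j => (1 : k) ⊗ₜ[F] z j) D A (fun b => m (γ.symm b)) := by
      rw [mem_powerEig] at hx ⊢
      intro j
      rw [← galAct_lie, hx j, galAct_smul, hbij fun b => b ^ j]
      simp
    rw [hgx _ _ hmem, hgx _ _ hx, galAct_smul, map_prod]
    congr 1
    symm
    refine Finset.prod_bij (fun a _ => γ a) (fun a ha => hAγ γ a ha)
      (fun a _ b _ h => γ.injective h) (fun b hb => ⟨γ.symm b, hAγ γ.symm b hb, by simp⟩) ?_
    intro a _
    simp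
  obtain ⟨g₀, rfl⟩ := exists_linearEquiv_baseChange_eq hcomm
  exact ⟨g₀, hg, mem_lieAut_of_baseChange (elemAut_le_lieAut hg), hgx⟩

end Torus

/-! ### From relative invariance under a group to infinitesimal relative invariance -/

section Curves

variable {K V : Type*} [Field K] [CharZero K] [AddCommGroup V] [Module K V] [FiniteDimensional K V]

lemma exists_polynomial_curve {ι : Type*} (s : Finset ι) (q : ι → Polynomial K) (v : ι → V)
    (f : polyFun K V) : ∃ P : Polynomial K, ∀ t, (f : V → K) (∑ i ∈ s, (q i).eval t • v i) = P.eval t ∧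
      dd f (∑ i ∈ s, (q i).eval t • v i) (∑ i ∈ s, (q i).derivative.eval t • v i) =
        P.derivative.eval t := by
  refine exists_polynomial_comp (fun l => ⟨∑ i ∈ s, q i * Polynomial.C (l (v i)), fun t => ?_⟩) f
  constructor
  · simp [Polynomial.eval_finsetSum]
  · simp [Polynomial.eval_finsetSum]

lemma dd_self_of_homogeneous {f : polyFun K V} {n : ℕ}
    (hf : ∀ (t : K) (x : V), (f : V → K) (t • x) = t ^ n * (f : V → K) x) (x : V) :
    dd f x x = n * (f : V → K) x := by
  obtain ⟨P, hP⟩ := exists_polynomial_curve (Finset.univ : Finset Unit) (fun _ => Polynomial.X)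
    (fun _ => x) f
  have h1 : P = Polynomial.X ^ n * Polynomial.C ((f : V → K) x) := Polynomial.funext fun t => by
    rw [← (hP t).1]
    simp [hf]
    ring
  have h2 := (hP 1).2
  rw [h1] at h2
  simp [Polynomial.derivative_X_pow] at h2
  rw [h2]
  ring

/-- If the values of `f` along two polynomial curves through `x` and `y` are proportional to `f x`
and `f y`, then so are the derivatives. -/
lemma dd_mul_eq_of_curves {f : polyFun K V} {ι : Type*} (s : Finset ι) (q : ι → Polynomial K)
    (v w : ι → V) {S : Set K} (hS : S.Infinite) {a b : K}
    (h : ∀ t ∈ S, (f : V → K) (∑ i ∈ s, (q i).eval t • v i) * b =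
      (f : V → K) (∑ i ∈ s, (q i).eval t • w i) * a) (t : K) :
    dd f (∑ i ∈ s, (q i).eval t • v i) (∑ i ∈ s, (q i).derivative.eval t • v i) * b =
      dd f (∑ i ∈ s, (q i).eval t • w i) (∑ i ∈ s, (q i).derivative.eval t • w i) * a := by
  obtain ⟨P, hP⟩ := exists_polynomial_curve s q v f
  obtain ⟨R, hR⟩ := exists_polynomial_curve s q w f
  have h1 : P * Polynomial.C b = R * Polynomial.C a := by
    refine Polynomial.eq_of_infinite_eval_eq _ _ (hS.mono fun t ht => ?_)
    simp only [Set.mem_ofPred_eq, Polynomial.eval_mul, Polynomial.eval_C]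
    rw [← (hP t).1, ← (hR t).1]
    exact h t ht
  have h2 := congrArg (fun P => P.derivative.eval t) h1
  simp only [Polynomial.derivative_mul, Polynomial.derivative_C, mul_zero, add_zero,
    Polynomial.eval_mul, Polynomial.eval_C] at h2
  rw [(hP t).2, (hR t).2, h2]

lemma exists_homogeneous {f : polyFun K V} {S : Set K} (hS : S.Infinite)
    (hf : ∀ t ∈ S, ∃ c, ∀ x, (f : V → K) (t ^ 2 • x) = c * (f : V → K) x) :
    ∃ n : ℕ, ∀ (t : K) (x : V), (f : V → K) (t • x) = t ^ n * (f : V → K) x := by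
  by_cases hne : IsNonconstant f
  · have hf0 : f ≠ 0 := by simpa using hne 0
    obtain ⟨y, hy⟩ := exists_apply_ne_zero hf0
    have key : ∀ x, dd f x x = (dd f y y / (f : V → K) y) * (f : V → K) x := by
      intro x
      have := dd_mul_eq_of_curves (f := f) (Finset.univ : Finset Unit)
        (fun _ => Polynomial.X ^ 2) (fun _ => x) (fun _ => y) hS (a := (f : V → K) x)
        (b := (f : V → K) y) (fun t ht => by
          obtain ⟨c, hc⟩ := hf t ht
          simp only [Finset.univ_unique, Finset.sum_singleton, Polynomial.eval_pow,
            Polynomial.eval_X, hc]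
          ring) 1
      simp [map_smul] at this
      field_simp
      have h2 : (2 : K) ≠ 0 := two_ne_zero
      apply mul_left_cancel₀ h2
      linear_combination this
    obtain ⟨n, -, -, hn⟩ := exists_nat_euler key hne
    exact ⟨n, hn⟩
  · unfold IsNonconstant at hne
    push Not at hne
    obtain ⟨c, rfl⟩ := hne
    exact ⟨0, fun t x => by simp⟩

end Curves

lemma derivative_prod_linear {K : Type*} [Field K] (A : Finset K) (n : K → ℕ) :
    (∏ a ∈ A, (1 + Polynomial.C a * Polynomial.X) ^ n a : Polynomial K).derivative.eval 0 =
      ∑ a ∈ A, a * n a ∧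
    (∏ a ∈ A, (1 + Polynomial.C a * Polynomial.X) ^ n a : Polynomial K).eval 0 = 1 := by
  classical
  induction A using Finset.induction_on with
  | empty => simp
  | insert a A ha ih =>
    rw [Finset.prod_insert ha, Finset.sum_insert ha, Polynomial.derivative_mul, Polynomial.eval_add,
      Polynomial.eval_mul, Polynomial.eval_mul, Polynomial.eval_mul, ih.1, ih.2]
    simp only [Polynomial.derivative_pow, Polynomial.derivative_add, Polynomial.derivative_one,
      Polynomial.derivative_C_mul, Polynomial.derivative_X, Polynomial.eval_mul, Polynomial.eval_C,
      Polynomial.eval_pow, Polynomial.eval_add, Polynomial.eval_one, Polynomial.eval_X, mul_zero,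
      add_zero, zero_add, one_pow, mul_one, one_mul, and_true]
    ring

section Bridge

variable {F k L : Type*} [Field F] [Field k] [Algebra F k] [LieRing L] [LieAlgebra F L]
  [FiniteDimensional F L] [CharZero F]

lemma infinite_good (A : Finset k) :
    (algebraMap F k '' {t : F | ∀ a ∈ A, 1 + algebraMap F k t * a ≠ 0}).Infinite := by
  refine Set.Infinite.image (algebraMap F k).injective.injOn ?_
  have hfin : {t : F | ∃ a ∈ A, 1 + algebraMap F k t * a = 0}.Finite := by
    have : {t : F | ∃ a ∈ A, 1 + algebraMap F k t * a = 0} =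
        ⋃ a ∈ A, {t : F | 1 + algebraMap F k t * a = 0} := by ext; simp
    rw [this]
    refine Set.Finite.biUnion A.finite_toSet fun a _ => Set.Subsingleton.finite ?_
    intro t ht t' ht'
    have ha : a ≠ 0 := by
      rintro rfl
      simp at ht
    apply (algebraMap F k).injective
    apply mul_right_cancel₀ ha
    simp only [Set.mem_ofPred_eq] at ht ht'
    linear_combination ht - ht'
  have := hfin.infinite_compl
  convert this using 1
  ext t
  simp

variable [CharZero k] [Algebra.IsAlgebraic F k] [IsAlgClosed k] [LieAlgebra.IsKilling F L]
  [LieAlgebra.IsKilling k (k ⊗[F] L)] {W : Submodule k (k ⊗[F] L)} {f : polyFun k W}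

lemma infRel_of_isAdDiag {s : Set L} {n : ℕ}
    (hn : ∀ (t : k) (x : W), (f : W → k) (t • x) = t ^ n * (f : W → k) x)
    (hinv : ∀ g : L ≃ₗ[F] L, g ∈ lieAut F L →
      LinearEquiv.baseChange F k L L g ∈ elemAut k (k ⊗[F] L) → (∀ u ∈ s, g u = u) →
        ∃ c, ∀ x : W, ∃ y : W, (y : k ⊗[F] L) = LinearEquiv.baseChange F k L L g x ∧
          (f : W → k) y = c * (f : W → k) x)
    {c : L} (hc : IsAdDiag k ((1 : k) ⊗ₜ[F] c)) (hs : ∀ u ∈ s, ⁅u, c⁆ = 0) :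
    ∃ e, InfRel f ((1 : k) ⊗ₜ[F] c) e := by
  classical
  by_cases hf0 : f = 0
  · subst hf0
    exact ⟨0, by simpa using infRel_algebraMap (W := W) (X := (1 : k) ⊗ₜ[F] c) (0 : k)⟩
  obtain ⟨x₀, hx₀⟩ := exists_apply_ne_zero hf0
  obtain ⟨z, A, D, hz, hD, htop, hg⟩ := exists_rational_of_isAdDiag hc
  obtain ⟨π, hπ⟩ := W.subtype.exists_leftInverse_of_injective (Submodule.ker_subtype W)
  have hπ' : ∀ x : W, π x = x := fun x => LinearMap.congr_fun hπ x
  let X := (1 : k) ⊗ₜ[F] c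
  refine ⟨dd f x₀ (π ⁅X, (x₀ : k ⊗[F] L)⁆) / (f : W → k) x₀, fun x w hw => ?_⟩
  have hdec : ∀ x : k ⊗[F] L, ∃ v : (k → ℤ) →₀ k ⊗[F] L, (∀ m, v m ∈ powerEig z D A m) ∧
      (v.sum fun _ xi => xi) = x := fun x =>
    (Submodule.mem_iSup_iff_exists_finsupp _ x).1 (htop ▸ Submodule.mem_top)
  obtain ⟨v, hv, hvx⟩ := hdec x
  obtain ⟨v₀, hv₀, hvx₀⟩ := hdec x₀
  let I := v.support ∪ v₀.support
  have hsum : ∀ u : (k → ℤ) →₀ k ⊗[F] L, u.support ⊆ I → (u.sum fun _ xi => xi) = ∑ m ∈ I, u m :=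
    fun u hu => Finsupp.sum_of_support_subset _ hu _ (by simp)
  rw [hsum v Finset.subset_union_left] at hvx
  rw [hsum v₀ Finset.subset_union_right] at hvx₀
  let N : ℕ := ∑ m ∈ I, ∑ a ∈ A, (m a).natAbs
  have hN : ∀ m ∈ I, ∀ a ∈ A, 0 ≤ (N : ℤ) + m a := by
    intro m hm a ha
    have h1 : (m a).natAbs ≤ N := (Finset.single_le_sum (f := fun a => (m a).natAbs)
      (fun _ _ => Nat.zero_le _) ha).trans (Finset.single_le_sum
        (f := fun m : k → ℤ => ∑ a ∈ A, (m a).natAbs) (fun _ _ => Nat.zero_le _) hm)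
    omega
  let q : (k → ℤ) → Polynomial k := fun m =>
    ∏ a ∈ A, (1 + Polynomial.C a * Polynomial.X) ^ ((N : ℤ) + m a).toNat
  let fM : polyFun k (k ⊗[F] L) := polyComp π f
  let σ : k := ∑ a ∈ A, a
  have hq0 : ∀ m, (q m).eval 0 = 1 := fun m => (derivative_prod_linear A _).2
  have hvel : ∀ (u : (k → ℤ) → k ⊗[F] L), (∀ m, u m ∈ powerEig z D A m) →
      ∑ m ∈ I, (q m).derivative.eval 0 • u m =
        ((N : k) * σ) • (∑ m ∈ I, u m) + (D : k) • ⁅X, ∑ m ∈ I, u m⁆ := by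
    intro u hu
    rw [Finset.smul_sum, lie_sum, Finset.smul_sum, ← Finset.sum_add_distrib]
    refine Finset.sum_congr rfl fun m hm => ?_
    have h1 := mem_powerEig.1 (hu m) 1
    rw [hz.eq_one] at h1
    have hD' : (D : k) ≠ 0 := Nat.cast_ne_zero.2 hD
    rw [h1, smul_smul, ← add_smul, mul_inv_cancel_left₀ hD', (derivative_prod_linear A _).1]
    congr 1
    simp only [σ]
    rw [Finset.mul_sum, ← Finset.sum_add_distrib]
    refine Finset.sum_congr rfl fun a ha => ?_
    have : ((((N : ℤ) + m a).toNat : ℕ) : k) = (N : k) + m a := by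
      have h2 := Int.toNat_of_nonneg (hN m hm a ha)
      have h3 := congrArg (Int.cast : ℤ → k) h2
      push_cast at h3
      simpa using h3
    rw [this]
    ring
  have hkey := dd_mul_eq_of_curves (f := fM) I q v v₀ (infinite_good (F := F) A)
    (a := (f : W → k) x) (b := (f : W → k) x₀) ?_ 0
  · simp only [hq0, one_smul] at hkey
    rw [hvel v hv, hvel v₀ hv₀, hvx, hvx₀] at hkey
    simp only [fM, dd_polyComp, map_add, map_smul, hπ', dd_self_of_homogeneous hn, smul_eq_mul] at hkey
    have hw' : w = π ⁅X, (x : k ⊗[F] L)⁆ := by rw [← hw, hπ']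
    rw [hw']
    have hD' : (D : k) ≠ 0 := Nat.cast_ne_zero.2 hD
    field_simp
    apply mul_left_cancel₀ hD'
    linear_combination hkey
  · rintro _ ⟨t, ht, rfl⟩
    obtain ⟨g, hge, hgl, hgx⟩ := hg t ht
    obtain ⟨e, he⟩ := hinv g hgl hge (fun u hu => by
      have h1 := hgx 0 _ (hz.mem_powerEig_zero (u := (1 : k) ⊗ₜ[F] u) (by
        rw [LieAlgebra.ExtendScalars.bracket_tmul, hs u hu, TensorProduct.tmul_zero]) D A)
      apply one_tmul_injective (F := F) (k := k)
      simpa using h1)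
    let lam : k := ∏ a ∈ A, (1 + algebraMap F k t * a) ^ N
    have hcurve : ∀ (u : (k → ℤ) → k ⊗[F] L), (∀ m, u m ∈ powerEig z D A m) →
        ∑ m ∈ I, (q m).eval (algebraMap F k t) • u m =
          lam • LinearEquiv.baseChange F k L L g (∑ m ∈ I, u m) := by
      intro u hu
      rw [map_sum, Finset.smul_sum]
      refine Finset.sum_congr rfl fun m hm => ?_
      rw [hgx m _ (hu m), smul_smul]
      congr 1
      simp only [q, lam, Polynomial.eval_prod, ← Finset.prod_mul_distrib]
      refine Finset.prod_congr rfl fun a ha => ?_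
      have h0 := ht a ha
      simp only [Polynomial.eval_pow, Polynomial.eval_add, Polynomial.eval_one, Polynomial.eval_mul,
        Polynomial.eval_C, Polynomial.eval_X]
      rw [mul_comm a, ← zpow_natCast _ (Int.toNat _), Int.toNat_of_nonneg (hN m hm a ha),
        zpow_add₀ h0, zpow_natCast]
    have hval : ∀ x : W, (fM : k ⊗[F] L → k) (lam • LinearEquiv.baseChange F k L L g x) =
        lam ^ n * (e * (f : W → k) x) := by
      intro x
      obtain ⟨y, hy, hfy⟩ := he x
      rw [← hy]
      change (polyComp π f : k ⊗[F] L → k) _ = _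
      rw [polyComp_apply, map_smul, hπ', hn, hfy]
    rw [hcurve v hv, hcurve v₀ hv₀, hvx, hvx₀, hval, hval]
    ring

lemma infRel_of_isNilpotent {X : k ⊗[F] L} (hX : ∀ t : k, IsNilpotent (LieAlgebra.ad k (k ⊗[F] L) (t • X)))
    {S : Set k} (hS : S.Infinite)
    (hinv : ∀ t ∈ S, ∃ c, ∀ x : W, ∃ y : W, (y : k ⊗[F] L) = expE (t • X) (hX t) x ∧
      (f : W → k) y = c * (f : W → k) x) :
    ∃ e, InfRel f X e := by
  by_cases hf0 : f = 0
  · subst hf0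
    exact ⟨0, by simpa using infRel_algebraMap (W := W) (X := X) (0 : k)⟩
  obtain ⟨x₀, hx₀⟩ := exists_apply_ne_zero hf0
  obtain ⟨π, hπ⟩ := W.subtype.exists_leftInverse_of_injective (Submodule.ker_subtype W)
  have hπ' : ∀ x : W, π x = x := fun x => LinearMap.congr_fun hπ x
  refine ⟨dd f x₀ (π ⁅X, (x₀ : k ⊗[F] L)⁆) / (f : W → k) x₀, fun x w hw => ?_⟩
  let fM : polyFun k (k ⊗[F] L) := polyComp π f
  obtain ⟨N, hN⟩ : ∃ N, LieAlgebra.ad k (k ⊗[F] L) X ^ (N + 2) = 0 := by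
    obtain ⟨N, hN⟩ := hX 1
    rw [one_smul] at hN
    exact ⟨N, by rw [pow_add, hN, zero_mul]⟩
  let q : ℕ → Polynomial k := fun i => Polynomial.C ((i.factorial : k)⁻¹) * Polynomial.X ^ i
  have hexp : ∀ (t : k) (x : k ⊗[F] L), expE (t • X) (hX t) x =
      ∑ i ∈ Finset.range (N + 2), (q i).eval t • (LieAlgebra.ad k (k ⊗[F] L) X ^ i) x := by
    intro t x
    rw [expE_apply (N := N + 2) _ (by rw [map_smul, smul_pow, hN, smul_zero]; rfl)]
    refine Finset.sum_congr rfl fun i _ => ?_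
    rw [map_smul, smul_pow, LinearMap.smul_apply, smul_smul]
    simp [q]
  have hzero : ∀ x : k ⊗[F] L, ∑ i ∈ Finset.range (N + 2),
      (q i).eval 0 • (LieAlgebra.ad k (k ⊗[F] L) X ^ i) x = x := by
    intro x
    rw [Finset.sum_eq_single 0]
    · simp [q]
    · intro i _ hi
      simp [q, hi]
    · simp
  have hvel : ∀ x : k ⊗[F] L, ∑ i ∈ Finset.range (N + 2),
      (q i).derivative.eval 0 • (LieAlgebra.ad k (k ⊗[F] L) X ^ i) x = ⁅X, x⁆ := by
    intro x
    rw [Finset.sum_eq_single 1]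
    · simp [q]
    · intro i _ hi
      rcases i with _ | _ | i
      · simp [q]
      · exact absurd rfl hi
      · simp [q]
    · simp
  have hkey := dd_mul_eq_of_curves (f := fM) (Finset.range (N + 2)) q
    (fun i => (LieAlgebra.ad k (k ⊗[F] L) X ^ i) x) (fun i => (LieAlgebra.ad k (k ⊗[F] L) X ^ i) x₀)
    hS (a := (f : W → k) x) (b := (f : W → k) x₀) ?_ 0
  · rw [hzero, hzero, hvel, hvel] at hkey
    simp only [fM, dd_polyComp, hπ'] at hkey
    have hw' : w = π ⁅X, (x : k ⊗[F] L)⁆ := by rw [← hw, hπ']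
    rw [hw']
    field_simp
    linear_combination hkey
  · intro t ht
    obtain ⟨c, hc⟩ := hinv t ht
    have hval : ∀ x : W, (fM : k ⊗[F] L → k) (expE (t • X) (hX t) x) = c * (f : W → k) x := by
      intro x
      obtain ⟨y, hy, hfy⟩ := hc x
      rw [← hy]
      change (polyComp π f : k ⊗[F] L → k) _ = _
      rw [polyComp_apply, hπ', hfy]
    rw [← hexp, ← hexp, hval, hval]
    ring

end Bridge

section GenericSubmodule

variable {K L : Type*} [Field K] [LieRing L] [LieAlgebra K L] [FiniteDimensional K L]

lemma exists_generic_isAdDiag_submodule [CharZero K] [IsAlgClosed K] [LieAlgebra.IsKilling K L]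
    {U : Submodule K L} {s : Set L}
    (hs : ∀ z ∈ s, IsAdDiag K z) (hU : ∀ x, x ∈ U ↔ ∀ z ∈ s, ⁅z, x⁆ = 0) (hsU : s ⊆ U) :
    ∃ P : polyFun K U, P ≠ 0 ∧ ∀ c : U, (P : U → K) c ≠ 0 → IsAdDiag K (c : L) := by
  have hC : ∀ x, x ∈ centralizerSubalgebra (K := K) s ↔ ∀ z ∈ s, ⁅z, x⁆ = 0 := fun _ => Iff.rfl
  obtain ⟨P, hP0, hP⟩ := exists_generic_isAdDiag hs hC fun z hz => (hC z).2 ((hU z).1 (hsU hz))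
  let φ : U →ₗ[K] centralizerSubalgebra (K := K) s :=
    { toFun := fun x => ⟨x, (hC x).2 ((hU x).1 x.2)⟩
      map_add' := fun _ _ => rfl
      map_smul' := fun _ _ => rfl }
  refine ⟨polyComp φ P, fun h0 => ?_, fun c hc => hP (φ c) ?_⟩
  · obtain ⟨x, hx⟩ := exists_apply_ne_zero hP0
    have hφ : φ ⟨x, (hU x).2 ((hC x).1 x.2)⟩ = x := rfl
    rw [← hφ, ← polyComp_apply, h0] at hx
    exact hx rfl
  · rwa [← polyComp_apply]

end GenericSubmodule

section Generic

variable {F k L : Type*} [Field F] [Field k] [Algebra F k] [LieRing L] [LieAlgebra F L]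
  [FiniteDimensional F L] [CharZero F] [CharZero k] [Algebra.IsAlgebraic F k] [IsAlgClosed k]
  [LieAlgebra.IsKilling F L] [LieAlgebra.IsKilling k (k ⊗[F] L)]

/-- The centralizer of commuting diagonalizable elements is spanned by elements that are defined
over `F` and diagonalizable over `k`. -/
lemma mem_span_isAdDiag {s : Set L} (hs : ∀ u ∈ s, IsDiag F u)
    (hcomm : ∀ u ∈ s, ∀ v ∈ s, ⁅u, v⁆ = 0) {X : k ⊗[F] L}
    (hX : ∀ u ∈ s, ⁅(1 : k) ⊗ₜ[F] u, X⁆ = 0) :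
    X ∈ Submodule.span k {Y | ∃ c : L, (∀ u ∈ s, ⁅u, c⁆ = 0) ∧ IsAdDiag k ((1 : k) ⊗ₜ[F] c) ∧
      Y = (1 : k) ⊗ₜ[F] c} := by
  let s' : Set (k ⊗[F] L) := (fun u => (1 : k) ⊗ₜ[F] u) '' s
  obtain ⟨C, hC⟩ : ∃ C : Submodule k (k ⊗[F] L), ∀ x, x ∈ C ↔ ∀ u ∈ s, ⁅(1 : k) ⊗ₜ[F] u, x⁆ = 0 :=
    ⟨⨅ u : s, eig k ((1 : k) ⊗ₜ[F] (u : L)) 0, fun x => by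
      simp only [Submodule.mem_iInf, mem_eig_zero, Subtype.forall]⟩
  obtain ⟨C₀, hC₀, hle⟩ : ∃ C₀ : Submodule F L, (∀ x, x ∈ C₀ ↔ ∀ u ∈ s, ⁅u, x⁆ = 0) ∧
      C ≤ C₀.baseChange k :=
    ⟨⨅ u : s, eig F (u : L) 0, fun x => by
      simp only [Submodule.mem_iInf, mem_eig_zero, Subtype.forall], fun x hx =>
      mem_baseChange_eig (h := fun u : s => (u : L)) (n := fun _ => 0) fun u =>
        mem_eig_zero.2 ((hC x).1 hx u u.2)⟩
  have hmem : ∀ x ∈ C₀, (1 : k) ⊗ₜ[F] x ∈ C := fun x hx => (hC _).2 fun u hu => by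
    rw [LieAlgebra.ExtendScalars.bracket_tmul, (hC₀ x).1 hx u hu, TensorProduct.tmul_zero]
  have hbc := isBaseChange_tmulMap hmem hle
  have hex := exists_generic_isAdDiag_submodule (U := C) (s := s')
    (by rintro _ ⟨u, hu, rfl⟩; exact (isDiag_tmul k (hs u hu)).isAdDiag)
    (fun x => by rw [hC]; simp only [s', Set.forall_mem_image])
    (by
      rintro _ ⟨u, hu, rfl⟩
      exact hmem u ((hC₀ u).2 fun v hv => hcomm v hv u hu))
  obtain ⟨Q, hQ0, hQ'⟩ := hex
  have hQ : ∀ x : C₀, (Q : C → k) (tmulMap hmem x) ≠ 0 →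
      IsAdDiag k ((1 : k) ⊗ₜ[F] (x : L)) := fun x hx => hQ' (tmulMap hmem x) hx
  obtain ⟨R, hR⟩ := exists_base_ne_zero hbc hQ0
  have hXC : X ∈ C₀.baseChange k := hle ((hC X).2 hX)
  rw [Submodule.baseChange_eq_span] at hXC
  refine Submodule.span_le.2 ?_ hXC
  rintro _ ⟨x, hx, rfl⟩
  obtain ⟨p, hp⟩ := exists_polynomial_curve (Finset.univ : Finset Bool)
    (fun b => cond b Polynomial.X 1) (fun b => cond b (tmulMap hmem ⟨x, hx⟩) (tmulMap hmem R)) Q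
  have hp' : ∀ t : F, (Q : C → k) (tmulMap hmem (t • ⟨x, hx⟩ + R)) =
      p.eval (algebraMap F k t) := by
    intro t
    rw [← (hp _).1, map_add, map_smul]
    simp
  have hpne : p ≠ 0 := by
    rintro rfl
    apply hR
    have := hp' 0
    simpa using this
  obtain ⟨t, ht0, ht⟩ : ∃ t : F, t ≠ 0 ∧ p.eval (algebraMap F k t) ≠ 0 := by
    by_contra hcon
    push Not at hcon
    refine hpne (Polynomial.eq_zero_of_infinite_isRoot p
      (Set.Infinite.mono (s := algebraMap F k '' {t | t ≠ 0}) ?_ ?_))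
    · rintro _ ⟨t, ht, rfl⟩
      exact hcon t ht
    · refine Set.Infinite.image (algebraMap F k).injective.injOn ?_
      exact (Set.finite_singleton (0 : F)).infinite_compl
  have h1 := hQ (t • ⟨x, hx⟩ + R) (by rw [hp']; exact ht)
  have h2 := hQ R hR
  have hxeq : (1 : k) ⊗ₜ[F] x = (algebraMap F k t)⁻¹ • ((1 : k) ⊗ₜ[F] (t • x + (R : L)) - (1 : k) ⊗ₜ[F] (R : L)) := by
    rw [← TensorProduct.tmul_sub, add_sub_cancel_right, TensorProduct.tmul_smul,
      ← algebraMap_smul k t, inv_smul_smul₀]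
    simpa using ht0
  change (1 : k) ⊗ₜ[F] x ∈ Submodule.span k _
  rw [hxeq]
  refine Submodule.smul_mem _ _ (Submodule.sub_mem _ (Submodule.subset_span ⟨_, ?_, h1, rfl⟩)
    (Submodule.subset_span ⟨_, (hC₀ R).1 R.2, h2, rfl⟩))
  exact (hC₀ _).1 (C₀.add_mem (C₀.smul_mem _ hx) R.2)

lemma infRel_span {W : Submodule k (k ⊗[F] L)} {f : polyFun k W} {T : Set (k ⊗[F] L)}
    (hT : ∀ X ∈ T, ∀ x ∈ W, ⁅X, x⁆ ∈ W) (hf : ∀ X ∈ T, ∃ e, InfRel f X e) {X : k ⊗[F] L}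
    (hX : X ∈ Submodule.span k T) : ∃ e, InfRel f X e := by
  suffices h : (∀ x ∈ W, ⁅X, x⁆ ∈ W) ∧ ∃ e, InfRel f X e from h.2
  induction hX using Submodule.span_induction with
  | mem X hX => exact ⟨hT X hX, hf X hX⟩
  | zero => exact ⟨fun x _ => by simp, 0, fun x w hw => by
      have : w = 0 := Subtype.ext (by simpa using hw)
      simp [this]⟩
  | add X Y _ _ hX hY =>
    obtain ⟨hX, e, he⟩ := hX
    obtain ⟨hY, e', he'⟩ := hY
    exact ⟨fun x hx => by rw [add_lie]; exact add_mem (hX x hx) (hY x hx), e + e', he.add hX he'⟩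
  | smul a X _ hX =>
    obtain ⟨hX, e, he⟩ := hX
    exact ⟨fun x hx => by rw [smul_lie]; exact Submodule.smul_mem _ _ (hX x hx), _, he.smul_left hX a⟩

end Generic

section Closure

variable {F L : Type*} [Field F] [LieRing L] [LieAlgebra F L]
  [FiniteDimensional F L] [CharZero F]

/-- Relative invariance of a polynomial over the algebraic closure under an automorphism over the
base field. -/
def RelInvBy {k : Type*} [Field k] [Algebra F k] {W : Submodule k (k ⊗[F] L)} (f : polyFun k W)
    (g : L ≃ₗ[F] L) : Prop :=
  ∃ c, ∀ x : W, ∃ y : W, (y : k ⊗[F] L) = LinearEquiv.baseChange F k L L g x ∧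
    (f : W → k) y = c * (f : W → k) x

lemma exists_scalar_aut {H0 : L} (hd : IsDiag F H0) (hreg : IsOneSimple F H0 (2 • H0)) {t : F} (ht : t ≠ 0) :
    ∃ g ∈ elemAut F L, (∀ u, ⁅H0, u⁆ = 0 → g u = u) ∧ ∀ x ∈ eig F H0 1, g x = t ^ 2 • x := by
  obtain ⟨e, _, f, _, tr⟩ := hreg
  have hd2 : IsDiag F (2 • H0) := by
    rw [IsDiag, eq_top_iff, ← (show _ = _ from hd)]
    refine iSup_le fun i => ?_
    refine le_trans ?_ (le_iSup (fun i => eig F (2 • H0) i) (2 * i))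
    intro x hx
    rw [mem_eig] at hx ⊢
    rw [nsmul_lie, hx, ← Nat.cast_smul_eq_nsmul F, smul_smul]
    push_cast
    ring_nf
  obtain ⟨g, hg, hgx⟩ := exists_torus hd2 tr ht
  refine ⟨g, hg, fun u hu => ?_, fun x hx => ?_⟩
  · have := hgx 0 u (mem_eig_zero.2 (by rw [nsmul_lie, hu, smul_zero]))
    simpa using this
  · have := hgx 2 x (by
      rw [mem_eig] at hx ⊢
      rw [nsmul_lie, hx, ← Nat.cast_smul_eq_nsmul F, smul_smul]
      norm_num)
    exact_mod_cast this

lemma mem_centr_of_elemAut {g : L ≃ₗ[F] L} (hg : g ∈ elemAut F L) {s : Set L}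
    (hs : ∀ u ∈ s, g u = u) : g ∈ centr (aut0 F L) s :=
  ⟨⟨elemAut_le_aut0 hg, elemAut_le_lieAut hg⟩, (mem_fixingSubgroup_iff _).2 hs⟩

variable [LieAlgebra.IsKilling F L] [LieAlgebra.IsKilling (AlgebraicClosure F) ((AlgebraicClosure F) ⊗[F] L)]

lemma charZero_algebraicClosure : CharZero (AlgebraicClosure F) := charZero_of_algebra F (AlgebraicClosure F)

variable {H0 : L} {W : Submodule (AlgebraicClosure F) ((AlgebraicClosure F) ⊗[F] L)} {f : polyFun (AlgebraicClosure F) W}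

lemma exists_homogeneous_of_centr (hd : IsDiag F H0) (hreg : IsOneSimple F H0 (2 • H0)) {s : Set L}
    (hs0 : ∀ u ∈ s, ⁅H0, u⁆ = 0) (hW : W ≤ eig (AlgebraicClosure F) ((1 : (AlgebraicClosure F)) ⊗ₜ[F] H0) 1)
    (hinv : ∀ g ∈ centr (aut0 F L) s, RelInvBy f g) :
    ∃ n : ℕ, ∀ (t : (AlgebraicClosure F)) (x : W), (f : W → (AlgebraicClosure F)) (t • x) = t ^ n * (f : W → (AlgebraicClosure F)) x := by
  have := charZero_algebraicClosure (F := F)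
  refine exists_homogeneous (S := algebraMap F (AlgebraicClosure F) '' {t | t ≠ 0})
    (Set.Infinite.image (algebraMap F (AlgebraicClosure F)).injective.injOn
      (Set.finite_singleton (0 : F)).infinite_compl) ?_
  rintro _ ⟨t, ht, rfl⟩
  obtain ⟨g, hg, hg0, hg1⟩ := exists_scalar_aut hd hreg ht
  obtain ⟨c, hc⟩ := hinv g (mem_centr_of_elemAut hg fun u hu => hg0 u (hs0 u hu))
  refine ⟨c, fun x => ?_⟩
  obtain ⟨y, hy, hfy⟩ := hc x
  rw [← hfy]
  refine congrArg f.1 (Subtype.ext ?_)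
  rw [hy]
  have hx : (x : (AlgebraicClosure F) ⊗[F] L) ∈ (eig F H0 1).baseChange (AlgebraicClosure F) := by
    have := mem_baseChange_eig (F := F) (k := (AlgebraicClosure F)) (ι := Unit) (h := fun _ => H0) (n := fun _ => 1)
      (x := (x : (AlgebraicClosure F) ⊗[F] L)) fun _ => hW x.2
    simpa using this
  change algebraMap F (AlgebraicClosure F) t ^ 2 • (x : (AlgebraicClosure F) ⊗[F] L) = _
  rw [Submodule.baseChange_eq_span] at hx
  generalize (x : (AlgebraicClosure F) ⊗[F] L) = v at hx
  induction hx using Submodule.span_induction with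
  | mem v hv =>
    obtain ⟨v, hv, rfl⟩ := hv
    change _ • ((1 : (AlgebraicClosure F)) ⊗ₜ[F] v) = LinearEquiv.baseChange F (AlgebraicClosure F) L L g ((1 : (AlgebraicClosure F)) ⊗ₜ[F] v)
    rw [LinearEquiv.baseChange_tmul, hg1 v hv, TensorProduct.tmul_smul, ← algebraMap_smul (AlgebraicClosure F) (t ^ 2),
      map_pow]
  | zero => simp
  | add v w _ _ hv hw => rw [smul_add, hv, hw, map_add]
  | smul a v _ hv => rw [smul_comm, hv, map_smul]

/-- A polynomial that is relatively invariant under the rational points of a centralizer is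
infinitesimally relatively invariant. -/
theorem infRel_of_centr (hd : IsDiag F H0) (hreg : IsOneSimple F H0 (2 • H0)) {s : Set L}
    (hs : ∀ u ∈ s, IsDiag F u) (hcomm : ∀ u ∈ s, ∀ v ∈ s, ⁅u, v⁆ = 0) (hs0 : ∀ u ∈ s, ⁅H0, u⁆ = 0)
    (hW : W ≤ eig (AlgebraicClosure F) ((1 : (AlgebraicClosure F)) ⊗ₜ[F] H0) 1)
    (hst : ∀ X : (AlgebraicClosure F) ⊗[F] L, (∀ u ∈ s, ⁅(1 : (AlgebraicClosure F)) ⊗ₜ[F] u, X⁆ = 0) → ∀ x ∈ W, ⁅X, x⁆ ∈ W)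
    (hinv : ∀ g ∈ centr (aut0 F L) s, RelInvBy f g) {X : (AlgebraicClosure F) ⊗[F] L}
    (hX : ∀ u ∈ s, ⁅(1 : (AlgebraicClosure F)) ⊗ₜ[F] u, X⁆ = 0) : ∃ e, InfRel f X e := by
  have := charZero_algebraicClosure (F := F)
  obtain ⟨n, hn⟩ := exists_homogeneous_of_centr hd hreg hs0 hW hinv
  refine infRel_span ?_ ?_ (mem_span_isAdDiag hs hcomm hX)
  · rintro _ ⟨c, hc, -, rfl⟩
    refine hst _ fun u hu => ?_
    rw [LieAlgebra.ExtendScalars.bracket_tmul, hc u hu, TensorProduct.tmul_zero]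
  · rintro _ ⟨c, hc, hcd, rfl⟩
    exact infRel_of_isAdDiag hn (fun g hg hg' hgu => hinv g
      ⟨⟨⟨hg, hg'⟩, hg⟩, (mem_fixingSubgroup_iff _).2 hgu⟩) hcd hc

/-- A polynomial that is relatively invariant under the rational points of the parabolic subgroup is
infinitesimally relatively invariant. -/
theorem infRel_of_parabolic {p : ℕ} {H : Fin p → L} (S : Sys F H0 H)
    (hreg : IsOneSimple F H0 (2 • H0)) {f : polyFun (AlgebraicClosure F) (eig (AlgebraicClosure F) ((1 : (AlgebraicClosure F)) ⊗ₜ[F] H0) 1)}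
    (hinv : ∀ g ∈ parabolic (aut0 F L) H0 H, RelInvBy f g) {X : (AlgebraicClosure F) ⊗[F] L}
    (hX : X ∈ parT (AlgebraicClosure F) ((1 : (AlgebraicClosure F)) ⊗ₜ[F] H0) (fun i => (1 : (AlgebraicClosure F)) ⊗ₜ[F] H i)) : ∃ e, InfRel f X e := by
  have := charZero_algebraicClosure (F := F)
  have hst : ∀ X ∈ eig (AlgebraicClosure F) ((1 : (AlgebraicClosure F)) ⊗ₜ[F] H0) 0, ∀ x ∈ eig (AlgebraicClosure F) ((1 : (AlgebraicClosure F)) ⊗ₜ[F] H0) 1,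
      ⁅X, x⁆ ∈ eig (AlgebraicClosure F) ((1 : (AlgebraicClosure F)) ⊗ₜ[F] H0) 1 := fun X hX x hx => lie_mem_eig' hX hx (by norm_num)
  obtain ⟨Y, hY, Z, hZ, rfl⟩ := Submodule.mem_sup.1 hX
  have hc0 : ∀ u ∈ insert H0 (Set.range H), ⁅H0, u⁆ = 0 := by
    rintro u (rfl | ⟨i, rfl⟩)
    · exact lie_self _
    · rw [← lie_skew, S.comm₀ i, neg_zero]
  obtain ⟨e, he⟩ : ∃ e, InfRel f Y e := by
    refine infRel_of_centr (H0 := H0) (s := insert H0 (Set.range H)) S.diag₀ hreg ?_ ?_ hc0 le_rfl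
      (fun X hX => hst X (mem_eig_zero.2 (hX H0 (Set.mem_insert _ _))))
      (fun g hg => hinv g ((le_sup_left : _ ≤ parabolic (aut0 F L) H0 H) hg)) ?_
    · rintro u (rfl | ⟨i, rfl⟩)
      exacts [S.diag₀, S.diag i]
    · rintro u (rfl | ⟨i, rfl⟩) v hv
      · exact hc0 v hv
      · rcases hv with rfl | ⟨j, rfl⟩
        · exact S.comm₀ i
        · exact S.comm i j
    · rintro u (rfl | ⟨i, rfl⟩)
      · exact mem_eig_zero.1 hY.1
      · exact mem_eig_zero.1 ((Submodule.mem_iInf _).1 hY.2 i)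
  obtain ⟨e', he'⟩ : ∃ e, InfRel f Z e := by
    have hZ' := nilT_baseChange_le hZ
    rw [Submodule.baseChange_eq_span] at hZ'
    refine infRel_span ?_ ?_ hZ'
    · rintro _ ⟨x, hx, rfl⟩
      exact hst _ (one_tmul_mem_eig (AlgebraicClosure F) (nilT_le _ _ hx))
    · rintro _ ⟨x, hx, rfl⟩
      have hnil := S.isNilpotent_nilT hx
      refine infRel_of_isNilpotent (S := Set.range (algebraMap F (AlgebraicClosure F))) (F := F) (k := (AlgebraicClosure F))
        (fun t => isNilpotent_ad_smul (isNilpotent_ad_tmul hnil) t)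
        (Set.infinite_range_of_injective (algebraMap F (AlgebraicClosure F)).injective) ?_
      rintro _ ⟨t, rfl⟩
      have hmem : t • x ∈ nilT F H0 H := Submodule.smul_mem _ _ hx
      obtain ⟨c, hc⟩ := hinv (expE (t • x) (S.isNilpotent_nilT hmem))
        ((le_sup_right : _ ≤ parabolic (aut0 F L) H0 H) (Subgroup.subset_closure (expE_mem _ hmem)))
      refine ⟨c, fun v => ?_⟩
      obtain ⟨y, hy, hfy⟩ := hc v
      refine ⟨y, ?_, hfy⟩
      rw [hy, baseChange_expE]
      congr 2
      rw [TensorProduct.tmul_smul, ← algebraMap_smul (AlgebraicClosure F) t]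
      rfl
  exact ⟨e + e', he.add (hst Y hY.1) he'⟩

end Closure

section Characters

variable {K V Γ : Type*} [Field K] [AddCommGroup V] [Module K V] [Group Γ]

lemma exists_isRelInv {ρ : Representation K Γ V} {q : polyFun K V} (hq : q ≠ 0)
    (h : ∀ g, ∃ c : K, ∀ x, (q : V → K) (ρ g x) = c * (q : V → K) x) :
    ∃ χ : Γ →* Kˣ, IsRelInv ρ q χ := by
  choose c hc using h
  obtain ⟨x₀, hx₀⟩ := exists_apply_ne_zero hq
  have h1 : c 1 = 1 := by
    have := hc 1 x₀
    rw [map_one, Module.End.one_apply] at this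
    exact (mul_right_cancel₀ hx₀ (by rw [← this, one_mul])).symm
  have hmul : ∀ g g', c (g * g') = c g * c g' := fun g g' => by
    have h2 := hc (g * g') x₀
    rw [map_mul, Module.End.mul_apply, hc, hc, ← mul_assoc] at h2
    exact (mul_right_cancel₀ hx₀ h2).symm
  exact ⟨MonoidHom.toHomUnits ⟨⟨c, h1⟩, hmul⟩, hc⟩

end Characters

section Normalizer

variable {K L : Type*} [Field K] [LieRing L] [LieAlgebra K L] [CharZero K] [FiniteDimensional K L]
  [IsAlgClosed K] {m W W' : Submodule K L} {h : L}

lemma IsNonconstant.of_irreducible {V : Type*} [AddCommGroup V] [Module K V] {f : polyFun K V}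
    (hf : Irreducible f) : IsNonconstant f := fun c hc => by
  rcases eq_or_ne c 0 with rfl | h0
  · exact hf.ne_zero (by rw [hc, map_zero])
  · exact hf.not_isUnit (hc ▸ (isUnit_iff_ne_zero.2 h0).map (algebraMap K (polyFun K V)))

lemma eq_smul_of_associated {V : Type*} [AddCommGroup V] [Module K V] [FiniteDimensional K V]
    {f g : polyFun K V} (h : Associated f g) : ∃ c : K, c ≠ 0 ∧ g = c • f := by
  obtain ⟨u, rfl⟩ := h
  obtain ⟨c, hc, hu⟩ := isUnit_polyFun_iff.1 u.isUnit
  exact ⟨c, hc, by rw [hu, mul_comm, Algebra.smul_def]⟩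

lemma IsRegularPair.eq_smul (D : IsRegularPair m W W' h) {f g : polyFun K W}
    (hf : ∀ X ∈ m, ∃ c, InfRel f X c) (hfi : Irreducible f)
    (hg : ∀ X ∈ m, ∃ c, InfRel g X c) (hgi : Irreducible g) : ∃ c : K, c ≠ 0 ∧ g = c • f := by
  obtain ⟨a, b, _, hb, _, _, c, _, hc⟩ := D.exists_pow_eq hf (.of_irreducible hfi) hg
    (.of_irreducible hgi)
  have hdvd : f ∣ g ^ a := by
    have h1 : f ∣ c • g ^ a := hc ▸ dvd_pow_self f hb.ne'
    have h2 : g ^ a = c⁻¹ • (c • g ^ a) := by rw [inv_smul_smul₀ ‹c ≠ 0›]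
    rw [h2, Algebra.smul_def]
    exact h1.mul_left _
  exact eq_smul_of_associated (hfi.associated_of_dvd hgi (hfi.prime.dvd_of_dvd_pow hdvd))

lemma IsRegularPair.exists_smul_of_aut (D : IsRegularPair m W W' h) {f : polyFun K W}
    (hf : ∀ X ∈ m, ∃ c, InfRel f X c) (hfi : Irreducible f) {g : L ≃ₗ[K] L} (hg : g ∈ lieAut K L)
    (hm : ∀ X ∈ m, g X ∈ m) (hW : ∀ x ∈ W, g x ∈ W) :
    ∃ c : K, c ≠ 0 ∧ ∀ x : W, (f : W → K) ⟨g x, hW x x.2⟩ = c * (f : W → K) x := by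
  let φ : W →ₗ[K] W := (g : L →ₗ[K] L).restrict hW
  have hinj : Function.Injective φ := fun x y hxy =>
    Subtype.ext (g.injective (congrArg Subtype.val hxy))
  let e := LinearEquiv.ofInjectiveEndo φ hinj
  have hirr : Irreducible (polyComp φ f) :=
    irreducible_polyComp (σ := (e.symm : W →ₗ[K] W)) (fun w => e.apply_symm_apply w) hfi
  obtain ⟨c, hc0, hc⟩ := D.eq_smul hf hfi (g := polyComp φ f) (fun X hX => by
    obtain ⟨c, hc⟩ := hf _ (hm X hX)
    refine ⟨c, fun x w hw => ?_⟩
    rw [dd_polyComp, polyComp_apply]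
    refine hc (φ x) (φ w) ?_
    change g w = ⁅g X, g x⁆
    rw [hw, hg]) hirr
  refine ⟨c, hc0, fun x => ?_⟩
  have := congrArg (fun q : polyFun K W => (q : W → K) x) hc
  exact this

end Normalizer

section Extension

variable {F k L : Type*} [Field F] [Field k] [Algebra F k] [LieRing L] [LieAlgebra F L]
  [FiniteDimensional F L] [CharZero F] {V : Submodule F L} {W : Submodule k (k ⊗[F] L)}

lemma baseChange_mem_of_stable (h : ∀ x ∈ V, (1 : k) ⊗ₜ[F] x ∈ W) (h' : W ≤ V.baseChange k)
    {g : L ≃ₗ[F] L} (hg : ∀ x ∈ V, g x ∈ V) : ∀ x ∈ W, LinearEquiv.baseChange F k L L g x ∈ W := by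
  intro x hx
  have hx' := h' hx
  rw [Submodule.baseChange_eq_span] at hx'
  clear hx
  induction hx' using Submodule.span_induction with
  | mem v hv =>
    obtain ⟨v, hv, rfl⟩ := hv
    exact h _ (hg v hv)
  | zero => simp
  | add v w _ _ hv hw => rw [map_add]; exact W.add_mem hv hw
  | smul a v _ hv => rw [map_smul]; exact W.smul_mem _ hv

lemma eq_mul_of_isPolyExt (h : ∀ x ∈ V, (1 : k) ⊗ₜ[F] x ∈ W) (h' : W ≤ V.baseChange k)
    {g : L ≃ₗ[F] L} (hg : ∀ x ∈ V, g x ∈ V) {f : polyFun F V} {f' : polyFun k W}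
    (hf : IsPolyExt (tmulMap h) f f') {c : F}
    (hc : ∀ x : V, (f : V → F) ⟨g x, hg x x.2⟩ = c * (f : V → F) x) (x : W) :
    (f' : W → k) ⟨LinearEquiv.baseChange F k L L g x, baseChange_mem_of_stable h h' hg x x.2⟩ =
      algebraMap F k c * (f' : W → k) x := by
  let φ : W →ₗ[k] W := (LinearEquiv.baseChange F k L L g : k ⊗[F] L →ₗ[k] k ⊗[F] L).restrict
    (baseChange_mem_of_stable h h' hg)
  have key : polyComp φ f' = algebraMap F k c • f' := by
    refine eq_of_forall_base (isBaseChange_tmulMap h h') fun x => ?_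
    have h1 : φ (tmulMap h x) = tmulMap h ⟨g x, hg x x.2⟩ := Subtype.ext rfl
    rw [polyComp_apply, polyFun_smul_apply, h1, hf, hf, hc, map_mul]
  have := congrArg (fun q : polyFun k W => (q : W → k) x) key
  exact this

end Extension

section Fundamental

variable {F L : Type*} [Field F] [LieRing L] [LieAlgebra F L]
  [FiniteDimensional F L] [CharZero F]

lemma lieAut_mem_eig {K M : Type*} [Field K] [LieRing M] [LieAlgebra K M] {g : M ≃ₗ[K] M}
    (hg : g ∈ lieAut K M) {u x : M} {i : ℤ} (hu : g u = u) (hx : x ∈ eig K u i) :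
    g x ∈ eig K u i := by
  rw [mem_eig] at hx ⊢
  have := hg u x
  rw [hu, hx, map_smul] at this
  exact this.symm

lemma eq_smul_pow_of_forall_dvd {K V : Type*} [Field K] [CharZero K] [IsAlgClosed K]
    [AddCommGroup V] [Module K V] [FiniteDimensional K V] {f q : polyFun K V} (hf : f ≠ 0)
    (hq : Irreducible q) (h : ∀ r, Irreducible r → r ∣ f → q ∣ r) :
    ∃ (n : ℕ) (c : K), f = c • q ^ n := by
  obtain ⟨r, hr, hqr⟩ := (FiniteMultiplicity.of_prime_left hq.prime hf).exists_eq_pow_mul_and_not_dvd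
  refine ⟨multiplicity q f, ?_⟩
  by_cases hu : IsUnit r
  · obtain ⟨c, -, rfl⟩ := isUnit_polyFun_iff.1 hu
    exact ⟨c, by rw [Algebra.smul_def, mul_comm]; exact hr⟩
  · have hr0 : r ≠ 0 := by rintro rfl; exact hqr (dvd_zero _)
    obtain ⟨s, hs, hsr⟩ := WfDvdMonoid.exists_irreducible_factor hu hr0
    exact absurd ((h s hs (hr ▸ hsr.mul_left _)).trans hsr) hqr

variable [LieAlgebra.IsKilling F L]
  [LieAlgebra.IsKilling (AlgebraicClosure F) (AlgebraicClosure F ⊗[F] L)]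

/-- A fundamental relative invariant is absolutely irreducible and infinitesimally relatively
invariant over the algebraic closure. -/
theorem irreducible_of_isFundamental {H0 h : L} (hd0 : IsDiag F H0) (hd : IsDiag F h)
    (hc : ⁅h, H0⁆ = 0) (hreg : IsOneSimple F H0 (2 • H0))
    {V : Submodule F L} (hV : V = eig F h 2 ⊓ eig F H0 1)
    {W W' m : Submodule (AlgebraicClosure F) (AlgebraicClosure F ⊗[F] L)}
    (hW : W = eig _ (1 ⊗ₜ[F] h) 2 ⊓ eig _ (1 ⊗ₜ[F] H0) 1)
    (hm : m = eig _ (1 ⊗ₜ[F] h) 0 ⊓ eig _ (1 ⊗ₜ[F] H0) 0)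
    (D : IsRegularPair m W W' (1 ⊗ₜ[F] h))
    {Γ : Subgroup (L ≃ₗ[F] L)} (hΓ : Γ = centr (aut0 F L) {H0, h})
    {hst : ∀ g ∈ Γ, ∀ x ∈ V, g x ∈ V} {f : polyFun F V}
    (hf : IsFundamental (restrictRep Γ V hst) f)
    {hVW : ∀ x ∈ V, (1 : AlgebraicClosure F) ⊗ₜ[F] x ∈ W} {f' : polyFun (AlgebraicClosure F) W}
    (hff' : IsPolyExt (tmulMap hVW) f f') :
    Irreducible f' ∧ ∀ X ∈ m, ∃ c, InfRel f' X c := by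
  have := charZero_of_algebra F (AlgebraicClosure F)
  have hWV : W ≤ V.baseChange (AlgebraicClosure F) := by
    subst hV hW
    exact fun x hx => mem_baseChange_eig_inf hx
  have hε := isBaseChange_tmulMap hVW hWV
  obtain ⟨χ, hχ⟩ := hf.relInv
  have hmmem : ∀ X : AlgebraicClosure F ⊗[F] L, X ∈ m ↔
      ∀ u ∈ ({H0, h} : Set L), ⁅(1 : AlgebraicClosure F) ⊗ₜ[F] u, X⁆ = 0 := by
    intro X
    rw [hm]
    simp [Submodule.mem_inf, mem_eig_zero, and_comm]
  have hinf : ∀ X ∈ m, ∃ c, InfRel f' X c := by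
    intro X hX
    refine infRel_of_centr (s := {H0, h}) hd0 hreg ?_ ?_ ?_ (hW.trans_le inf_le_right) ?_ ?_
      ((hmmem X).1 hX)
    · rintro u (rfl | rfl) <;> assumption
    · rintro u (rfl | rfl) v (rfl | rfl)
      · exact lie_self _
      · rw [← lie_skew, hc, neg_zero]
      · exact hc
      · exact lie_self _
    · rintro u (rfl | rfl)
      · exact lie_self _
      · rw [← lie_skew, hc, neg_zero]
    · exact fun X hX x hx => D.stable X ((hmmem X).2 hX) x hx
    · intro g hg
      have hgΓ : g ∈ Γ := hΓ ▸ hg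
      exact ⟨_, fun x => ⟨⟨_, baseChange_mem_of_stable hVW hWV (hst g hgΓ) x x.2⟩, rfl,
        eq_mul_of_isPolyExt hVW hWV (hst g hgΓ) hff' (fun x => hχ ⟨g, hgΓ⟩ x) x⟩⟩
  refine ⟨?_, hinf⟩
  have hf0 : f ≠ 0 := fun h0 => hf.nonconstant 0 (by rw [h0, map_zero])
  have hf'0 := hff'.ne_zero hf0
  have hf'u : ¬ IsUnit f' := by
    intro hu
    obtain ⟨c, -, hc⟩ := isUnit_polyFun_iff.1 hu
    have hconst : ∀ x y, (f : V → F) x = (f : V → F) y := fun x y =>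
      (algebraMap F (AlgebraicClosure F)).injective (by rw [← hff', ← hff', hc]; rfl)
    exact hf.nonconstant ((f : V → F) 0) (polyFun_ext fun x => hconst x 0)
  have hfac : ∀ r, Irreducible r → r ∣ f' → ∀ X ∈ m, ∃ c, InfRel r X c := fun r hr hrf X hX => by
    obtain ⟨c, hc⟩ := hinf X hX
    exact hc.of_dvd (D.stable X hX) hf'0 hr hrf
  obtain ⟨q₁, hq₁, hq₁f⟩ := WfDvdMonoid.exists_irreducible_factor hf'u hf'0
  obtain ⟨x₀, hx₀⟩ := exists_base_ne_zero hε hq₁.ne_zero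
  obtain ⟨q, hq, hqf, hqx⟩ : ∃ q, Irreducible q ∧ q ∣ f' ∧
      (q : W → AlgebraicClosure F) (tmulMap hVW x₀) = 1 := by
    have hass : Associated q₁ (((q₁ : W → AlgebraicClosure F) (tmulMap hVW x₀))⁻¹ • q₁) := by
      rw [Algebra.smul_def, mul_comm]
      exact ⟨((isUnit_iff_ne_zero.2 (inv_ne_zero hx₀)).map (algebraMap _ (polyFun _ W))).unit, rfl⟩
    exact ⟨_, hass.irreducible hq₁, hass.symm.dvd.trans hq₁f, inv_mul_cancel₀ hx₀⟩
  have hqinf := hfac q hq hqf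
  obtain ⟨q₀, hq₀⟩ : ∃ q₀ : polyFun F V, IsPolyExt (tmulMap hVW) q₀ q := by
    refine exists_isPolyExt_of_fixed hε fun γ x => ?_
    obtain ⟨φ, hφ⟩ := exists_conj hε γ
    have hφf : φ f' = f' := eq_of_forall_base hε fun x => by rw [hφ, hff', AlgEquiv.commutes]
    have hφq : Irreducible (φ q) := (MulEquiv.irreducible_iff φ).2 hq
    obtain ⟨c, -, hc⟩ := D.eq_smul hqinf hq (hfac _ hφq (hφf ▸ map_dvd φ hqf)) hφq
    have hv : ∀ x, γ ((q : W → AlgebraicClosure F) (tmulMap hVW x)) =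
        c * (q : W → AlgebraicClosure F) (tmulMap hVW x) := fun x => by
      rw [← hφ, hc, polyFun_smul_apply]
    have h1 := hv x₀
    rw [hqx, map_one, mul_one] at h1
    rw [hv, ← h1, one_mul]
  have hq₀x : (q₀ : V → F) x₀ = 1 := (algebraMap F (AlgebraicClosure F)).injective (by
    rw [← hq₀, hqx, map_one])
  have hq₀0 : q₀ ≠ 0 := by rintro rfl; exact zero_ne_one hq₀x
  obtain ⟨ψ, hψ⟩ : ∃ ψ, IsRelInv (restrictRep Γ V hst) q₀ ψ := by
    refine exists_isRelInv hq₀0 fun g => ⟨(q₀ : V → F) (restrictRep Γ V hst g x₀), fun x => ?_⟩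
    have hg : (g : L ≃ₗ[F] L) ∈ centr (aut0 F L) {H0, h} := hΓ ▸ g.2
    have hfix : ∀ u ∈ ({H0, h} : Set L), (g : L ≃ₗ[F] L) u = u := (mem_fixingSubgroup_iff _).1 hg.2
    have hstab := baseChange_mem_of_stable hVW hWV (hst g g.2)
    have haut := baseChange_mem_lieAut (k := AlgebraicClosure F) hg.1.2
    obtain ⟨c, -, hc⟩ := D.exists_smul_of_aut hqinf hq haut (fun X hX => by
      subst hm
      exact ⟨lieAut_mem_eig haut (by simp [hfix]) hX.1, lieAut_mem_eig haut (by simp [hfix]) hX.2⟩)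
      hstab
    have hc' : ∀ x : V, algebraMap F (AlgebraicClosure F) ((q₀ : V → F) (restrictRep Γ V hst g x)) =
        c * algebraMap F (AlgebraicClosure F) ((q₀ : V → F) x) := fun x => by
      rw [← hq₀, ← hq₀, ← hc]
      rfl
    apply (algebraMap F (AlgebraicClosure F)).injective
    rw [map_mul, hc', hc', hq₀x, map_one, mul_one]
  have hq₀n : IsNonconstant q₀ := fun c hc => by
    refine IsNonconstant.of_irreducible hq (algebraMap F _ c) ?_
    exact hq₀.unique hε (hc ▸ isPolyExt_algebraMap c)
  obtain ⟨n, c, hn⟩ := eq_smul_pow_of_forall_dvd hf'0 hq fun r hr hrf => by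
    obtain ⟨c, -, hc⟩ := D.eq_smul hqinf hq (hfac r hr hrf) hr
    exact hc ▸ Dvd.intro_left _ (Algebra.smul_def c q).symm
  have hn' : f = algebraMap F _ ((f : V → F) x₀) * q₀ ^ n := by
    refine hff'.inj ?_
    have h1 : c = algebraMap F _ ((f : V → F) x₀) := by
      rw [← hff', hn, polyFun_smul_apply]
      simp [hqx]
    rw [hn, Algebra.smul_def, h1]
    exact (isPolyExt_algebraMap _).mul (hq₀.pow n)
  have hdeg : pdeg f ≤ pdeg q₀ := mem_polyLE_iff.1
    (hf.minimal q₀ ψ hψ hq₀n _ (mem_polyLE_iff.2 le_rfl))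
  have hpow : ∀ n, pdeg (q₀ ^ n) = n * pdeg q₀ := by
    intro n
    induction n with
    | zero => rw [pow_zero, pdeg_one, zero_mul]
    | succ n ih => rw [pow_succ, pdeg_mul (pow_ne_zero n hq₀0) hq₀0, ih, add_one_mul]
  have hfx0 : algebraMap F (polyFun F V) ((f : V → F) x₀) ≠ 0 := by
    intro h0
    rw [h0, zero_mul] at hn'
    exact hf0 hn'
  rw [hn', pdeg_mul hfx0 (pow_ne_zero n hq₀0), pdeg_algebraMap, hpow, zero_add] at hdeg
  have hpos := Nat.pos_of_ne_zero (isNonconstant_iff.1 hq₀n)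
  have hn1 : n ≤ 1 := by nlinarith
  interval_cases n
  · rw [pow_zero] at hn
    refine absurd ?_ hf'u
    rw [hn]
    refine isUnit_polyFun_iff.2 ⟨c, ?_, by rw [Algebra.smul_def, mul_one]⟩
    rintro rfl
    exact hf'0 (by rw [hn, zero_smul])
  · rw [pow_one] at hn
    have hc0 : c ≠ 0 := by
      rintro rfl
      exact hf'0 (by rw [hn, zero_smul])
    refine Associated.irreducible ⟨((isUnit_iff_ne_zero.2 hc0).map (algebraMap _ (polyFun _ W))).unit,
      ?_⟩ hq
    rw [hn, Algebra.smul_def, mul_comm]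
    rfl

end Fundamental

section Invariants

variable {K L : Type*} [Field K] [LieRing L] [LieAlgebra K L] [CharZero K] [FiniteDimensional K L]
  {p : ℕ} {H0 : L} {H : Fin p → L}

/-- The projection of `𝔤_1` onto `E_2(h_k) ∩ 𝔤_1`. -/
def Sys.topMap (S : Sys K H0 H) (k : ℕ) :
    eig K H0 1 →ₗ[K] (eig K (partialSum H k) 2 ⊓ eig K H0 1 : Submodule K L) :=
  (S.top k).restrict fun x hx => ⟨eproj_mem _ _ x, S.top_mem k hx⟩

lemma Sys.topMap_apply (S : Sys K H0 H) (k : ℕ) (x : eig K H0 1) :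
    (S.topMap k x : L) = S.top k x := rfl

/-- The natural extension of a polynomial on `E_2(h_k) ∩ 𝔤_1` to `𝔤_1`. -/
def Sys.ext (S : Sys K H0 H) {k : ℕ}
    (f : polyFun K (eig K (partialSum H k) 2 ⊓ eig K H0 1 : Submodule K L)) :
    polyFun K (eig K H0 1) :=
  polyComp (S.topMap k) f

/-- Irreducible, infinitesimally relatively invariant polynomials on the spaces
`E_2(h_k) ∩ 𝔤_1`. -/
structure Sys.Invs (_ : Sys K H0 H) (f : ∀ k : Fin p,
    polyFun K (eig K (partialSum H ((k : ℕ) + 1)) 2 ⊓ eig K H0 1 : Submodule K L)) : Prop where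
  irr : ∀ k, Irreducible (f k)
  inf : ∀ k : Fin p, ∀ X ∈ eig K (partialSum H ((k : ℕ) + 1)) 0 ⊓ eig K H0 0, ∃ c, InfRel (f k) X c

variable {S : Sys K H0 H} {f : ∀ k : Fin p,
    polyFun K (eig K (partialSum H ((k : ℕ) + 1)) 2 ⊓ eig K H0 1 : Submodule K L)}

lemma Sys.Invs.irreducible_ext (I : S.Invs f) (k : Fin p) : Irreducible (S.ext (f k)) :=
  irreducible_polyComp (σ := Submodule.inclusion inf_le_right)
    (fun w => Subtype.ext (eproj_self (S.diag_partialSum _) w.2.1)) (I.irr k)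

lemma lieAut_mem_eig_iff {g : L ≃ₗ[K] L} (hg : g ∈ lieAut K L) {u x : L} {i : ℤ} (hu : g u = u) :
    g x ∈ eig K u i ↔ x ∈ eig K u i := by
  refine ⟨fun h => ?_, lieAut_mem_eig hg hu⟩
  rw [mem_eig] at h ⊢
  apply g.injective
  rw [hg, hu, h, map_smul]

variable [IsAlgClosed K] [LieAlgebra.IsKilling K L]

lemma Sys.Invs.good (I : S.Invs f) (hirr : IsIrreducibleDegreeOne K H0) {x : eig K H0 1}
    (hx : ∀ k, (S.ext (f k) : eig K H0 1 → K) x ≠ 0) : S.Good (x : L) := by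
  refine ⟨x.2, fun k hk => ?_⟩
  rcases k with - | k
  · exact ⟨0, zero_mem _, zero_mem _, by rw [lie_zero, partialSum_zero]⟩
  · obtain ⟨t, ht, tr⟩ := ((S.isRegularPair hirr k.succ_pos hk).exists_triple (I.inf ⟨k, hk⟩)
      (.of_irreducible (I.irr ⟨k, hk⟩))).2 (S.topMap (k + 1) x) (hx ⟨k, hk⟩)
    exact ⟨t, ht.2, ht.1, tr.lie_e_f⟩

lemma Sys.Invs.exists_smul_of_aut (I : S.Invs f) (hirr : IsIrreducibleDegreeOne K H0) (k : Fin p)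
    {g : L ≃ₗ[K] L} (hg : g ∈ lieAut K L) (h0 : g H0 = H0)
    (hk : g (partialSum H ((k : ℕ) + 1)) = partialSum H ((k : ℕ) + 1)) :
    ∃ c : K, c ≠ 0 ∧ ∀ x y : (eig K (partialSum H ((k : ℕ) + 1)) 2 ⊓ eig K H0 1 : Submodule K L),
      (y : L) = g x → (f k).1 y = c * (f k).1 x := by
  obtain ⟨c, hc0, hc⟩ := (S.isRegularPair hirr k.1.succ_pos k.2).exists_smul_of_aut (I.inf k) (I.irr k)
    hg (fun X hX => ⟨lieAut_mem_eig hg hk hX.1, lieAut_mem_eig hg h0 hX.2⟩)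
    (fun X hX => ⟨lieAut_mem_eig hg hk hX.1, lieAut_mem_eig hg h0 hX.2⟩)
  refine ⟨c, hc0, fun x y hy => ?_⟩
  rw [← hc]
  exact congrArg (f k).1 (Subtype.ext hy)

/-- The extended polynomials are relatively invariant under the parabolic subgroup. -/
theorem Sys.Invs.relInv (I : S.Invs f) (hirr : IsIrreducibleDegreeOne K H0) (k : Fin p)
    {g : L ≃ₗ[K] L} (hg : g ∈ parabolic (lieAut K L) H0 H) :
    ∃ c : K, ∀ x y : eig K H0 1, (y : L) = g x →
      (S.ext (f k)).1 y = c * (S.ext (f k)).1 x := by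
  let T : Subgroup (L ≃ₗ[K] L) :=
    { carrier := {g | (∀ x, g x ∈ eig K H0 1 ↔ x ∈ eig K H0 1) ∧ ∃ c : K, c ≠ 0 ∧
        ∀ x y : eig K H0 1, (y : L) = g x → (S.ext (f k)).1 y = c * (S.ext (f k)).1 x}
      mul_mem' := by
        rintro g g' ⟨hg, c, hc0, hc⟩ ⟨hg', c', hc0', hc'⟩
        refine ⟨fun x => (hg _).trans (hg' x), c * c', mul_ne_zero hc0 hc0', fun x y hy => ?_⟩
        rw [hc ⟨g' x, (hg' x).2 x.2⟩ y hy, hc' x _ rfl, mul_assoc]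
      one_mem' := ⟨fun _ => Iff.rfl, 1, one_ne_zero, fun x y hy => by
        rw [show y = x from Subtype.ext hy, one_mul]⟩
      inv_mem' := by
        rintro g ⟨hg, c, hc0, hc⟩
        have hgg : ∀ x, g (g⁻¹ x) = x := g.apply_symm_apply
        refine ⟨fun x => by rw [← hg, hgg], c⁻¹, inv_ne_zero hc0, fun x y hy => ?_⟩
        rw [eq_inv_mul_iff_mul_eq₀ hc0, hc y x (by rw [hy, hgg])] }
  suffices h : parabolic (lieAut K L) H0 H ≤ T by
    obtain ⟨-, c, -, hc⟩ := h hg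
    exact ⟨c, hc⟩
  refine sup_le ?_ ((Subgroup.closure_le _).2 ?_)
  · intro g hg
    have hfix : ∀ u ∈ insert H0 (Set.range H), g u = u := (mem_fixingSubgroup_iff _).1 hg.2
    have h0 := hfix H0 (Set.mem_insert _ _)
    have hps : g (partialSum H ((k : ℕ) + 1)) = partialSum H ((k : ℕ) + 1) := by
      rw [partialSum, map_sum]
      exact Finset.sum_congr rfl fun i _ => hfix _ (Set.mem_insert_of_mem _ ⟨i, rfl⟩)
    obtain ⟨c, hc0, hc⟩ := I.exists_smul_of_aut hirr k hg.1.1 h0 hps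
    refine ⟨fun x => lieAut_mem_eig_iff hg.1.1 h0, c, hc0, fun x y hy => hc _ _ ?_⟩
    rw [S.topMap_apply, S.topMap_apply, hy]
    have := eproj_shift (S.diag_partialSum ((k : ℕ) + 1)) (a := 0) (φ := (g : L →ₗ[K] L))
      (fun j x hx => by rw [add_zero]; exact lieAut_mem_eig hg.1.1 hps hx) 2 x
    exact this
  · rintro _ ⟨X, hX, hn, hg⟩
    rw [eq_expE hn hg]
    have h0 : expE X hn H0 = H0 := expE_of_lie_eq_zero hn (by
      rw [← lie_skew, mem_eig_zero.1 (nilT_le _ _ hX), neg_zero])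
    have hl := S.levi_mem hX ((k : ℕ) + 1)
    obtain ⟨c, hc0, hc⟩ := I.exists_smul_of_aut hirr k
      (expE_mem_lieAut (S.isNilpotent_nilT hl))
      (expE_of_lie_eq_zero _ (by rw [← lie_skew, mem_eig_zero.1 (nilT_le _ _ hl), neg_zero]))
      (expE_of_lie_eq_zero _ (S.lie_levi X _))
    refine ⟨fun x => lieAut_mem_eig_iff (expE_mem_lieAut hn) h0, c, hc0, fun x y hy => hc _ _ ?_⟩
    rw [S.topMap_apply, S.topMap_apply, hy]
    exact S.top_expE hX _ x.2

lemma Sys.exists_eq_sum_nat (S : Sys K H0 H) (j : Fin p) (x : eig K H0 1) :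
    ∃ (s : Finset ℕ) (v : ℕ → eig K H0 1), (∀ i : ℕ, (v i : L) ∈ eig K (H j) i) ∧ x = ∑ i ∈ s, v i := by
  obtain ⟨s, hs⟩ := exists_eq_sum_eproj (S.diag j) (x : L)
  have hmem : ∀ i, eproj (H j) (S.diag j) i (x : L) ∈ eig K H0 1 := fun i =>
    eproj_mem_eig _ (S.comm₀ j) i x.2
  refine ⟨(s.filter (0 ≤ ·)).image Int.toNat, fun i => ⟨_, hmem i⟩, fun i => eproj_mem _ _ _, ?_⟩
  apply Subtype.ext
  rw [AddSubmonoidClass.coe_finsetSum, Finset.sum_image]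
  · conv_lhs => rw [hs]
    rw [← Finset.sum_filter_add_sum_filter_not s (0 ≤ ·), Finset.sum_eq_zero (s := s.filter (¬ 0 ≤ ·)),
      add_zero]
    · refine Finset.sum_congr rfl fun i hi => ?_
      rw [Int.toNat_of_nonneg (Finset.mem_filter.1 hi).2]
    · intro i hi
      exact S.pos j i _ (hmem i) (eproj_mem _ _ _) (not_le.1 (Finset.mem_filter.1 hi).2)
  · intro a ha b hb hab
    have h1 := (Finset.mem_filter.1 ha).2
    have h2 := (Finset.mem_filter.1 hb).2
    rw [← Int.toNat_of_nonneg h1, ← Int.toNat_of_nonneg h2, hab]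

/-- The weights of the one-parameter group of `H_j` on the invariants are triangular. -/
lemma Sys.Invs.exists_weight (I : S.Invs f) (hirr : IsIrreducibleDegreeOne K H0) (k j : Fin p) :
    ∃ n : ℕ, (j = k → 0 < n) ∧ (k < j → n = 0) ∧ InfRel (S.ext (f k)) (H j) (n : K) ∧
      ∀ (t : K) (g : L ≃ₗ[K] L), (∀ i : ℕ, ∀ x ∈ eig K (H j) i, g x = t ^ i • x) →
        ∀ x y : eig K H0 1, (y : L) = g x → (S.ext (f k)).1 y = t ^ n * (S.ext (f k)).1 x := by
  have hj0 : H j ∈ eig K H0 0 := S.mem_zero j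
  have hjk : ⁅partialSum H ((k : ℕ) + 1), H j⁆ = 0 := by
    rw [← lie_skew, S.lie_partialSum, neg_zero]
  have hjm : H j ∈ eig K (partialSum H ((k : ℕ) + 1)) 0 ⊓ eig K H0 0 := ⟨mem_eig_zero.2 hjk, hj0⟩
  obtain ⟨c, hc⟩ := I.inf k (H j) hjm
  have D := S.isRegularPair hirr k.1.succ_pos k.2
  obtain ⟨⟨n', hn', hw, -⟩, -⟩ := D.exists_triple (I.inf k) (.of_irreducible (I.irr k))
  have hkf := hw (H j) hjm c hc
  rw [S.kf_partialSum] at hkf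
  have hst : ∀ x ∈ eig K H0 1, ⁅H j, x⁆ ∈ eig K H0 1 := fun x hx => lie_mem_eig' hj0 hx (by norm_num)
  have hQ : InfRel (S.ext (f k)) (H j) c := by
    intro x w hw
    rw [Sys.ext, dd_polyComp, polyComp_apply]
    refine hc _ _ ?_
    rw [S.topMap_apply, S.topMap_apply, hw]
    exact eproj_comm _ hjk _ _
  have key : ∀ x : eig K H0 1, (S.ext (f k)).1 x ≠ 0 → ∃ n : ℕ, c = n ∧
      ∀ (t : K) (g : L ≃ₗ[K] L), (∀ i : ℕ, ∀ x ∈ eig K (H j) i, g x = t ^ i • x) →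
        ∀ y : eig K H0 1, (y : L) = g x → (S.ext (f k)).1 y = t ^ n * (S.ext (f k)).1 x := by
    intro x hx
    obtain ⟨s, v, hv, hxv⟩ := S.exists_eq_sum_nat j x
    obtain ⟨n, hn, hnt⟩ := exists_nat_of_lder (T := (LieAlgebra.ad K L (H j)).restrict hst)
      (f := S.ext (f k)) (c := c) (fun y => hQ y _ rfl) s v (fun i => Subtype.ext (by
        have := mem_eig.1 (hv i)
        rw [Int.cast_natCast] at this
        exact this)) (by rw [← hxv]; exact hx)
    refine ⟨n, hn, fun t g hg y hy => ?_⟩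
    have hy' : y = ∑ i ∈ s, t ^ i • v i := by
      apply Subtype.ext
      rw [hy, hxv, AddSubmonoidClass.coe_finsetSum, AddSubmonoidClass.coe_finsetSum, map_sum]
      exact Finset.sum_congr rfl fun i _ => hg i _ (hv i)
    rw [hy', hnt t, ← hxv]
  obtain ⟨x₀, hx₀⟩ := exists_apply_ne_zero (I.irreducible_ext k).ne_zero
  obtain ⟨n, hn, -⟩ := key x₀ hx₀
  refine ⟨n, ?_, ?_, hn ▸ hQ, fun t g hg => ?_⟩
  · rintro rfl
    rw [if_pos (Nat.lt_succ_self _)] at hkf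
    obtain ⟨r, hr, hr'⟩ := S.exists_kf_nat j
    rw [hr'] at hkf
    refine Nat.pos_of_ne_zero fun h0 => ?_
    rw [hn, h0, Nat.cast_zero, zero_mul, eq_comm] at hkf
    have : (2 * n' * r : ℕ) = 0 := by exact_mod_cast hkf
    simp [hn'.ne', hr.ne'] at this
  · intro hlt
    rw [if_neg (by simpa [Nat.lt_succ_iff] using hlt), mul_zero] at hkf
    have := (mul_eq_zero.1 hkf).resolve_right D.kf_ne
    rw [hn] at this
    exact_mod_cast this
  · have hgst : ∀ x ∈ eig K H0 1, g x ∈ eig K H0 1 := by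
      intro x hx
      obtain ⟨s, v, hv, hxv⟩ := S.exists_eq_sum_nat j ⟨x, hx⟩
      have : x = ∑ i ∈ s, (v i : L) := by
        rw [← AddSubmonoidClass.coe_finsetSum, ← hxv]
      rw [this, map_sum]
      refine Submodule.sum_mem _ fun i _ => ?_
      rw [hg i _ (hv i)]
      exact Submodule.smul_mem _ _ (v i).2
    let φ : eig K H0 1 →ₗ[K] eig K H0 1 := (g : L →ₗ[K] L).restrict hgst
    have heq : polyComp φ (S.ext (f k)) = t ^ n • S.ext (f k) := by
      refine mul_right_cancel₀ (I.irreducible_ext k).ne_zero (polyFun_ext fun x => ?_)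
      change (polyComp φ (S.ext (f k))).1 x * (S.ext (f k)).1 x =
        (t ^ n * (S.ext (f k)).1 x) * (S.ext (f k)).1 x
      by_cases hx : (S.ext (f k)).1 x = 0
      · rw [hx, mul_zero, mul_zero]
      · obtain ⟨n₁, hn₁, h⟩ := key x hx
        have : n₁ = n := by exact_mod_cast hn₁.symm.trans hn
        rw [polyComp_apply, h t g hg (φ x) rfl, this]
    intro x y hy
    have := congrArg (fun q : polyFun K (eig K H0 1) => q.1 x) heq
    rw [show y = φ x from Subtype.ext hy]
    exact this

lemma Sys.Invs.not_dvd (I : S.Invs f) (hirr : IsIrreducibleDegreeOne K H0) {k j : Fin p}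
    (hkj : k ≠ j) : ¬ S.ext (f k) ∣ S.ext (f j) := by
  intro hd
  obtain ⟨c, hc0, hc⟩ := eq_smul_of_associated
    ((I.irreducible_ext k).associated_of_dvd (I.irreducible_ext j) hd)
  have key : ∀ i, ∀ n n' : ℕ, InfRel (S.ext (f k)) (H i) (n : K) →
      InfRel (S.ext (f j)) (H i) (n' : K) → n = n' := by
    intro i n n' hn hn'
    have h1 : InfRel (S.ext (f j)) (H i) (n : K) := hc ▸ hn.smul c
    exact_mod_cast h1.unique (fun x hx => lie_mem_eig' (S.mem_zero i) hx (by norm_num))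
      (I.irreducible_ext j).ne_zero hn'
  rcases lt_or_gt_of_ne hkj with h | h
  · obtain ⟨n, -, hn0, hn, -⟩ := I.exists_weight hirr k j
    obtain ⟨n', hn', -, hn₁, -⟩ := I.exists_weight hirr j j
    have := key j n n' hn hn₁
    have := hn' rfl
    have := hn0 h
    omega
  · obtain ⟨n, -, hn0, hn, -⟩ := I.exists_weight hirr j k
    obtain ⟨n', hn', -, hn₁, -⟩ := I.exists_weight hirr k k
    have := key k n' n hn₁ hn
    have := hn' rfl
    have := hn0 h
    omega

end Invariants

section Factorization

/-- Exponents in a product of pairwise non-associated primes are determined by the product. -/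
lemma exponents_unique {R ι : Type*} [CommMonoidWithZero R] [IsCancelMulZero R] [Fintype ι] [DecidableEq ι]
    {q : ι → R} (hq : ∀ i, Prime (q i)) (hne : ∀ i j, i ≠ j → ¬ q i ∣ q j) {u : R} (hu : IsUnit u)
    {m n : ι → ℕ} (h : ∏ i, q i ^ m i = u * ∏ i, q i ^ n i) : m = n := by
  have key : ∀ (m n : ι → ℕ) (v : R), IsUnit v → ∏ i, q i ^ m i = v * ∏ i, q i ^ n i →
      ∀ i, m i ≤ n i := by
    intro m n v hv h i
    by_contra hlt
    push Not at hlt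
    rw [← Finset.mul_prod_erase _ _ (Finset.mem_univ i),
      ← Finset.mul_prod_erase _ (fun i => q i ^ n i) (Finset.mem_univ i)] at h
    obtain ⟨r, hr⟩ : ∃ r, m i = n i + (r + 1) := ⟨m i - n i - 1, by omega⟩
    rw [hr, pow_add, mul_assoc, ← mul_assoc v, mul_comm v, mul_assoc (q i ^ n i)] at h
    have h' := mul_left_cancel₀ (pow_ne_zero _ (hq i).ne_zero) h
    have hd : q i ∣ v * ∏ j ∈ Finset.univ.erase i, q j ^ n j := by
      rw [← h', pow_succ', mul_assoc]
      exact dvd_mul_right _ _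
    rcases (hq i).dvd_or_dvd hd with hd | hd
    · exact (hq i).not_isUnit (isUnit_of_dvd_unit hd hv)
    · obtain ⟨j, hj, hd⟩ := (hq i).exists_mem_finset_dvd hd
      exact hne i j (Finset.ne_of_mem_erase hj).symm ((hq i).dvd_of_dvd_pow hd)
  obtain ⟨u, rfl⟩ := hu
  funext i
  refine le_antisymm (key m n u u.isUnit h i) (key n m ↑u⁻¹ u⁻¹.isUnit ?_ i)
  rw [h, Units.inv_mul_cancel_left]

end Factorization

section GroupBaseChange

variable {F k L : Type*} [Field F] [Field k] [Algebra F k] [LieRing L] [LieAlgebra F L]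
  [FiniteDimensional F L] [CharZero F] {p : ℕ} {H0 : L} {H : Fin p → L}

lemma parabolic_mono {K M : Type*} [Field K] [LieRing M] [LieAlgebra K M]
    {A B : Subgroup (M ≃ₗ[K] M)} (hAB : A ≤ B) (u : M) (v : Fin p → M) :
    parabolic A u v ≤ parabolic B u v :=
  sup_le_sup_right (inf_le_inf_right _ (inf_le_inf_right _ hAB)) _

lemma baseChange_mem_parabolic {g : L ≃ₗ[F] L} (hg : g ∈ parabolic (aut0 F L) H0 H) :
    LinearEquiv.baseChange F (AlgebraicClosure F) L L g ∈
      parabolic (elemAut (AlgebraicClosure F) (AlgebraicClosure F ⊗[F] L))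
        ((1 : AlgebraicClosure F) ⊗ₜ[F] H0) fun i => (1 : AlgebraicClosure F) ⊗ₜ[F] H i := by
  have := charZero_of_algebra F (AlgebraicClosure F)
  let T : Subgroup (L ≃ₗ[F] L) :=
    { carrier := {g | LinearEquiv.baseChange F (AlgebraicClosure F) L L g ∈
        parabolic (elemAut (AlgebraicClosure F) (AlgebraicClosure F ⊗[F] L))
        ((1 : AlgebraicClosure F) ⊗ₜ[F] H0) fun i => (1 : AlgebraicClosure F) ⊗ₜ[F] H i}
      mul_mem' := fun ha hb => by
        simp only [Set.mem_ofPred_eq, LinearEquiv.baseChange_mul] at *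
        exact mul_mem ha hb
      one_mem' := by
        simp only [Set.mem_ofPred_eq, LinearEquiv.baseChange_one]
        exact one_mem _
      inv_mem' := fun ha => by
        simp only [Set.mem_ofPred_eq, LinearEquiv.baseChange_inv] at *
        exact inv_mem ha }
  suffices h : parabolic (aut0 F L) H0 H ≤ T from h hg
  refine sup_le (fun g hg => ?_) ((Subgroup.closure_le _).2 ?_)
  · have hfix := (mem_fixingSubgroup_iff _).1 hg.2
    refine (le_sup_left : _ ≤ parabolic _ _ _)
      ⟨⟨hg.1.1.2, baseChange_mem_lieAut hg.1.2⟩, (mem_fixingSubgroup_iff _).2 ?_⟩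
    have key : ∀ u, g u = u → LinearEquiv.baseChange F (AlgebraicClosure F) L L g (1 ⊗ₜ[F] u) =
        1 ⊗ₜ[F] u := fun u hu => by rw [LinearEquiv.baseChange_tmul, hu]
    rintro _ (rfl | ⟨i, rfl⟩)
    · exact key _ (hfix H0 (Set.mem_insert _ _))
    · exact key _ (hfix _ (Set.mem_insert_of_mem _ ⟨i, rfl⟩))
  · rintro _ ⟨X, hX, hn, hg⟩
    refine (le_sup_right : _ ≤ parabolic _ _ _) (Subgroup.subset_closure ?_)
    rw [eq_expE hn hg, baseChange_expE]
    exact expE_mem _ (one_tmul_mem_nilT hX)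

end GroupBaseChange

section Fractions

variable {K V : Type*} [Field K] [CharZero K] [AddCommGroup V] [Module K V] [FiniteDimensional K V]

lemma associated_polyComp {a b : polyFun K V} (hab : IsRelPrime a b) {φ ψ : V →ₗ[K] V}
    (hψ : ∀ x, ψ (φ x) = x) {c c' : K}
    (h : polyComp φ a * b = c • (a * polyComp φ b))
    (h' : polyComp ψ a * b = c' • (a * polyComp ψ b)) : Associated a (polyComp φ a) := by
  have key : ∀ (φ : V →ₗ[K] V) (c : K), polyComp φ a * b = c • (a * polyComp φ b) →
      a ∣ polyComp φ a := fun φ c h => isRelPrime_dvd hab (by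
    rw [h, Algebra.smul_def]
    exact (dvd_mul_right _ _).mul_left _)
  refine associated_of_dvd_dvd (key φ c h) ?_
  have h2 := map_dvd (polyComp φ) (key ψ c' h')
  rwa [show polyComp φ (polyComp ψ a) = a from polyFun_ext fun x => by
    rw [polyComp_apply, polyComp_apply, hψ]] at h2

lemma toNat_identity (m n : ℕ) : m + (-((m : ℤ) - n)).toNat = n + ((m : ℤ) - n).toNat := by omega

lemma exists_int_exponents {ι : Type*} [Fintype ι] {q : ι → polyFun K V} {a b d : polyFun K V}
    {n n' : ι → ℕ} {c c' : K} (hc' : c' ≠ 0) (ha : a = d * (c • ∏ i, q i ^ n i))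
    (hb : b = d * (c' • ∏ i, q i ^ n' i)) :
    a * ∏ i, q i ^ (-((n i : ℤ) - n' i)).toNat =
      (c / c') • (b * ∏ i, q i ^ ((n i : ℤ) - n' i).toNat) := by
  rw [ha, hb]
  simp only [mul_smul_comm, smul_mul_assoc, smul_smul, mul_assoc, ← Finset.prod_mul_distrib,
    ← pow_add, toNat_identity]
  rw [div_mul_cancel₀ _ hc']

lemma int_exponents_unique {ι : Type*} [Fintype ι] {q : ι → polyFun K V}
    (hq : ∀ i, Irreducible (q i)) (hne : ∀ i j, i ≠ j → ¬ q i ∣ q j) {a b : polyFun K V} (ha : a ≠ 0)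
    (hb : b ≠ 0) {m m' : ι → ℤ} {c c' : K} (hc : c ≠ 0) (hc' : c' ≠ 0)
    (h : a * ∏ i, q i ^ (-(m i)).toNat = c • (b * ∏ i, q i ^ (m i).toNat))
    (h' : a * ∏ i, q i ^ (-(m' i)).toNat = c' • (b * ∏ i, q i ^ (m' i).toNat)) : m = m' := by
  classical
  have key : ∏ i, q i ^ ((-(m i)).toNat + (m' i).toNat) =
      algebraMap K _ (c / c') * ∏ i, q i ^ ((-(m' i)).toNat + (m i).toNat) := by
    simp only [pow_add, Finset.prod_mul_distrib]
    refine mul_left_cancel₀ (mul_ne_zero (smul_ne_zero hc' ha) hb) ?_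
    rw [Algebra.smul_def] at h h' ⊢
    have h1 : algebraMap K (polyFun K V) c = algebraMap K _ c' * algebraMap K _ (c / c') := by
      rw [← map_mul, mul_div_cancel₀ _ hc']
    calc _ = algebraMap K (polyFun K V) c' * (a * ∏ i, q i ^ (-(m i)).toNat) *
          (b * ∏ i, q i ^ (m' i).toNat) := by ring
      _ = (algebraMap K _ c' * (b * ∏ i, q i ^ (m' i).toNat)) * algebraMap K _ c *
          (b * ∏ i, q i ^ (m i).toNat) := by rw [h]; ring
      _ = _ := by rw [← h', h1]; ring
  have := exponents_unique (fun i => (hq i).prime) hne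
    ((isUnit_iff_ne_zero.2 (div_ne_zero hc hc')).map (algebraMap K (polyFun K V))) key
  funext i
  have := congrFun this i
  omega

end Fractions

section FundamentalSystem

variable {F L : Type*} [Field F] [LieRing L] [LieAlgebra F L] [FiniteDimensional F L] [CharZero F]
  [LieAlgebra.IsKilling F L]
  [LieAlgebra.IsKilling (AlgebraicClosure F) (AlgebraicClosure F ⊗[F] L)]
  {p : ℕ} {H0 : L} {H : Fin p → L}

/-- A fraction that is relatively invariant under the rational points of the parabolic subgroup is
a product of powers of the basic invariants. -/
theorem exists_eq_prod_of_fraction (S : Sys F H0 H) (hreg : IsOneSimple F H0 (2 • H0))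
    {S' : Sys (AlgebraicClosure F) ((1 : AlgebraicClosure F) ⊗ₜ[F] H0)
      fun i => (1 : AlgebraicClosure F) ⊗ₜ[F] H i}
    (hirr : IsIrreducibleDegreeOne (AlgebraicClosure F) ((1 : AlgebraicClosure F) ⊗ₜ[F] H0))
    {f : ∀ k : Fin p, polyFun (AlgebraicClosure F)
      (eig (AlgebraicClosure F) (partialSum (fun i => (1 : AlgebraicClosure F) ⊗ₜ[F] H i)
        ((k : ℕ) + 1)) 2 ⊓ eig (AlgebraicClosure F) (1 ⊗ₜ[F] H0) 1 : Submodule _ _)}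
    (I : S'.Invs f)
    {a b : polyFun (AlgebraicClosure F) (eig (AlgebraicClosure F) (1 ⊗ₜ[F] H0) 1)}
    (ha : a ≠ 0) (hb : b ≠ 0)
    (h : ∀ g ∈ parabolic (aut0 F L) H0 H, ∃ c : AlgebraicClosure F, ∀ x y : eig (AlgebraicClosure F)
      ((1 : AlgebraicClosure F) ⊗ₜ[F] H0) 1,
      (y : AlgebraicClosure F ⊗[F] L) = LinearEquiv.baseChange F (AlgebraicClosure F) L L g x →
        a.1 y * b.1 x = c * (a.1 x * b.1 y)) :
    ∃! m : Fin p → ℤ, ∃ c : (AlgebraicClosure F)ˣ, a * ∏ i, S'.ext (f i) ^ (-(m i)).toNat =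
      (c : AlgebraicClosure F) • (b * ∏ i, S'.ext (f i) ^ (m i).toNat) := by
  have := charZero_of_algebra F (AlgebraicClosure F)
  obtain ⟨d, a', b', hd, rfl, rfl, hab⟩ := exists_isRelPrime (g := b) ha
  have ha' := right_ne_zero_of_mul ha
  have hb' := right_ne_zero_of_mul hb
  have hst : ∀ g ∈ parabolic (aut0 F L) H0 H, ∀ x ∈ eig (AlgebraicClosure F) (1 ⊗ₜ[F] H0) 1,
      LinearEquiv.baseChange F (AlgebraicClosure F) L L g x ∈
        eig (AlgebraicClosure F) ((1 : AlgebraicClosure F) ⊗ₜ[F] H0) 1 := fun g hg =>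
    parabolic_stable _ _ _ 1 _ (baseChange_mem_parabolic hg)
  let φ : ∀ g, g ∈ parabolic (aut0 F L) H0 H →
      (eig (AlgebraicClosure F) ((1 : AlgebraicClosure F) ⊗ₜ[F] H0) 1 →ₗ[AlgebraicClosure F]
        eig (AlgebraicClosure F) ((1 : AlgebraicClosure F) ⊗ₜ[F] H0) 1) := fun g hg =>
    LinearMap.restrict (LinearEquiv.baseChange F (AlgebraicClosure F) L L g :
      AlgebraicClosure F ⊗[F] L →ₗ[AlgebraicClosure F] AlgebraicClosure F ⊗[F] L) (hst g hg)
  have hred : ∀ g (hg : g ∈ parabolic (aut0 F L) H0 H), ∃ c : AlgebraicClosure F,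
      polyComp (φ g hg) a' * b' =
      c • (a' * polyComp (φ g hg) b') := by
    intro g hg
    obtain ⟨c, hc⟩ := h g hg
    refine ⟨c, ?_⟩
    have hdφ : polyComp (φ g hg) d ≠ 0 := by
      intro h0
      obtain ⟨x, hx⟩ := exists_apply_ne_zero hd
      have hx' := hst g⁻¹ (inv_mem hg) x x.2
      refine hx ?_
      have h1 := congrArg (fun q : polyFun (AlgebraicClosure F) _ => q.1 ⟨_, hx'⟩) h0
      have h2 : φ g hg ⟨_, hx'⟩ = x := Subtype.ext (by
        change LinearEquiv.baseChange F (AlgebraicClosure F) L L g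
          (LinearEquiv.baseChange F (AlgebraicClosure F) L L g⁻¹ x) = x
        rw [← LinearEquiv.mul_apply, ← LinearEquiv.baseChange_mul, mul_inv_cancel,
          LinearEquiv.baseChange_one]
        rfl)
      rw [← h2]
      exact h1
    refine mul_left_cancel₀ (mul_ne_zero hdφ hd) (polyFun_ext fun x => ?_)
    have := hc x (φ g hg x) rfl
    change (d.1 (φ g hg x) * d.1 x) * (a'.1 (φ g hg x) * b'.1 x) =
      (d.1 (φ g hg x) * d.1 x) * (c * (a'.1 x * b'.1 (φ g hg x)))
    change (d.1 (φ g hg x) * a'.1 (φ g hg x)) * (d.1 x * b'.1 x) =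
      c * ((d.1 x * a'.1 x) * (d.1 (φ g hg x) * b'.1 (φ g hg x))) at this
    linear_combination this
  have hinvφ : ∀ g (hg : g ∈ parabolic (aut0 F L) H0 H) x,
      (φ g⁻¹ (inv_mem hg))
      ((φ g hg) x) = x :=
    fun g hg x => Subtype.ext (by
      change LinearEquiv.baseChange F (AlgebraicClosure F) L L g⁻¹
        (LinearEquiv.baseChange F (AlgebraicClosure F) L L g x) = x
      rw [← LinearEquiv.mul_apply, ← LinearEquiv.baseChange_mul, inv_mul_cancel,
        LinearEquiv.baseChange_one]
      rfl)
  have hprod : ∀ a' b' : polyFun (AlgebraicClosure F)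
      (eig (AlgebraicClosure F) ((1 : AlgebraicClosure F) ⊗ₜ[F] H0) 1), a' ≠ 0 → IsRelPrime a' b' →
      (∀ g (hg : g ∈ parabolic (aut0 F L) H0 H), ∃ c : AlgebraicClosure F,
        polyComp (φ g hg) a' * b' =
        c • (a' * polyComp (φ g hg) b')) →
      ∃ (n : Fin p → ℕ) (c : AlgebraicClosure F), c ≠ 0 ∧ a' = c • ∏ k, S'.ext (f k) ^ n k := by
    intro a' b' ha' hab hred
    refine S'.exists_eq_prod I.irreducible_ext (fun x hx => I.good hirr hx) ha' fun X hX =>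
      infRel_of_parabolic S hreg (fun g hg => ?_) hX
    obtain ⟨c, hc⟩ := hred g hg
    obtain ⟨c', hc'⟩ := hred g⁻¹ (inv_mem hg)
    obtain ⟨e, -, he⟩ := eq_smul_of_associated (associated_polyComp hab (hinvφ g hg) hc hc')
    refine ⟨e, fun x => ⟨⟨_, hst g hg x x.2⟩, rfl, ?_⟩⟩
    exact congrArg (fun q : polyFun (AlgebraicClosure F) _ => q.1 x) he
  obtain ⟨n, c, hc, hn⟩ := hprod a' b' ha' hab hred
  obtain ⟨n', c', hc', hn'⟩ := hprod b' a' hb' hab.symm fun g hg => by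
    obtain ⟨c, hc⟩ := hred g hg
    have hc0 : c ≠ 0 := by
      rintro rfl
      rw [zero_smul] at hc
      obtain ⟨x, hx⟩ := exists_apply_ne_zero ha'
      refine (mul_ne_zero ?_ hb') hc
      intro h0
      refine hx ?_
      have := hinvφ g⁻¹ (inv_mem hg) x
      have h1 := congrArg (fun q : polyFun (AlgebraicClosure F) _ => q.1 ⟨_, hst g⁻¹ (inv_mem hg) x x.2⟩) h0
      change a'.1 _ = 0 at h1
      rw [← this]
      simp only [inv_inv]
      exact h1
    refine ⟨c⁻¹, ?_⟩
    rw [mul_comm b', hc, inv_smul_smul₀ hc0, mul_comm]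
  refine ⟨fun i => (n i : ℤ) - n' i, ⟨Units.mk0 _ (div_ne_zero hc hc'),
    exists_int_exponents hc' (by rw [← hn]) (by rw [← hn'])⟩, ?_⟩
  rintro m ⟨u, hu⟩
  exact int_exponents_unique I.irreducible_ext (fun i j hij => I.not_dvd hirr hij) ha hb u.ne_zero
    (div_ne_zero hc hc') hu (exists_int_exponents hc' (by rw [← hn]) (by rw [← hn']))

end FundamentalSystem

section Chevalley

open MvPolynomial in
/-- A dominant polynomial map, restricted to a principal open set, attains all values in some
principal open set. -/
lemma exists_forall_eval_ne_zero {K σ ι : Type*} [Field K] [IsAlgClosed K] [Finite σ] [Finite ι]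
    {Ψ : ι → MvPolynomial σ K} (hΨ : Function.Injective (aeval Ψ : MvPolynomial ι K →ₐ[K] _))
    {b : MvPolynomial σ K} (hb : b ≠ 0) : ∃ f : MvPolynomial ι K, f ≠ 0 ∧
      ∀ v : ι → K, eval v f ≠ 0 → ∃ t : σ → K, eval t b ≠ 0 ∧ ∀ i, eval t (Ψ i) = v i := by
  let φ : MvPolynomial ι K →+* MvPolynomial σ K := (aeval Ψ : MvPolynomial ι K →ₐ[K] _)
  have hφ : φ.FinitePresentation := by
    have h1 : (φ.comp (algebraMap K (MvPolynomial ι K))).FiniteType := by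
      have : φ.comp (algebraMap K (MvPolynomial ι K)) = algebraMap K (MvPolynomial σ K) :=
        (aeval Ψ : MvPolynomial ι K →ₐ[K] _).comp_algebraMap
      rw [this]
      exact RingHom.finiteType_algebraMap.2 inferInstance
    exact RingHom.FinitePresentation.of_finiteType.1 (RingHom.FiniteType.of_comp_finiteType h1)
  have hcon := PrimeSpectrum.isConstructible_comap_image hφ
    (s := (PrimeSpectrum.basicOpen b : Set _))
    ((PrimeSpectrum.isCompact_basicOpen b).isConstructible (PrimeSpectrum.basicOpen b).isOpen)
  obtain ⟨S, hS⟩ := PrimeSpectrum.exists_constructibleSetData_iff.2 hcon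
  have hη : (⊥ : PrimeSpectrum (MvPolynomial ι K)) ∈ S.toSet := by
    rw [hS]
    refine ⟨⊥, ?_, ?_⟩
    · rw [SetLike.mem_coe, PrimeSpectrum.mem_basicOpen]
      exact hb
    · apply PrimeSpectrum.ext
      exact (RingHom.injective_iff_ker_eq_bot φ).1 hΨ
  obtain ⟨B, hB, hηB⟩ := Set.mem_iUnion₂.1 hη
  have hg : ∀ i, B.g i = 0 := fun i => hηB.1 ⟨i, rfl⟩
  have hf : B.f ≠ 0 := fun h0 => hηB.2 (by rw [PrimeSpectrum.mem_zeroLocus]; simp [h0])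
  refine ⟨B.f, hf, fun v hv => ?_⟩
  let m : PrimeSpectrum (MvPolynomial ι K) := ⟨RingHom.ker (eval v), RingHom.ker_isPrime _⟩
  have hm : m ∈ S.toSet := Set.mem_iUnion₂.2 ⟨B, hB, by
    rw [PrimeSpectrum.mem_zeroLocus]
    rintro _ ⟨i, rfl⟩
    rw [hg i]
    exact zero_mem _, fun h => hv (by
      rw [PrimeSpectrum.mem_zeroLocus, Set.singleton_subset_iff] at h
      exact h)⟩
  rw [hS] at hm
  obtain ⟨P, hP, hPm⟩ := hm
  rw [SetLike.mem_coe, PrimeSpectrum.mem_basicOpen] at hP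
  have hrad := vanishingIdeal_zeroLocus_eq_radical (k := K) (K := K) P.asIdeal
  rw [P.isPrime.radical] at hrad
  rw [← hrad, mem_vanishingIdeal_iff] at hP
  push Not at hP
  obtain ⟨t, ht, hbt⟩ := hP
  refine ⟨t, by simpa [aeval_eq_eval] using hbt, fun i => ?_⟩
  have hmem : X i - MvPolynomial.C (v i) ∈ m.asIdeal := by
    change eval v (X i - MvPolynomial.C (v i)) = 0
    simp
  rw [← hPm] at hmem
  have := ht _ hmem
  change aeval t (aeval Ψ (X i - MvPolynomial.C (v i))) = 0 at this
  simp only [map_sub, aeval_X, algHom_C, algebraMap_eq] at this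
  simpa [aeval_eq_eval, sub_eq_zero] using this

end Chevalley

section PolyMap

variable {K V E : Type*} [Field K] [CharZero K] [AddCommGroup V] [Module K V]
  [FiniteDimensional K V] [AddCommGroup E] [Module K E] [FiniteDimensional K E]

/-- `Ψ` is a polynomial map with derivative `D`. -/
def IsPolyMap (Ψ : E → V) (D : E → E → V) : Prop :=
  ∀ l : V →ₗ[K] K, ∃ r : polyFun K E, ∀ t, r.1 t = l (Ψ t) ∧ ∀ v, dd r t v = l (D t v)

lemma IsPolyMap.comp {Ψ : E → V} {D : E → E → V} (h : IsPolyMap (K := K) Ψ D) (q : polyFun K V) :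
    ∃ r : polyFun K E, ∀ t, r.1 t = q.1 (Ψ t) ∧ ∀ v, dd r t v = dd q (Ψ t) (D t v) := by
  induction q using polyFun_induction with
  | const c => exact ⟨algebraMap K _ c, fun t => ⟨rfl, fun v => by simp [← pder_apply]⟩⟩
  | lin l =>
    obtain ⟨r, hr⟩ := h l
    refine ⟨r, fun t => ⟨(hr t).1, fun v => ?_⟩⟩
    rw [(hr t).2, ← pder_apply, pder_linElt]
    rfl
  | add f g hf hg =>
    obtain ⟨r, hr⟩ := hf
    obtain ⟨s, hs⟩ := hg
    refine ⟨r + s, fun t => ⟨?_, fun v => ?_⟩⟩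
    · exact congrArg₂ (· + ·) (hr t).1 (hs t).1
    · rw [dd_add, dd_add, (hr t).2, (hs t).2]
  | mul f g hf hg =>
    obtain ⟨r, hr⟩ := hf
    obtain ⟨s, hs⟩ := hg
    refine ⟨r * s, fun t => ⟨?_, fun v => ?_⟩⟩
    · exact congrArg₂ (· * ·) (hr t).1 (hs t).1
    · rw [dd_mul, dd_mul, (hr t).2, (hs t).2, (hr t).1, (hs t).1]

/-- A polynomial map `K^n → V` whose derivative at the origin is bijective is dominant. -/
lemma IsPolyMap.eq_zero {n : ℕ} {Ψ : (Fin n → K) → V} {D : (Fin n → K) → (Fin n → K) → V}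
    (h : IsPolyMap (K := K) Ψ D) (β : Module.Basis (Fin n) K V)
    (hβ : ∀ i, D 0 (Pi.single i 1) = β i) {q : polyFun K V} (hq : ∀ t, q.1 (Ψ t) = 0) : q = 0 := by
  choose r hr using fun j => h (β.coord j)
  let M : Matrix (Fin n) (Fin n) (polyFun K (Fin n → K)) :=
    Matrix.of fun i j => pder K (Pi.single i (1 : K)) (r j)
  have hM : ∀ t i j, (M i j).1 t = β.coord j (D t (Pi.single i 1)) := fun t i j => (hr j t).2 _
  have hdet : M.det ≠ 0 := by
    intro h0
    let ev : polyFun K (Fin n → K) →+* K := (Pi.evalRingHom _ 0).comp (polyFun K (Fin n → K)).val.toRingHom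
    have h1 : ev M.det = (ev.mapMatrix M).det := ev.map_det M
    have h2 : ev.mapMatrix M = 1 := by
      ext i j
      change (M i j).1 0 = _
      rw [hM, hβ, Module.Basis.coord_apply, Module.Basis.repr_self, Finsupp.single_apply,
        Matrix.one_apply]
    rw [h0, map_zero, h2, Matrix.det_one] at h1
    exact zero_ne_one h1
  suffices H : ∀ d, ∀ q : polyFun K V, pdeg q ≤ d → (∀ t, q.1 (Ψ t) = 0) → q = 0 from
    H _ q le_rfl hq
  have hconst : ∀ c : K, (∀ t, (algebraMap K (polyFun K V) c).1 (Ψ t) = 0) →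
      algebraMap K (polyFun K V) c = 0 := fun c hc => by
    have : c = 0 := hc 0
    rw [this, map_zero]
  intro d
  induction d with
  | zero =>
    intro q hd hq
    obtain ⟨c, rfl⟩ := eq_algebraMap_of_pdeg_eq_zero (Nat.le_zero.1 hd)
    exact hconst c hq
  | succ d ih =>
    intro q hd hq
    choose u hu using fun j => h.comp (pder K (β j) q)
    obtain ⟨s, hs⟩ := h.comp q
    have hs0 : s = 0 := polyFun_ext fun t => (hs t).1.trans (hq t)
    have hmul : M.mulVec u = 0 := by
      funext i
      refine polyFun_ext fun t => ?_
      have h1 : (M.mulVec u i).1 t = ∑ j, (M i j).1 t * (u j).1 t := by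
        simp [Matrix.mulVec, dotProduct]
      have h2 := (hs t).2 (Pi.single i 1)
      rw [hs0, ← pder_apply, map_zero, ← β.sum_repr (D t (Pi.single i 1)), map_sum] at h2
      rw [h1]
      refine Eq.trans ?_ h2.symm
      refine Finset.sum_congr rfl fun j _ => ?_
      rw [hM, (hu j t).1, pder_apply, map_smul, smul_eq_mul]
      rfl
    have hu0 := Matrix.eq_zero_of_mulVec_eq_zero hdet hmul
    have hder : ∀ j, pder K (β j) q = 0 := fun j =>
      ih _ ((pdeg_pder_le _ _).trans (by omega)) fun t => by
        rw [← (hu j t).1, hu0]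
        rfl
    obtain ⟨c, rfl⟩ := eq_algebraMap_of_dd_eq_zero (f := q) fun x v => by
      rw [← β.sum_repr v, map_sum]
      refine Finset.sum_eq_zero fun j _ => ?_
      rw [map_smul, ← pder_apply, hder]
      exact smul_zero _
    exact hconst c hq

/-- The image of a principal open set under a dominant polynomial map contains a principal open
set. -/
lemma IsPolyMap.exists_open [IsAlgClosed K] {n : ℕ} {Ψ : (Fin n → K) → V}
    {D : (Fin n → K) → (Fin n → K) → V}
    (h : IsPolyMap (K := K) Ψ D) (β : Module.Basis (Fin n) K V)
    (hβ : ∀ i, D 0 (Pi.single i 1) = β i) {b : polyFun K (Fin n → K)} (hb : b ≠ 0) :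
    ∃ f : polyFun K V, f ≠ 0 ∧ ∀ v, f.1 v ≠ 0 → ∃ t, b.1 t ≠ 0 ∧ Ψ t = v := by
  choose r hr using fun j => h (β.coord j)
  let e := polyEquiv (Pi.basisFun K (Fin n))
  have he : ∀ (p : polyFun K (Fin n → K)) t, MvPolynomial.eval t (e.symm p) = p.1 t := fun p t => by
    obtain ⟨p, rfl⟩ := e.surjective p
    rw [AlgEquiv.symm_apply_apply, polyEquiv_apply]
    simp
  have hcoord : ∀ t j, MvPolynomial.eval t (e.symm (r j)) = β.repr (Ψ t) j := fun t j => by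
    rw [he, (hr j t).1]
    rfl
  obtain ⟨f, hf0, hf⟩ := exists_forall_eval_ne_zero (Ψ := fun j => e.symm (r j)) (b := e.symm b)
    ((injective_iff_map_eq_zero _).2 fun p hp => by
      rw [← map_eq_zero_iff (polyEquiv β) (polyEquiv β).injective]
      refine h.eq_zero β hβ fun t => ?_
      have h1 := congrArg (MvPolynomial.eval t) hp
      rw [map_zero, ← MvPolynomial.aeval_eq_eval, MvPolynomial.comp_aeval_apply] at h1
      rw [polyEquiv_apply, ← MvPolynomial.aeval_eq_eval]
      refine Eq.trans ?_ h1
      congr 2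
      funext j
      rw [← hcoord t j, MvPolynomial.aeval_eq_eval])
    (by simpa using hb)
  refine ⟨polyEquiv β f, by simpa using hf0, fun v hv => ?_⟩
  rw [polyEquiv_apply] at hv
  obtain ⟨t, ht, htv⟩ := hf _ hv
  refine ⟨t, by rwa [he] at ht, β.repr.injective (Finsupp.ext fun j => ?_)⟩
  rw [← htv, hcoord]

end PolyMap

section OpenOrbit

variable {K M : Type*} [Field K] [CharZero K] [LieRing M] [LieAlgebra K M] [FiniteDimensional K M]

/-- `w` is the derivative at the origin of a polynomial curve through `x` that is drawn by a
polynomial curve of operators which, on `V`, belong to `Γ` outside a finite set. -/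
def IsDirection (Γ : Subgroup (M ≃ₗ[K] M)) (V : Submodule K M) (x w : M) : Prop :=
  ∃ (n : ℕ) (P : Fin n → Polynomial K) (T : Fin n → Module.End K M) (b : Polynomial K),
    b.eval 0 ≠ 0 ∧ (∀ t, b.eval t ≠ 0 → ∃ g ∈ Γ, ∀ v ∈ V, ∑ s, (P s).eval t • T s v = g v) ∧
      (∀ v, ∑ s, (P s).eval 0 • T s v = v) ∧ ∑ s, (P s).derivative.eval 0 • T s x = w

lemma aeval_linElt {E : Type*} [AddCommGroup E] [Module K E] [FiniteDimensional K E] (l : E →ₗ[K] K)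
    (P : Polynomial K) (t : E) : (Polynomial.aeval (linElt l) P).1 t = P.eval (l t) ∧
      ∀ v, dd (Polynomial.aeval (linElt l) P) t v = P.derivative.eval (l t) * l v := by
  have h1 : ∀ P : Polynomial K, (Polynomial.aeval (linElt l) P).1 t = P.eval (l t) := by
    intro P
    have h2 : (Polynomial.aeval (linElt l) P).1 = Polynomial.aeval (fun x => l x) P :=
      (Polynomial.aeval_algHom_apply (polyFun K E).val (linElt l) P).symm
    rw [h2]
    have h3 := Polynomial.aeval_algHom_apply (Pi.evalAlgHom K (fun _ : E => K) t) (fun x => l x) P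
    exact h3.symm.trans (by simp [Polynomial.aeval_def, Polynomial.eval₂_eq_eval_map])
  refine ⟨h1 P, fun v => ?_⟩
  rw [← pder_apply, Derivation.map_aeval, pder_linElt]
  change (Polynomial.aeval (linElt l) P.derivative).1 t * l v = _
  rw [h1]

lemma exists_isPolyMap_of_directions {Γ : Subgroup (M ≃ₗ[K] M)} {V : Submodule K M}
    (hst : ∀ g ∈ Γ, ∀ x ∈ V, g x ∈ V) {x : M} (hx : x ∈ V) {n : ℕ} {w : Fin n → M}
    (hw : ∀ i, IsDirection Γ V x (w i)) :
    ∃ (Ψ : (Fin n → K) → M) (D : (Fin n → K) → (Fin n → K) → M) (b : polyFun K (Fin n → K)),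
      IsPolyMap (K := K) Ψ D ∧ (∀ v, D 0 v = ∑ i, v i • w i) ∧ b ≠ 0 ∧
        ∀ t, b.1 t ≠ 0 → ∃ g ∈ Γ, Ψ t = g x := by
  choose d P T b hb0 hΓ h0 h1 using hw
  have key : ∀ l : List (Fin n), ∃ (Ψ : (Fin n → K) → M) (D : (Fin n → K) → (Fin n → K) → M),
      IsPolyMap (K := K) Ψ D ∧ (∀ t, (∀ i, (b i).eval (t i) ≠ 0) → ∃ g ∈ Γ, Ψ t = g x) ∧
        Ψ 0 = x ∧ ∀ v, D 0 v = (l.map fun i => v i • w i).sum := by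
    intro l
    induction l with
    | nil =>
      refine ⟨fun _ => x, fun _ _ => 0, fun l => ⟨algebraMap K _ (l x), fun t => ⟨rfl, fun v => ?_⟩⟩,
        fun t _ => ⟨1, one_mem _, rfl⟩, rfl, fun v => by simp⟩
      rw [← pder_apply]
      simp
    | cons i l ih =>
      obtain ⟨Ψ, D, hp, hg, hΨ0, hD⟩ := ih
      refine ⟨fun t => ∑ s, (P i s).eval (t i) • T i s (Ψ t),
        fun t v => ∑ s, ((P i s).eval (t i) • T i s (D t v) +
          (v i * (P i s).derivative.eval (t i)) • T i s (Ψ t)), ?_, ?_, ?_, ?_⟩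
      · intro φ
        choose r hr using fun s => hp (φ ∘ₗ T i s)
        refine ⟨∑ s, Polynomial.aeval (linElt (LinearMap.proj i)) (P i s) * r s, fun t =>
          ⟨?_, fun v => ?_⟩⟩
        · have : (∑ s, Polynomial.aeval (linElt (LinearMap.proj i)) (P i s) * r s).1 t =
              ∑ s, (Polynomial.aeval (linElt (LinearMap.proj i)) (P i s)).1 t * (r s).1 t := by simp
          rw [this, map_sum]
          refine Finset.sum_congr rfl fun s _ => ?_
          rw [(aeval_linElt _ _ t).1, (hr s t).1, map_smul]
          rfl
        · have : dd (∑ s, Polynomial.aeval (linElt (LinearMap.proj i)) (P i s) * r s) t v =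
              ∑ s, dd (Polynomial.aeval (linElt (LinearMap.proj i)) (P i s) * r s) t v := by
            simp [← pder_apply]
          rw [this, map_sum]
          refine Finset.sum_congr rfl fun s _ => ?_
          rw [dd_mul, (aeval_linElt _ _ t).1, (aeval_linElt _ _ t).2, (hr s t).1, (hr s t).2, map_add,
            map_smul, map_smul]
          simp only [LinearMap.comp_apply, LinearMap.proj_apply, smul_eq_mul]
          ring
      · intro t ht
        obtain ⟨g, hgΓ, hgx⟩ := hg t ht
        obtain ⟨g', hgΓ', hgx'⟩ := hΓ i (t i) (ht i)
        refine ⟨g' * g, mul_mem hgΓ' hgΓ, ?_⟩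
        rw [LinearEquiv.mul_apply, ← hgx, ← hgx' _ (hgx ▸ hst g hgΓ x hx)]
      · simp only [Pi.zero_apply, hΨ0]
        exact h0 i x
      · intro v
        simp only [Pi.zero_apply, hΨ0, hD, Finset.sum_add_distrib, h0 i, mul_smul,
          ← Finset.smul_sum, h1 i]
        rw [List.map_cons, List.sum_cons, add_comm]
  obtain ⟨Ψ, D, hp, hg, hΨ0, hD⟩ := key (List.finRange n)
  have hB : ∀ t, (∏ i, Polynomial.aeval (linElt (LinearMap.proj i)) (b i) :
      polyFun K (Fin n → K)).1 t = ∏ i, (b i).eval (t i) := fun t => by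
    have : (∏ i, Polynomial.aeval (linElt (LinearMap.proj i)) (b i) : polyFun K (Fin n → K)).1 t =
      ∏ i, (Polynomial.aeval (linElt (LinearMap.proj i)) (b i) : polyFun K (Fin n → K)).1 t := by simp
    rw [this]
    exact Finset.prod_congr rfl fun i _ => (aeval_linElt _ _ t).1
  refine ⟨Ψ, D, ∏ i, Polynomial.aeval (linElt (LinearMap.proj i)) (b i), hp,
    fun v => by rw [hD, Fin.sum_univ_def], fun h => ?_, fun t ht => hg t fun i => ?_⟩
  · have h2 := hB 0
    rw [h] at h2
    exact (Finset.prod_ne_zero_iff.2 fun i _ => hb0 i) h2.symm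
  · rw [hB] at ht
    exact Finset.prod_ne_zero_iff.1 ht i (Finset.mem_univ i)

/-- An orbit whose directions span the space is Zariski open. -/
theorem isPrehomogeneous_of_directions [IsAlgClosed K] {Γ : Subgroup (M ≃ₗ[K] M)}
    {V : Submodule K M} (hst : ∀ g ∈ Γ, ∀ x ∈ V, g x ∈ V) {x : M} (hx : x ∈ V)
    (hspan : ∀ w ∈ V, w ∈ Submodule.span K {w | w ∈ V ∧ IsDirection Γ V x w}) :
    IsPrehomogeneous (restrictRep Γ V hst) := by
  have hs : ⊤ ≤ Submodule.span K {w : V | IsDirection Γ V x w} := by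
    rw [← Submodule.map_le_map_iff_of_injective V.injective_subtype, Submodule.map_span,
      Submodule.map_top, Submodule.range_subtype]
    intro w hw
    refine Submodule.span_mono ?_ (hspan w hw)
    rintro w ⟨hw, h⟩
    exact ⟨⟨w, hw⟩, h, rfl⟩
  let β₀ := Module.Basis.ofSpan hs
  have := Module.Finite.finite_basis β₀
  let β := β₀.reindex (Finite.equivFin _)
  have hβ : ∀ i, IsDirection Γ V x (β i) := by
    intro i
    rw [Module.Basis.reindex_apply]
    exact Module.Basis.ofSpan_subset hs ⟨_, rfl⟩
  obtain ⟨Ψ, D, b, hΨ, hD, hb, hbΓ⟩ := exists_isPolyMap_of_directions hst hx hβ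
  obtain ⟨π, hπ⟩ := V.subtype.exists_leftInverse_of_injective (Submodule.ker_subtype V)
  have hπ' : ∀ x : V, π x = x := fun x => LinearMap.congr_fun hπ x
  have hΨ' : IsPolyMap (K := K) (fun t => π (Ψ t)) (fun t v => π (D t v)) := fun l => hΨ (l ∘ₗ π)
  obtain ⟨f, hf0, hf⟩ := hΨ'.exists_open β (fun i => by
    rw [hD, Finset.sum_eq_single i (fun j _ hj => by rw [Pi.single_eq_of_ne hj, zero_smul])
      (fun h => absurd (Finset.mem_univ i) h), Pi.single_eq_same, one_smul, hπ']) hb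
  have hfΓ : ∀ v, f.1 v ≠ 0 → ∃ g : Γ, restrictRep Γ V hst g ⟨x, hx⟩ = v := by
    intro v hv
    obtain ⟨t, ht, rfl⟩ := hf v hv
    obtain ⟨g, hg, hgx⟩ := hbΓ t ht
    refine ⟨⟨g, hg⟩, ?_⟩
    rw [hgx, ← hπ' (restrictRep Γ V hst ⟨g, hg⟩ ⟨x, hx⟩)]
    rfl
  refine ⟨⟨x, hx⟩, Set.range fun g : Γ => polyComp (restrictRep Γ V hst g⁻¹) f, ?_⟩
  have hmul : ∀ (g g' : Γ) v, restrictRep Γ V hst g (restrictRep Γ V hst g' v) =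
      restrictRep Γ V hst (g * g') v := fun g g' v => by rw [map_mul, Module.End.mul_apply]
  ext y
  constructor
  · rintro ⟨h, rfl⟩
    obtain ⟨u, hu⟩ := exists_apply_ne_zero hf0
    obtain ⟨g, hg⟩ := hfΓ u hu
    refine ⟨_, ⟨h * g⁻¹, rfl⟩, ?_⟩
    rw [polyComp_apply, hmul, mul_inv_rev, inv_inv, inv_mul_cancel_right, hg]
    exact hu
  · rintro ⟨_, ⟨g, rfl⟩, hg⟩
    rw [polyComp_apply] at hg
    obtain ⟨h, hh⟩ := hfΓ _ hg
    refine ⟨g * h, ?_⟩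
    dsimp only
    rw [← hmul, hh, hmul, mul_inv_cancel, map_one, Module.End.one_apply]

end OpenOrbit

section Directions

variable {K M : Type*} [Field K] [CharZero K] [IsAlgClosed K] [LieRing M] [LieAlgebra K M]
  [FiniteDimensional K M] {p : ℕ} {H0 : M} {H : Fin p → M}

lemma mem_parabolic_of_elemAut {g : M ≃ₗ[K] M} (hg : g ∈ elemAut K M) (h0 : g H0 = H0)
    (hH : ∀ i, g (H i) = H i) : g ∈ parabolic (elemAut K M) H0 H := by
  refine (le_sup_left : _ ≤ parabolic _ _ _) ⟨⟨hg, elemAut_le_lieAut hg⟩,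
    (mem_fixingSubgroup_iff _).2 ?_⟩
  rintro _ (rfl | ⟨i, rfl⟩)
  exacts [h0, hH i]

lemma Sys.exists_scalar (S : Sys K H0 H) (hreg : IsOneSimple K H0 (2 • H0)) {c : K} (hc : c ≠ 0) :
    ∃ g ∈ parabolic (elemAut K M) H0 H, ∀ x ∈ eig K H0 1, g x = c • x := by
  obtain ⟨t, rfl⟩ := IsAlgClosed.exists_pow_nat_eq c (n := 2) two_pos
  obtain ⟨g, hg, hg0, hg1⟩ := exists_scalar_aut S.diag₀ hreg (t := t) (by rintro rfl; simp at hc)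
  exact ⟨g, mem_parabolic_of_elemAut hg (hg0 _ (lie_self _)) fun i => hg0 _ (by
    rw [← lie_skew, S.comm₀ i, neg_zero]), hg1⟩

lemma Sys.isDirection_self (S : Sys K H0 H) (hreg : IsOneSimple K H0 (2 • H0)) (x : M) :
    IsDirection (parabolic (elemAut K M) H0 H) (eig K H0 1) x x := by
  refine ⟨1, fun _ => 1 + Polynomial.X, fun _ => 1, 1 + Polynomial.X, by simp, fun t ht => ?_,
    fun v => by simp, by simp⟩
  obtain ⟨g, hg, hgx⟩ := S.exists_scalar hreg ht
  exact ⟨g, hg, fun v hv => by rw [hgx v hv]; simp⟩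

lemma Sys.isDirection_nilT (S : Sys K H0 H) (x : M) {X : M} (hX : X ∈ nilT K H0 H) :
    IsDirection (parabolic (elemAut K M) H0 H) (eig K H0 1) x ⁅X, x⁆ := by
  have hnil := S.isNilpotent_nilT hX
  have hN : ∃ N, LieAlgebra.ad K M X ^ N = 0 := hnil
  obtain ⟨N, hN⟩ := hN
  have hN' : LieAlgebra.ad K M X ^ (N + 2) = 0 := pow_eq_zero_of_le (by omega) hN
  refine ⟨N + 2, fun i => Polynomial.C ((i : ℕ).factorial : K)⁻¹ * Polynomial.X ^ (i : ℕ),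
    fun i => LieAlgebra.ad K M X ^ (i : ℕ), 1, by simp, fun t _ => ?_, fun v => ?_, ?_⟩
  · have hmem : t • X ∈ nilT K H0 H := Submodule.smul_mem _ _ hX
    refine ⟨expE (t • X) (S.isNilpotent_nilT hmem), (le_sup_right : _ ≤ parabolic _ _ _)
      (Subgroup.subset_closure (expE_mem _ hmem)), fun v _ => ?_⟩
    rw [expE_apply _ (N := N + 2) (by
      rw [map_smul, smul_pow, hN', smul_zero, LinearMap.zero_apply]), Finset.sum_range]
    refine Finset.sum_congr rfl fun i _ => ?_
    rw [map_smul, smul_pow, LinearMap.smul_apply, smul_smul]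
    simp
  · rw [Fin.sum_univ_succ, Finset.sum_eq_zero (fun i _ => by simp)]
    simp
  · rw [Fin.sum_univ_succ, Fin.sum_univ_succ, Finset.sum_eq_zero (fun i _ => by simp)]
    simp

lemma Sys.isDirection_isAdDiag [LieAlgebra.IsKilling K M] (S : Sys K H0 H)
    (hreg : IsOneSimple K H0 (2 • H0)) (x : M) {c : M}
    (hc : IsAdDiag K c) (h0 : ⁅H0, c⁆ = 0) (hH : ∀ i, ⁅H i, c⁆ = 0) : ∃ (e : K) (D : ℕ), D ≠ 0 ∧
      IsDirection (parabolic (elemAut K M) H0 H) (eig K H0 1) x (e • x + (D : K) • ⁅c, x⁆) := by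
  obtain ⟨z, hz⟩ := IsPowerTrace.exists (K := K) c
  have hfin : {a | Module.End.HasEigenvalue (LieAlgebra.ad K M c) a}.Finite :=
    Module.End.finite_hasEigenvalue _
  let A : Finset K := hfin.toFinset
  obtain ⟨D, hD, htop, hg⟩ := exists_elemAut_of_isAdDiag hc hz (A := A)
    (fun a ha => hfin.mem_toFinset.2 ha)
  have hs : ⊤ ≤ Submodule.span K (⋃ m : K → ℤ, (powerEig z D A m : Set M)) := by
    rw [← htop]
    exact iSup_le fun m => (Set.subset_iUnion (fun m => (powerEig z D A m : Set M)) m).trans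
      Submodule.subset_span
  let β₀ := Module.Basis.ofSpan hs
  have := Module.Finite.finite_basis β₀
  let β := β₀.reindex (Finite.equivFin _)
  have hβ : ∀ i, ∃ m, β i ∈ powerEig z D A m := by
    intro i
    rw [Module.Basis.reindex_apply]
    exact Set.mem_iUnion.1 (Module.Basis.ofSpan_subset hs ⟨_, rfl⟩)
  choose m hm using hβ
  let N : ℕ := ∑ i, ∑ a ∈ A, (m i a).natAbs
  have hN : ∀ i, ∀ a ∈ A, 0 ≤ (N : ℤ) + m i a := by
    intro i a ha
    have h1 : (m i a).natAbs ≤ N := (Finset.single_le_sum (f := fun a => (m i a).natAbs)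
      (fun _ _ => Nat.zero_le _) ha).trans (Finset.single_le_sum
        (f := fun i => ∑ a ∈ A, (m i a).natAbs) (fun _ _ => Nat.zero_le _) (Finset.mem_univ i))
    omega
  let q := fun i => ∏ a ∈ A, (1 + Polynomial.C a * Polynomial.X) ^ ((N : ℤ) + m i a).toNat
  have hq0 : ∀ i, (q i).eval 0 = 1 := fun i => (derivative_prod_linear A _).2
  have hD' : (D : K) ≠ 0 := Nat.cast_ne_zero.2 hD
  refine ⟨N * ∑ a ∈ A, a, D, hD, _, q, fun i => (β.coord i).smulRight (β i),
    ∏ a ∈ A, (1 + Polynomial.C a * Polynomial.X), ?_, fun t ht => ?_, fun v => ?_, ?_⟩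
  · simp [Polynomial.eval_prod]
  · simp only [Polynomial.eval_prod, Polynomial.eval_add, Polynomial.eval_one, Polynomial.eval_mul,
      Polynomial.eval_C, Polynomial.eval_X] at ht
    have ht' := Finset.prod_ne_zero_iff.1 ht
    obtain ⟨g, hge, hgx⟩ := hg (fun a => 1 + a * t) ht'
    have hfix : ∀ u, ⁅u, c⁆ = 0 → g u = u := fun u hu => by
      simpa using hgx 0 u (hz.mem_powerEig_zero hu D A)
    have hgP : g ∈ parabolic (elemAut K M) H0 H :=
      mem_parabolic_of_elemAut hge (hfix _ h0) fun i => hfix _ (hH i)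
    obtain ⟨s, hsP, hsx⟩ := S.exists_scalar hreg (pow_ne_zero N ht)
    refine ⟨s * g, mul_mem hsP hgP, fun v hv => ?_⟩
    rw [LinearEquiv.mul_apply, hsx _ (parabolic_stable _ _ _ 1 g hgP v hv)]
    conv_rhs => rw [← β.sum_repr v, map_sum, Finset.smul_sum]
    refine Finset.sum_congr rfl fun i _ => ?_
    have hq : (q i).eval t = (∏ a ∈ A, (1 + a * t)) ^ N * ∏ a ∈ A, (1 + a * t) ^ m i a := by
      simp only [q, Polynomial.eval_prod, Polynomial.eval_pow, Polynomial.eval_add,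
        Polynomial.eval_one, Polynomial.eval_mul, Polynomial.eval_C, Polynomial.eval_X]
      rw [← Finset.prod_pow, ← Finset.prod_mul_distrib]
      refine Finset.prod_congr rfl fun a ha => ?_
      rw [← zpow_natCast _ (Int.toNat _), Int.toNat_of_nonneg (hN i a ha), zpow_add₀ (ht' a ha),
        zpow_natCast]
    rw [map_smul, hgx _ _ (hm i), LinearMap.smulRight_apply, Module.Basis.coord_apply, hq]
    simp only [smul_smul]
    congr 1
    ring
  · conv_rhs => rw [← β.sum_repr v]
    refine Finset.sum_congr rfl fun i _ => ?_
    rw [hq0, one_smul]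
    rfl
  · conv_rhs => rw [← β.sum_repr x]
    rw [Finset.smul_sum, lie_sum, Finset.smul_sum, ← Finset.sum_add_distrib]
    refine Finset.sum_congr rfl fun i _ => ?_
    have h1 := mem_powerEig.1 (hm i) 1
    rw [hz.eq_one] at h1
    have hq : (q i).derivative.eval 0 = N * ∑ a ∈ A, a + ∑ a ∈ A, a ^ 1 * m i a := by
      rw [(derivative_prod_linear A _).1, Finset.mul_sum, ← Finset.sum_add_distrib]
      refine Finset.sum_congr rfl fun a ha => ?_
      have : ((((N : ℤ) + m i a).toNat : ℕ) : K) = (N : K) + m i a := by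
        have h3 := congrArg (Int.cast : ℤ → K) (Int.toNat_of_nonneg (hN i a ha))
        push_cast at h3
        simpa using h3
      rw [this]
      ring
    rw [lie_smul, h1, LinearMap.smulRight_apply, Module.Basis.coord_apply, hq]
    simp only [smul_smul, ← add_smul]
    congr 1
    field_simp

end Directions

section Main

variable {F L : Type*} [Field F] [LieRing L] [LieAlgebra F L] [FiniteDimensional F L] [CharZero F]
  [LieAlgebra.IsKilling F L]
  [LieAlgebra.IsKilling (AlgebraicClosure F) (AlgebraicClosure F ⊗[F] L)]
  {p : ℕ} {H0 : L} {H : Fin p → L}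
  {S' : Sys (AlgebraicClosure F) ((1 : AlgebraicClosure F) ⊗ₜ[F] H0)
      fun i => (1 : AlgebraicClosure F) ⊗ₜ[F] H i}
  {f : ∀ k : Fin p, polyFun (AlgebraicClosure F)
      (eig (AlgebraicClosure F) (partialSum (fun i => (1 : AlgebraicClosure F) ⊗ₜ[F] H i)
        ((k : ℕ) + 1)) 2 ⊓ eig (AlgebraicClosure F) (1 ⊗ₜ[F] H0) 1 : Submodule _ _)}

lemma isOneSimple_tmul (hreg : IsOneSimple F H0 (2 • H0)) : IsOneSimple (AlgebraicClosure F)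
    ((1 : AlgebraicClosure F) ⊗ₜ[F] H0) (2 • ((1 : AlgebraicClosure F) ⊗ₜ[F] H0)) := by
  obtain ⟨x, hx, y, hy, t⟩ := hreg
  refine ⟨_, one_tmul_mem_eig _ hx, _, one_tmul_mem_eig _ hy, ?_⟩
  rw [← TensorProduct.tmul_smul]
  exact isSl2Triple_tmul t

/-- The parabolic subgroup has a Zariski open orbit over the algebraic closure. -/
theorem isPrehomogeneous_geometric (S : Sys F H0 H) (hreg : IsOneSimple F H0 (2 • H0))
    (hirr : IsIrreducibleDegreeOne (AlgebraicClosure F) ((1 : AlgebraicClosure F) ⊗ₜ[F] H0))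
    (I : S'.Invs f) : IsPrehomogeneous (geometricRep (K := F) H0 H 1) := by
  have := charZero_of_algebra F (AlgebraicClosure F)
  obtain ⟨x, hx⟩ := exists_apply_ne_zero (Finset.prod_ne_zero_iff.2 fun k (_ : k ∈ Finset.univ) =>
    (I.irreducible_ext k).ne_zero)
  have hgood : S'.Good (x : AlgebraicClosure F ⊗[F] L) := I.good hirr fun k h0 => hx (by
    rw [Finset.prod_eq_mul_prod_sdiff_singleton_of_mem (Finset.mem_univ k)]
    exact mul_eq_zero_of_left h0 _)
  have htr := S'.transversal hgood
  have hreg' := isOneSimple_tmul hreg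
  let T : Submodule (AlgebraicClosure F) (AlgebraicClosure F ⊗[F] L) :=
    Submodule.span (AlgebraicClosure F) {w | w ∈ eig (AlgebraicClosure F) (1 ⊗ₜ[F] H0) 1 ∧
      IsDirection (parabolic (elemAut (AlgebraicClosure F) (AlgebraicClosure F ⊗[F] L))
        (1 ⊗ₜ[F] H0) fun i => 1 ⊗ₜ[F] H i) (eig (AlgebraicClosure F) (1 ⊗ₜ[F] H0) 1) x w}
  have hst : ∀ X ∈ eig (AlgebraicClosure F) ((1 : AlgebraicClosure F) ⊗ₜ[F] H0) 0,
      ⁅X, (x : AlgebraicClosure F ⊗[F] L)⁆ ∈ eig (AlgebraicClosure F) (1 ⊗ₜ[F] H0) 1 :=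
    fun X hX => lie_mem_eig' hX x.2 (by norm_num)
  have hxT : (x : AlgebraicClosure F ⊗[F] L) ∈ T :=
    Submodule.subset_span ⟨x.2, S'.isDirection_self hreg' _⟩
  refine isPrehomogeneous_of_directions _ x.2 fun w hw => ?_
  obtain ⟨X, hX, rfl⟩ := S'.exists_lie_eq x.2 htr hw
  obtain ⟨Y, hY, Z, hZ, rfl⟩ := Submodule.mem_sup.1 hX
  rw [add_lie]
  refine add_mem ?_ (Submodule.subset_span ⟨hst Z (nilT_le _ _ hZ), S'.isDirection_nilT _ hZ⟩)
  have hYs := mem_span_isAdDiag (F := F) (k := AlgebraicClosure F) (s := insert H0 (Set.range H))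
    (X := Y) (by
      rintro u (rfl | ⟨i, rfl⟩)
      exacts [S.diag₀, S.diag i])
    (by
      rintro u (rfl | ⟨i, rfl⟩) v (rfl | ⟨j, rfl⟩)
      · exact lie_self _
      · rw [← lie_skew, S.comm₀ j, neg_zero]
      · exact S.comm₀ i
      · exact S.comm i j)
    (by
      rintro u (rfl | ⟨i, rfl⟩)
      · exact mem_eig_zero.1 hY.1
      · exact mem_eig_zero.1 ((Submodule.mem_iInf _).1 hY.2 i))
  change _ ∈ T
  clear hX hY hw
  induction hYs using Submodule.span_induction with
  | mem Y hY =>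
    obtain ⟨c, hc, hcd, rfl⟩ := hY
    have hc0 : ∀ u ∈ insert H0 (Set.range H), ⁅(1 : AlgebraicClosure F) ⊗ₜ[F] u,
        (1 : AlgebraicClosure F) ⊗ₜ[F] c⁆ = 0 := fun u hu => by
      rw [LieAlgebra.ExtendScalars.bracket_tmul, hc u hu, TensorProduct.tmul_zero]
    obtain ⟨e, D, hD, hdir⟩ := S'.isDirection_isAdDiag hreg' (x : AlgebraicClosure F ⊗[F] L) hcd
      (hc0 _ (Set.mem_insert _ _)) fun i => hc0 _ (Set.mem_insert_of_mem _ ⟨i, rfl⟩)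
    have hcx := hst _ (mem_eig_zero.2 (hc0 _ (Set.mem_insert _ _)))
    have h1 := T.sub_mem (Submodule.subset_span ⟨add_mem (Submodule.smul_mem _ e x.2)
      (Submodule.smul_mem _ (D : AlgebraicClosure F) hcx), hdir⟩) (T.smul_mem e hxT)
    rw [add_sub_cancel_left] at h1
    exact (Submodule.smul_mem_iff _ (Nat.cast_ne_zero.2 hD)).1 h1
  | zero => rw [zero_lie]; exact zero_mem _
  | add Y Z _ _ hY hZ => rw [add_lie]; exact add_mem hY hZ
  | smul a Y _ hY => rw [smul_lie]; exact T.smul_mem a hY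

theorem isFundamentalSystem_geometric (S : Sys F H0 H) (hreg : IsOneSimple F H0 (2 • H0))
    (hirr : IsIrreducibleDegreeOne (AlgebraicClosure F) ((1 : AlgebraicClosure F) ⊗ₜ[F] H0))
    (I : S'.Invs f) :
    IsFundamentalSystem (geometricRep (K := F) H0 H 1) fun k => S'.ext (f k) where
  relInv k := by
    have := charZero_of_algebra F (AlgebraicClosure F)
    refine exists_isRelInv (I.irreducible_ext k).ne_zero fun g => ?_
    obtain ⟨c, hc⟩ := I.relInv hirr k (parabolic_mono elemAut_le_lieAut _ _ g.2)
    exact ⟨c, fun x => hc _ _ rfl⟩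
  irreducible := by
    have := charZero_of_algebra F (AlgebraicClosure F)
    exact I.irreducible_ext
  existsUnique a b χ ha hb h := exists_eq_prod_of_fraction S hreg hirr I ha hb fun g hg =>
    ⟨χ ⟨_, baseChange_mem_parabolic hg⟩, fun x y hy => by
      have := h ⟨_, baseChange_mem_parabolic hg⟩ x
      rwa [show geometricRep (K := F) H0 H 1 ⟨_, baseChange_mem_parabolic hg⟩ x = y from
        Subtype.ext hy.symm] at this⟩

lemma irreducible_of_isPolyExt {k V W : Type*} [Field k] [Algebra F k]
    [AddCommGroup V] [Module F V] [FiniteDimensional F V]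
    [AddCommGroup W] [Module F W] [Module k W] [IsScalarTower F k W]
    {ε : V →ₗ[F] W} (hε : IsBaseChange k ε) {q : polyFun F V} {r : polyFun k W}
    (h : IsPolyExt ε q r) (hr : Irreducible r) : Irreducible q := by
  have := charZero_of_algebra F k
  have := finiteDimensional_of_isBaseChange hε
  have hunit : ∀ (a : polyFun F V) (a' : polyFun k W), IsPolyExt ε a a' → IsUnit a' → IsUnit a := by
    intro a a' haa' hu
    obtain ⟨c, hc0, rfl⟩ := isUnit_polyFun_iff.1 hu
    have hval : ∀ x, algebraMap F k (a.1 x) = c := fun x => (haa' x).symm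
    refine isUnit_polyFun_iff.2 ⟨a.1 0, fun h0 => hc0 ?_, polyFun_ext fun x =>
      (algebraMap F k).injective ((hval x).trans (hval 0).symm)⟩
    rw [← hval 0, h0, map_zero]
  refine ⟨fun hu => ?_, fun a b hab => ?_⟩
  · obtain ⟨c, hc0, rfl⟩ := isUnit_polyFun_iff.1 hu
    rw [h.unique hε (isPolyExt_algebraMap c)] at hr
    exact hr.not_isUnit (isUnit_polyFun_iff.2 ⟨_, by simpa using hc0, rfl⟩)
  · obtain ⟨a', ha'⟩ := exists_isPolyExt hε a
    obtain ⟨b', hb'⟩ := exists_isPolyExt hε b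
    rcases hr.isUnit_or_isUnit (h.unique hε (hab ▸ ha'.mul hb')) with h1 | h1
    · exact .inl (hunit a a' ha' h1)
    · exact .inr (hunit b b' hb' h1)

lemma eig_le_baseChange (j : ℤ) : eig (AlgebraicClosure F) ((1 : AlgebraicClosure F) ⊗ₜ[F] H0) j ≤
    (eig F H0 j).baseChange (AlgebraicClosure F) := fun x hx => by
  have := mem_baseChange_eig (ι := Unit) (h := fun _ => H0) (n := fun _ => j) fun _ => hx
  simpa using this

theorem isFundamentalSystem_rational (S : Sys F H0 H) (hreg : IsOneSimple F H0 (2 • H0))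
    (hirr : IsIrreducibleDegreeOne (AlgebraicClosure F) ((1 : AlgebraicClosure F) ⊗ₜ[F] H0))
    (I : S'.Invs f) {Q : Fin p → polyFun F (eig F H0 1)}
    (hQ : ∀ k, IsPolyExt (tmulMap fun _ hx => one_tmul_mem_eig (AlgebraicClosure F) hx) (Q k)
      (S'.ext (f k))) :
    IsFundamentalSystem (rationalRep (K := F) H0 H 1) Q := by
  have := charZero_of_algebra F (AlgebraicClosure F)
  have hε := isBaseChange_tmulMap
    (fun x (hx : x ∈ eig F H0 1) => one_tmul_mem_eig (AlgebraicClosure F) hx) (eig_le_baseChange 1)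
  have hirrQ : ∀ k, Irreducible (Q k) := fun k =>
    irreducible_of_isPolyExt hε (hQ k) (I.irreducible_ext k)
  refine ⟨fun k => exists_isRelInv (hirrQ k).ne_zero fun g => ?_, hirrQ, fun a b χ ha hb h => ?_⟩
  · obtain ⟨x₀, hx₀⟩ := exists_apply_ne_zero (hirrQ k).ne_zero
    obtain ⟨c, hc⟩ := I.relInv hirr k
      (parabolic_mono elemAut_le_lieAut _ _ (baseChange_mem_parabolic g.2))
    have hc' : ∀ x, algebraMap F (AlgebraicClosure F) ((Q k).1 (rationalRep (K := F) H0 H 1 g x)) =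
        c * algebraMap F _ ((Q k).1 x) := fun x => by
      rw [← hQ k, ← hQ k]
      exact hc _ _ rfl
    refine ⟨(Q k).1 (rationalRep (K := F) H0 H 1 g x₀) / (Q k).1 x₀, fun x => ?_⟩
    apply (algebraMap F (AlgebraicClosure F)).injective
    have hx₀' : algebraMap F (AlgebraicClosure F) ((Q k).1 x₀) ≠ 0 := by simpa using hx₀
    rw [map_mul, map_div₀, hc', hc', mul_div_cancel_right₀ _ hx₀']
  · obtain ⟨a', ha'⟩ := exists_isPolyExt hε a
    obtain ⟨b', hb'⟩ := exists_isPolyExt hε b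
    obtain ⟨m, ⟨c, hc⟩, huniq⟩ := exists_eq_prod_of_fraction S hreg hirr I (ha'.ne_zero ha)
      (hb'.ne_zero hb) fun g hg => by
        have hgst := parabolic_stable (aut0 F L) H0 H 1 g hg
        let φ : eig (AlgebraicClosure F) ((1 : AlgebraicClosure F) ⊗ₜ[F] H0) 1 →ₗ[AlgebraicClosure F]
            eig (AlgebraicClosure F) ((1 : AlgebraicClosure F) ⊗ₜ[F] H0) 1 :=
          LinearMap.restrict (LinearEquiv.baseChange F (AlgebraicClosure F) L L g :
            AlgebraicClosure F ⊗[F] L →ₗ[AlgebraicClosure F] AlgebraicClosure F ⊗[F] L)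
            (parabolic_stable _ _ _ 1 _ (baseChange_mem_parabolic hg))
        have hφ : polyComp φ a' * b' = algebraMap F (AlgebraicClosure F) (χ ⟨g, hg⟩ : F) •
            (a' * polyComp φ b') := by
          refine eq_of_forall_base hε fun x => ?_
          have h1 := congrArg (algebraMap F (AlgebraicClosure F)) (h ⟨g, hg⟩ x)
          simp only [map_mul] at h1
          rw [← ha' x, ← hb' x, ← ha', ← hb'] at h1
          exact h1
        refine ⟨algebraMap F _ (χ ⟨g, hg⟩ : F), fun x y hy => ?_⟩
        have h1 := congrArg (fun q : polyFun (AlgebraicClosure F) _ => q.1 x) hφ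
        rw [show y = φ x from Subtype.ext hy]
        exact h1
    have hext : ∀ m : Fin p → ℤ, IsPolyExt _ (a * ∏ i, Q i ^ (-(m i)).toNat)
          (a' * ∏ i, S'.ext (f i) ^ (-(m i)).toNat) ∧
        IsPolyExt _ (b * ∏ i, Q i ^ (m i).toNat) (b' * ∏ i, S'.ext (f i) ^ (m i).toNat) := fun m =>
      ⟨ha'.mul (.prod _ fun i _ => (hQ i).pow _), hb'.mul (.prod _ fun i _ => (hQ i).pow _)⟩
    refine ⟨m, ?_, ?_⟩
    · obtain ⟨h1, h2⟩ := hext m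
      have hne : ∀ (b : polyFun F (eig F H0 1)) (n : Fin p → ℕ), b ≠ 0 → b * ∏ i, Q i ^ n i ≠ 0 :=
        fun b n hb => mul_ne_zero hb (Finset.prod_ne_zero_iff.2 fun i _ =>
          pow_ne_zero _ (hirrQ i).ne_zero)
      obtain ⟨x₀, hx₀⟩ := exists_apply_ne_zero (hne b (fun i => (m i).toNat) hb)
      have hval : ∀ x, algebraMap F (AlgebraicClosure F) ((a * ∏ i, Q i ^ (-(m i)).toNat).1 x) =
          c * algebraMap F (AlgebraicClosure F) ((b * ∏ i, Q i ^ (m i).toNat).1 x) := fun x => by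
        rw [← h1, ← h2, hc, polyFun_smul_apply]
      have hx₀' : algebraMap F (AlgebraicClosure F) ((b * ∏ i, Q i ^ (m i).toNat).1 x₀) ≠ 0 :=
        (map_ne_zero _).2 hx₀
      have hcF : (c : AlgebraicClosure F) = algebraMap F _ ((a * ∏ i, Q i ^ (-(m i)).toNat).1 x₀ /
          (b * ∏ i, Q i ^ (m i).toNat).1 x₀) := by
        rw [map_div₀, hval, mul_div_cancel_right₀ _ hx₀']
      refine ⟨Units.mk0 ((a * ∏ i, Q i ^ (-(m i)).toNat).1 x₀ /
          (b * ∏ i, Q i ^ (m i).toNat).1 x₀) fun h0 => c.ne_zero (by rw [hcF, h0, map_zero]),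
        polyFun_ext fun x => (algebraMap F (AlgebraicClosure F)).injective ?_⟩
      rw [hval, polyFun_smul_apply, map_mul, Units.val_mk0, ← hcF]
    · rintro m' ⟨c', hc'⟩
      refine huniq m' ⟨Units.map (algebraMap F (AlgebraicClosure F)) c', ?_⟩
      refine (hext m').1.unique hε ?_
      rw [hc', Algebra.smul_def, Algebra.smul_def]
      exact (isPolyExt_algebraMap _).mul (hext m').2

end Main

section Components

variable {K L : Type*} [Field K] [LieRing L] [LieAlgebra K L] [CharZero K] [FiniteDimensional K L]
  {p : ℕ} {H0 : L} {H : Fin p → L}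

/-- Evaluation at a point. -/
def evalAt {V : Type*} [AddCommGroup V] [Module K V] (x : V) : polyFun K V →+* K :=
  (Pi.evalRingHom _ x).comp (polyFun K V).val.toRingHom

lemma evalAt_apply {V : Type*} [AddCommGroup V] [Module K V] (x : V) (q : polyFun K V) :
    evalAt x q = q.1 x := rfl

/-- `g` acts by `t ^ i` on the eigenspaces `E_i(h)`. -/
def ActsBy (h : L) (t : K) (g : L ≃ₗ[K] L) : Prop :=
  ∀ i : ℕ, ∀ x ∈ eig K h i, g x = t ^ i • x

lemma Sys.actsBy_apply (S : Sys K H0 H) {j : Fin p} {t : K} {g : L ≃ₗ[K] L} (hg : ActsBy (H j) t g)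
    {x : L} (hx : x ∈ eig K H0 1) :
    g x = ∑ i ∈ Finset.range 3, t ^ i • eproj (H j) (S.diag j) i x := by
  have hmem : ∀ i, eproj (H j) (S.diag j) i x ∈ eig K H0 1 := fun i =>
    eproj_mem_eig _ (S.comm₀ j) i hx
  have hsum : x = ∑ i ∈ Finset.range 3, eproj (H j) (S.diag j) ((i : ℕ) : ℤ) x := by
    obtain ⟨s, hs⟩ := exists_eq_sum_eproj (S.diag j) x
    have h0 : ∀ i : ℤ, i < 0 ∨ 2 < i → eproj (H j) (S.diag j) i x = 0 := fun i hi =>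
      S.eq_zero_of_one' (hmem i) (eproj_mem _ _ _) hi
    refine sub_eq_zero.1 (eq_zero_of_eproj_eq_zero (S.diag j) fun i => ?_)
    have hpp : ∀ n : ℕ, eproj (H j) (S.diag j) i (eproj (H j) (S.diag j) ((n : ℕ) : ℤ) x) =
        if i = n then eproj (H j) (S.diag j) i x else 0 := fun n => by
      rw [eproj_eq_ite _ (eproj_mem (S.diag j) _ x)]
      split_ifs with h
      · rw [h]
      · rfl
    rw [map_sub, map_sum, Finset.sum_congr rfl fun n _ => hpp n]
    by_cases hi : i < 0 ∨ 2 < i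
    · rw [h0 i hi]
      simp
    · obtain ⟨n, rfl⟩ : ∃ n : ℕ, i = n := ⟨i.toNat, by omega⟩
      have hn : n ∈ Finset.range 3 := Finset.mem_range.2 (by omega)
      simp only [Nat.cast_inj, Finset.sum_ite_eq, hn, if_true, sub_self]
  conv_lhs => rw [hsum, map_sum]
  exact Finset.sum_congr rfl fun i _ => hg i _ (eproj_mem _ _ _)

lemma Sys.exists_components (S : Sys K H0 H) (j : Fin p) (q : polyFun K (eig K H0 1)) :
    ∃ r : Polynomial (polyFun K (eig K H0 1)), ∀ (t : K) (g : L ≃ₗ[K] L), ActsBy (H j) t g →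
      ∀ x y : eig K H0 1, (y : L) = g x → q.1 y = r.eval₂ (evalAt x) t := by
  induction q using polyFun_induction with
  | const c => exact ⟨Polynomial.C (algebraMap K _ c), fun t g _ x y _ => by
      rw [Polynomial.eval₂_C]; rfl⟩
  | lin l =>
    let π : ℕ → (eig K H0 1 →ₗ[K] eig K H0 1) := fun i =>
      (eproj (H j) (S.diag j) i).restrict fun x hx => eproj_mem_eig _ (S.comm₀ j) i hx
    refine ⟨∑ i ∈ Finset.range 3, Polynomial.C (linElt (l ∘ₗ π i)) * Polynomial.X ^ i,
      fun t g hg x y hy => ?_⟩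
    have hy' : y = ∑ i ∈ Finset.range 3, t ^ i • π i x := by
      apply Subtype.ext
      rw [hy, S.actsBy_apply hg x.2, AddSubmonoidClass.coe_finsetSum]
      rfl
    rw [Polynomial.eval₂_finsetSum]
    change l y = _
    rw [hy', map_sum]
    refine Finset.sum_congr rfl fun i _ => ?_
    rw [Polynomial.eval₂_mul, Polynomial.eval₂_C, Polynomial.eval₂_X_pow, map_smul, smul_eq_mul,
      mul_comm]
    rfl
  | add a b ha hb =>
    obtain ⟨r, hr⟩ := ha
    obtain ⟨s, hs⟩ := hb
    exact ⟨r + s, fun t g hg x y hy => by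
      rw [Polynomial.eval₂_add, ← hr t g hg x y hy, ← hs t g hg x y hy]; rfl⟩
  | mul a b ha hb =>
    obtain ⟨r, hr⟩ := ha
    obtain ⟨s, hs⟩ := hb
    exact ⟨r * s, fun t g hg x y hy => by
      rw [Polynomial.eval₂_mul, ← hr t g hg x y hy, ← hs t g hg x y hy]; rfl⟩

lemma coeff_eq_of_eval₂ {V : Type*} [AddCommGroup V] [Module K V] {r : Polynomial (polyFun K V)}
    {x y : V} {c s : K} (h : ∀ t : K, t ≠ 0 → r.eval₂ (evalAt y) t = c * r.eval₂ (evalAt x) (t * s))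
    (m : ℕ) : (r.coeff m).1 y = c * s ^ m * (r.coeff m).1 x := by
  have heq : r.map (evalAt y) = Polynomial.C c * (r.map (evalAt x)).comp
      (Polynomial.C s * Polynomial.X) := by
    refine Polynomial.eq_of_infinite_eval_eq _ _
      ((Set.finite_singleton (0 : K)).infinite_compl.mono fun t ht => ?_)
    have := h t ht
    simp only [Set.mem_ofPred_eq, Polynomial.eval_map, Polynomial.eval_mul, Polynomial.eval_C,
      Polynomial.eval_comp, Polynomial.eval_X]
    rw [this, mul_comm t]
  have := congrArg (Polynomial.coeff · m) heq
  simp only [Polynomial.coeff_map, Polynomial.coeff_C_mul, Polynomial.comp_C_mul_X_coeff] at this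
  rw [evalAt_apply, evalAt_apply] at this
  rw [this]
  ring

end Components

section InvariantRing

variable {F L : Type*} [Field F] [LieRing L] [LieAlgebra F L] [FiniteDimensional F L] [CharZero F]
  [LieAlgebra.IsKilling F L]
  [LieAlgebra.IsKilling (AlgebraicClosure F) (AlgebraicClosure F ⊗[F] L)]
  {p : ℕ} {H0 : L} {H : Fin p → L}
  {S' : Sys (AlgebraicClosure F) ((1 : AlgebraicClosure F) ⊗ₜ[F] H0)
      fun i => (1 : AlgebraicClosure F) ⊗ₜ[F] H i}
  {f : ∀ k : Fin p, polyFun (AlgebraicClosure F)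
      (eig (AlgebraicClosure F) (partialSum (fun i => (1 : AlgebraicClosure F) ⊗ₜ[F] H i)
        ((k : ℕ) + 1)) 2 ⊓ eig (AlgebraicClosure F) (1 ⊗ₜ[F] H0) 1 : Submodule _ _)}

lemma Sys.exists_actsBy (S : Sys F H0 H) (j : Fin p) {t : F} (ht : t ≠ 0) :
    ∃ g ∈ parabolic (aut0 F L) H0 H, ActsBy (H j) t g := by
  obtain ⟨x, -, y, -, tr⟩ := S.triple j
  obtain ⟨g, hg, hgx⟩ := exists_torus (S.diag j) tr ht
  have hfix : ∀ u, ⁅H j, u⁆ = 0 → g u = u := fun u hu => by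
    simpa using hgx 0 u (mem_eig_zero.2 hu)
  refine ⟨g, (le_sup_left : _ ≤ parabolic _ _ _) (mem_centr_of_elemAut hg ?_), fun i x hx => by
    rw [hgx i x hx, zpow_natCast]⟩
  rintro _ (rfl | ⟨i, rfl⟩)
  · exact hfix _ (S.comm₀ j)
  · exact hfix _ (S.comm j i)

lemma exists_rational_weight (I : S'.Invs f)
    (hirr : IsIrreducibleDegreeOne (AlgebraicClosure F) ((1 : AlgebraicClosure F) ⊗ₜ[F] H0))
    {Q : Fin p → polyFun F (eig F H0 1)}
    (hQ : ∀ k, IsPolyExt (tmulMap fun _ hx => one_tmul_mem_eig (AlgebraicClosure F) hx) (Q k)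
      (S'.ext (f k))) (k j : Fin p) :
    ∃ n : ℕ, (j = k → 0 < n) ∧ (k < j → n = 0) ∧ ∀ (t : F) (g : L ≃ₗ[F] L), ActsBy (H j) t g →
      ∀ x y : eig F H0 1, (y : L) = g x → (Q k).1 y = t ^ n * (Q k).1 x := by
  have := charZero_of_algebra F (AlgebraicClosure F)
  obtain ⟨n, hn1, hn2, -, hn⟩ := I.exists_weight hirr k j
  refine ⟨n, hn1, hn2, fun t g hg x y hy => (algebraMap F (AlgebraicClosure F)).injective ?_⟩
  rw [map_mul, map_pow, ← hQ k, ← hQ k]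
  refine hn (algebraMap F _ t) (LinearEquiv.baseChange F (AlgebraicClosure F) L L g)
    (fun i v hv => ?_) _ _ ?_
  · have hv' := eig_le_baseChange _ hv
    rw [Submodule.baseChange_eq_span] at hv'
    clear hv
    induction hv' using Submodule.span_induction with
    | mem v hv =>
      obtain ⟨v, hv, rfl⟩ := hv
      change LinearEquiv.baseChange F _ L L g (1 ⊗ₜ[F] v) = _ • ((1 : AlgebraicClosure F) ⊗ₜ[F] v)
      rw [LinearEquiv.baseChange_tmul, hg i v hv, TensorProduct.tmul_smul,
        ← algebraMap_smul (AlgebraicClosure F) (t ^ i), map_pow]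
    | zero => simp
    | add v w _ _ hv hw => rw [map_add, hv, hw, smul_add]
    | smul a v _ hv => rw [map_smul, hv, smul_comm]
  · change (1 : AlgebraicClosure F) ⊗ₜ[F] (y : L) = LinearEquiv.baseChange F _ L L g (1 ⊗ₜ[F] (x : L))
    rw [LinearEquiv.baseChange_tmul, hy]

/-- Over an algebraically closed field the invariants of the common kernel of the characters are
the polynomials in the basic invariants. -/
theorem invariantRing_eq [IsAlgClosed F] (S : Sys F H0 H) (hreg : IsOneSimple F H0 (2 • H0))
    (hirr : IsIrreducibleDegreeOne (AlgebraicClosure F) ((1 : AlgebraicClosure F) ⊗ₜ[F] H0))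
    (I : S'.Invs f) {Q : Fin p → polyFun F (eig F H0 1)}
    (hQ : ∀ k, IsPolyExt (tmulMap fun _ hx => one_tmul_mem_eig (AlgebraicClosure F) hx) (Q k)
      (S'.ext (f k))) {χ : Fin p → (parabolic (aut0 F L) H0 H →* Fˣ)}
    (hχ : ∀ k, IsRelInv (rationalRep H0 H 1) (Q k) (χ k)) :
    invariantRing (rationalRep H0 H 1) (⨅ k, (χ k).ker) = Algebra.adjoin F (Set.range Q) := by
  have := charZero_of_algebra F (AlgebraicClosure F)
  have hε := isBaseChange_tmulMap
    (fun x (hx : x ∈ eig F H0 1) => one_tmul_mem_eig (AlgebraicClosure F) hx) (eig_le_baseChange 1)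
  have hQ0 : ∀ k, Q k ≠ 0 := fun k =>
    (irreducible_of_isPolyExt hε (hQ k) (I.irreducible_ext k)).ne_zero
  have hM : ∀ g, g ∈ ⨅ k, (χ k).ker ↔ ∀ k, χ k g = 1 := fun g => by
    simp [Subgroup.mem_iInf, MonoidHom.mem_ker]
  set ρ := rationalRep (K := F) H0 H 1 with hρ
  have hmul : ∀ g h x, ρ (g * h) x = ρ g (ρ h x) := fun g h x => by rw [map_mul, Module.End.mul_apply]
  refine le_antisymm ?_ (Algebra.adjoin_le ?_)
  swap
  · rintro _ ⟨k, rfl⟩ g hg x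
    rw [hχ k g x, (hM g).1 hg k, Units.val_one, one_mul]
  choose n hn1 hn2 hn using exists_rational_weight I hirr hQ
  have hχD : ∀ k j (t : F) (g : parabolic (aut0 F L) H0 H), ActsBy (H j) t g.1 →
      (χ k g : F) = t ^ n k j := by
    intro k j t g hg
    obtain ⟨x, hx⟩ := exists_apply_ne_zero (hQ0 k)
    exact mul_right_cancel₀ hx ((hχ k g x).symm.trans (hn k j t g hg x _ rfl))
  have hdiag : ∀ q : polyFun F (eig F H0 1), (∀ g ∈ ⨅ k, (χ k).ker, ∀ x, q.1 (ρ g x) = q.1 x) →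
      (∀ (j : Fin p) (t : F) (g : parabolic (aut0 F L) H0 H), t ≠ 0 → ActsBy (H j) t g.1 →
        ∃ c : F, ∀ x, q.1 (ρ g x) = c * q.1 x) → q ∈ Algebra.adjoin F (Set.range Q) := by
    intro q hqM hqT
    rcases eq_or_ne q 0 with rfl | hq0
    · exact zero_mem _
    have hrel : ∀ g, ∃ c : F, ∀ x, q.1 (ρ g x) = c * q.1 x := by
      intro g
      have key : ∀ r ≤ p, ∃ d : parabolic (aut0 F L) H0 H, (∃ c : F, ∀ x, q.1 (ρ d x) = c * q.1 x) ∧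
          ∀ k : Fin p, (k : ℕ) < r → χ k d = χ k g := by
        intro r
        induction r with
        | zero => exact fun _ => ⟨1, ⟨1, fun x => by rw [map_one, one_mul]; rfl⟩, by simp⟩
        | succ r ih =>
          intro hr
          obtain ⟨d, ⟨c, hc⟩, hd⟩ := ih (by omega)
          let j : Fin p := ⟨r, hr⟩
          obtain ⟨t, ht⟩ := IsAlgClosed.exists_pow_nat_eq ((χ j d)⁻¹ * χ j g : Fˣ).1 (hn1 j j rfl)
          have ht0 : t ≠ 0 := by
            rintro rfl
            rw [zero_pow (hn1 j j rfl).ne'] at ht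
            exact Units.ne_zero _ ht.symm
          obtain ⟨e, heP, he⟩ := S.exists_actsBy j ht0
          obtain ⟨c', hc'⟩ := hqT j t ⟨e, heP⟩ ht0 he
          refine ⟨d * ⟨e, heP⟩, ⟨c * c', fun x => by rw [hmul, hc, hc', mul_assoc]⟩, fun k hk => ?_⟩
          rw [map_mul]
          have hke := hχD k j t ⟨e, heP⟩ he
          rcases Nat.lt_succ_iff_lt_or_eq.1 hk with hk | hk
          · rw [hn2 k j hk, pow_zero] at hke
            have hke' : χ k ⟨e, heP⟩ = 1 := Units.ext hke
            rw [hd k hk, hke', mul_one]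
          · obtain rfl : k = j := Fin.ext hk
            rw [ht] at hke
            have hke' : χ j ⟨e, heP⟩ = (χ j d)⁻¹ * χ j g := Units.ext hke
            rw [hke', mul_inv_cancel_left]
      obtain ⟨d, ⟨c, hc⟩, hd⟩ := key p le_rfl
      refine ⟨c, fun x => ?_⟩
      have hm : d⁻¹ * g ∈ ⨅ k, (χ k).ker := (hM _).2 fun k => by
        rw [map_mul, map_inv, hd k k.2, inv_mul_cancel]
      rw [← hqM _ hm x, ← hc, ← hmul, mul_inv_cancel_left]
    obtain ⟨q', hq'⟩ := exists_isPolyExt hε q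
    obtain ⟨m, c, -, hm⟩ := S'.exists_eq_prod I.irreducible_ext (fun x hx => I.good hirr hx)
      (hq'.ne_zero hq0) fun X hX => infRel_of_parabolic S hreg (fun g hg => by
        obtain ⟨c, hc⟩ := hrel ⟨g, hg⟩
        have hgst := parabolic_stable (aut0 F L) H0 H 1 g hg
        refine ⟨algebraMap F _ c, fun x => ⟨⟨_, baseChange_mem_of_stable
          (fun _ hx => one_tmul_mem_eig _ hx) (eig_le_baseChange 1) hgst x x.2⟩, rfl, ?_⟩⟩
        exact eq_mul_of_isPolyExt _ (eig_le_baseChange 1) hgst hq' hc x) hX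
    obtain ⟨c, rfl⟩ := (IsAlgClosed.algebraMap_bijective_of_isIntegral (k := F)).2 c
    have : q = algebraMap F _ c * ∏ k, Q k ^ m k := by
      refine hq'.inj ?_
      rw [hm, Algebra.smul_def]
      exact (isPolyExt_algebraMap c).mul (.prod _ fun k _ => (hQ k).pow _)
    rw [this]
    exact mul_mem (Subalgebra.algebraMap_mem _ c) (prod_mem fun k _ => pow_mem
      (Algebra.subset_adjoin (Set.mem_range_self k)) _)
  have hnormal : ∀ (d g : parabolic (aut0 F L) H0 H), g ∈ ⨅ k, (χ k).ker →
      d * g * d⁻¹ ∈ ⨅ k, (χ k).ker := fun d g hg => (hM _).2 fun k => by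
    rw [map_mul, map_mul, (hM g).1 hg k, mul_one, map_inv, mul_inv_cancel]
  have hdec : ∀ l : List (Fin p), ∀ q : polyFun F (eig F H0 1),
      (∀ g ∈ ⨅ k, (χ k).ker, ∀ x, q.1 (ρ g x) = q.1 x) →
      (∀ (j : Fin p) (t : F) (g : parabolic (aut0 F L) H0 H), j ∉ l → t ≠ 0 → ActsBy (H j) t g.1 →
        ∃ c : F, ∀ x, q.1 (ρ g x) = c * q.1 x) → q ∈ Algebra.adjoin F (Set.range Q) := by
    intro l
    induction l with
    | nil => exact fun q hq hq' => hdiag q hq fun j t g => hq' j t g List.not_mem_nil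
    | cons j l ih =>
      intro q hqM hqT
      obtain ⟨r, hr⟩ := S.exists_components j q
      have hr' : ∀ t (g : parabolic (aut0 F L) H0 H), ActsBy (H j) t g.1 → ∀ x,
          q.1 (ρ g x) = r.eval₂ (evalAt x) t := fun t g hg x => hr t g hg x _ rfl
      have hone : q = ∑ m ∈ r.support, r.coeff m := by
        refine polyFun_ext fun x => ?_
        have h1 := hr 1 1 (fun i x _ => by rw [one_pow, one_smul]; rfl) x x rfl
        rw [h1, Polynomial.eval₂_eq_sum, Polynomial.sum]
        simp only [one_pow, mul_one]
        rw [← map_sum, evalAt_apply]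
      rw [hone]
      refine sum_mem fun m _ => ih _ (fun g hg x => ?_) fun i t g hi ht0 hg => ?_
      · have := coeff_eq_of_eval₂ (r := r) (x := x) (y := ρ g x) (c := 1) (s := 1) (fun t ht => by
          obtain ⟨d, hdP, hd⟩ := S.exists_actsBy j ht
          rw [← hr' t ⟨d, hdP⟩ hd, mul_one, one_mul, ← hr' t ⟨d, hdP⟩ hd, ← hmul,
            ← hqM _ (hnormal ⟨d, hdP⟩ g hg) (ρ ⟨d, hdP⟩ x), ← hmul, inv_mul_cancel_right]) m
        rw [this, one_pow, one_mul, one_mul]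
      · by_cases hij : i = j
        · subst hij
          refine ⟨1 * t ^ m, fun x => coeff_eq_of_eval₂ (fun s hs => ?_) m⟩
          obtain ⟨d, hdP, hd⟩ := S.exists_actsBy i hs
          rw [← hr' s ⟨d, hdP⟩ hd, one_mul, ← hr' (s * t) (⟨d, hdP⟩ * g) (fun a v hv => ?_), hmul]
          change d (g.1 v) = _
          rw [hg a v hv, map_smul, hd a v hv, smul_smul, mul_pow, mul_comm]
        · obtain ⟨c, hc⟩ := hqT i t g (by simp [hij, hi]) ht0 hg
          refine ⟨c * 1 ^ m, fun x => coeff_eq_of_eval₂ (fun s hs => ?_) m⟩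
          obtain ⟨d, hdP, hd⟩ := S.exists_actsBy j hs
          rw [← hr' s ⟨d, hdP⟩ hd, mul_one, ← hr' s ⟨d, hdP⟩ hd, ← hc]
          refine congrArg q.1 (Subtype.ext ?_)
          change d (g.1 x) = g.1 (d x)
          have hcomm : ∀ a : ℕ, ∀ v ∈ eig F (H i) a, v ∈ eig F H0 1 → d (g.1 v) = g.1 (d v) := by
            intro a v hv hv0
            rw [hg a v hv, map_smul, S.actsBy_apply hd hv0, map_sum, Finset.smul_sum]
            refine Finset.sum_congr rfl fun b _ => ?_
            rw [map_smul, hg a _ (eproj_mem_eig _ (S.comm j i) _ hv), smul_comm]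
          obtain ⟨s, v, hv, hxv⟩ := S.exists_eq_sum_nat i x
          have hx : (x : L) = ∑ a ∈ s, (v a : L) := by
            rw [← AddSubmonoidClass.coe_finsetSum, ← hxv]
          rw [hx, map_sum, map_sum, map_sum, map_sum]
          exact Finset.sum_congr rfl fun a _ => hcomm a _ (hv a) (v a).2
  exact fun q hq => hdec (List.finRange p) q hq fun j t g hj =>
    absurd (List.mem_finRange j) hj

end InvariantRing

/-! ### Change of signs -/

section Duality

variable {K L : Type*} [Field K] [LieRing L] [LieAlgebra K L] [CharZero K] [FiniteDimensional K L]
  {p : ℕ} {H0 : L} {H : Fin p → L}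

lemma exists_kf_ne_zero [LieAlgebra.IsKilling K L] (hd : IsDiag K H0) {W : Submodule K L} {w : L}
    {i : ℤ} (hw : w ∈ eig K H0 (-i)) (hW : W ≤ eig K H0 (-i)) (hwW : w ∉ W) :
    ∃ x ∈ eig K H0 i, kf K x w ≠ 0 ∧ ∀ v ∈ W, kf K x v = 0 := by
  obtain ⟨φ, hφ, hφW⟩ := Submodule.exists_le_ker_of_notMem hwW
  obtain ⟨z, -, hz⟩ := exists_kf_eq (K := K) (m := (⊤ : Submodule K L))
    (fun x _ hx => eq_zero_of_kf (K := K) fun y => hx y trivial) (φ ∘ₗ (⊤ : Submodule K L).subtype)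
  have key : ∀ v ∈ eig K H0 (-i), kf K (eproj H0 hd i z) v = φ v := fun v hv => by
    rw [kf_comm]
    have h1 := kf_eproj hd hv z
    rw [neg_neg] at h1
    rw [← h1, kf_comm]
    exact hz ⟨v, trivial⟩
  refine ⟨_, eproj_mem hd i z, by rwa [key w hw], fun v hv => ?_⟩
  rw [key v (hW hv)]
  exact hφW hv

lemma IsIrreducibleDegreeOne.neg [LieAlgebra.IsKilling K L] (hd : IsDiag K H0)
    (h : IsIrreducibleDegreeOne K H0) : IsIrreducibleDegreeOne K (-H0) := by
  have h1 : eig K (-H0) 1 = eig K H0 (-1) := Submodule.ext fun x => mem_eig_neg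
  have h0 : eig K (-H0) 0 = eig K H0 0 := Submodule.ext fun x => by simp [mem_eig_neg]
  have hnd : ∀ {i : ℤ}, ∀ x ∈ eig K H0 i, (∀ y ∈ eig K H0 (-i), kf K x y = 0) → x = 0 :=
    fun x hx hy => eq_zero_of_kf (K := K) fun y => by
      rw [kf_eproj hd hx]
      exact hy _ (eproj_mem hd _ y)
  rw [IsIrreducibleDegreeOne, h1, h0]
  refine ⟨fun hbot => h.1 ((Submodule.eq_bot_iff _).2 fun x hx => hnd x hx fun y hy => ?_),
    fun W hW hst => ?_⟩
  · rw [hbot, Submodule.mem_bot] at hy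
    simp [hy, kf]
  let U : Submodule K L := eig K H0 1 ⊓ ⨅ w ∈ W, LinearMap.ker ((killingForm K L) w)
  have hU : ∀ x, x ∈ U ↔ x ∈ eig K H0 1 ∧ ∀ w ∈ W, kf K w x = 0 := fun x => by
    simp [U, kf]
  rcases h.2 U inf_le_left fun z hz x hx => by
    rw [hU] at hx ⊢
    refine ⟨lie_mem_eig' hz hx.1 (by norm_num), fun w hw => ?_⟩
    rw [← kf_lie]
    refine hx.2 _ ?_
    rw [← lie_skew]
    exact W.neg_mem (hst z hz w hw) with h2 | h2
  · refine .inr (le_antisymm hW fun w hw => ?_)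
    by_contra hwW
    obtain ⟨x, hx, hxw, hxW⟩ := exists_kf_ne_zero hd hw hW hwW
    have hxU : x ∈ U := (hU x).2 ⟨hx, fun v hv => by rw [kf_comm, hxW v hv]⟩
    rw [h2, Submodule.mem_bot] at hxU
    simp [hxU, kf] at hxw
  · refine .inl ((Submodule.eq_bot_iff _).2 fun w hw => hnd w (hW hw) fun x hx => ?_)
    rw [neg_neg, ← h2] at hx
    exact ((hU x).1 hx).2 w hw

lemma IsOneSimple.neg (h : IsOneSimple K H0 (2 • H0)) : IsOneSimple K (-H0) (2 • -H0) := by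
  obtain ⟨x, hx, y, hy, t⟩ := h
  rw [smul_neg]
  exact ⟨y, mem_eig_neg.2 hy, x, mem_eig_neg.2 (by simpa using hx), t.symm⟩

lemma Sys.rev (S : Sys K H0 H) : Sys K (-H0) (fun i => -H (Fin.rev i)) :=
  S.symm.reindex Fin.revPerm

lemma Sys.nilT_le_rev (S : Sys K H0 H) : nilT K H0 H ≤ nilT K (-H0) (fun i => -H (Fin.rev i)) := by
  intro X hX
  refine S.nilT_induction (P := fun X => X ∈ nilT K (-H0) (fun i => -H (Fin.rev i)))
    (fun m a b X _ hX hm h0 ha hb hab hz => ?_) (zero_mem _) (fun x y => add_mem) hX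
  refine mem_nilT (m := fun i => -m (Fin.rev i)) ((isPositiveWeight_iff (a := Fin.rev b)
    (b := Fin.rev a) ?_ ?_ fun i hi hi' => ?_).2 (Fin.rev_lt_rev.2 hab)) (by simpa [mem_eig_neg])
    fun i => by simpa [mem_eig_neg] using hm _
  · simpa [hb] using ha
  · simp [hb]
  · rw [hz, neg_zero]
    · rintro rfl; simp at hi'
    · rintro rfl; simp at hi

lemma Sys.nilT_rev (S : Sys K H0 H) : nilT K (-H0) (fun i => -H (Fin.rev i)) = nilT K H0 H :=
  le_antisymm (by simpa using S.rev.nilT_le_rev) S.nilT_le_rev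

lemma centr_congr (A : Subgroup (L ≃ₗ[K] L)) {s t : Set L}
    (h : ∀ g : L ≃ₗ[K] L, (∀ x ∈ s, g x = x) ↔ ∀ x ∈ t, g x = x) : centr A s = centr A t := by
  have : fixingSubgroup (L ≃ₗ[K] L) s = fixingSubgroup (L ≃ₗ[K] L) t := by
    ext g
    simp only [mem_fixingSubgroup_iff]
    exact h g
  rw [centr, this, centr]

lemma Sys.parabolic_rev (S : Sys K H0 H) (A : Subgroup (L ≃ₗ[K] L)) :
    parabolic A (-H0) (fun i => -H (Fin.rev i)) = parabolic A H0 H := by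
  rw [parabolic, S.nilT_rev, parabolic]
  congr 1
  refine centr_congr A fun g => ?_
  simp only [Set.forall_mem_insert, Set.forall_mem_range, map_neg, neg_inj]
  refine and_congr_right fun _ => ⟨fun h i => ?_, fun h i => h _⟩
  simpa using h (Fin.rev i)

lemma Sys.partialSum_rev (S : Sys K H0 H) {k : ℕ} (hk : k ≤ p) :
    partialSum (fun i => -H (Fin.rev i)) k = partialSum H (p - k) - 2 • H0 := by
  have h1 : partialSum (fun i => H (Fin.rev i)) k =
      ∑ i ∈ Finset.univ.filter (fun i : Fin p => ¬ (i : ℕ) < p - k), H i := by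
    rw [partialSum, Finset.sum_filter, Finset.sum_filter, ← Equiv.sum_comp Fin.revPerm]
    refine Finset.sum_congr rfl fun i _ => ?_
    simp only [Fin.revPerm_apply, Fin.rev_rev, Fin.val_rev]
    exact if_congr (by omega) rfl rfl
  rw [partialSum_neg (fun i => H (Fin.rev i)), h1, ← S.sum_eq, partialSum,
    ← Finset.sum_filter_add_sum_filter_not Finset.univ (fun i : Fin p => (i : ℕ) < p - k) H]
  abel

lemma mem_eig_sub_inf {h x : L} {i : ℤ} :
    x ∈ eig K (h - 2 • H0) (i + 2) ⊓ eig K (-H0) 1 ↔ x ∈ eig K h i ⊓ eig K H0 (-1) := by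
  rw [Submodule.mem_inf, Submodule.mem_inf, mem_eig_neg]
  refine and_congr_left fun hx => ?_
  rw [mem_eig] at hx
  rw [mem_eig, mem_eig, sub_lie, nsmul_lie, hx, ← Nat.cast_smul_eq_nsmul K, smul_smul,
    sub_eq_iff_eq_add, ← add_smul]
  push_cast
  rw [show (i : K) + 2 + 2 * -1 = i by ring]

lemma sub_eproj_mem {h : L} (hd : IsDiag K h) (hc : ⁅h, H0⁆ = 0) (i : ℤ) {j : ℤ} {z : L}
    (hz : z ∈ eig K H0 j) :
    z - eproj h hd i z ∈ ⨆ l : {l : ℤ // l ≠ i}, eig K h l ⊓ eig K H0 j := by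
  have hmem : ∀ l ≠ i, eproj h hd l z ∈ ⨆ l : {l : ℤ // l ≠ i}, eig K h l ⊓ eig K H0 j :=
    fun l hl => Submodule.mem_iSup_of_mem ⟨l, hl⟩ ⟨eproj_mem hd l z, eproj_mem_eig hd hc l hz⟩
  obtain ⟨s, hs⟩ := exists_eq_sum_eproj hd z
  have h0 : z - eproj h hd i z = ∑ l ∈ s.erase i, eproj h hd l z := by
    have h1 : eproj h hd i z = if i ∈ s then eproj h hd i z else 0 := by
      conv_lhs => rw [hs, map_sum]
      rw [← Finset.sum_ite_eq s i fun l => eproj h hd l z]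
      exact Finset.sum_congr rfl fun l _ => eproj_eq_ite hd (eproj_mem hd l z)
    split_ifs at h1 with his
    · rw [sub_eq_iff_eq_add', Finset.add_sum_erase s (fun l => eproj h hd l z) his]
      exact hs
    · rw [Finset.erase_eq_of_notMem his, h1, sub_zero]
      exact hs
  rw [h0]
  exact Submodule.sum_mem _ fun l hl => hmem l (Finset.ne_of_mem_erase hl)

end Duality

/-! ### The properties of very special systems -/

section VerySpecial

variable {K L : Type*} [Field K] [LieRing L] [LieAlgebra K L] [CharZero K] [FiniteDimensional K L]
  {p : ℕ} {H0 : L} {H : Fin p → L}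

open Polynomial in
lemma mem_iSup_eig_of_aeval {h : L} (s : Finset ℤ) {x : L}
    (hx : aeval (LieAlgebra.ad K L h) (∏ i ∈ s, (X - C (i : K))) x = 0) :
    x ∈ ⨆ i, eig K h i := by
  classical
  induction s using Finset.induction_on generalizing x with
  | empty =>
    have : x = 0 := by simpa using hx
    simp [this]
  | insert a s ha ih =>
    set q : K[X] := ∏ i ∈ s, (X - C (i : K)) with hq
    set T := LieAlgebra.ad K L h with hT
    rw [Finset.prod_insert ha, map_mul, Module.End.mul_apply] at hx
    have hz : aeval T q x ∈ eig K h a := by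
      rw [map_sub, aeval_X, aeval_C, LinearMap.sub_apply, Module.algebraMap_end_apply,
        sub_eq_zero] at hx
      exact mem_eig.2 hx
    have hc : q.eval (a : K) ≠ 0 := by
      rw [hq, eval_prod]
      refine Finset.prod_ne_zero_iff.2 fun i hi => ?_
      rw [eval_sub, eval_X, eval_C, sub_ne_zero]
      exact fun h => ha ((Int.cast_injective h) ▸ hi)
    by_cases h0 : aeval T q x = 0
    · exact ih h0
    have h1 : aeval T q (aeval T q x) = q.eval (a : K) • aeval T q x :=
      Module.End.aeval_apply_of_hasEigenvector ⟨hz, h0⟩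
    have h2 := ih (x := x - (q.eval (a : K))⁻¹ • aeval T q x) (by
      rw [map_sub, map_smul, h1, smul_smul, inv_mul_cancel₀ hc, one_smul, sub_self])
    rw [← sub_add_cancel x ((q.eval (a : K))⁻¹ • aeval T q x)]
    exact add_mem h2 (Submodule.mem_iSup_of_mem a (Submodule.smul_mem _ _ hz))

open Polynomial in
lemma kf_aeval (h : L) (q : K[X]) (x y : L) :
    kf K (aeval (LieAlgebra.ad K L h) q x) y = kf K x (aeval (LieAlgebra.ad K L (-h)) q y) := by
  induction q using Polynomial.induction_on' with
  | add q r hq hr => simp only [kf, map_add, LinearMap.add_apply] at *; rw [hq, hr]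
  | monomial n a =>
    have key : ∀ y, kf K ((LieAlgebra.ad K L h ^ n) x) y =
        kf K x ((LieAlgebra.ad K L (-h) ^ n) y) := by
      induction n with
      | zero => intro y; rfl
      | succ n ih =>
        intro y
        rw [pow_succ', Module.End.mul_apply, pow_succ, Module.End.mul_apply, ← ih,
          LieAlgebra.ad_apply, LieAlgebra.ad_apply, ← lie_skew, neg_lie]
        simp only [kf, map_neg, LinearMap.neg_apply]
        exact congrArg Neg.neg (kf_lie _ _ _)
    simp only [aeval_monomial, Algebra.algebraMap_eq_smul_one, smul_mul_assoc, one_mul,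
      LinearMap.smul_apply, kf, map_smul]
    exact congrArg (a • ·) (key y)

open Polynomial in
/-- The eigenspaces of `h` span the part of degree `-1` if they span the part of degree `1`. -/
lemma le_iSup_eig_neg_one [LieAlgebra.IsKilling K L] (hd : IsDiag K H0) {h : L} (hh : ⁅H0, h⁆ = 0)
    (h1 : eig K H0 1 ≤ ⨆ i, eig K h i) : eig K H0 (-1) ≤ ⨆ i, eig K h i := by
  obtain ⟨B, hB⟩ := exists_eig_eq_bot K h
  set s := Finset.Icc (-(B : ℤ)) B
  set q : K[X] := ∏ i ∈ s, (X - C (i : K)) with hq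
  have hq0 : ∀ y ∈ ⨆ i, eig K h i, aeval (LieAlgebra.ad K L (-h)) q y = 0 := fun y hy => by
    induction hy using Submodule.iSup_induction' with
    | mem i y hy =>
      by_cases h0 : y = 0
      · rw [h0, map_zero]
      have hi : |i| ≤ B := by
        by_contra hi
        rw [hB i (not_le.1 hi), Submodule.mem_bot] at hy
        exact h0 hy
      rw [Module.End.aeval_apply_of_hasEigenvector ⟨neg_mem_eig hy, h0⟩, hq, eval_prod,
        Finset.prod_eq_zero (i := -i) (Finset.mem_Icc.2 (by rw [abs_le] at hi; omega)) (by simp),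
        zero_smul]
    | zero => exact map_zero _
    | add x y _ _ hx hy => rw [map_add, hx, hy, add_zero]
  have hst : ∀ (r : K[X]), ∀ x ∈ eig K H0 (-1),
      aeval (LieAlgebra.ad K L h) r x ∈ eig K H0 (-1) := fun r x hx => by
    induction r using Polynomial.induction_on' with
    | add q r hq hr => rw [map_add]; exact add_mem hq hr
    | monomial n a =>
      simp only [aeval_monomial, Algebra.algebraMap_eq_smul_one, smul_mul_assoc, one_mul,
        LinearMap.smul_apply]
      have := pow_ad_mem_eig (mem_eig_zero.2 hh) hx n
      rw [mul_zero, add_zero] at this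
      exact Submodule.smul_mem _ _ this
  refine fun x hx => mem_iSup_eig_of_aeval s (eq_zero_of_kf (K := K) fun y => ?_)
  have h2 := hq0 _ (h1 (show eproj H0 hd (- -1) y ∈ eig K H0 1 from eproj_mem hd _ y))
  rw [kf_eproj hd (hst _ x hx), kf_aeval, ← hq, h2]
  simp [kf]

lemma IsVerySpecialSystem.sys [LieAlgebra.IsKilling K L] (hd : IsDiag K H0)
    (hgen : LieSubalgebra.lieSpan K L ((eig K H0 1 : Set L) ∪ (eig K H0 (-1) : Set L)) = ⊤)
    (hH : IsVerySpecialSystem K H0 H) : Sys K H0 H := by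
  have hpar : ∀ i, eig K H0 1 ≤ parab K (H i) := fun i x hx => (hH.verySpecial i).1.2
    (Submodule.mem_iSup_of_mem ⟨2 * 1, by norm_num⟩ (mem_eig_two_smul.2 hx))
  have hzero : ∀ i, ⁅H0, H i⁆ = 0 := fun i => by
    obtain ⟨x, hx, y, hy, t⟩ := (hH.verySpecial i).1.1
    rw [← t.lie_e_f, ← mem_eig_zero (K := K)]
    exact lie_mem_eig' hx hy (by norm_num)
  have hdiag : ∀ i, IsDiag K (H i) := fun i => by
    have h1 : eig K H0 1 ≤ ⨆ j, eig K (H i) j :=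
      (hpar i).trans (iSup_le fun j => le_iSup (fun j => eig K (H i) j) j.1)
    let D : LieSubalgebra K L :=
      { (⨆ j, eig K (H i) j : Submodule K L) with
        lie_mem' := fun {x y} hx hy => by
          refine Submodule.iSup_induction _ (motive := fun x => ⁅x, y⁆ ∈ ⨆ j, eig K (H i) j) hx
            (fun a x hx => ?_) (by simp) fun x x' hx hx' => by rw [add_lie]; exact add_mem hx hx'
          refine Submodule.iSup_induction _ (motive := fun y => ⁅x, y⁆ ∈ ⨆ j, eig K (H i) j) hy
            (fun b y hy => ?_) (by simp) fun x x' hx hx' => by rw [lie_add]; exact add_mem hx hx'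
          exact Submodule.mem_iSup_of_mem _ (lie_mem_eig hx hy) }
    have hD : ⊤ ≤ D := by
      rw [← hgen, LieSubalgebra.lieSpan_le]
      exact Set.union_subset h1 (le_iSup_eig_neg_one hd (hzero i) h1)
    exact eq_top_iff.2 fun x _ => hD (LieSubalgebra.mem_top x)
  have hpos : ∀ i j, ∀ x ∈ eig K H0 1, x ∈ eig K (H i) j → j < 0 → x = 0 := by
    intro i j x hx hxj hj
    rw [← eproj_self (hdiag i) hxj]
    refine Submodule.iSup_induction _ (motive := fun x => eproj (H i) (hdiag i) j x = 0) (hpar i hx)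
      (fun l x hx => eproj_of_ne _ (by have := l.2; omega) hx) (map_zero _)
      fun x y hx hy => by rw [map_add, hx, hy, add_zero]
  refine ⟨hd, hdiag, hH.commute, hH.sum_eq, fun i => (hH.verySpecial i).1.1, hpos, ?_⟩
  intro i j x hx hxj hj
  refine eq_zero_of_kf (K := K) fun y => ?_
  rw [kf_eproj hd hx, kf_eproj (hdiag i) hxj, hpos i (-j) _ (eproj_mem_eig _
    (by rw [← lie_skew, hzero, neg_zero]) _ (by simpa using eproj_mem hd _ y))
    (eproj_mem _ _ _) (by omega)]
  simp [kf]

lemma isKilling_of_tmul {F k M : Type*} [Field F] [Field k] [Algebra F k] [LieRing M]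
    [LieAlgebra F M] [FiniteDimensional F M] [CharZero F] [CharZero k]
    [LieAlgebra.IsKilling k (k ⊗[F] M)] : LieAlgebra.IsKilling F M := by
  refine ⟨(LieSubmodule.eq_bot_iff _).2 fun x hx => ?_⟩
  have h1 : ∀ y, killingForm F M x y = 0 := fun y => by
    rw [LieIdeal.mem_killingCompl] at hx
    rw [LieModule.traceForm_comm]
    exact hx y trivial
  have h2 : (1 : k) ⊗ₜ[F] x = 0 := by
    refine eq_zero_of_kf (K := k) fun y => ?_
    induction y using TensorProduct.induction_on with
    | zero => simp [kf]
    | add y z hy hz => simp only [kf, map_add] at *; rw [hy, hz, add_zero]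
    | tmul a y =>
      rw [← mul_one a, ← smul_eq_mul, ← TensorProduct.smul_tmul']
      simp only [kf, map_smul]
      rw [killingForm_tmul, h1, map_zero, smul_zero]
  exact Module.FaithfullyFlat.tensorProduct_mk_injective (A := F) (B := k) M (by simpa using h2)

end VerySpecial

section Assembly

variable {F L : Type*} [Field F] [LieRing L] [LieAlgebra F L] [FiniteDimensional F L] [CharZero F]
  [LieAlgebra.IsKilling F L]
  [LieAlgebra.IsKilling (AlgebraicClosure F) (AlgebraicClosure F ⊗[F] L)]
  {p : ℕ} {H0 : L} {H : Fin p → L}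

lemma eproj_tmul {k : Type*} [Field k] [Algebra F k] [CharZero k] {h : L} (hd : IsDiag F h)
    (hd' : IsDiag k ((1 : k) ⊗ₜ[F] h)) (i : ℤ) (x : L) :
    eproj ((1 : k) ⊗ₜ[F] h) hd' i ((1 : k) ⊗ₜ[F] x) = (1 : k) ⊗ₜ[F] eproj h hd i x := by
  induction x using diag_induction hd with
  | mem j x hx =>
    rw [eproj_eq_ite hd hx, eproj_eq_ite hd' (one_tmul_mem_eig k hx)]
    split_ifs <;> simp
  | add x y hx hy => rw [TensorProduct.tmul_add, map_add, hx, hy, map_add, TensorProduct.tmul_add]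

lemma eproj_congr {K M : Type*} [Field K] [LieRing M] [LieAlgebra K M] [CharZero K] {h h' : M}
    (e : h = h') (hd : IsDiag K h) (hd' : IsDiag K h') (i : ℤ) (x : M) :
    eproj h hd i x = eproj h' hd' i x := by
  subst e
  rfl

/-- The extensions to the algebraic closure of the fundamental relative invariants. -/
theorem exists_invs (S : Sys F H0 H)
    (S' : Sys (AlgebraicClosure F) ((1 : AlgebraicClosure F) ⊗ₜ[F] H0)
      fun i => (1 : AlgebraicClosure F) ⊗ₜ[F] H i)
    (hreg : IsOneSimple F H0 (2 • H0))
    (hirr : IsIrreducibleDegreeOne (AlgebraicClosure F) ((1 : AlgebraicClosure F) ⊗ₜ[F] H0))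
    {V : Fin p → Submodule F L}
    (hV : ∀ k, V k = eig F (partialSum H ((k : ℕ) + 1)) 2 ⊓ eig F H0 1)
    {Γ : Fin p → Subgroup (L ≃ₗ[F] L)}
    (hΓ : ∀ k, Γ k = centr (aut0 F L) {H0, partialSum H ((k : ℕ) + 1)})
    {hst : ∀ k, ∀ g ∈ Γ k, ∀ x ∈ V k, g x ∈ V k} {f : ∀ k, polyFun F (V k)}
    (hf : ∀ k, IsFundamental (restrictRep (Γ k) (V k) (hst k)) (f k))
    {Q : Fin p → polyFun F (eig F H0 1)}
    (hQ : ∀ k (z : eig F H0 1) (x : V k), (x : L) = S.top ((k : ℕ) + 1) z →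
      (Q k : eig F H0 1 → F) z = (f k : V k → F) x) :
    ∃ f', S'.Invs f' ∧ ∀ k, IsPolyExt
      (tmulMap fun _ hx => one_tmul_mem_eig (AlgebraicClosure F) hx) (Q k) (S'.ext (f' k)) := by
  have := charZero_of_algebra F (AlgebraicClosure F)
  have key : ∀ k : Fin p, ∃ f' : polyFun (AlgebraicClosure F)
      (eig (AlgebraicClosure F) (partialSum (fun i => (1 : AlgebraicClosure F) ⊗ₜ[F] H i)
        ((k : ℕ) + 1)) 2 ⊓ eig (AlgebraicClosure F) (1 ⊗ₜ[F] H0) 1 : Submodule _ _),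
      (Irreducible f' ∧ ∀ X ∈ eig (AlgebraicClosure F)
        (partialSum (fun i => (1 : AlgebraicClosure F) ⊗ₜ[F] H i) ((k : ℕ) + 1)) 0 ⊓
          eig (AlgebraicClosure F) (1 ⊗ₜ[F] H0) 0, ∃ c, InfRel f' X c) ∧
      IsPolyExt (tmulMap fun _ hx => one_tmul_mem_eig (AlgebraicClosure F) hx) (Q k)
        (S'.ext f') := fun k => by
    have hps := partialSum_tmul (F := F) (k := AlgebraicClosure F) H ((k : ℕ) + 1)
    obtain ⟨W, hW⟩ : ∃ W, W = (eig (AlgebraicClosure F)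
      (partialSum (fun i => (1 : AlgebraicClosure F) ⊗ₜ[F] H i) ((k : ℕ) + 1)) 2 ⊓
        eig (AlgebraicClosure F) (1 ⊗ₜ[F] H0) 1 : Submodule _ _) := ⟨_, rfl⟩
    have hW' := hW
    rw [hps] at hW'
    have hVW : ∀ x ∈ V k, (1 : AlgebraicClosure F) ⊗ₜ[F] x ∈ W := fun x hx => by
      rw [hV] at hx
      rw [hW']
      exact ⟨one_tmul_mem_eig _ hx.1, one_tmul_mem_eig _ hx.2⟩
    obtain ⟨f', hf'⟩ := exists_isPolyExt (isBaseChange_tmulMap hVW fun x hx => by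
      rw [hW'] at hx
      rw [hV]
      exact mem_baseChange_eig_inf hx) (f k)
    have D := S'.isRegularPair hirr (k := k + 1) (by omega) (by omega)
    rw [← hW, hps] at D
    have h1 := irreducible_of_isFundamental S.diag₀ (S.diag_partialSum (k + 1))
      (S.comm_partialSum _) hreg (hV k) hW' rfl D (hΓ k) (hf k) hf'
    rw [← hps] at h1
    subst hW
    refine ⟨f', h1, fun z => ?_⟩
    have hx : S.top ((k : ℕ) + 1) z ∈ V k := by
      rw [hV]
      exact ⟨eproj_mem _ _ _, S.top_mem _ z.2⟩
    rw [hQ k z ⟨_, hx⟩ rfl, ← hf']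
    refine congrArg f'.1 (Subtype.ext ?_)
    refine (eproj_congr hps (S'.diag_partialSum _) (isDiag_tmul _ (S.diag_partialSum _)) 2 _).trans ?_
    exact eproj_tmul (S.diag_partialSum _) _ 2 _
  choose f' h1 h2 using key
  exact ⟨f', ⟨fun k => (h1 k).1, fun k => (h1 k).2⟩, h2⟩

/-- The action of the parabolic subgroup on `𝔤_1`; the spaces and groups are only given up to
propositional equality. -/
theorem geomPrehomogeneous (S : Sys F H0 H) (hreg : IsOneSimple F H0 (2 • H0))
    (hirr : IsIrreducibleDegreeOne (AlgebraicClosure F) ((1 : AlgebraicClosure F) ⊗ₜ[F] H0))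
    {V : Fin p → Submodule F L}
    (hV : ∀ k, V k = eig F (partialSum H ((k : ℕ) + 1)) 2 ⊓ eig F H0 1)
    {Γ : Fin p → Subgroup (L ≃ₗ[F] L)}
    (hΓ : ∀ k, Γ k = centr (aut0 F L) {H0, partialSum H ((k : ℕ) + 1)})
    {hst : ∀ k, ∀ g ∈ Γ k, ∀ x ∈ V k, g x ∈ V k} {f : ∀ k, polyFun F (V k)}
    (hf : ∀ k, IsFundamental (restrictRep (Γ k) (V k) (hst k)) (f k))
    {U : Submodule F L} (hU : U = eig F H0 1)
    {U' : Submodule (AlgebraicClosure F) (AlgebraicClosure F ⊗[F] L)}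
    (hU' : U' = eig (AlgebraicClosure F) (1 ⊗ₜ[F] H0) 1)
    {P : Subgroup (L ≃ₗ[F] L)} (hP : P = parabolic (aut0 F L) H0 H)
    {P' : Subgroup ((AlgebraicClosure F ⊗[F] L) ≃ₗ[AlgebraicClosure F] (AlgebraicClosure F ⊗[F] L))}
    (hP' : P' = parabolic (elemAut (AlgebraicClosure F) (AlgebraicClosure F ⊗[F] L))
      (1 ⊗ₜ[F] H0) fun i => 1 ⊗ₜ[F] H i)
    {hs : ∀ g ∈ P, ∀ x ∈ U, g x ∈ U} {hs' : ∀ g ∈ P', ∀ x ∈ U', g x ∈ U'}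
    {Q : Fin p → polyFun F U}
    (hQ : ∀ k (z : U) (x : V k), (x : L) = S.top ((k : ℕ) + 1) z →
      (Q k : U → F) z = (f k : V k → F) x) :
    IsPrehomogeneous (restrictRep P' U' hs') ∧ IsFundamentalSystem (restrictRep P U hs) Q ∧
      ∃ Q' : Fin p → polyFun (AlgebraicClosure F) U', (∀ i, ∀ (x : U) (y : U'),
        (y : AlgebraicClosure F ⊗[F] L) = 1 ⊗ₜ[F] (x : L) → (Q' i : U' → AlgebraicClosure F) y =
          algebraMap F (AlgebraicClosure F) ((Q i : U → F) x)) ∧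
      IsFundamentalSystem (restrictRep P' U' hs') Q' := by
  have := charZero_of_algebra F (AlgebraicClosure F)
  subst hU hU' hP hP'
  obtain ⟨f', I, hext⟩ := exists_invs S (sys_tmul _ S) hreg hirr hV hΓ hf hQ
  refine ⟨isPrehomogeneous_geometric S hreg hirr I, isFundamentalSystem_rational S hreg hirr I hext,
    _, fun i x y hy => ?_, isFundamentalSystem_geometric S hreg hirr I⟩
  rw [← hext i x]
  exact congrArg _ (Subtype.ext hy)

end Assembly

section Opposite

variable {F L : Type*} [Field F] [LieRing L] [LieAlgebra F L] [FiniteDimensional F L] [CharZero F]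
  [LieAlgebra.IsKilling F L]
  [LieAlgebra.IsKilling (AlgebraicClosure F) (AlgebraicClosure F ⊗[F] L)]
  {p : ℕ} {H0 : L} {H : Fin p → L}

lemma IsNaturalExtension.apply_eq {h : L} {i j : ℤ}
    {q : polyFun F (eig F h i ⊓ eig F H0 j : Submodule F L)} {Q : polyFun F (eig F H0 j)}
    (hQ : IsNaturalExtension q Q) {z : eig F H0 j}
    {x : (eig F h i ⊓ eig F H0 j : Submodule F L)}
    (hz : (z : L) - x ∈ ⨆ l : {l : ℤ // l ≠ i}, eig F h l ⊓ eig F H0 j) :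
    (Q : eig F H0 j → F) z = (q : (eig F h i ⊓ eig F H0 j : Submodule F L) → F) x :=
  hQ z x _ hz (add_sub_cancel _ _).symm

theorem isGeomPrehomogeneousWith_one (S : Sys F H0 H) (hreg : IsOneSimple F H0 (2 • H0))
    (hirr : IsIrreducibleDegreeOne (AlgebraicClosure F) ((1 : AlgebraicClosure F) ⊗ₜ[F] H0))
    {f : ∀ k : Fin p, polyFun F (eig F (partialSum H ((k : ℕ) + 1)) 2 ⊓ eig F H0 1 : Submodule F L)}
    (hf : ∀ k : Fin p, IsFundamental (subRep (aut0 F L) H0 (partialSum H ((k : ℕ) + 1)) 2 1) (f k))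
    {Q : Fin p → polyFun F (eig F H0 1)} (hQ : ∀ k, IsNaturalExtension (f k) (Q k)) :
    IsGeomPrehomogeneousWith H0 H 1 Q := by
  obtain ⟨h1, h2, h3⟩ := geomPrehomogeneous S hreg hirr (fun _ => rfl) (fun _ => rfl) hf rfl rfl rfl
    rfl (hs := parabolic_stable _ _ _ 1) (hs' := parabolic_stable _ _ _ 1) (Q := Q)
    fun k z x hx => (hQ k).apply_eq (by
      rw [hx]
      exact sub_eproj_mem _ (S.comm_partialSum _) 2 z.2)
  exact ⟨h1, h2, h3⟩

theorem isGeomPrehomogeneousWith_neg_one (S : Sys F H0 H) (hreg : IsOneSimple F H0 (2 • H0))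
    (hirr : IsIrreducibleDegreeOne (AlgebraicClosure F) ((1 : AlgebraicClosure F) ⊗ₜ[F] H0))
    {f : ∀ k : Fin p,
      polyFun F (eig F (partialSum H (p - ((k : ℕ) + 1))) 0 ⊓ eig F H0 (-1) : Submodule F L)}
    (hf : ∀ k : Fin p,
      IsFundamental (subRep (aut0 F L) H0 (partialSum H (p - ((k : ℕ) + 1))) 0 (-1)) (f k))
    {Q : Fin p → polyFun F (eig F H0 (-1))} (hQ : ∀ k, IsNaturalExtension (f k) (Q k)) :
    IsGeomPrehomogeneousWith H0 H (-1) Q := by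
  have := charZero_of_algebra F (AlgebraicClosure F)
  have S' := sys_tmul (AlgebraicClosure F) S
  have hps : ∀ k : Fin p, partialSum (fun i => -H (Fin.rev i)) ((k : ℕ) + 1) =
      partialSum H (p - ((k : ℕ) + 1)) - 2 • H0 := fun k => S.partialSum_rev (by omega)
  have hneg : ∀ x : L, (1 : AlgebraicClosure F) ⊗ₜ[F] (-x) = -((1 : AlgebraicClosure F) ⊗ₜ[F] x) :=
    fun x => TensorProduct.tmul_neg _ _
  obtain ⟨h1, h2, h3⟩ := geomPrehomogeneous S.rev hreg.neg
    (by rw [hneg]; exact hirr.neg S'.diag₀)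
    (fun k => Submodule.ext fun x => by rw [hps]; exact mem_eig_sub_inf.symm)
    (fun k => centr_congr _ fun g => by
      simp only [Set.forall_mem_insert, Set.mem_singleton_iff, forall_eq, hps, map_neg, neg_inj,
        map_sub, map_nsmul]
      exact and_congr_right fun h0 => by rw [h0, sub_left_inj]) hf
    (Submodule.ext fun x => mem_eig_neg.symm)
    (U' := eig (AlgebraicClosure F) ((1 : AlgebraicClosure F) ⊗ₜ[F] H0) (-1))
    (by rw [hneg]; exact Submodule.ext fun x => mem_eig_neg.symm)
    (S.parabolic_rev _).symm
    (P' := parabolic (elemAut (AlgebraicClosure F) (AlgebraicClosure F ⊗[F] L))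
      ((1 : AlgebraicClosure F) ⊗ₜ[F] H0) fun i => (1 : AlgebraicClosure F) ⊗ₜ[F] H i)
    (by simp only [hneg]; exact (S'.parabolic_rev _).symm)
    (hs := parabolic_stable _ _ _ (-1)) (hs' := parabolic_stable _ _ _ (-1)) (Q := Q)
    fun k z x hx => (hQ k).apply_eq (by
      have h := sub_eproj_mem (S.rev.diag_partialSum (k + 1)) (S.rev.comm_partialSum _) 2
        (mem_eig_neg.2 z.2)
      rw [hx]
      refine Submodule.iSup_induction _ (motive := fun x => x ∈ _) h (fun l x hx => ?_) (zero_mem _)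
        fun x y => add_mem
      rw [hps] at hx
      refine Submodule.mem_iSup_of_mem ⟨l.1 - 2, by have := l.2; omega⟩ (mem_eig_sub_inf.1 ?_)
      simpa using hx)
  exact ⟨h1, h2, h3⟩

end Opposite

end ParabolicPV

end

open ParabolicPV

theorem proposition1p4p5 {F L : Type*} [NontriviallyNormedField F] [LocallyCompactSpace F]
    [CharZero F] [LieRing L] [LieAlgebra F L] [FiniteDimensional F L]
    (H0 : L) (hg : IsAbsIrredRegular F H0)
    {p : ℕ} (H : Fin p → L) (hH : IsVerySpecialSystem F H0 H)
    -- `f k` is the invariant with number `k + 1`, on `E_2(h_{k+1}) ∩ 𝔤_1`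
    (f : ∀ k : Fin p, polyFun F (eig F (partialSum H ((k : ℕ) + 1)) 2 ⊓ eig F H0 1 : Submodule F L))
    (hf : ∀ k : Fin p, IsFundamental (subRep (aut0 F L) H0 (partialSum H ((k : ℕ) + 1)) 2 1) (f k))
    (Q : Fin p → polyFun F (eig F H0 1))
    (hQ : ∀ k, IsNaturalExtension (f k) (Q k))
    -- `f' k` is the dual invariant with number `k + 1`, on `E_0(h_{p-(k+1)}) ∩ 𝔤_{-1}`
    (f' : ∀ k : Fin p,
      polyFun F (eig F (partialSum H (p - ((k : ℕ) + 1))) 0 ⊓ eig F H0 (-1) : Submodule F L))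
    (hf' : ∀ k : Fin p, IsFundamental (subRep (aut0 F L) H0 (partialSum H (p - ((k : ℕ) + 1))) 0 (-1)) (f' k))
    (Q' : Fin p → polyFun F (eig F H0 (-1)))
    (hQ' : ∀ k, IsNaturalExtension (f' k) (Q' k)) :
    IsGeomPrehomogeneousWith H0 H 1 Q ∧
    IsGeomPrehomogeneousWith H0 H (-1) Q' ∧
    -- among the local fields of characteristic zero only `ℂ` is algebraically closed
    (IsAlgClosed F → ∀ χ : Fin p → (parabolic (aut0 F L) H0 H →* Fˣ),
      (∀ k, IsRelInv (rationalRep H0 H 1) (Q k) (χ k)) →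
        invariantRing (rationalRep H0 H 1) (⨅ k, (χ k).ker) =
          Algebra.adjoin F (Set.range Q)) := by
  have := charZero_of_algebra F (AlgebraicClosure F)
  have := hg.simple
  have : LieAlgebra.IsKilling (AlgebraicClosure F) (TensorProduct F (AlgebraicClosure F) L) :=
    inferInstance
  have : LieAlgebra.IsKilling F L := isKilling_of_tmul (k := AlgebraicClosure F)
  have S := hH.sys hg.graded hg.generated
  refine ⟨isGeomPrehomogeneousWith_one S hg.regular hg.irreducible hf hQ,
    isGeomPrehomogeneousWith_neg_one S hg.regular hg.irreducible hf' hQ', fun _ χ hχ => ?_⟩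
  obtain ⟨f', I, hext⟩ := exists_invs S (sys_tmul _ S) hg.regular hg.irreducible (fun _ => rfl)
    (fun _ => rfl) hf (Q := Q) fun k z x hx => (hQ k).apply_eq (by
      rw [hx]
      exact sub_eproj_mem _ (S.comm_partialSum _) 2 z.2)
  exact invariantRing_eq S hg.regular hg.irreducible I hext hχ
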